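/- All polynomials have complex coefficients. A differential form of degree at most $3$ is $\omega=P\,dx+Q\,dy$ with $P,Q\in\mathbb C[x,y]$ of degree $\le 3$. A curve $\{F=0\}$ is an integral curve of $\omega$ if $dF\wedge\omega=F\,K_F$ for a polynomial $2$-form $K_F$, the cofactor of $F$; we identify $2$-forms with their coefficient at $dx\wedge dy$. A *configuration* consists of an irreducible affine quartic $C$ with three ordinary cusps $R,S,T$ and a line $L$ tangent to $C$ at a smooth point $B$ of $C$, such that $C\cup L$ has five distinct points on the line at infinity. It is *generic* if moreover $L$ meets $C$ in two further distinct points. (1) Let $(C,L,R,S,T,B)$ be a configuration and let $\omega$ be a form of degree at most $3$ with integral curves $C$ and $L$. Then $\omega$ vanishes at $R,S,T,B$, and the ratio $(K_L:K_C:d\omega)$ is $(0:6:5)$ at each of the cusps $R,S,T$, is $(2:2:3)$ at $B$, and is $(1:4:4)$ at each point of the line at infinity (for the homogenizations of degree $2$), where at each point $(0:0:0)$ is also allowed. Furthermore $$4K_L+5K_C-6\,d\omega=0,$$ and $\omega$ is Darboux integrable with integrating factor $\mu=L^{-2/3}C^{-5/6}$: at every point off $C\cup L$ there are a formal branch of $\mu$,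 i.e. a power series $\mu$ with $\mu^6L^4C^5=1$, and a power series $H$ with $dH=\mu\,\omega$. (2) For a generic configuration the space of forms of degree at most $3$ with integral curve $C\cup L$ is one-dimensional. (3) Let $\Omega$ be the set of nonzero forms of degree at most $3$ that have the curves $C$ and $L$ of some generic configuration as integral curves. The Zariski closure of $\Omega$ in the $20$-dimensional space of forms is irreducible, of dimension $9$ up to scaling (i.e. it is a cone of dimension $10$), and the forms in $\Omega$ with a center are Zariski dense in it. Here $\omega$ has a center at $a\in\mathbb C^2$ if in suitable complex affine coordinates centered at $a$ it is $(x+p)\,dx+(y+q)\,dy$ with $p,q$ of order at least $2$ and all its focal values $s_j$ vanish, where the $s_j$ are defined through a formal series $F=x^2+y^2+\cdots$ with $dF\wedge\omega=\sum_{j\ge1}s_j(x^{2j+2}+y^{2j+2})\,dx\wedge dy$. (4) Let the degree-$3$ center variety be the Zariski closure of the set of all pairs $(\omega,a)$, where $\omega$ is a form of degree at most $3$ with a center at $a$. Then the Zariski closure of the set of all such pairs with $\omega\in\Omega$ is an irreducible component of the degree-$3$ center variety, and its dimension is $9$ up to scaling of $\omega$. (5) An explicit example is $$\begin{aligned}\omega=&(-11x^2y+3xy^2+y^3-2x^2+xy+5y^2-2x+4y)\,dx\\&+(11x^3-3x^2y-xy^2+10x^2-4xy-y^2-x-y)\,dy\end{aligned}$$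 with $L=-7x+2y+1$, $C=x^2y^2-2x^2yw-2xy^2w+x^2w^2-2xyw^2+y^2w^2$, $w=x+y+1$: these form a generic configuration with cusps $(0,0),(0,-1),(-1,0)$ and tangent point $(-1,-4)$, both are integral curves of $\omega$, $\omega\in\Omega$ has a center at $(-1,2)$, and $\omega$ spans the space of forms of degree at most $3$ with integral curve $C\cup L$. -/

import Mathlib

open MvPolynomial

namespace CuspidalCenter

noncomputable section

/-- Polynomials in the affine coordinates `x = X 0`, `y = X 1`. -/
abbrev Poly2 := MvPolynomial (Fin 2) ℂ

/-- A polynomial differential form `ω 0 dx + ω 1 dy`. -/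
abbrev Form := Fin 2 → Poly2

/-- Coefficient of `dx ∧ dy` in `dω`. -/
def dForm (ω : Form) : Poly2 := pderiv 0 (ω 1) - pderiv 1 (ω 0)

/-- Coefficient of `dx ∧ dy` in `df ∧ ω`. -/
def dWedge (f : Poly2) (ω : Form) : Poly2 := pderiv 0 f * ω 1 - pderiv 1 f * ω 0

/-- `K` (times `dx ∧ dy`) is a cofactor of the curve `f = 0`: `df ∧ ω = f K`. -/
def IsCofactor (ω : Form) (f K : Poly2) : Prop := dWedge f ω = f * K

/-- `f = 0` is an algebraic integral curve of `ω`. -/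
def IsAlgIntegralCurve (ω : Form) (f : Poly2) : Prop := ∃ K, IsCofactor ω f K

/-- The polynomial `v ↦ f (a + v)`. -/
def translate (a : Fin 2 → ℂ) (f : Poly2) : Poly2 := aeval (fun i => X i + C (a i)) f

/-- The curve `f = 0` has an ordinary cusp (type `A₂`) at `a`: a double point with a single tangent
line `u x + v y = 0`, which meets the curve at `a` with multiplicity exactly three. -/
def IsCusp (f : Poly2) (a : Fin 2 → ℂ) : Prop :=
  homogeneousComponent 0 (translate a f) = 0 ∧
  homogeneousComponent 1 (translate a f) = 0 ∧
  ∃ u v : ℂ, (u ≠ 0 ∨ v ≠ 0) ∧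
    homogeneousComponent 2 (translate a f) = (C u * X 0 + C v * X 1) ^ 2 ∧
    eval ![-v, u] (homogeneousComponent 3 (translate a f)) ≠ 0

/-- The line `l = 0` is tangent to the curve `f = 0` at the smooth point `b` of the curve. -/
def IsTangentAt (f l : Poly2) (b : Fin 2 → ℂ) : Prop :=
  eval b f = 0 ∧ eval b l = 0 ∧
  (eval b (pderiv 0 f) ≠ 0 ∨ eval b (pderiv 1 f) ≠ 0) ∧
  eval b (pderiv 0 f) * eval b (pderiv 1 l) = eval b (pderiv 1 f) * eval b (pderiv 0 l)

/-- The points at infinity of the curve `f = 0`, as directions in the affine plane. -/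
def pointsAtInfinity (f : Poly2) : Set (Projectivization ℂ (Fin 2 → ℂ)) :=
  {p | eval p.rep (homogeneousComponent f.totalDegree f) = 0}

/-- A three-cuspidal quartic `q` with cusps `r`, `s`, `t` and a line `l` tangent to it at `b`, such
that `q` and `l` together have five distinct points at infinity. -/
structure IsConfig (q l : Poly2) (r s t b : Fin 2 → ℂ) : Prop where
  irreducible : Irreducible q
  degree_q : q.totalDegree = 4
  degree_l : l.totalDegree = 1
  r_ne_s : r ≠ s
  s_ne_t : s ≠ t
  r_ne_t : r ≠ t
  cusp_r : IsCusp q r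
  cusp_s : IsCusp q s
  cusp_t : IsCusp q t
  tangent : IsTangentAt q l b
  infinity : (pointsAtInfinity (q * l)).ncard = 5

/-- In addition the line meets the quartic in two further distinct points. -/
structure IsGenericConfig (q l : Poly2) (r s t b : Fin 2 → ℂ) : Prop
    extends IsConfig q l r s t b where
  meets : {p : Fin 2 → ℂ | eval p q = 0 ∧ eval p l = 0}.ncard = 3

/-- `(K₁(a) : K₂(a) : D(a)) = (u : v : w)` or `(0 : 0 : 0)`. -/
def HasEta (K₁ K₂ D : Poly2) (a : Fin 2 → ℂ) (u v w : ℂ) : Prop :=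
  ∃ c : ℂ, eval a K₁ = c * u ∧ eval a K₂ = c * v ∧ eval a D = c * w

/-- The same ratio, at every point of the line at infinity, for polynomials of degree at most `e`
homogenized to degree `e`. -/
def HasEtaAtInfinity (e : ℕ) (K₁ K₂ D : Poly2) (u v w : ℂ) : Prop :=
  ∀ p : Fin 2 → ℂ, p ≠ 0 → HasEta (homogeneousComponent e K₁) (homogeneousComponent e K₂)
    (homogeneousComponent e D) p u v w

/-- `ω` has the integrating factor `l ^ (-2/3) * q ^ (-5/6)`: at each point `a` off the two
curves there are a formal branch `μ` of it (so `μ ^ 6 * l ^ 4 * q ^ 5 = 1`) and a formal first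
integral `H` with `dH = μ ω`. -/
def HasDarbouxFactor (ω : Form) (l q : Poly2) : Prop :=
  ∀ a : Fin 2 → ℂ, eval a l ≠ 0 → eval a q ≠ 0 →
    ∃ μ H : MvPowerSeries (Fin 2) ℂ,
      μ ^ 6 * (translate a l : MvPowerSeries (Fin 2) ℂ) ^ 4 *
        (translate a q : MvPowerSeries (Fin 2) ℂ) ^ 5 = 1 ∧
      ∀ i, MvPowerSeries.pderiv ℂ i H = μ * (translate a (ω i) : MvPowerSeries (Fin 2) ℂ)

/-- The `20` coefficients of a form of degree at most three: the pair `(i, (j, k))` stands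
for the coefficient of `x ^ j * y ^ k` in the `i`-th component. -/
abbrev CoeffIdx := Fin 2 × {m : Fin 4 × Fin 4 // (m.1 : ℕ) + (m.2 : ℕ) ≤ 3}

/-- The form of degree at most three with given coefficients. -/
def cubicForm (c : CoeffIdx → ℂ) : Form := fun i =>
  ∑ m : {m : Fin 4 × Fin 4 // (m.1 : ℕ) + (m.2 : ℕ) ≤ 3},
    C (c (i, m)) * (X 0 ^ (m.1.1 : ℕ) * X 1 ^ (m.1.2 : ℕ))

theorem cubicForm_add (c d : CoeffIdx → ℂ) : cubicForm (c + d) = cubicForm c + cubicForm d := by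
  funext i
  simp [cubicForm, add_mul, Finset.sum_add_distrib]

theorem cubicForm_smul (a : ℂ) (c : CoeffIdx → ℂ) (i : Fin 2) :
    cubicForm (a • c) i = C a * cubicForm c i := by
  simp [cubicForm, Finset.mul_sum, mul_assoc]

/-- The space of forms of degree at most three with integral curve `f = 0`. -/
def cubicFormsWith (f : Poly2) : Submodule ℂ (CoeffIdx → ℂ) where
  carrier := {c | IsAlgIntegralCurve (cubicForm c) f}
  zero_mem' := by
    refine ⟨0, ?_⟩
    simp [IsCofactor, dWedge, cubicForm]
  add_mem' := by
    rintro c d ⟨K, hK⟩ ⟨K', hK'⟩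
    refine ⟨K + K', ?_⟩
    simp only [IsCofactor, dWedge, cubicForm_add, Pi.add_apply] at *
    linear_combination hK + hK'
  smul_mem' := by
    rintro a c ⟨K, hK⟩
    refine ⟨C a * K, ?_⟩
    simp only [IsCofactor, dWedge, cubicForm_smul] at *
    linear_combination (C a) * hK

/-- `F = x² + y² + …` is a formal power series with
`dF ∧ ω = ∑_{j ≥ 1} s j (x ^ (2 j + 2) + y ^ (2 j + 2))`; the `s j` are the focal values. -/
structure IsFocalExpansion (ω : Form) (F : MvPowerSeries (Fin 2) ℂ) (s : ℕ → ℂ) : Prop where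
  low : ∀ m : Fin 2 →₀ ℕ, m.degree ≤ 2 →
    MvPowerSeries.coeff m F = coeff m (X 0 ^ 2 + X 1 ^ 2 : Poly2)
  focal : ∀ i : Fin 2, ∀ j : ℕ, 1 ≤ j → MvPowerSeries.coeff (Finsupp.single i (2 * j + 2))
    (MvPowerSeries.pderiv ℂ 0 F * (ω 1 : MvPowerSeries (Fin 2) ℂ) -
      MvPowerSeries.pderiv ℂ 1 F * (ω 0 : MvPowerSeries (Fin 2) ℂ)) = s j
  other : ∀ m : Fin 2 →₀ ℕ, (∀ i : Fin 2, ∀ j : ℕ, 1 ≤ j → m ≠ Finsupp.single i (2 * j + 2)) →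
    MvPowerSeries.coeff m
    (MvPowerSeries.pderiv ℂ 0 F * (ω 1 : MvPowerSeries (Fin 2) ℂ) -
      MvPowerSeries.pderiv ℂ 1 F * (ω 0 : MvPowerSeries (Fin 2) ℂ)) = 0

/-- `ω = (x + p) dx + (y + q) dy` with `p`, `q` of order at least two, and all focal values of `ω`
at the origin vanish. -/
def IsPoincareCenter (ω : Form) : Prop :=
  (∀ i, homogeneousComponent 0 (ω i) = 0 ∧ homogeneousComponent 1 (ω i) = X i) ∧
  ∃ F s, IsFocalExpansion ω F s ∧ ∀ j, 1 ≤ j → s j = 0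

/-- The pullback of `ω` under the affine map `v ↦ a + A v`. -/
def pullback (a : Fin 2 → ℂ) (A : Matrix (Fin 2) (Fin 2) ℂ) (ω : Form) : Form := fun j =>
  ∑ i, C (A i j) * aeval (fun k => C (a k) + ∑ n, C (A k n) * (X n : Poly2)) (ω i)

/-- `ω` has a (complex) center at `a`: in suitable affine coordinates centered at `a` it is in
Poincaré's normal form and all its focal values vanish. -/
def HasCenterAt (ω : Form) (a : Fin 2 → ℂ) : Prop :=
  ∃ A : Matrix (Fin 2) (Fin 2) ℂ, A.det ≠ 0 ∧ IsPoincareCenter (pullback a A ω)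

/-- The forms of degree at most three with a center, together with the center. -/
def centers : Set (CoeffIdx ⊕ Fin 2 → ℂ) :=
  {p | HasCenterAt (cubicForm fun i => p (Sum.inl i)) fun k => p (Sum.inr k)}

/-- The nonzero forms of degree at most three that have a three-cuspidal quartic and a tangent line
of it in general position as integral curves. -/
def family : Set (CoeffIdx → ℂ) :=
  {c | c ≠ 0 ∧ ∃ q l r s t b, IsGenericConfig q l r s t b ∧
    IsAlgIntegralCurve (cubicForm c) q ∧ IsAlgIntegralCurve (cubicForm c) l}

/-- The members of the family with a center, together with the center. -/
def familyCenters : Set (CoeffIdx ⊕ Fin 2 → ℂ) :=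
  {p | (fun i => p (Sum.inl i)) ∈ family ∧ p ∈ centers}

/-- Dimension of the Zariski closure of a set of points in affine space. -/
def zariskiDim {σ : Type} (S : Set (σ → ℂ)) : WithBot ℕ∞ :=
  ringKrullDim (MvPolynomial σ ℂ ⧸ vanishingIdeal ℂ S)

/-- The Zariski closure of `S` is irreducible. -/
def IsZariskiIrreducible {σ : Type} (S : Set (σ → ℂ)) : Prop :=
  (vanishingIdeal ℂ S).IsPrime

/-- The Zariski closure of `S` is an irreducible component of the Zariski closure of `T`. -/
def IsZariskiComponent {σ : Type} (S T : Set (σ → ℂ)) : Prop :=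
  vanishingIdeal ℂ S ∈ (vanishingIdeal ℂ T).minimalPrimes

/-- The line `-7 x + 2 y + 1`. -/
def exampleLine : Poly2 := -7 * X 0 + 2 * X 1 + 1

/-- The auxiliary linear polynomial `w = x + y + 1`. -/
def exampleW : Poly2 := X 0 + X 1 + 1

/-- The quartic `x²y² - 2x²yw - 2xy²w + x²w² - 2xyw² + y²w²`. -/
def exampleQuartic : Poly2 :=
  X 0 ^ 2 * X 1 ^ 2 - 2 * X 0 ^ 2 * X 1 * exampleW - 2 * X 0 * X 1 ^ 2 * exampleW
    + X 0 ^ 2 * exampleW ^ 2 - 2 * X 0 * X 1 * exampleW ^ 2 + X 1 ^ 2 * exampleW ^ 2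

/-- The explicit form having the two curves above as integral curves. -/
def exampleForm : Form :=
  ![-11 * X 0 ^ 2 * X 1 + 3 * X 0 * X 1 ^ 2 + X 1 ^ 3 - 2 * X 0 ^ 2 + X 0 * X 1 + 5 * X 1 ^ 2
      - 2 * X 0 + 4 * X 1,
    11 * X 0 ^ 3 - 3 * X 0 ^ 2 * X 1 - X 0 * X 1 ^ 2 + 10 * X 0 ^ 2 - 4 * X 0 * X 1 - X 1 ^ 2
      - X 0 - X 1]

end

end CuspidalCenter

open CuspidalCenter

/-! ### Jacobian criteria, transcendence degree and Krull dimension. -/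

section DimensionTheory

/-! The local ratios come from differentiating `dF ∧ ω = F K`. At a cusp, derivatives of order at
most two force `ω = 0`, and the third ones give `6 dω = 5 K_C`; since `L` does not pass through the
cusps, `K_L = 0` there. At infinity the leading part of `ω` contracts with the radial field to a
binary quartic vanishing at five distinct points. So this part is a multiple `g (x dy - y dx)`, and
the leading parts of `K_L`, `K_C`, `dω` are `g`, `4g`, `4g`. Hence `4 K_L + 5 K_C - 6 dω` loses its
quadratic part (`4 + 20 - 24 = 0`) and becomes an affine-linear polynomial vanishing at three
non-collinear cusps (`30 - 30 = 0`), so it is zero. The relation says exactly that `L^{-2/3}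
C^{-5/6} ω` is closed, and at the tangent point it turns `K_L = K_C` into the ratio `(2:2:3)`.

Every configuration has a normal form. The Cremona transformation centered at the cusps turns the
quartic into a conic tangent to the three sides of the triangle. So `C = x²y² + y²z² + z²x² - 2xyz(x
+ y + z)` for three affine-linear polynomials `x, y, z` (a frame), and `L = m³x + n³y + k³z` with `m
+ n + k = 0`, the tangent at `(1/m² : 1/n² : 1/k²)`. An explicit form `A dx + B dy + C' dz` with
cubic coefficients has both curves as integral curves (`isCofactor_frameQuartic`,
`isCofactor_frameLine`), which gives existence. For uniqueness (`IsGenericConfig.wedge_eq_zero`),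
the wedge of two such forms is divisible by `C L` and has degree at most five, so it is a constant
times `C L`. At a transversal intersection point the linear parts of the forms are proportional, so
the quadratic part of the wedge vanishes and the constant is zero. The relation between the
cofactors also excludes common factors of the two components, so the forms are proportional.

The frames and the parameter `m`, with `n = 1`, give ten parameters; the scaling of the form is
absorbed into the frame. A Jacobian determinant that does not vanish modulo `101` shows that the
dimension is ten. A nondegenerate zero of `ω` off the curves is a center by Darboux integrability
(`hasCenterAt_of_relation`). The only candidate is the point `(1/m : 1/n : 1/k)`, and generically it
works. Thus the pairs of a form and its center also have a ten-parameter description.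

For the component statement, let `Q` be the prime of the family of pairs and `P ≤ Q` a prime
containing all relations satisfied by pairs with a center. The space of pairs has dimension 22. A
center imposes three conditions on the terms of order at most one and nine focal conditions, up to a
normalizing factor. The focal conditions are written as determinants of augmented linear systems for
the coefficients of a first integral. Over dual numbers modulo `23` their differentials at one point
of the closure are computed from certified truncated power series, and the twelve differentials are
independent (`det_focalJacobian_ne_zero`). So `P` has dimension at most `22 - 12 = 10`, the
dimension of `Q`, and `P = Q`. -/

open scoped IntermediateField.algebraAdjoinAdjoin in
theorem isAlgebraic_algebraAdjoin {k K : Type} [Field k] [Field K] [Algebra k K] {T : Set K}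
    (h : Algebra.IsAlgebraic (IntermediateField.adjoin k T) K) :
    Algebra.IsAlgebraic (Algebra.adjoin k T) K :=
  (IsFractionRing.comap_isAlgebraic_iff (A := Algebra.adjoin k T)
    (K := IntermediateField.adjoin k T)).mpr h

/-- A field generated by `x` is algebraic over an intermediate field that contains enough
polynomial expressions in `x` with nonvanishing Jacobian. -/
theorem isAlgebraic_of_jacobian {k K σ ι : Type} [Field k] [CharZero k] [Field K] [Algebra k K]
    [Fintype σ] [Fintype ι] [DecidableEq ι] (x : σ → K) (hx : IntermediateField.adjoin k (Set.range x) = ⊤)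
    (E : IntermediateField k K) (s : ι → σ) (hs : Function.Injective s) (g : ι → MvPolynomial σ k)
    (hE : ∀ c, c ∉ Set.range s → x c ∈ E) (hg : ∀ i, aeval x (g i) ∈ E)
    (hdet : (Matrix.of fun i j => aeval x (pderiv (s j) (g i))).det ≠ 0) :
    Algebra.IsAlgebraic E K := by
  classical
  have hfg : Algebra.EssFiniteType k K := by
    have h1 : (⊤ : IntermediateField k K).FG := by
      rw [← hx]
      exact ⟨Finset.univ.image x, by simp⟩
    exact IntermediateField.fg_top_iff.mp h1
  have : Algebra.EssFiniteType E K := Algebra.EssFiniteType.of_comp k E K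
  -- It suffices that the differentials of `K` over `E` vanish. They are spanned by the `D (x c)`,
  -- and the relations `D (g i (x)) = 0` form a square linear system for those outside `E`.
  have : Algebra.FormallyUnramified E K := by
    refine ⟨?_⟩
    set D := KaehlerDifferential.D E K with hD
    have hDE : ∀ y ∈ E, D y = 0 := fun y hy => D.map_algebraMap (⟨y, hy⟩ : E)
    let D' : Derivation k K (Ω[K⁄E]) := D.restrictScalars k
    have hD' : ∀ y, D' y = D y := fun y => rfl
    have hchain : ∀ p : MvPolynomial σ k,
        D (aeval x p) = ∑ c, aeval x (pderiv c p) • D (x c) := by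
      intro p
      induction p using MvPolynomial.induction_on with
      | C a =>
        rw [← hD']
        simp [D'.map_algebraMap]
      | add p q hp hq => simp [map_add, hp, hq, add_smul, Finset.sum_add_distrib]
      | mul_X p c hp =>
        simp only [map_mul, aeval_X, Derivation.leibniz, hp, pderiv_X, map_add, smul_eq_mul,
          add_smul, Finset.sum_add_distrib, mul_smul, Finset.smul_sum]
        congr 1
        rw [Finset.sum_eq_single c]
        · simp
        · intro b _ hb
          simp [hb.symm]
        · simp
    have hker : ∀ i, ∑ j, aeval x (pderiv (s j) (g i)) • D (x (s j)) = 0 := by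
      intro i
      have h1 := hDE _ (hg i)
      rw [hchain] at h1
      rw [← h1, ← Finset.sum_image (s := Finset.univ) (g := s)
        (f := fun c => aeval x (pderiv c (g i)) • D (x c)) (fun a _ b _ h => hs h)]
      refine Finset.sum_subset (Finset.subset_univ _) ?_
      intro c _ hc
      rw [hDE _ (hE c (by simpa using hc)), smul_zero]
    have hzero : ∀ c, D (x c) = 0 := by
      intro c
      by_cases hc : c ∈ Set.range s
      · obtain ⟨j, rfl⟩ := hc
        set J : Matrix ι ι K := Matrix.of fun i j => aeval x (pderiv (s j) (g i)) with hJ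
        have h2 : ∀ i, ∑ j, J i j • D (x (s j)) = 0 := hker
        -- Cramer's rule: multiplication by the adjugate.
        have h3 : J.det • D (x (s j)) = 0 := by
          have h4 : ∀ l, ∑ i, ∑ j, (J.adjugate l i * J i j) • D (x (s j)) = 0 := by
            intro l
            refine Finset.sum_eq_zero fun i _ => ?_
            simp_rw [mul_smul, ← Finset.smul_sum, h2, smul_zero]
          have h5 := h4 j
          rw [Finset.sum_comm] at h5
          simp_rw [← Finset.sum_smul, ← Matrix.mul_apply, Matrix.adjugate_mul] at h5
          simpa [Matrix.smul_apply, Matrix.one_apply] using h5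
        exact (smul_eq_zero.mp h3).resolve_left hdet
      · exact hDE _ (hE c hc)
    have hall : ∀ y, D y = 0 := by
      intro y
      have hy : y ∈ IntermediateField.adjoin k (Set.range x) := by rw [hx]; trivial
      induction hy using IntermediateField.adjoin_induction with
      | mem y hy => obtain ⟨c, rfl⟩ := hy; exact hzero c
      | algebraMap a => exact D'.map_algebraMap a
      | add a b _ _ ha hb => rw [map_add, ha, hb, add_zero]
      | inv a _ ha => rw [Derivation.leibniz_inv, ha, smul_zero]
      | mul a b _ _ ha hb => rw [Derivation.leibniz, ha, hb]; simp
    rw [← Submodule.subsingleton_iff K, ← subsingleton_iff_bot_eq_top,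
      ← KaehlerDifferential.span_range_derivation E K, eq_comm, Submodule.span_eq_bot]
    rintro _ ⟨y, rfl⟩
    exact hall y
  -- For an essentially finite field extension, unramified means separable, in particular algebraic.
  have := (Algebra.FormallyUnramified.iff_isSeparable (K := E) K).mp inferInstance
  infer_instance

/-- Lying over and going up lift chains of primes from `R` to `S`; incomparability makes contraction
strictly monotone, so chains of `S` also descend. -/
theorem ringKrullDim_eq_of_isIntegral (R S : Type) [CommRing R] [CommRing S] [Algebra R S]
    [FaithfulSMul R S] [Algebra.IsIntegral R S] : ringKrullDim R = ringKrullDim S := by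
  apply le_antisymm
  · refine iSup_le fun l => ?_
    obtain ⟨⟨P, hP, hPl⟩⟩ := (inferInstance : Nonempty (Ideal.primesOver l.head.asIdeal S))
    obtain ⟨L, hL, -⟩ := Ideal.exists_ltSeries_of_hasGoingUp l P
    rw [← hL]
    exact le_iSup (fun p : LTSeries (PrimeSpectrum S) => (p.length : WithBot ℕ∞)) L
  · refine Order.krullDim_le_of_strictMono (PrimeSpectrum.comap (algebraMap R S)) ?_
    intro I J hIJ
    exact Ideal.IsIntegral.comap_lt_comap hIJ

/-- The Krull dimension of a finitely generated domain is its transcendence degree. -/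
theorem exists_ringKrullDim_eq_trdeg (k B : Type) [Field k] [CommRing B] [IsDomain B] [Algebra k B]
    [Algebra.FiniteType k B] :
    ∃ d : ℕ, ringKrullDim B = d ∧ Algebra.trdeg k B = d := by
  obtain ⟨d, φ, hinj, hint⟩ := exists_integral_inj_algHom_of_fg k B
  refine ⟨d, ?_, ?_⟩
  · algebraize [φ.toRingHom]
    have h1 : ringKrullDim (MvPolynomial (Fin d) k) = ringKrullDim B := by
      have : Algebra.IsIntegral (MvPolynomial (Fin d) k) B := ⟨hint⟩
      have : FaithfulSMul (MvPolynomial (Fin d) k) B :=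
        (faithfulSMul_iff_algebraMap_injective _ _).mpr hinj
      exact ringKrullDim_eq_of_isIntegral _ _
    rw [← h1]
    simp [ringKrullDim_eq_zero_of_field]
  · have hai : AlgebraicIndependent k fun i => φ (X i) := by
      have := (MvPolynomial.algebraicIndependent_X (Fin d) k).map' (f := φ) hinj
      exact this
    have halg : Algebra.IsAlgebraic (Algebra.adjoin k (Set.range fun i => φ (X i))) B := by
      refine ⟨fun b => ?_⟩
      refine IsIntegral.isAlgebraic ?_
      have hr : Algebra.adjoin k (Set.range fun i => φ (X i)) = φ.range := by
        rw [← Algebra.map_top, ← MvPolynomial.adjoin_range_X, AlgHom.map_adjoin, ← Set.range_comp]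
        rfl
      rw [hr]
      obtain ⟨p, hp, hpb⟩ := hint b
      refine ⟨p.map (φ.rangeRestrict : _ →+* φ.range), hp.map _, ?_⟩
      rw [Polynomial.eval₂_map]
      exact hpb
    have := Algebra.IsAlgebraic.trdeg_le_cardinalMk k (Set.range fun i => φ (X i))
    apply le_antisymm
    · refine this.trans ?_
      refine Cardinal.mk_range_le.trans ?_
      simp
    · simpa using hai.cardinalMk_le_trdeg

/-- In the function field of the quotient the `g i` become zero, so the nonvanishing minor makes
everything algebraic over the coordinates outside the range of `s`. Counting these bounds the
transcendence degree. -/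
theorem trdeg_le_of_jacobian {k σ ι : Type} [Field k] [CharZero k] [Fintype σ] [Fintype ι]
    [DecidableEq ι] (P : Ideal (MvPolynomial σ k)) [P.IsPrime] (s : ι → σ)
    (hs : Function.Injective s) (g : ι → MvPolynomial σ k) (hg : ∀ i, g i ∈ P)
    (hdet : (Matrix.of fun i j => pderiv (s j) (g i)).det ∉ P) :
    Algebra.trdeg k (MvPolynomial σ k ⧸ P) ≤ (Fintype.card σ - Fintype.card ι : ℕ) := by
  classical
  set B := MvPolynomial σ k ⧸ P
  let K := FractionRing B
  let x : σ → K := fun c => algebraMap B K (Ideal.Quotient.mk P (X c))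
  have hx : ∀ p, aeval x p = algebraMap B K (Ideal.Quotient.mk P p) := by
    intro p
    have : (aeval x : MvPolynomial σ k →ₐ[k] K) =
        (IsScalarTower.toAlgHom k B K).comp (Ideal.Quotient.mkₐ k P) := by
      ext c
      simp [x]
      rfl
    rw [this]
    rfl
  have hinj : Function.Injective (algebraMap B K) := IsFractionRing.injective B K
  have htop : IntermediateField.adjoin k (Set.range x) = ⊤ := by
    rw [eq_top_iff]
    intro y _
    have hB : ∀ b : B, algebraMap B K b ∈ IntermediateField.adjoin k (Set.range x) := by
      intro b
      obtain ⟨p, rfl⟩ := Ideal.Quotient.mk_surjective b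
      rw [← hx]
      exact IntermediateField.algebra_adjoin_le_adjoin _ _
        (by rw [← MvPolynomial.aeval_range]; exact ⟨p, rfl⟩)
    obtain ⟨a, b, -, rfl⟩ := IsFractionRing.div_surjective (A := B) y
    exact div_mem (hB a) (hB b)
  set T : Set K := x '' (Set.range s)ᶜ
  have halg := isAlgebraic_of_jacobian x htop (IntermediateField.adjoin k T) s hs g
    (fun c hc => IntermediateField.subset_adjoin _ _ ⟨c, hc, rfl⟩)
    (fun i => by
      rw [hx, Ideal.Quotient.eq_zero_iff_mem.mpr (hg i), map_zero]
      exact zero_mem _) (by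
      have h1 : (Matrix.of fun i j => aeval x (pderiv (s j) (g i))) =
          (Matrix.of fun i j => pderiv (s j) (g i)).map
            ((algebraMap B K).comp (Ideal.Quotient.mk P)) := by
        ext i j
        simp [hx]
      rw [h1, ← RingHom.mapMatrix_apply, ← RingHom.map_det]
      simp only [RingHom.comp_apply, ne_eq, map_eq_zero_iff _ hinj]
      rwa [Ideal.Quotient.eq_zero_iff_mem])
  have halg2 : Algebra.IsAlgebraic (Algebra.adjoin k T) K :=
    isAlgebraic_algebraAdjoin halg
  have h3 := Algebra.IsAlgebraic.trdeg_le_cardinalMk k T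
  have h4 : Algebra.trdeg k B ≤ Algebra.trdeg k K :=
    trdeg_le_of_injective (IsScalarTower.toAlgHom k B K) hinj
  refine h4.trans (h3.trans (Cardinal.mk_image_le.trans ?_))
  rw [Cardinal.mk_fintype, Nat.cast_le]
  rw [Fintype.card_compl_set, Set.card_range_of_injective hs]

/-- The Jacobian makes the rational function field algebraic over the field generated by the `g i`.
As they are only as many as the transcendence degree, they form a transcendence basis. -/
theorem algebraicIndependent_of_jacobian {k τ : Type} [Field k] [CharZero k] [Fintype τ]
    [DecidableEq τ] (g : τ → MvPolynomial τ k)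
    (hdet : (Matrix.of fun i j => pderiv j (g i)).det ≠ 0) : AlgebraicIndependent k g := by
  classical
  let B := MvPolynomial τ k
  let K := FractionRing B
  have hinj : Function.Injective (algebraMap B K) := IsFractionRing.injective B K
  let x : τ → K := fun c => algebraMap B K (X c)
  have hx : ∀ p, aeval x p = algebraMap B K p := by
    intro p
    have : (aeval x : B →ₐ[k] K) = IsScalarTower.toAlgHom k B K := by
      ext c
      simp [x]
      rfl
    rw [this]
    rfl
  have htop : IntermediateField.adjoin k (Set.range x) = ⊤ := by
    rw [eq_top_iff]
    intro y _
    have hB : ∀ b : B, algebraMap B K b ∈ IntermediateField.adjoin k (Set.range x) := by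
      intro p
      rw [← hx]
      exact IntermediateField.algebra_adjoin_le_adjoin _ _
        (by rw [← MvPolynomial.aeval_range]; exact ⟨p, rfl⟩)
    obtain ⟨a, b, -, rfl⟩ := IsFractionRing.div_surjective (A := B) y
    exact div_mem (hB a) (hB b)
  let y : τ → K := fun i => algebraMap B K (g i)
  have halg := isAlgebraic_of_jacobian x htop (IntermediateField.adjoin k (Set.range y)) id
    Function.injective_id g
    (fun c hc => absurd ⟨c, rfl⟩ hc)
    (fun i => by
      rw [hx]
      exact IntermediateField.subset_adjoin _ _ ⟨i, rfl⟩) (by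
      have h1 : (Matrix.of fun i j => aeval x (pderiv (id j) (g i))) =
          (Matrix.of fun i j => pderiv j (g i)).map (algebraMap B K) := by
        ext i j
        simp [hx]
      rw [h1, ← RingHom.mapMatrix_apply, ← RingHom.map_det]
      simpa only [ne_eq, map_eq_zero_iff _ hinj] using hdet)
  have halg2 : Algebra.IsAlgebraic (Algebra.adjoin k (Set.range y)) K :=
    isAlgebraic_algebraAdjoin halg
  have h5 : (Cardinal.mk τ) ≤ Algebra.trdeg k K := by
    have h4 : Algebra.trdeg k B ≤ Algebra.trdeg k K :=
      trdeg_le_of_injective (IsScalarTower.toAlgHom k B K) hinj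
    simpa [B] using h4
  have h6 : AlgebraicIndependent k y :=
    (Algebra.IsAlgebraic.isTranscendenceBasis_of_le_trdeg_of_finite k y h5).1
  exact AlgebraicIndependent.of_comp (f := IsScalarTower.toAlgHom k B K) (x := g) h6

/-- A prime that contains polynomials with a Jacobian minor not vanishing at a point of the
smaller irreducible set cuts out nothing larger. -/
theorem eq_of_jacobian {k σ ι : Type} [Field k] [CharZero k] [Fintype σ] [Fintype ι]
    [DecidableEq ι] {P Q : Ideal (MvPolynomial σ k)} [P.IsPrime] [Q.IsPrime] (hPQ : P ≤ Q)
    (s : ι → σ) (hs : Function.Injective s) (g : ι → MvPolynomial σ k) (hg : ∀ i, g i ∈ P)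
    (hdet : (Matrix.of fun i j => pderiv (s j) (g i)).det ∉ P)
    (hQ : ringKrullDim (MvPolynomial σ k ⧸ Q) = (Fintype.card σ - Fintype.card ι : ℕ)) :
    P = Q := by
  obtain ⟨d, hd, hd'⟩ := exists_ringKrullDim_eq_trdeg k (MvPolynomial σ k ⧸ P)
  have h1 := trdeg_le_of_jacobian P s hs g hg hdet
  rw [hd', Nat.cast_le] at h1
  by_contra hne
  obtain ⟨r, hrQ, hrP⟩ := SetLike.exists_of_lt (lt_of_le_of_ne hPQ hne)
  set r' := Ideal.Quotient.mk P r
  have hr' : r' ∈ nonZeroDivisors (MvPolynomial σ k ⧸ P) := by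
    rw [mem_nonZeroDivisors_iff_ne_zero]
    rwa [Ne, Ideal.Quotient.eq_zero_iff_mem]
  -- If `P ≠ Q`, a nonzero element of `Q / P` is a nonzerodivisor of the domain, so the dimension
  -- drops by at least one on passing to `Q`, against the bound for `P`.
  have h2 := ringKrullDim_succ_le_of_surjective (Ideal.Quotient.factor hPQ)
    (Ideal.Quotient.factor_surjective hPQ) hr' (by simpa [r', Ideal.Quotient.eq_zero_iff_mem])
  rw [hd, hQ] at h2
  have h3 : (Fintype.card σ - Fintype.card ι) + 1 ≤ d := by exact_mod_cast h2
  omega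

end DimensionTheory

/-! ### Vanishing ideals and dimensions of parametrized sets. -/

section Parametrization

open CuspidalCenter

/-- The set lies between the image of the parametrization and the image of the dense open set `G ≠
0`. Pulling a polynomial back along `φ` therefore tests it on the set. -/
theorem vanishingIdeal_eq_ker_of_parametrization {σ τ : Type} [Finite τ] (S : Set (σ → ℂ))
    (φ : σ → MvPolynomial τ ℂ) (G : MvPolynomial τ ℂ) (hG : G ≠ 0)
    (h1 : ∀ s ∈ S, ∃ t, s = fun c => eval t (φ c))
    (h2 : ∀ t, eval t G ≠ 0 → (fun c => eval t (φ c)) ∈ S) :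
    vanishingIdeal ℂ S = RingHom.ker (aeval φ : MvPolynomial σ ℂ →ₐ[ℂ] MvPolynomial τ ℂ) := by
  have key : ∀ (f : MvPolynomial σ ℂ) t,
      eval t (aeval φ f) = aeval (fun c => eval t (φ c)) f := by
    intro f t
    have := MvPolynomial.comp_aeval_apply (f := φ) (φ := (aeval t : MvPolynomial τ ℂ →ₐ[ℂ] ℂ)) f
    simpa [coe_aeval_eq_eval] using this
  ext f
  rw [mem_vanishingIdeal_iff, RingHom.mem_ker]
  constructor
  · intro h
    have h3 : aeval φ f * G = 0 := by
      refine MvPolynomial.funext fun t => ?_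
      rw [map_mul, map_zero]
      by_cases ht : eval t G = 0
      · rw [ht, mul_zero]
      · have := h _ (h2 t ht)
        rw [← key] at this
        rw [this, zero_mul]
    exact (mul_eq_zero.mp h3).resolve_right hG
  · intro h s hs
    obtain ⟨t, rfl⟩ := h1 s hs
    rw [← key]
    change aeval φ f = 0 at h
    rw [h, map_zero]

/-- The coordinate ring embeds into the polynomial ring of the parameters, which bounds the
dimension above. The chosen coordinates are algebraically independent after pullback, which bounds
it below. -/
theorem zariskiDim_of_vanishingIdeal_eq_ker {σ τ : Type} [Fintype σ] [Fintype τ] [DecidableEq τ]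
    (S : Set (σ → ℂ)) (φ : σ → MvPolynomial τ ℂ)
    (h : vanishingIdeal ℂ S = RingHom.ker (aeval φ : MvPolynomial σ ℂ →ₐ[ℂ] MvPolynomial τ ℂ))
    (s : τ → σ) (hdet : (Matrix.of fun i j => pderiv j (φ (s i))).det ≠ 0) :
    zariskiDim S = Fintype.card τ := by
  have hprime : (vanishingIdeal ℂ S).IsPrime := by rw [h]; exact RingHom.ker_isPrime _
  obtain ⟨d, hd, hd'⟩ := exists_ringKrullDim_eq_trdeg ℂ (MvPolynomial σ ℂ ⧸ vanishingIdeal ℂ S)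
  rw [zariskiDim, hd]
  congr 1
  let ι : (MvPolynomial σ ℂ ⧸ vanishingIdeal ℂ S) →ₐ[ℂ] MvPolynomial τ ℂ :=
    Ideal.Quotient.liftₐ _ (aeval φ) (fun a ha => by rw [h] at ha; exact ha)
  have hι : Function.Injective ι := by
    rw [injective_iff_map_eq_zero]
    intro a ha
    obtain ⟨p, rfl⟩ := Ideal.Quotient.mk_surjective a
    rw [Ideal.Quotient.eq_zero_iff_mem, h]
    exact ha
  apply Nat.le_antisymm
  · have := trdeg_le_of_injective ι hι
    rw [hd', MvPolynomial.trdeg_of_isDomain] at this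
    simpa using this
  · have hai := algebraicIndependent_of_jacobian (fun i => φ (s i)) hdet
    have : AlgebraicIndependent ℂ fun i => Ideal.Quotient.mk (vanishingIdeal ℂ S) (X (s i)) := by
      refine AlgebraicIndependent.of_comp ι ?_
      have h0 : ι ∘ (fun i => Ideal.Quotient.mk (vanishingIdeal ℂ S) (X (s i))) = fun i => φ (s i) := by
        funext i
        change aeval φ (X (s i)) = _
        simp
      rw [h0]
      exact hai
    have := this.cardinalMk_le_trdeg
    rw [hd'] at this
    simpa using this

end Parametrization

namespace CuspidalCenter

noncomputable section

/-! ### Formal sixth roots and formal primitives. -/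

section PowerSeries

/-- Write `f = c (1 + u)` with `u` of zero constant term, substitute `u` into the binomial series of
exponent `-1/6`, and multiply by a sixth root of `1/c`. -/
theorem exists_pow_six_mul_eq_one (f : MvPowerSeries (Fin 2) ℂ)
    (hf : MvPowerSeries.constantCoeff f ≠ 0) : ∃ μ, μ ^ 6 * f = 1 := by
  set c := MvPowerSeries.constantCoeff f with hc
  obtain ⟨d, hd⟩ := IsAlgClosed.exists_pow_nat_eq c⁻¹ (n := 6) (by norm_num)
  set u : MvPowerSeries (Fin 2) ℂ := MvPowerSeries.C c⁻¹ * f - 1 with hu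
  have hsub : PowerSeries.HasSubst u := by
    apply PowerSeries.HasSubst.of_constantCoeff_zero
    simp [hu, ← hc, hf]
  have hb : (PowerSeries.binomialSeries ℂ (-1 / 6 : ℚ)) ^ 6 * (1 + PowerSeries.X) = 1 := by
    have h1 : (1 + PowerSeries.X : PowerSeries ℂ) = PowerSeries.binomialSeries ℂ (1 : ℚ) := by
      have := PowerSeries.binomialSeries_nat (R := ℚ) (A := ℂ) 1
      simpa using this.symm
    have h0 : (1 : PowerSeries ℂ) = PowerSeries.binomialSeries ℂ (0 : ℚ) := by
      simp
    rw [h1, h0]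
    simp only [pow_succ, pow_zero, one_mul, ← PowerSeries.binomialSeries_add]
    norm_num
  have hs := congrArg (PowerSeries.substAlgHom (S := ℂ) (R := ℂ) hsub) hb
  simp only [map_mul, map_pow, map_add, map_one, PowerSeries.substAlgHom_X] at hs
  refine ⟨MvPowerSeries.C d * PowerSeries.substAlgHom hsub (PowerSeries.binomialSeries ℂ (-1 / 6 : ℚ)), ?_⟩
  have h2 : MvPowerSeries.C c * (1 + u) = f := by
    rw [hu, add_sub_cancel, ← mul_assoc, ← map_mul, mul_inv_cancel₀ hf, map_one, one_mul]
  have h3 : (MvPowerSeries.C d : MvPowerSeries (Fin 2) ℂ) ^ 6 * MvPowerSeries.C c = 1 := by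
    rw [← map_pow, hd, ← map_mul, inv_mul_cancel₀ hf, map_one]
  rw [← h2, mul_pow]
  linear_combination (MvPowerSeries.C d : MvPowerSeries (Fin 2) ℂ) ^ 6 * MvPowerSeries.C c * hs + h3

theorem finsupp_fin_two_eq (m : Fin 2 →₀ ℕ) :
    m = Finsupp.single 0 (m 0) + Finsupp.single 1 (m 1) := by
  ext i
  fin_cases i <;> simp

/-- The formal Poincaré lemma in two variables. -/
theorem exists_formal_primitive (θ : Fin 2 → MvPowerSeries (Fin 2) ℂ)
    (hθ : MvPowerSeries.pderiv ℂ 0 (θ 1) = MvPowerSeries.pderiv ℂ 1 (θ 0)) :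
    ∃ H, ∀ i, MvPowerSeries.pderiv ℂ i H = θ i := by
  classical
  -- Monomials in `y` alone are integrated from `θ 1`, all others from `θ 0`. For the constant term
  -- the division by zero returns zero. Closedness is needed only for the `y`-derivative of the
  -- mixed part.
  let H : MvPowerSeries (Fin 2) ℂ := fun m =>
    if m 0 = 0 then MvPowerSeries.coeff (m - Finsupp.single 1 1) (θ 1) / (m 1 : ℂ)
    else MvPowerSeries.coeff (m - Finsupp.single 0 1) (θ 0) / (m 0 : ℂ)
  have hH : ∀ m, MvPowerSeries.coeff m H =
    if m 0 = 0 then MvPowerSeries.coeff (m - Finsupp.single 1 1) (θ 1) / (m 1 : ℂ)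
    else MvPowerSeries.coeff (m - Finsupp.single 0 1) (θ 0) / (m 0 : ℂ) := fun m => rfl
  refine ⟨H, fun i => ?_⟩
  ext n
  rw [MvPowerSeries.coeff_pderiv, hH]
  have hne : ∀ j : Fin 2, (n j : ℂ) + 1 ≠ 0 := fun j => Nat.cast_add_one_ne_zero (n j)
  fin_cases i
  · simp [hne 0]
  · by_cases h0 : n 0 = 0
    · simp [h0, hne 1]
    · obtain ⟨k, hk⟩ : ∃ k, n = k + Finsupp.single 0 1 := by
        refine ⟨n - Finsupp.single 0 1, ?_⟩
        rw [tsub_add_cancel_of_le]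
        simpa using Nat.one_le_iff_ne_zero.mpr h0
      have h1 := congrArg (MvPowerSeries.coeff k) hθ
      rw [MvPowerSeries.coeff_pderiv, MvPowerSeries.coeff_pderiv] at h1
      have h2 : n + Finsupp.single 1 1 - Finsupp.single 0 1 = k + Finsupp.single 1 1 := by
        rw [hk, add_right_comm, add_tsub_cancel_right]
      have hk0 : (n 0 : ℂ) = k 0 + 1 := by rw [hk]; simp
      have hk1 : (n 1 : ℂ) = k 1 := by rw [hk]; simp
      have h3 : (k 0 : ℂ) + 1 ≠ 0 := hk0 ▸ (by exact_mod_cast h0)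
      simp only [Fin.mk_one, Fin.isValue, Finsupp.coe_add, Pi.add_apply, Finsupp.single_apply]
      simp only [Fin.isValue, one_ne_zero, if_false, add_zero, h0, h2]
      rw [← hk] at h1
      rw [hk0, hk1]
      field_simp
      linear_combination -h1
end PowerSeries

/-! ### Affine substitutions, pullbacks and cofactors. -/

section ChainRule

theorem pderiv_aeval (g : Fin 2 → Poly2) (j : Fin 2) (f : Poly2) :
    pderiv j (aeval g f) = ∑ i, aeval g (pderiv i f) * pderiv j (g i) := by
  induction f using MvPolynomial.induction_on with
  | C a => simp [MvPolynomial.algebraMap_eq]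
  | add p q hp hq => simp only [map_add, hp, hq, add_mul, Finset.sum_add_distrib]
  | mul_X p c hp =>
    simp only [map_mul, aeval_X, Derivation.leibniz, hp, pderiv_X, smul_eq_mul, map_add,
      Fin.sum_univ_two]
    fin_cases c <;> simp <;> ring

theorem eval_aeval (g : Fin 2 → Poly2) (v : Fin 2 → ℂ) (f : Poly2) :
    eval v (aeval g f) = eval (fun k => eval v (g k)) f := by
  induction f using MvPolynomial.induction_on with
  | C a => simp [MvPolynomial.algebraMap_eq]
  | add p q hp hq => simp only [map_add, hp, hq]
  | mul_X p c hp => simp only [map_mul, aeval_X, hp, eval_X]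

theorem pderiv_translate (a : Fin 2 → ℂ) (i : Fin 2) (f : Poly2) :
    pderiv i (translate a f) = translate a (pderiv i f) := by
  rw [translate, pderiv_aeval, translate]
  fin_cases i <;> simp [Fin.sum_univ_two, pderiv_X]

/-- Substitution of the affine map `v ↦ a + A v`. -/
def affineSubst (a : Fin 2 → ℂ) (A : Matrix (Fin 2) (Fin 2) ℂ) : Poly2 →ₐ[ℂ] Poly2 :=
  aeval fun k => C (a k) + ∑ n, C (A k n) * (X n : Poly2)

theorem pderiv_affineSubst (a : Fin 2 → ℂ) (A : Matrix (Fin 2) (Fin 2) ℂ) (j : Fin 2) (f : Poly2) :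
    pderiv j (affineSubst a A f) = ∑ i, affineSubst a A (pderiv i f) * C (A i j) := by
  rw [affineSubst, pderiv_aeval]
  fin_cases j <;> simp [Fin.sum_univ_two, pderiv_X]

theorem eval_affineSubst (a : Fin 2 → ℂ) (A : Matrix (Fin 2) (Fin 2) ℂ) (v : Fin 2 → ℂ) (f : Poly2) :
    eval v (affineSubst a A f) = eval (a + A.mulVec v) f := by
  rw [affineSubst, eval_aeval]
  congr 2
  funext k
  fin_cases k <;> simp

theorem pullback_apply (a : Fin 2 → ℂ) (A : Matrix (Fin 2) (Fin 2) ℂ) (ω : Form) (j : Fin 2) :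
    pullback a A ω j = ∑ i, C (A i j) * affineSubst a A (ω i) := rfl

theorem dWedge_pullback (a : Fin 2 → ℂ) (A : Matrix (Fin 2) (Fin 2) ℂ) (f : Poly2) (ω : Form) :
    dWedge (affineSubst a A f) (pullback a A ω) = C A.det * affineSubst a A (dWedge f ω) := by
  simp only [dWedge, pderiv_affineSubst, pullback_apply, Fin.sum_univ_two, Matrix.det_fin_two,
    map_sub, map_mul]
  ring

theorem dForm_pullback (a : Fin 2 → ℂ) (A : Matrix (Fin 2) (Fin 2) ℂ) (ω : Form) :
    dForm (pullback a A ω) = C A.det * affineSubst a A (dForm ω) := by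
  simp only [dForm, pderiv_affineSubst, pullback_apply, Fin.sum_univ_two, Matrix.det_fin_two,
    map_sub, map_mul, map_add, Derivation.leibniz, pderiv_C, smul_eq_mul]
  ring

theorem IsCofactor.pullback {ω : Form} {f K : Poly2} (h : IsCofactor ω f K) (a : Fin 2 → ℂ)
    (A : Matrix (Fin 2) (Fin 2) ℂ) :
    IsCofactor (pullback a A ω) (affineSubst a A f) (C A.det * affineSubst a A K) := by
  rw [IsCofactor, dWedge_pullback, h, map_mul]
  ring

end ChainRule

/-! ### Integrating factors and diagonalization of quadratic forms. -/

section Darboux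

/-- The logarithmic differential of `μ` satisfies `6 dμ/μ = -4 dl/l - 5 dq/q`, so `6 d(μω) = -μ (4
Kl + 5 Kq - 6 dω) = 0`. The formal Poincaré lemma then yields the first integral. -/
theorem hasDarbouxFactor_of_relation {ω : Form} {l q Kl Kq : Poly2} (hl : IsCofactor ω l Kl)
    (hq : IsCofactor ω q Kq) (h : 4 * Kl + 5 * Kq - 6 * dForm ω = 0) : HasDarbouxFactor ω l q := by
  intro a hla hqa
  set T : Poly2 →+* MvPowerSeries (Fin 2) ℂ := (MvPolynomial.coeToMvPowerSeries.ringHom).comp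
    (aeval (fun i => X i + C (a i)) : Poly2 →ₐ[ℂ] Poly2).toRingHom with hT
  have hTa : ∀ f, T f = (translate a f : MvPowerSeries (Fin 2) ℂ) := fun f => rfl
  have hTd : ∀ i f, MvPowerSeries.pderiv ℂ i (T f) = T (pderiv i f) := by
    intro i f
    rw [hTa, hTa, ← pderiv_translate, MvPowerSeries.pderiv_coe]
  have hc : ∀ f, MvPowerSeries.constantCoeff (T f) = eval a f := by
    intro f
    rw [hTa, ← MvPowerSeries.coeff_zero_eq_constantCoeff_apply, MvPolynomial.coeff_coe,
      ← MvPolynomial.constantCoeff_eq, translate, ← MvPolynomial.eval_zero]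
    rw [eval_aeval]
    congr 2
    funext k
    simp
  obtain ⟨μ, hμ⟩ := exists_pow_six_mul_eq_one (T l ^ 4 * T q ^ 5) (by
    simp [hc, hla, hqa])
  have hlq : T l * T q ≠ 0 := by
    intro h0
    have := congrArg MvPowerSeries.constantCoeff h0
    simp [hc, hla, hqa] at this
  have hdμ : ∀ i, 6 * MvPowerSeries.pderiv ℂ i μ * (T l * T q) =
      -μ * (4 * T (pderiv i l) * T q + 5 * T l * T (pderiv i q)) := by
    intro i
    have h1 := congrArg (MvPowerSeries.pderiv ℂ i) hμ
    simp only [Derivation.leibniz, Derivation.leibniz_pow, smul_eq_mul, nsmul_eq_mul, hTd,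
      Derivation.map_one_eq_zero] at h1
    -- The common factor of the derivative of `μ ^ 6 l ^ 4 q ^ 5 = 1`; cancelling it leaves the
    -- logarithmic derivative cleared of denominators.
    have hne : μ ^ 5 * (T l ^ 3 * T q ^ 4) ≠ 0 := by
      intro h0
      have h2 : μ ^ 6 * (T l ^ 4 * T q ^ 5) = 0 := by
        linear_combination (μ * T l * T q) * h0
      rw [hμ] at h2
      exact one_ne_zero h2
    refine mul_left_cancel₀ hne ?_
    push_cast at h1
    linear_combination h1
  obtain ⟨H, hH⟩ := exists_formal_primitive (fun i => μ * T (ω i)) (by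
    have e1 := congrArg T hl
    have e2 := congrArg T hq
    have e3 := congrArg T h
    simp only [dWedge, dForm, map_sub, map_mul, map_add, map_zero, map_ofNat] at e1 e2 e3
    simp only [Derivation.leibniz, smul_eq_mul, hTd]
    have h60 : (6 : MvPowerSeries (Fin 2) ℂ) ≠ 0 := by
      intro h0
      have := congrArg MvPowerSeries.constantCoeff h0
      simp only [map_ofNat, map_zero] at this
      norm_num at this
    refine mul_left_cancel₀ (mul_ne_zero h60 hlq) ?_
    linear_combination T (ω 1) * hdμ 0 - T (ω 0) * hdμ 1 - 4 * μ * T q * e1 - 5 * μ * T l * e2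
      - μ * T l * T q * e3)
  exact ⟨μ, H, by rw [← hTa, ← hTa, mul_assoc]; exact hμ, fun i => hH i⟩

/-- Over the complex numbers every nondegenerate symmetric form is a sum of squares: complete the
square at a nonzero diagonal entry and take square roots. -/
theorem exists_isometry {p q r : ℂ} (h : p * r - q ^ 2 ≠ 0) : ∃ A : Matrix (Fin 2) (Fin 2) ℂ,
    A.det ≠ 0 ∧ A.transpose * !![p, q; q, r] * A = 1 := by
  suffices ∃ A : Matrix (Fin 2) (Fin 2) ℂ, A.transpose * !![p, q; q, r] * A = 1 by
    obtain ⟨A, hA⟩ := this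
    refine ⟨A, ?_, hA⟩
    have := congrArg Matrix.det hA
    rw [Matrix.det_mul, Matrix.det_one] at this
    exact right_ne_zero_of_mul_eq_one this
  have key : ∀ a b c d : ℂ, p * a ^ 2 + 2 * q * a * c + r * c ^ 2 = 1 →
      p * b ^ 2 + 2 * q * b * d + r * d ^ 2 = 1 →
      p * a * b + q * (a * d + b * c) + r * c * d = 0 →
      ∃ A : Matrix (Fin 2) (Fin 2) ℂ, A.transpose * !![p, q; q, r] * A = 1 := by
    intro a b c d h1 h2 h3
    refine ⟨!![a, b; c, d], ?_⟩
    ext i j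
    fin_cases i <;> fin_cases j <;> simp [Matrix.mul_apply, Fin.sum_univ_two]
    · linear_combination h1
    · linear_combination h3
    · linear_combination h3
    · linear_combination h2
  by_cases hp : p = 0
  · by_cases hr : r = 0
    · have hq : q ≠ 0 := by
        rintro rfl
        simp [hp] at h
      -- The form is the hyperbolic plane `2qxy`; the vectors `(1, 1)` and `(i, -i)` are orthogonal
      -- with common value `2q`.
      obtain ⟨g, hg⟩ := IsAlgClosed.exists_pow_nat_eq (2 * q) (n := 2) (by norm_num)
      have hg0 : g ≠ 0 := by
        rintro rfl
        simp [hq] at hg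
      refine key (1 / g) (Complex.I / g) (1 / g) (-Complex.I / g) ?_ ?_ ?_
      · rw [hp, hr]; field_simp; linear_combination -hg
      · rw [hp, hr]; field_simp; linear_combination -hg - 2 * q * Complex.I_sq
      · rw [hp, hr]; field_simp; ring
    · obtain ⟨g, hg⟩ := IsAlgClosed.exists_pow_nat_eq r (n := 2) (by norm_num)
      obtain ⟨e, he⟩ := IsAlgClosed.exists_pow_nat_eq (p - q ^ 2 / r) (n := 2) (by norm_num)
      have hg0 : g ≠ 0 := by
        rintro rfl
        simp at hg; exact hr hg.symm
      have he0 : e ≠ 0 := by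
        rintro rfl
        apply h
        field_simp at he
        linear_combination -he
      refine key 0 (1 / e) (1 / g) (-q / r / e) ?_ ?_ ?_
      · field_simp; linear_combination -hg
      · field_simp; field_simp at he; linear_combination -he
      · field_simp; ring
  · obtain ⟨g, hg⟩ := IsAlgClosed.exists_pow_nat_eq p (n := 2) (by norm_num)
    obtain ⟨e, he⟩ := IsAlgClosed.exists_pow_nat_eq (r - q ^ 2 / p) (n := 2) (by norm_num)
    have hg0 : g ≠ 0 := by
      rintro rfl
      simp at hg; exact hp hg.symm
    have he0 : e ≠ 0 := by
      rintro rfl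
      apply h
      field_simp at he
      linear_combination -he
    refine key (1 / g) (-q / p / e) 0 (1 / e) ?_ ?_ ?_
    · field_simp; linear_combination -hg
    · field_simp; field_simp at he; linear_combination -he
    · field_simp; ring

end Darboux

end

end CuspidalCenter

/-! ### Nondegenerate zeros off the integral curves are centers. -/

namespace CuspidalCenter

noncomputable section

theorem coeff_single_one (f : Poly2) (i : Fin 2) :
    coeff (Finsupp.single i 1) f = eval 0 (pderiv i f) := by
  have h := MvPowerSeries.coeff_pderiv (R := ℂ) (i := i) (f : MvPowerSeries (Fin 2) ℂ) 0
  rw [MvPowerSeries.pderiv_coe, MvPolynomial.coeff_coe, zero_add, MvPolynomial.coeff_coe] at h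
  rw [← constantCoeff_eq] at h
  rw [eval_zero, h]
  simp

theorem homogeneousComponent_one_eq (f : Poly2) :
    homogeneousComponent 1 f = C (eval 0 (pderiv 0 f)) * X 0 + C (eval 0 (pderiv 1 f)) * X 1 := by
  ext m
  rw [coeff_homogeneousComponent, ← coeff_single_one, ← coeff_single_one, coeff_add, coeff_C_mul,
    coeff_C_mul, coeff_X, coeff_X]
  have hdeg : m.degree = m 0 + m 1 := by
    rw [Finsupp.degree_eq_sum, Fin.sum_univ_two]
  by_cases h0 : m = Finsupp.single 0 1
  · subst h0; simp [Finsupp.degree_single, Finsupp.single_left_inj]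
  by_cases h1 : m = Finsupp.single 1 1
  · subst h1; simp [Finsupp.degree_single, Finsupp.single_left_inj]
  rw [if_neg (Ne.symm h0), if_neg (Ne.symm h1), if_neg]
  · simp
  · intro h
    rw [hdeg] at h
    have : (m 0 = 1 ∧ m 1 = 0) ∨ (m 0 = 0 ∧ m 1 = 1) := by omega
    rcases this with ⟨a, b⟩ | ⟨a, b⟩
    · apply h0; rw [finsupp_fin_two_eq m, a, b]; simp
    · apply h1; rw [finsupp_fin_two_eq m, a, b]; simp

theorem translate_zero (f : Poly2) : translate 0 f = f := by
  simp [translate]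

/-- A nondegenerate zero off the two curves of a form with Darboux relation is a center. -/
theorem hasCenterAt_of_relation {ω : Form} {l q Kl Kq : Poly2} (hl : IsCofactor ω l Kl)
    (hq : IsCofactor ω q Kq) (h : 4 * Kl + 5 * Kq - 6 * dForm ω = 0) {a : Fin 2 → ℂ}
    (hla : eval a l ≠ 0) (hqa : eval a q ≠ 0) (hω : ∀ i, eval a (ω i) = 0)
    (hdet : eval a (pderiv 0 (ω 0)) * eval a (pderiv 1 (ω 1)) -
      eval a (pderiv 1 (ω 0)) * eval a (pderiv 0 (ω 1)) ≠ 0) : HasCenterAt ω a := by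
  -- At a zero of `ω` off a curve, `dF ∧ ω = F K` gives `K = 0`. The relation then makes `dω` vanish
  -- there, so the linear part of `ω` is symmetric and can be diagonalized.
  have hsymm : eval a (pderiv 0 (ω 1)) = eval a (pderiv 1 (ω 0)) := by
    have e1 := congrArg (eval a) hl
    have e2 := congrArg (eval a) hq
    have e3 := congrArg (eval a) h
    simp only [dWedge, dForm, map_sub, map_mul, map_add, map_zero, map_ofNat, hω, mul_zero,
      sub_zero] at e1 e2 e3
    have k1 : eval a Kl = 0 := by simpa [hla] using e1.symm
    have k2 : eval a Kq = 0 := by simpa [hqa] using e2.symm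
    rw [k1, k2] at e3
    linear_combination -e3 / 6
  set p := eval a (pderiv 0 (ω 0))
  set q' := eval a (pderiv 1 (ω 0))
  set r := eval a (pderiv 1 (ω 1))
  rw [hsymm] at hdet
  obtain ⟨A, hA, hAS⟩ := exists_isometry (p := p) (q := q') (r := r)
    (fun h0 => hdet (by linear_combination h0))
  refine ⟨A, hA, ?_⟩
  set ω' := pullback a A ω with hω'
  have hzero : a + A.mulVec 0 = a := by simp
  have h0 : ∀ i, eval 0 (ω' i) = 0 := by
    intro i
    rw [hω', pullback_apply]
    simp only [map_sum, map_mul, eval_affineSubst, hzero, hω, mul_zero, Finset.sum_const_zero]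
  have h1 : ∀ i j, eval 0 (pderiv j (ω' i)) = if i = j then 1 else 0 := by
    intro i j
    have := congrFun (congrFun hAS i) j
    rw [Matrix.one_apply] at this
    rw [← this, hω', pullback_apply]
    simp only [Derivation.leibniz, pderiv_C, smul_eq_mul, map_zero, hω,
      pderiv_affineSubst, map_mul, eval_C, eval_affineSubst, hzero, Fin.sum_univ_two, map_add,
      Matrix.mul_apply, Matrix.transpose_apply]
    simp only [hsymm, p, q', r, Fin.isValue, Matrix.cons_val', Matrix.cons_val_zero,
      Matrix.cons_val_one, Matrix.of_apply, Matrix.cons_val_fin_one]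
    ring
  have hnorm : ∀ i, homogeneousComponent 0 (ω' i) = 0 ∧ homogeneousComponent 1 (ω' i) = X i := by
    intro i
    refine ⟨?_, ?_⟩
    · rw [homogeneousComponent_zero, ← constantCoeff_eq, ← eval_zero, h0, map_zero]
    · rw [homogeneousComponent_one_eq, h1, h1]
      fin_cases i <;> simp
  refine ⟨hnorm, ?_⟩
  have hD : HasDarbouxFactor ω' (affineSubst a A l) (affineSubst a A q) := by
    refine hasDarbouxFactor_of_relation (hl.pullback a A) (hq.pullback a A) ?_
    rw [dForm_pullback]
    have := congrArg (affineSubst a A) h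
    simp only [map_sub, map_mul, map_add, map_zero, map_ofNat] at this
    linear_combination C A.det * this
  obtain ⟨μ, H, hμ, hH⟩ := hD 0 (by rwa [eval_affineSubst, hzero]) (by rwa [eval_affineSubst, hzero])
  simp only [translate_zero] at hμ hH
  set m0 := MvPowerSeries.constantCoeff μ with hm0
  have hm0' : m0 ≠ 0 := by
    intro h0
    have := congrArg MvPowerSeries.constantCoeff hμ
    rw [mul_assoc, map_mul, map_pow, ← hm0, h0] at this
    simp at this
  have hcoef0 : ∀ i, MvPowerSeries.coeff 0 (ω' i : MvPowerSeries (Fin 2) ℂ) = 0 := by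
    intro i
    rw [MvPolynomial.coeff_coe, ← constantCoeff_eq, ← eval_zero, h0]
  have hprod0 : ∀ i, MvPowerSeries.coeff 0 (μ * (ω' i : MvPowerSeries (Fin 2) ℂ)) = 0 := by
    intro i
    rw [MvPowerSeries.coeff_zero_eq_constantCoeff_apply, map_mul,
      ← MvPowerSeries.coeff_zero_eq_constantCoeff_apply (ω' i : MvPowerSeries (Fin 2) ℂ), hcoef0, mul_zero]
  have hprod1 : ∀ i j, MvPowerSeries.coeff (Finsupp.single j 1)
      (μ * (ω' i : MvPowerSeries (Fin 2) ℂ)) = if i = j then m0 else 0 := by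
    intro i j
    have e := congrArg MvPowerSeries.constantCoeff
      (Derivation.leibniz (MvPowerSeries.pderiv ℂ j) μ (ω' i : MvPowerSeries (Fin 2) ℂ))
    rw [← MvPowerSeries.coeff_zero_eq_constantCoeff_apply, MvPowerSeries.coeff_pderiv] at e
    simp only [zero_add, smul_eq_mul, map_add, map_mul, MvPowerSeries.pderiv_coe] at e
    simp only [← MvPowerSeries.coeff_zero_eq_constantCoeff_apply, hcoef0, zero_mul, add_zero] at e
    rw [MvPolynomial.coeff_coe, ← constantCoeff_eq, ← eval_zero, h1,
      MvPowerSeries.coeff_zero_eq_constantCoeff_apply] at e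
    simpa using e
  -- The linear part of `μ ω'` is `m0 (x dx + y dy)`, so `H - H(0)` starts with `(m0 / 2)(x² + y²)`;
  -- the factor normalizes this.
  set F : MvPowerSeries (Fin 2) ℂ :=
    MvPowerSeries.C (2 / m0) * (H - MvPowerSeries.C (MvPowerSeries.constantCoeff H)) with hF
  have hdF : ∀ i, MvPowerSeries.pderiv ℂ i F = MvPowerSeries.C (2 / m0) *
      (μ * (ω' i : MvPowerSeries (Fin 2) ℂ)) := by
    intro i
    rw [hF, Derivation.leibniz, map_sub, MvPowerSeries.pderiv_C, MvPowerSeries.pderiv_C, hH]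
    simp
  -- `dF` is a multiple of `ω'`, so all focal values are zero with this choice of `F`.
  have hdWF : MvPowerSeries.pderiv ℂ 0 F * (ω' 1 : MvPowerSeries (Fin 2) ℂ) -
      MvPowerSeries.pderiv ℂ 1 F * (ω' 0 : MvPowerSeries (Fin 2) ℂ) = 0 := by
    rw [hdF, hdF]; ring
  refine ⟨F, 0, ⟨?_, ?_, ?_⟩, fun _ _ => rfl⟩
  · intro m hm
    have hdeg : m.degree = m 0 + m 1 := by
      rw [Finsupp.degree_eq_sum, Fin.sum_univ_two]
    rw [hdeg] at hm
    have hFc : ∀ i n, MvPowerSeries.coeff (n + Finsupp.single i 1) F * (n i + 1) =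
        2 / m0 * MvPowerSeries.coeff n (μ * (ω' i : MvPowerSeries (Fin 2) ℂ)) := by
      intro i n
      rw [← MvPowerSeries.coeff_pderiv, hdF, MvPowerSeries.coeff_C_mul]
    have hX : ∀ i : Fin 2, (X i ^ 2 : Poly2) = monomial (Finsupp.single i 2) 1 := fun i => X_pow_eq_monomial
    rw [coeff_add, hX, hX, coeff_monomial, coeff_monomial]
    have hcase : m = 0 ∨ (∃ i, m = 0 + Finsupp.single i 1) ∨
        ∃ i j, m = Finsupp.single j 1 + Finsupp.single i 1 := by
      have : (m 0 = 0 ∧ m 1 = 0) ∨ (m 0 = 1 ∧ m 1 = 0) ∨ (m 0 = 0 ∧ m 1 = 1) ∨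
        (m 0 = 2 ∧ m 1 = 0) ∨ (m 0 = 1 ∧ m 1 = 1) ∨ (m 0 = 0 ∧ m 1 = 2) := by omega
      rw [finsupp_fin_two_eq m]
      rcases this with ⟨a, b⟩ | ⟨a, b⟩ | ⟨a, b⟩ | ⟨a, b⟩ | ⟨a, b⟩ | ⟨a, b⟩ <;> rw [a, b]
      · left; simp
      · right; left; exact ⟨0, by simp⟩
      · right; left; exact ⟨1, by simp⟩
      · right; right; exact ⟨0, 0, by simp [← Finsupp.single_add]⟩
      · right; right; exact ⟨1, 0, by simp⟩
      · right; right; exact ⟨1, 1, by simp [← Finsupp.single_add]⟩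
    rcases hcase with rfl | ⟨i, rfl⟩ | ⟨i, j, rfl⟩
    · rw [if_neg (by simp), if_neg (by simp), hF]
      simp
    · have := hFc i 0
      rw [hprod0] at this
      rw [if_neg, if_neg]
      · simpa using this
      · intro h; have := congrArg Finsupp.degree h; simp [Finsupp.degree_single] at this
      · intro h; have := congrArg Finsupp.degree h; simp [Finsupp.degree_single] at this
    · have := hFc i (Finsupp.single j 1)
      rw [hprod1] at this
      by_cases hij : i = j
      · subst hij
        rw [if_pos rfl] at this
        rw [← Finsupp.single_add] at this ⊢
        have h2 : MvPowerSeries.coeff (Finsupp.single i (1 + 1)) F = 1 := by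
          simp only [Finsupp.single_eq_same, Nat.cast_one] at this
          field_simp at this
          linear_combination this / 2
        rw [h2]
        fin_cases i <;> simp [Finsupp.single_left_inj]
      · rw [if_neg hij, mul_zero] at this
        have h2 : MvPowerSeries.coeff (Finsupp.single j 1 + Finsupp.single i 1) F = 0 := by
          rcases mul_eq_zero.mp this with h | h
          · exact h
          · exact absurd h (Nat.cast_add_one_ne_zero _)
        rw [h2, if_neg, if_neg, add_zero]
        all_goals
          intro h
          have e0 := DFunLike.congr_fun h 0
          have e1 := DFunLike.congr_fun h 1
          fin_cases i <;> fin_cases j <;> simp at hij e0 e1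
  · intro i j _
    rw [hdWF]; simp
  · intro m _
    rw [hdWF]; simp

end

end CuspidalCenter

namespace CuspidalCenter

noncomputable section

/-! ### The explicit form attached to a frame, its cofactors and its center. -/

section NormalForm

/-- The three-cuspidal quartic in homogeneous normal form. -/
def quart {R : Type*} [CommRing R] (x y z : R) : R :=
  x ^ 2 * y ^ 2 + y ^ 2 * z ^ 2 + z ^ 2 * x ^ 2 - 2 * x * y * z * (x + y + z)

/-- The coefficient of `dx` in the normal form of the foliation; the other two coefficients
arise by cyclic permutation. -/
def netCoeff {R : Type*} [CommRing R] (m n k x y z : R) : R :=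
  m * x * (z - y) * (k * z + n * y) + y * z * (k * (2 * k - m) * z - n * (2 * n - m) * y)

/-- The coefficient at `dy ∧ dz` of the cofactor of the quartic, in the three linear polynomials of
the frame; cyclic permutation gives the coefficients at `dz ∧ dx` and `dx ∧ dy`. The parameter `k`
is eliminated. The next definition plays the same role for the line. -/
def quartCofactor {R : Type*} [CommRing R] (m n x y z : R) : R :=
  -6 * x ^ 2 * m ^ 2 + 4 * x * y * m * n + 6 * x * y * n ^ 2 + 2 * x * z * m ^ 2
    + 8 * x * z * m * n + 6 * x * z * n ^ 2 - 4 * y * z * m * n - 4 * y * z * n ^ 2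

def lineCofactor {R : Type*} [CommRing R] (m n x y z : R) : R :=
  x * y * m * n + 3 * x * y * n ^ 2 + 2 * x * z * m ^ 2 + 5 * x * z * m * n + 3 * x * z * n ^ 2
    - y * z * m * n - y * z * n ^ 2

/-- The affine-linear polynomial with coefficients `u`. -/
def lin (u : Fin 3 → ℂ) : Poly2 := C (u 0) + C (u 1) * X 0 + C (u 2) * X 1

theorem pderiv_lin (u : Fin 3 → ℂ) (i : Fin 2) : pderiv i (lin u) = C (u i.succ) := by
  fin_cases i <;> simp [lin, pderiv_X]

theorem eval_lin (u : Fin 3 → ℂ) (a : Fin 2 → ℂ) :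
    eval a (lin u) = u 0 + u 1 * a 0 + u 2 * a 1 := by
  simp [lin]

variable (U : Matrix (Fin 3) (Fin 3) ℂ) (m n k : ℂ)

/-- The quartic given by three affine-linear polynomials. -/
def frameQuartic : Poly2 := quart (lin (U 0)) (lin (U 1)) (lin (U 2))

/-- The tangent line with parameters `m`, `n`, `k`. -/
def frameLine : Poly2 := C (m ^ 3) * lin (U 0) + C (n ^ 3) * lin (U 1) + C (k ^ 3) * lin (U 2)

def frameA : Poly2 := netCoeff (C m) (C n) (C k) (lin (U 0)) (lin (U 1)) (lin (U 2))
def frameB : Poly2 := netCoeff (C n) (C k) (C m) (lin (U 1)) (lin (U 2)) (lin (U 0))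
def frameC : Poly2 := netCoeff (C k) (C m) (C n) (lin (U 2)) (lin (U 0)) (lin (U 1))

/-- The form of degree three with the quartic and the line as integral curves. -/
def frameForm : Form := fun i =>
  frameA U m n k * C (U 0 i.succ) + frameB U m n k * C (U 1 i.succ)
    + frameC U m n k * C (U 2 i.succ)

/-- The combination of three polynomials with the `2 × 2` minors of the linear parts. -/
def minorSum (K₁ K₂ K₃ : Poly2) : Poly2 :=
  C (U 1 1 * U 2 2 - U 1 2 * U 2 1) * K₁ + C (U 2 1 * U 0 2 - U 2 2 * U 0 1) * K₂
    + C (U 0 1 * U 1 2 - U 0 2 * U 1 1) * K₃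

def frameQuarticCofactor : Poly2 := minorSum U
  (quartCofactor (C m) (C n) (lin (U 0)) (lin (U 1)) (lin (U 2)))
  (quartCofactor (C n) (C k) (lin (U 1)) (lin (U 2)) (lin (U 0)))
  (quartCofactor (C k) (C m) (lin (U 2)) (lin (U 0)) (lin (U 1)))

def frameLineCofactor : Poly2 := minorSum U
  (lineCofactor (C m) (C n) (lin (U 0)) (lin (U 1)) (lin (U 2)))
  (lineCofactor (C n) (C k) (lin (U 1)) (lin (U 2)) (lin (U 0)))
  (lineCofactor (C k) (C m) (lin (U 2)) (lin (U 0)) (lin (U 1)))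

variable {U m n k}

theorem pderiv_quart (i : Fin 2) (x y z : Poly2) : pderiv i (quart x y z) =
    (2 * x * y ^ 2 + 2 * x * z ^ 2 - 4 * x * y * z - 2 * y * z * (y + z)) * pderiv i x
    + (2 * y * x ^ 2 + 2 * y * z ^ 2 - 4 * x * y * z - 2 * x * z * (x + z)) * pderiv i y
    + (2 * z * x ^ 2 + 2 * z * y ^ 2 - 4 * x * y * z - 2 * x * y * (x + y)) * pderiv i z := by
  have h2 : pderiv i (2 : Poly2) = 0 := by
    rw [show (2 : Poly2) = C 2 from rfl, pderiv_C]
  simp only [quart, map_sub, map_add, Derivation.leibniz, Derivation.leibniz_pow, smul_eq_mul,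
    nsmul_eq_mul, h2]
  push_cast
  ring

/-- After `k = -(m + n)` this is a polynomial identity in which `x, y, z` and the entries of the
linear parts are independent variables, so degenerate frames are allowed. -/
theorem isCofactor_frameQuartic (h : m + n + k = 0) :
    IsCofactor (frameForm U m n k) (frameQuartic U) (frameQuarticCofactor U m n k) := by
  obtain rfl : k = -(m + n) := by linear_combination h
  simp only [IsCofactor, dWedge, frameQuartic, pderiv_quart, pderiv_lin, frameForm, frameA, frameB,
    frameC, frameQuarticCofactor, minorSum, Fin.succ_zero_eq_one, Fin.succ_one_eq_two, map_sub,
    map_mul, map_neg, map_add]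
  generalize lin (U 0) = x
  generalize lin (U 1) = y
  generalize lin (U 2) = z
  generalize (C m : Poly2) = m
  generalize (C n : Poly2) = n
  simp only [quart, netCoeff, quartCofactor]
  ring

theorem isCofactor_frameLine (h : m + n + k = 0) :
    IsCofactor (frameForm U m n k) (frameLine U m n k) (frameLineCofactor U m n k) := by
  obtain rfl : k = -(m + n) := by linear_combination h
  simp only [IsCofactor, dWedge, frameLine, pderiv_lin, frameForm, frameA, frameB,
    frameC, frameLineCofactor, minorSum, Fin.succ_zero_eq_one, Fin.succ_one_eq_two, map_sub,
    map_mul, map_neg, map_add, map_pow, Derivation.leibniz, Derivation.leibniz_pow, smul_eq_mul,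
    pderiv_C, mul_zero, add_zero, smul_zero, neg_zero]
  generalize lin (U 0) = x
  generalize lin (U 1) = y
  generalize lin (U 2) = z
  generalize (C m : Poly2) = m
  generalize (C n : Poly2) = n
  simp only [netCoeff, lineCofactor]
  ring

theorem pderiv_netCoeff (i : Fin 2) (m n k : ℂ) (x y z : Poly2) :
    pderiv i (netCoeff (C m) (C n) (C k) x y z) =
    C m * (z - y) * (C k * z + C n * y) * pderiv i x
    + (C m * x * (-(C k * z + C n * y) + C n * (z - y))
      + z * (C k * (2 * C k - C m) * z - C n * (2 * C n - C m) * y)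
      - y * z * (C n * (2 * C n - C m))) * pderiv i y
    + (C m * x * (C k * z + C n * y + C k * (z - y))
      + y * (C k * (2 * C k - C m) * z - C n * (2 * C n - C m) * y)
      + y * z * (C k * (2 * C k - C m))) * pderiv i z := by
  have h2 : pderiv i (2 : Poly2) = 0 := by
    rw [show (2 : Poly2) = C 2 from rfl, pderiv_C]
  simp only [netCoeff, map_sub, map_add, Derivation.leibniz, smul_eq_mul, h2, pderiv_C]
  ring

theorem pderiv_frameForm (i j : Fin 2) : pderiv j (frameForm U m n k i) =
    pderiv j (frameA U m n k) * C (U 0 i.succ) + pderiv j (frameB U m n k) * C (U 1 i.succ)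
    + pderiv j (frameC U m n k) * C (U 2 i.succ) := by
  simp only [frameForm, map_add, Derivation.leibniz, smul_eq_mul, pderiv_C]
  ring

/-- For frames the relation is again a polynomial identity; it needs no configuration, and so can be
used before genericity is discussed. -/
theorem frame_relation (h : m + n + k = 0) :
    4 * frameLineCofactor U m n k + 5 * frameQuarticCofactor U m n k
      - 6 * dForm (frameForm U m n k) = 0 := by
  obtain rfl : k = -(m + n) := by linear_combination h
  simp only [dForm, pderiv_frameForm, frameA, frameB, frameC, pderiv_netCoeff, pderiv_lin,
    frameLineCofactor, frameQuarticCofactor, minorSum, Fin.succ_zero_eq_one, Fin.succ_one_eq_two]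
  simp only [map_sub, map_mul, map_neg, map_add]
  generalize lin (U 0) = x
  generalize lin (U 1) = y
  generalize lin (U 2) = z
  generalize (C m : Poly2) = m
  generalize (C n : Poly2) = n
  simp only [quartCofactor, lineCofactor]
  ring

/-- The contraction of `A dx + B dy + C dz` with the radial field vanishes: this is what makes it a
projective one-form. -/
theorem frame_syzygy :
    lin (U 0) * frameA U m n k + lin (U 1) * frameB U m n k + lin (U 2) * frameC U m n k = 0 := by
  simp only [frameA, frameB, frameC, netCoeff]
  ring

/-- The products of the line with `z (ny - mx)` and `x (kz - ny)` lie in the ideal of `A, B, C`. Off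
the two curves the common zeros of `A, B, C` therefore satisfy `mx = ny = kz`. -/
theorem frame_net_identity (h : m + n + k = 0) :
    6 * frameLine U m n k * (lin (U 2) * (C n * lin (U 1) - C m * lin (U 0))) =
      -(C (n * (m + 3 * n)) * frameA U m n k + C (m * (n + 3 * m)) * frameB U m n k
        + C (m * n) * frameC U m n k) ∧
    6 * frameLine U m n k * (lin (U 0) * (C k * lin (U 2) - C n * lin (U 1))) =
      -(C (k * (n + 3 * k)) * frameB U m n k + C (n * (k + 3 * n)) * frameC U m n k
        + C (n * k) * frameA U m n k) := by
  obtain rfl : k = -(m + n) := by linear_combination h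
  simp only [frameLine, frameA, frameB, frameC, netCoeff, map_mul, map_neg, map_add, map_pow,
    map_ofNat]
  generalize lin (U 0) = x
  generalize lin (U 1) = y
  generalize lin (U 2) = z
  generalize (C m : Poly2) = m
  generalize (C n : Poly2) = n
  constructor <;> ring

/-- The two components of the form and the syzygy are three linear equations for the values of `A,
B, C`, whose matrix is equivalent to the transpose of `U`. -/
theorem eval_frame_eq_zero (hU : U.det ≠ 0) {a : Fin 2 → ℂ}
    (ha : ∀ i, eval a (frameForm U m n k i) = 0) :
    eval a (frameA U m n k) = 0 ∧ eval a (frameB U m n k) = 0 ∧ eval a (frameC U m n k) = 0 := by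
  set v : Fin 3 → ℂ :=
    ![eval a (frameA U m n k), eval a (frameB U m n k), eval a (frameC U m n k)] with hv
  have h0 := ha 0
  have h1 := ha 1
  have hs := congrArg (eval a) (frame_syzygy (U := U) (m := m) (n := n) (k := k))
  simp only [frameForm, map_add, map_mul, eval_C, Fin.succ_zero_eq_one, Fin.succ_one_eq_two,
    eval_lin, map_zero] at h0 h1 hs
  have hz : v = 0 := by
    refine Matrix.eq_zero_of_vecMul_eq_zero hU ?_
    funext j
    fin_cases j <;> simp [Matrix.vecMul, dotProduct, Fin.sum_univ_three, hv]
    · linear_combination hs - a 0 * h0 - a 1 * h1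
    · linear_combination h0
    · linear_combination h1
  exact ⟨congrFun hz 0, congrFun hz 1, congrFun hz 2⟩

/-- The only zero of the form off the two curves. -/
theorem center_of_eval_eq_zero (hU : U.det ≠ 0) (h : m + n + k = 0) (hn : n ≠ 0)
    (hk : k ≠ 0) {a : Fin 2 → ℂ} (ha : ∀ i, eval a (frameForm U m n k i) = 0)
    (hl : eval a (frameLine U m n k) ≠ 0) (hq : eval a (frameQuartic U) ≠ 0) :
    ∃ c : ℂ, c ≠ 0 ∧ eval a (lin (U 0)) = c * (n * k) ∧ eval a (lin (U 1)) = c * (m * k) ∧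
      eval a (lin (U 2)) = c * (m * n) := by
  obtain ⟨hA, hB, hC⟩ := eval_frame_eq_zero hU ha
  obtain ⟨i1, i2⟩ := frame_net_identity (U := U) h
  have e1 := congrArg (eval a) i1
  have e2 := congrArg (eval a) i2
  simp only [map_mul, map_neg, map_add, map_sub, eval_C, map_ofNat, hA, hB, hC, mul_zero, add_zero,
    neg_zero] at e1 e2
  rw [frameQuartic] at hq
  simp only [quart, map_add, map_sub, map_mul, map_pow, map_ofNat] at hq
  generalize eval a (lin (U 0)) = x at *
  generalize eval a (lin (U 1)) = y at *
  generalize eval a (lin (U 2)) = z at *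
  have f1 : z * (n * y - m * x) = 0 := by
    rcases mul_eq_zero.mp e1 with h | h
    · exact absurd h (mul_ne_zero (by norm_num) hl)
    · exact h
  have f2 : x * (k * z - n * y) = 0 := by
    rcases mul_eq_zero.mp e2 with h | h
    · exact absurd h (mul_ne_zero (by norm_num) hl)
    · exact h
  have hx : x ≠ 0 := by
    rintro rfl
    apply hq
    have : z * y = 0 := by
      have : n * (z * y) = 0 := by linear_combination f1
      exact (mul_eq_zero.mp this).resolve_left hn
    linear_combination (z * y) * this
  have hz : z ≠ 0 := by
    rintro rfl
    apply hq
    have : x * y = 0 := by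
      have : n * (x * y) = 0 := by linear_combination -f2
      exact (mul_eq_zero.mp this).resolve_left hn
    linear_combination (x * y) * this
  have g1 := (mul_eq_zero.mp f1).resolve_left hz
  have g2 := (mul_eq_zero.mp f2).resolve_left hx
  refine ⟨x / (n * k), by positivity, by field_simp, ?_, ?_⟩
  · field_simp; linear_combination g1
  · field_simp; linear_combination g1 + g2

/-- If the form vanished, `A, B, C` would be zero polynomials, and the net identity would write zero
as a product of nonzero linear polynomials. -/
theorem frameForm_ne_zero (hU : U.det ≠ 0) (h : m + n + k = 0) (hm : m ≠ 0) (hn : n ≠ 0) :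
    frameForm U m n k ≠ 0 := by
  intro h0
  have hz : ∀ a, eval a (frameA U m n k) = 0 ∧ eval a (frameB U m n k) = 0 ∧
      eval a (frameC U m n k) = 0 := fun a => eval_frame_eq_zero hU (fun i => by rw [h0]; simp)
  have hA : frameA U m n k = 0 := MvPolynomial.funext fun a => by simpa using (hz a).1
  have hB : frameB U m n k = 0 := MvPolynomial.funext fun a => by simpa using (hz a).2.1
  have hC : frameC U m n k = 0 := MvPolynomial.funext fun a => by simpa using (hz a).2.2
  have key : ∀ c : Fin 3 → ℂ,
      C (c 0) * lin (U 0) + C (c 1) * lin (U 1) + C (c 2) * lin (U 2) = 0 → c = 0 := by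
    intro c hc
    refine Matrix.eq_zero_of_vecMul_eq_zero hU ?_
    have hev : ∀ a, c 0 * eval a (lin (U 0)) + c 1 * eval a (lin (U 1)) + c 2 * eval a (lin (U 2)) = 0 := by
      intro a
      have := congrArg (eval a) hc
      simpa using this
    have e0 := hev ![0, 0]
    have e1 := hev ![1, 0]
    have e2 := hev ![0, 1]
    simp [eval_lin] at e0 e1 e2
    funext j
    fin_cases j <;> simp [Matrix.vecMul, dotProduct, Fin.sum_univ_three]
    · linear_combination e0
    · linear_combination e1 - e0
    · linear_combination e2 - e0
  have h6 := (frame_net_identity (U := U) h).1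
  rw [hA, hB, hC] at h6
  simp only [mul_zero, add_zero, neg_zero, mul_eq_zero] at h6
  rcases h6 with (h6 | h6) | h6 | h6
  · have := congrArg (eval 0) h6
    rw [map_ofNat, map_zero] at this
    norm_num at this
  · have := congrFun (key ![m ^ 3, n ^ 3, k ^ 3] (by simpa [frameLine] using h6)) 0
    simp [hm] at this
  · have := congrFun (key ![0, 0, 1] (by simpa using h6)) 2
    simp at this
  · have := congrFun (key ![-m, n, 0] (by simp; linear_combination h6)) 1
    simp [hn] at this

/-- The form has a center where the three affine-linear polynomials are proportional to
`1 / m`, `1 / n`, `1 / k`. -/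
theorem frameForm_hasCenterAt (hU : U.det ≠ 0) (h : m + n + k = 0) (hm : m ≠ 0) (hn : n ≠ 0)
    (hk : k ≠ 0) (hs : m ^ 2 + m * n + n ^ 2 ≠ 0) {a : Fin 2 → ℂ} {c : ℂ} (hc : c ≠ 0)
    (hx : eval a (lin (U 0)) = c * (n * k)) (hy : eval a (lin (U 1)) = c * (m * k))
    (hz : eval a (lin (U 2)) = c * (m * n)) : HasCenterAt (frameForm U m n k) a := by
  have hdet : U.det = c * (n * k * (U 1 1 * U 2 2 - U 1 2 * U 2 1)
      + m * k * (U 2 1 * U 0 2 - U 2 2 * U 0 1) + m * n * (U 0 1 * U 1 2 - U 0 2 * U 1 1)) := by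
    rw [eval_lin] at hx hy hz
    rw [Matrix.det_fin_three]
    linear_combination (U 1 1 * U 2 2 - U 1 2 * U 2 1) * hx
      + (U 2 1 * U 0 2 - U 2 2 * U 0 1) * hy + (U 0 1 * U 1 2 - U 0 2 * U 1 1) * hz
  refine hasCenterAt_of_relation (isCofactor_frameLine h) (isCofactor_frameQuartic h)
    (frame_relation h) ?_ ?_ ?_ ?_
  · simp only [frameLine, map_add, map_mul, eval_C, hx, hy, hz]
    have : m ^ 3 * (c * (n * k)) + n ^ 3 * (c * (m * k)) + k ^ 3 * (c * (m * n)) =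
        2 * c * (m * n * k) * (m ^ 2 + m * n + n ^ 2) := by
      linear_combination c * m * n * k * (k - m - n) * h
    rw [this]
    exact mul_ne_zero (mul_ne_zero (mul_ne_zero two_ne_zero hc)
      (mul_ne_zero (mul_ne_zero hm hn) hk)) hs
  · simp only [frameQuartic, quart, map_add, map_sub, map_mul, map_pow, map_ofNat, hx, hy, hz]
    obtain rfl : k = -(m + n) := by linear_combination h
    have : (c * (n * -(m + n))) ^ 2 * (c * (m * -(m + n))) ^ 2
        + (c * (m * -(m + n))) ^ 2 * (c * (m * n)) ^ 2 + (c * (m * n)) ^ 2 * (c * (n * -(m + n))) ^ 2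
        - 2 * (c * (n * -(m + n))) * (c * (m * -(m + n))) * (c * (m * n)) *
          (c * (n * -(m + n)) + c * (m * -(m + n)) + c * (m * n)) =
        4 * c ^ 4 * (m * n * -(m + n)) ^ 2 * (m ^ 2 + m * n + n ^ 2) := by
      ring
    rw [this]
    exact mul_ne_zero (mul_ne_zero (mul_ne_zero (by norm_num) (pow_ne_zero _ hc))
      (pow_ne_zero _ (mul_ne_zero (mul_ne_zero hm hn) hk))) hs
  · intro i
    simp only [frameForm, frameA, frameB, frameC, netCoeff, map_add, map_sub, map_mul, eval_C, map_ofNat, hx, hy, hz]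
    obtain rfl : k = -(m + n) := by linear_combination h
    ring
  · obtain rfl : k = -(m + n) := by linear_combination h
    set D : ℂ := n * -(m + n) * (U 1 1 * U 2 2 - U 1 2 * U 2 1)
      + m * -(m + n) * (U 2 1 * U 0 2 - U 2 2 * U 0 1)
      + m * n * (U 0 1 * U 1 2 - U 0 2 * U 1 1) with hD
    have hD0 : D ≠ 0 := by
      intro h0
      rw [h0, mul_zero] at hdet
      exact hU hdet
    -- The determinant of the linear part at the candidate center; it is nonzero because `U.det = c
    -- * D`.
    have key : eval a (pderiv 0 (frameForm U m n (-(m + n)) 0)) *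
        eval a (pderiv 1 (frameForm U m n (-(m + n)) 1)) -
        eval a (pderiv 1 (frameForm U m n (-(m + n)) 0)) *
        eval a (pderiv 0 (frameForm U m n (-(m + n)) 1)) =
        -(12 * c ^ 4 * (m * n * -(m + n)) ^ 2 * (m ^ 2 + m * n + n ^ 2) * D ^ 2) := by
      rw [hD]
      simp only [pderiv_frameForm, frameA, frameB, frameC, pderiv_netCoeff, pderiv_lin]
      simp only [map_add, map_sub, map_mul, map_neg, eval_C, map_ofNat, hx, hy, hz,
        Fin.succ_zero_eq_one, Fin.succ_one_eq_two]
      ring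
    rw [key]
    exact neg_ne_zero.mpr (mul_ne_zero (mul_ne_zero (mul_ne_zero (mul_ne_zero (by norm_num)
      (pow_ne_zero _ hc)) (pow_ne_zero _ (mul_ne_zero (mul_ne_zero hm hn) hk))) hs)
      (pow_ne_zero _ hD0))

end NormalForm

end

end CuspidalCenter

namespace CuspidalCenter

noncomputable section

/-! ### The linear system for the coefficients of a first integral. -/

section FocalSystem

/-- The exponent vector of `x ^ a * y ^ b`. -/
def expo (a b : ℕ) : Fin 2 →₀ ℕ := Finsupp.single 0 a + Finsupp.single 1 b

theorem expo_zero (a b : ℕ) : expo a b 0 = a := by simp [expo]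

theorem expo_one (a b : ℕ) : expo a b 1 = b := by simp [expo]

theorem expo_apply (m : Fin 2 →₀ ℕ) : expo (m 0) (m 1) = m := (finsupp_fin_two_eq m).symm

theorem degree_expo (a b : ℕ) : (expo a b).degree = a + b := by
  rw [Finsupp.degree_eq_sum, Fin.sum_univ_two, expo_zero, expo_one]

theorem expo_le {a b i j : ℕ} : expo a b ≤ expo i j ↔ a ≤ i ∧ b ≤ j := by
  rw [Finsupp.le_def, Fin.forall_fin_two, expo_zero, expo_zero, expo_one, expo_one]

theorem expo_sub (a b i j : ℕ) : expo i j - expo a b = expo (i - a) (j - b) := by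
  ext k
  fin_cases k <;> simp [expo]

theorem expo_inj {a b i j : ℕ} : expo a b = expo i j ↔ a = i ∧ b = j := by
  constructor
  · intro h
    exact ⟨by simpa [expo] using DFunLike.congr_fun h 0, by simpa [expo] using DFunLike.congr_fun h 1⟩
  · rintro ⟨rfl, rfl⟩; rfl

theorem eq_sum_range_monomial {R : Type*} [CommRing R] {f : MvPolynomial (Fin 2) R} {n : ℕ}
    (hf : f.totalDegree ≤ n) : f = ∑ a ∈ Finset.range (n + 1), ∑ b ∈ Finset.range (n + 1),
      monomial (expo a b) (coeff (expo a b) f) := by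
  ext m
  rw [← expo_apply m]
  simp only [coeff_sum, coeff_monomial, expo_inj]
  by_cases h : m 0 ≤ n ∧ m 1 ≤ n
  · rw [Finset.sum_eq_single (m 0), Finset.sum_eq_single (m 1)]
    · simp
    · intro b _ hb; rw [if_neg]; simp [hb]
    · intro hb; exact absurd (Finset.mem_range.mpr (by omega)) hb
    · intro a _ ha; exact Finset.sum_eq_zero fun b _ => if_neg (by simp [ha])
    · intro hb; exact absurd (Finset.mem_range.mpr (by omega)) hb
  · rw [coeff_eq_zero_of_totalDegree_lt, Finset.sum_eq_zero]
    · intro a ha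
      refine Finset.sum_eq_zero fun b hb => if_neg ?_
      simp only [Finset.mem_range] at ha hb
      omega
    · have := degree_expo (m 0) (m 1)
      rw [Finsupp.degree_apply] at this
      rw [this]
      omega

theorem coeff_pderiv_expo_zero (f : Poly2) (i j : ℕ) :
    coeff (expo i j) (pderiv 0 f) = coeff (expo (i + 1) j) f * (i + 1 : ℕ) := by
  have h := MvPowerSeries.coeff_pderiv (R := ℂ) (i := (0 : Fin 2)) (f : MvPowerSeries (Fin 2) ℂ)
    (expo i j)
  rw [MvPowerSeries.pderiv_coe, MvPolynomial.coeff_coe, MvPolynomial.coeff_coe, expo_zero] at h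
  rw [h, show expo i j + Finsupp.single 0 1 = expo (i + 1) j by
    ext k; fin_cases k <;> simp [expo]]
  push_cast
  rfl

theorem coeff_pderiv_expo_one (f : Poly2) (i j : ℕ) :
    coeff (expo i j) (pderiv 1 f) = coeff (expo i (j + 1)) f * (j + 1 : ℕ) := by
  have h := MvPowerSeries.coeff_pderiv (R := ℂ) (i := (1 : Fin 2)) (f : MvPowerSeries (Fin 2) ℂ)
    (expo i j)
  rw [MvPowerSeries.pderiv_coe, MvPolynomial.coeff_coe, MvPolynomial.coeff_coe, expo_one] at h
  rw [h, show expo i j + Finsupp.single 1 1 = expo i (j + 1) by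
    ext k; fin_cases k <;> simp [expo]]
  push_cast
  rfl

variable {T : Type*} [CommRing T]

/-- The coefficient of `x ^ i * y ^ j` in `dF ∧ ω`, where `F` and the two components of `ω` have
coefficients `x` and `w`, and `ω` has degree at most three and no constant terms. -/
def wedgeCoeff (w : Fin 2 → ℕ → ℕ → T) (x : ℕ → ℕ → T) (i j : ℕ) : T :=
  ∑ a ∈ Finset.range 4, ∑ b ∈ Finset.range 4, if a + b ≠ 0 ∧ a ≤ i ∧ b ≤ j then
    x (i - a + 1) (j - b) * ((i - a + 1 : ℕ) : T) * w 1 a b -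
      x (i - a) (j - b + 1) * ((j - b + 1 : ℕ) : T) * w 0 a b else 0

theorem map_wedgeCoeff {S : Type*} [CommRing S] (f : T →+* S) (w : Fin 2 → ℕ → ℕ → T)
    (x : ℕ → ℕ → T) (i j : ℕ) : f (wedgeCoeff w x i j) =
      wedgeCoeff (fun i a b => f (w i a b)) (fun i j => f (x i j)) i j := by
  simp only [wedgeCoeff, map_sum, apply_ite f, map_sub, map_mul, map_natCast, map_zero]

theorem wedgeCoeff_sum {ι : Type*} (s : Finset ι) (w : Fin 2 → ℕ → ℕ → T) (c : ι → T)
    (x : ι → ℕ → ℕ → T) (i j : ℕ) : ∑ r ∈ s, wedgeCoeff w (x r) i j * c r =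
      wedgeCoeff w (fun i j => ∑ r ∈ s, x r i j * c r) i j := by
  simp only [wedgeCoeff, Finset.sum_mul]
  rw [Finset.sum_comm]
  refine Finset.sum_congr rfl fun a _ => ?_
  rw [Finset.sum_comm]
  refine Finset.sum_congr rfl fun b _ => ?_
  split_ifs
  · rw [← Finset.sum_sub_distrib]
    exact Finset.sum_congr rfl fun r _ => by ring
  · simp

/-- When `ω` has only terms of degrees one to three, a coefficient of `dF ∧ ω` in degree `d`
involves only coefficients of `F` in degrees `d - 2` to `d`. The second alternative records a
violation of the degree bound. -/
theorem wedgeCoeff_congr (w : Fin 2 → ℕ → ℕ → T) {x y : ℕ → ℕ → T} {i j : ℕ}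
    (h : ∀ i' j', i' + j' ≤ i + j → i + j ≤ i' + j' + 2 → x i' j' = y i' j') :
    wedgeCoeff w x i j = wedgeCoeff w y i j ∨ ∃ a b, a + b > 3 ∧ (w 0 a b ≠ 0 ∨ w 1 a b ≠ 0) := by
  by_cases hw : ∀ a b, a + b > 3 → w 0 a b = 0 ∧ w 1 a b = 0
  · left
    refine Finset.sum_congr rfl fun a _ => Finset.sum_congr rfl fun b _ => ?_
    split_ifs with hc
    · by_cases hab : a + b > 3
      · rw [(hw a b hab).1, (hw a b hab).2]; ring
      · rw [h (i - a + 1) (j - b) (by omega) (by omega), h (i - a) (j - b + 1) (by omega) (by omega)]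
    · rfl
  · right
    push Not at hw
    obtain ⟨a, b, h1, h2⟩ := hw
    refine ⟨a, b, h1, ?_⟩
    by_contra! h3
    exact h2 h3.1 h3.2

theorem coeff_dWedge {F : Poly2} {ω : Form} (hω : ∀ i, (ω i).totalDegree ≤ 3)
    (h0 : ∀ i, coeff (expo 0 0) (ω i) = 0) (i j : ℕ) :
    coeff (expo i j) (dWedge F ω) = wedgeCoeff (fun i a b => coeff (expo a b) (ω i))
      (fun i j => coeff (expo i j) F) i j := by
  have key : ∀ (p : Poly2) (r : Fin 2), coeff (expo i j) (p * ω r) =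
      ∑ a ∈ Finset.range 4, ∑ b ∈ Finset.range 4, if a + b ≠ 0 ∧ a ≤ i ∧ b ≤ j then
        coeff (expo (i - a) (j - b)) p * coeff (expo a b) (ω r) else 0 := by
    intro p r
    conv_lhs => rw [eq_sum_range_monomial (hω r)]
    simp only [Finset.mul_sum, coeff_sum, coeff_mul_monomial', expo_le, expo_sub]
    refine Finset.sum_congr rfl fun a _ => Finset.sum_congr rfl fun b _ => ?_
    by_cases hab : a + b = 0
    · obtain ⟨rfl, rfl⟩ : a = 0 ∧ b = 0 := by omega
      simp [h0]
    · simp only [ne_eq, hab, not_false_eq_true, true_and]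
  rw [dWedge, coeff_sub, key, key, ← Finset.sum_sub_distrib]
  refine Finset.sum_congr rfl fun a _ => ?_
  rw [← Finset.sum_sub_distrib]
  refine Finset.sum_congr rfl fun b _ => ?_
  split_ifs
  · rw [coeff_pderiv_expo_zero, coeff_pderiv_expo_one]
  · simp

/-- The coefficients of the translate of a form of degree at most three with coefficients
`c ∘ Sum.inl` by the vector `c ∘ Sum.inr`. -/
def translateCoeff (c : CoeffIdx ⊕ Fin 2 → T) (i : Fin 2) (a b : ℕ) : T :=
  coeff (expo a b) (∑ m : {m : Fin 4 × Fin 4 // (m.1 : ℕ) + (m.2 : ℕ) ≤ 3},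
    C (c (Sum.inl (i, m))) * ((X 0 + C (c (Sum.inr 0))) ^ (m.1.1 : ℕ) *
      (X 1 + C (c (Sum.inr 1))) ^ (m.1.2 : ℕ)) : MvPolynomial (Fin 2) T)

theorem map_translateCoeff {S : Type*} [CommRing S] (f : T →+* S) (c : CoeffIdx ⊕ Fin 2 → T)
    (i : Fin 2) (a b : ℕ) :
    f (translateCoeff c i a b) = translateCoeff (fun k => f (c k)) i a b := by
  rw [translateCoeff, ← coeff_map]
  simp only [map_sum, map_mul, map_pow, map_add, map_C, map_X, translateCoeff]

theorem translateCoeff_of_zero {c : CoeffIdx ⊕ Fin 2 → T} (hc : ∀ k, c (Sum.inr k) = 0) (i : Fin 2)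
    (a b : ℕ) : translateCoeff c i a b = if h : a + b ≤ 3 then
      c (Sum.inl (i, ⟨(⟨a, by omega⟩, ⟨b, by omega⟩), h⟩)) else 0 := by
  have : ∀ (m : ℕ × ℕ), (X 0 ^ m.1 * X 1 ^ m.2 : MvPolynomial (Fin 2) T) =
      monomial (expo m.1 m.2) 1 := by
    intro m
    rw [X_pow_eq_monomial, X_pow_eq_monomial, monomial_mul, expo, one_mul]
  simp only [translateCoeff, hc, map_zero, add_zero, coeff_sum, coeff_C_mul]
  split_ifs with h
  · rw [Finset.sum_eq_single ⟨(⟨a, by omega⟩, ⟨b, by omega⟩), h⟩]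
    · rw [this (a, b), coeff_monomial, if_pos rfl, mul_one]
    · intro m _ hm
      rw [this (m.1.1, m.1.2), coeff_monomial, if_neg, mul_zero]
      intro he
      apply hm
      rw [expo_inj] at he
      ext
      · exact he.1
      · exact he.2
    · simp
  · refine Finset.sum_eq_zero fun m _ => ?_
    rw [this (m.1.1, m.1.2), coeff_monomial, if_neg, mul_zero]
    intro he
    rw [expo_inj] at he
    have := m.2
    simp only at he
    omega

theorem translateCoeff_eq (c : CoeffIdx ⊕ Fin 2 → ℂ) (i : Fin 2) (a b : ℕ) :
    translateCoeff c i a b = coeff (expo a b) (translate (fun k => c (Sum.inr k))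
      (cubicForm (fun k => c (Sum.inl k)) i)) := by
  simp only [translateCoeff, translate, cubicForm, map_sum, map_mul, map_pow, aeval_X, aeval_C]
  rfl

theorem totalDegree_translate_le (a : Fin 2 → ℂ) (f : Poly2) :
    (translate a f).totalDegree ≤ f.totalDegree := by
  rw [translate, aeval_def, eval₂_eq']
  refine (totalDegree_finsetSum _ _).trans (Finset.sup_le fun m hm => ?_)
  refine (totalDegree_mul _ _).trans ?_
  rw [MvPolynomial.algebraMap_eq, totalDegree_C, zero_add]
  refine (totalDegree_finsetProd _ _).trans ?_
  refine le_trans (Finset.sum_le_sum fun k _ => (totalDegree_pow _ _).trans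
    (Nat.mul_le_mul_left (m k) (show (X k + C (a k) : Poly2).totalDegree ≤ 1 from ?_))) ?_
  · refine (totalDegree_add _ _).trans ?_
    simp [totalDegree_X, totalDegree_C]
  · have := le_totalDegree hm
    rw [Finsupp.sum_fintype _ _ (fun _ => rfl)] at this
    simpa using this

theorem totalDegree_cubicForm_le (c : CoeffIdx → ℂ) (i : Fin 2) :
    (cubicForm c i).totalDegree ≤ 3 := by
  refine (totalDegree_finsetSum _ _).trans (Finset.sup_le fun m _ => ?_)
  refine (totalDegree_mul _ _).trans ?_
  rw [totalDegree_C, zero_add]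
  refine (totalDegree_mul _ _).trans ?_
  rw [totalDegree_X_pow, totalDegree_X_pow]
  exact m.2

/-- The exponents of the unknown coefficients of a formal first integral. -/
abbrev FocalIdx := {p : Fin 21 × Fin 21 // 3 ≤ (p.1 : ℕ) + p.2 ∧ (p.1 : ℕ) + p.2 ≤ 20 ∧ p.1 ≠ p.2}

/-- The unit vectors, and the quadratic part of a first integral of a form with coefficients `w`. -/
def focalColumn (w : Fin 2 → ℕ → ℕ → T) : FocalIdx ⊕ Unit → ℕ → ℕ → T
  | Sum.inl c => fun i j => if i = c.1.1 ∧ j = c.1.2 then 1 else 0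
  | Sum.inr _ => fun i j => if i = 2 ∧ j = 0 then w 0 1 0 else
      if i = 1 ∧ j = 1 then w 0 0 1 + w 1 1 0 else if i = 0 ∧ j = 2 then w 1 0 1 else 0

theorem focalColumn_inl (w : Fin 2 → ℕ → ℕ → T) (c : FocalIdx) (i j : ℕ) :
    focalColumn w (Sum.inl c) i j = if i = c.1.1 ∧ j = c.1.2 then 1 else 0 := rfl

theorem focalColumn_inr (w : Fin 2 → ℕ → ℕ → T) (u : Unit) (i j : ℕ) :
    focalColumn w (Sum.inr u) i j = if i = 2 ∧ j = 0 then w 0 1 0 else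
      if i = 1 ∧ j = 1 then w 0 0 1 + w 1 1 0 else if i = 0 ∧ j = 2 then w 1 0 1 else 0 := rfl

/-- Unknowns and equations share the same off-diagonal exponents, since a linear part `xy` acts
diagonally on monomials; the last equation is the resonant one at `(xy) ^ k`. -/
def focalRow (k : ℕ) : FocalIdx ⊕ Unit → ℕ × ℕ
  | Sum.inl c => (c.1.1, c.1.2)
  | Sum.inr _ => (k, k)

/-- The augmented matrix of the linear system for the coefficients of a first integral, consisting
of the equations for the unknown coefficients and of one equation on the diagonal. -/
def focalMatrix (w : Fin 2 → ℕ → ℕ → T) (k : ℕ) :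
    Matrix (FocalIdx ⊕ Unit) (FocalIdx ⊕ Unit) T :=
  Matrix.of fun r c => wedgeCoeff w (focalColumn w c) (focalRow k r).1 (focalRow k r).2

theorem map_focalMatrix {S : Type*} [CommRing S] (f : T →+* S) (w : Fin 2 → ℕ → ℕ → T) (k : ℕ) :
    (focalMatrix w k).map f = focalMatrix (fun i a b => f (w i a b)) k := by
  ext r c
  simp only [focalMatrix, Matrix.map_apply, Matrix.of_apply, map_wedgeCoeff]
  congr 1
  funext i j
  rcases c with c | c
  · simp only [focalColumn, apply_ite f, map_one, map_zero]
  · simp only [focalColumn, apply_ite f, map_add, map_zero]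

/-- A solution `x` of the off-diagonal equations lets column operations clear the last column except
for its bottom entry, the residual at `(k, k)`. Being valid over any ring, this serves two purposes:
over the complex numbers the determinant vanishes at centers, and over dual numbers it yields
derivatives. -/
theorem det_focalMatrix {w : Fin 2 → ℕ → ℕ → T} (hw : ∀ i a b, a + b > 3 → w i a b = 0)
    {x : ℕ → ℕ → T} (h10 : x 1 0 = 0) (h01 : x 0 1 = 0) (h20 : x 2 0 = w 0 1 0)
    (h11 : x 1 1 = w 0 0 1 + w 1 1 0) (h02 : x 0 2 = w 1 0 1)
    (hd : ∀ k, 2 ≤ k → k ≤ 10 → x k k = 0)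
    (hx : ∀ i j, 3 ≤ i + j → i + j ≤ 20 → i ≠ j → wedgeCoeff w x i j = 0)
    {k : ℕ} (hk : 2 ≤ k) (hk' : k ≤ 10) :
    (focalMatrix w k).det = (focalMatrix w k).toBlocks₁₁.det * wedgeCoeff w x k k := by
  have hfull : ∀ i j, 3 ≤ i + j → i + j ≤ 20 →
      ∑ c : FocalIdx, wedgeCoeff w (focalColumn w (Sum.inl c)) i j * x c.1.1 c.1.2 +
        wedgeCoeff w (focalColumn w (Sum.inr ())) i j = wedgeCoeff w x i j := by
    intro i j hij hij'
    have := wedgeCoeff_sum Finset.univ w (Sum.elim (fun c : FocalIdx => x c.1.1 c.1.2) 1)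
      (focalColumn w) i j
    rw [Fintype.sum_sum_type] at this
    simp only [Sum.elim_inl, Sum.elim_inr, Finset.univ_unique, Finset.sum_singleton, Pi.one_apply,
      mul_one] at this
    rw [show (default : Unit) = () from rfl] at this
    rw [this]
    refine (wedgeCoeff_congr w fun i' j' h1 h2 => ?_).resolve_right ?_
    · rw [Fintype.sum_sum_type]
      simp only [Sum.elim_inl, Sum.elim_inr, Finset.univ_unique, Finset.sum_singleton, Pi.one_apply,
        mul_one]
      by_cases hI : 3 ≤ i' + j' ∧ i' ≠ j'
      · rw [Finset.sum_eq_single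
          (⟨(⟨i', by omega⟩, ⟨j', by omega⟩), hI.1, h1.trans hij', by simpa using hI.2⟩ : FocalIdx)]
        · rw [focalColumn_inl, focalColumn_inr, if_pos ⟨rfl, rfl⟩, if_neg (by omega), if_neg (by omega),
            if_neg (by omega)]
          simp
        · intro c _ hc
          rw [focalColumn_inl, if_neg, zero_mul]
          rintro ⟨rfl, rfl⟩
          exact hc rfl
        · simp
      · rw [Finset.sum_eq_zero, zero_add]
        · have : (i' = 1 ∧ j' = 0) ∨ (i' = 0 ∧ j' = 1) ∨ (i' = 2 ∧ j' = 0) ∨ (i' = 1 ∧ j' = 1) ∨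
            (i' = 0 ∧ j' = 2) ∨ (2 ≤ i' ∧ i' ≤ 10 ∧ i' = j') := by omega
          rcases this with ⟨rfl, rfl⟩ | ⟨rfl, rfl⟩ | ⟨rfl, rfl⟩ | ⟨rfl, rfl⟩ | ⟨rfl, rfl⟩ | ⟨h3, h4, rfl⟩
          · simp [focalColumn_inr, h10]
          · simp [focalColumn_inr, h01]
          · simp [focalColumn_inr, h20]
          · simp [focalColumn_inr, h11]
          · simp [focalColumn_inr, h02]
          · rw [hd i' h3 h4, focalColumn_inr, if_neg (by omega), if_neg (by omega), if_neg (by omega)]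
        · intro c _
          rw [focalColumn_inl, if_neg, zero_mul]
          rintro ⟨rfl, rfl⟩
          have := c.2
          exact hI ⟨this.1, fun h => this.2.2 (Fin.ext h)⟩
    · rintro ⟨a, b, hab, h | h⟩
      · exact h (hw 0 a b hab)
      · exact h (hw 1 a b hab)
  -- The unipotent matrix of these column operations, with the solution in its last column.
  set V : Matrix (FocalIdx ⊕ Unit) (FocalIdx ⊕ Unit) T :=
    Matrix.fromBlocks 1 (Matrix.of fun c _ => x c.1.1 c.1.2) 0 1 with hV
  have hprod : focalMatrix w k * V = Matrix.fromBlocks (focalMatrix w k).toBlocks₁₁ 0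
      (focalMatrix w k).toBlocks₂₁ (Matrix.of fun _ _ => wedgeCoeff w x k k) := by
    rw [← Matrix.fromBlocks_toBlocks (focalMatrix w k), hV, Matrix.fromBlocks_multiply]
    simp only [Matrix.mul_one, Matrix.mul_zero, add_zero, Matrix.toBlocks_fromBlocks₁₁,
      Matrix.toBlocks_fromBlocks₂₁]
    congr 1
    · ext r u
      simp only [Matrix.add_apply, Matrix.mul_apply, Matrix.of_apply, Matrix.toBlocks₁₁,
        Matrix.toBlocks₁₂, focalMatrix, focalRow, Matrix.zero_apply]
      exact (hfull r.1.1 r.1.2 r.2.1 r.2.2.1).trans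
        (hx _ _ r.2.1 r.2.2.1 fun h => r.2.2.2 (Fin.ext h))
    · ext r u
      simp only [Matrix.add_apply, Matrix.mul_apply, Matrix.of_apply, Matrix.toBlocks₂₁,
        Matrix.toBlocks₂₂, focalMatrix, focalRow]
      exact hfull k k (by omega) (by omega)
  have hdV : V.det = 1 := by rw [hV, Matrix.det_fromBlocks_zero₂₁, Matrix.det_one, Matrix.det_one, mul_one]
  have := congrArg Matrix.det hprod
  rw [Matrix.det_mul, hdV, mul_one, Matrix.det_fromBlocks_zero₁₂] at this
  rw [this]
  simp

end FocalSystem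

end

end CuspidalCenter

namespace CuspidalCenter

noncomputable section

/-! ### Truncated first integrals in the original coordinates. -/

section FirstIntegral

theorem affineSubst_comp (a : Fin 2 → ℂ) (A B : Matrix (Fin 2) (Fin 2) ℂ) (f : Poly2) :
    affineSubst 0 B (affineSubst a A f) = affineSubst a (A * B) f := by
  have : (affineSubst 0 B).comp (affineSubst a A) = affineSubst a (A * B) := by
    ext k
    simp only [affineSubst, AlgHom.comp_apply, aeval_X, map_add, map_mul,
      Fin.sum_univ_two, Matrix.mul_apply, Pi.zero_apply, map_zero, zero_add,
      MvPolynomial.aeval_C, MvPolynomial.algebraMap_eq]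
    congr 1
    ring
  exact DFunLike.congr_fun this f

theorem affineSubst_one (a : Fin 2 → ℂ) (f : Poly2) : affineSubst a 1 f = translate a f := by
  rw [affineSubst, translate]
  congr 2
  funext k
  revert k
  rw [Fin.forall_fin_two]
  constructor <;> simp [add_comm]

theorem pullback_pullback_inv (a : Fin 2 → ℂ) {A : Matrix (Fin 2) (Fin 2) ℂ} (hA : A.det ≠ 0)
    (ω : Form) : pullback 0 A⁻¹ (pullback a A ω) = fun i => translate a (ω i) := by
  have hAB : A * A⁻¹ = 1 := Matrix.mul_nonsing_inv _ (isUnit_iff_ne_zero.mpr hA)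
  have hs : ∀ f, affineSubst 0 A⁻¹ (affineSubst a A f) = translate a f := fun f => by
    rw [affineSubst_comp, hAB, affineSubst_one]
  have hC : ∀ c : ℂ, affineSubst 0 A⁻¹ (C c) = C c := fun c => by
    rw [affineSubst, aeval_C]; rfl
  funext j
  have e : ∀ i, A i 0 * A⁻¹ 0 j + A i 1 * A⁻¹ 1 j = if i = j then 1 else 0 := fun i => by
    have := congrFun (congrFun hAB i) j
    rwa [Matrix.mul_apply, Fin.sum_univ_two, Matrix.one_apply] at this
  have e0 := congrArg (C : ℂ → Poly2) (e 0)
  have e1 := congrArg (C : ℂ → Poly2) (e 1)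
  simp only [map_add, map_mul] at e0 e1
  simp only [pullback_apply, Fin.sum_univ_two, map_add, map_mul, hs, hC]
  have hj : translate a (ω j) = C (if (0 : Fin 2) = j then 1 else 0) * translate a (ω 0) +
      C (if (1 : Fin 2) = j then 1 else 0) * translate a (ω 1) := by
    fin_cases j <;> simp
  rw [hj]
  linear_combination translate a (ω 0) * e0 + translate a (ω 1) * e1

theorem affineSubst_mem_pow (B : Matrix (Fin 2) (Fin 2) ℂ) {n : ℕ} {f : Poly2}
    (hf : f ∈ idealOfVars (Fin 2) ℂ ^ n) : affineSubst 0 B f ∈ idealOfVars (Fin 2) ℂ ^ n := by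
  have hX : ∀ i, (X i : Poly2) ∈ idealOfVars (Fin 2) ℂ := fun i => Ideal.subset_span ⟨i, rfl⟩
  have h1 : (idealOfVars (Fin 2) ℂ).map (affineSubst 0 B) ≤ idealOfVars (Fin 2) ℂ := by
    rw [idealOfVars, Ideal.map_span, Ideal.span_le]
    rintro _ ⟨_, ⟨i, rfl⟩, rfl⟩
    rw [affineSubst, aeval_X, Pi.zero_apply, map_zero, zero_add]
    exact Ideal.sum_mem _ fun k _ => Ideal.mul_mem_left _ _ (hX k)
  have h2 := Ideal.mem_map_of_mem (affineSubst 0 B) hf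
  rw [Ideal.map_pow] at h2
  exact Ideal.pow_right_mono h1 n h2

theorem pderiv_mem_pow {n : ℕ} {f : Poly2} (hf : f ∈ idealOfVars (Fin 2) ℂ ^ (n + 1)) (i : Fin 2) :
    pderiv i f ∈ idealOfVars (Fin 2) ℂ ^ n := by
  rw [mem_pow_idealOfVars_iff'] at hf ⊢
  intro m hm
  have h := MvPowerSeries.coeff_pderiv (R := ℂ) (i := i) (f : MvPowerSeries (Fin 2) ℂ) m
  rw [MvPowerSeries.pderiv_coe, MvPolynomial.coeff_coe, MvPolynomial.coeff_coe] at h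
  rw [h, hf, zero_mul]
  rw [map_add, Finsupp.degree_single]
  omega

theorem coeff_expo_of_mem {n i j : ℕ} {f : Poly2} (hf : f ∈ idealOfVars (Fin 2) ℂ ^ n)
    (h : i + j < n) : coeff (expo i j) f = 0 :=
  (mem_pow_idealOfVars_iff' _ _).mp hf _ (by rwa [degree_expo])

/-- A form with a center has a first integral up to any order. -/
theorem HasCenterAt.exists_firstIntegral {ω : Form} {a : Fin 2 → ℂ} (h : HasCenterAt ω a) (N : ℕ)
    (hN : 3 ≤ N) : ∃ F ∈ idealOfVars (Fin 2) ℂ ^ 2,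
      dWedge F (fun i => translate a (ω i)) ∈ idealOfVars (Fin 2) ℂ ^ N ∧
      ∀ i, 2 * translate a (ω i) - pderiv i F ∈ idealOfVars (Fin 2) ℂ ^ 2 := by
  obtain ⟨A, hA, hnorm, F, s, hF, hs⟩ := h
  set ω' := pullback a A ω with hω'
  have hzero : MvPowerSeries.pderiv ℂ 0 F * (ω' 1 : MvPowerSeries (Fin 2) ℂ) -
      MvPowerSeries.pderiv ℂ 1 F * (ω' 0 : MvPowerSeries (Fin 2) ℂ) = 0 := by
    ext m
    rw [map_zero]
    by_cases hm : ∃ i : Fin 2, ∃ j : ℕ, 1 ≤ j ∧ m = Finsupp.single i (2 * j + 2)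
    · obtain ⟨i, j, hj, rfl⟩ := hm
      rw [hF.focal i j hj, hs j hj]
    · push Not at hm
      exact hF.other m hm
  -- Differentiation lowers the degree by one, so all terms of degree up to `N` are kept to have `dF
  -- ∧ ω` exact below degree `N`.
  set F₀ : Poly2 := MvPowerSeries.truncTotal (N + 1) F with hF₀
  have hcoeff : ∀ m : Fin 2 →₀ ℕ, m.degree < N + 1 → coeff m F₀ = MvPowerSeries.coeff m F :=
    fun m hm => MvPowerSeries.coeff_truncTotal F hm
  have hcp : ∀ i (m : Fin 2 →₀ ℕ), m.degree < N →
      coeff m (pderiv i F₀) = MvPowerSeries.coeff m (MvPowerSeries.pderiv ℂ i F) := by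
    intro i m hm
    have h := MvPowerSeries.coeff_pderiv (R := ℂ) (i := i) (F₀ : MvPowerSeries (Fin 2) ℂ) m
    rw [MvPowerSeries.pderiv_coe, MvPolynomial.coeff_coe, MvPolynomial.coeff_coe] at h
    rw [h, MvPowerSeries.coeff_pderiv, hcoeff]
    rw [map_add, Finsupp.degree_single]
    omega
  have hprod : ∀ i j (m : Fin 2 →₀ ℕ), m.degree < N → coeff m (pderiv i F₀ * ω' j) =
      MvPowerSeries.coeff m (MvPowerSeries.pderiv ℂ i F * (ω' j : MvPowerSeries (Fin 2) ℂ)) := by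
    intro i j m hm
    rw [coeff_mul, MvPowerSeries.coeff_mul]
    refine Finset.sum_congr rfl fun p hp => ?_
    rw [hcp, MvPolynomial.coeff_coe]
    have := congrArg Finsupp.degree (Finset.HasAntidiagonal.mem_antidiagonal.mp hp)
    rw [map_add] at this
    omega
  have hd : dWedge F₀ ω' ∈ idealOfVars (Fin 2) ℂ ^ N := by
    rw [mem_pow_idealOfVars_iff']
    intro m hm
    rw [dWedge, coeff_sub, hprod _ _ _ hm, hprod _ _ _ hm, ← map_sub, hzero, map_zero]
  have hlow : F₀ - (X 0 ^ 2 + X 1 ^ 2) ∈ idealOfVars (Fin 2) ℂ ^ 3 := by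
    rw [mem_pow_idealOfVars_iff']
    intro m hm
    rw [coeff_sub, hcoeff m (by omega), hF.low m (by omega), sub_self]
  have hX : ∀ i, (X i : Poly2) ∈ idealOfVars (Fin 2) ℂ := fun i => Ideal.subset_span ⟨i, rfl⟩
  have hF2 : F₀ ∈ idealOfVars (Fin 2) ℂ ^ 2 := by
    have := Ideal.add_mem _ (Ideal.pow_le_pow_right (show 2 ≤ 3 by norm_num) hlow)
      (Ideal.add_mem _ (Ideal.pow_mem_pow (hX 0) 2) (Ideal.pow_mem_pow (hX 1) 2))
    rwa [sub_add_cancel] at this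
  have hω2 : ∀ i, ω' i - X i ∈ idealOfVars (Fin 2) ℂ ^ 2 := by
    intro i
    rw [mem_pow_idealOfVars_iff']
    intro m hm
    obtain ⟨h0, h1⟩ := hnorm i
    have e0 := congrArg (coeff m) h0
    have e1 := congrArg (coeff m) h1
    rw [coeff_homogeneousComponent] at e0 e1
    rw [coeff_sub, ← e1]
    rw [coeff_zero] at e0
    have : m.degree = 0 ∨ m.degree = 1 := by omega
    rcases this with h | h <;> simp_all
  have hθ : ∀ i, 2 * ω' i - pderiv i F₀ ∈ idealOfVars (Fin 2) ℂ ^ 2 := by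
    intro i
    have e1 := pderiv_mem_pow hlow i
    have e2 : pderiv i (X 0 ^ 2 + X 1 ^ 2 : Poly2) = 2 * X i := by
      fin_cases i <;> simp [Derivation.leibniz_pow, pderiv_X]
    rw [map_sub, e2] at e1
    have := Ideal.sub_mem _ (Ideal.mul_mem_left _ 2 (hω2 i)) e1
    convert this using 1
    ring
  -- The linear change of axes is undone, so that only the translation to the center remains.
  refine ⟨affineSubst 0 A⁻¹ F₀, affineSubst_mem_pow _ hF2, ?_, ?_⟩
  · rw [← pullback_pullback_inv a hA ω, dWedge_pullback]
    exact Ideal.mul_mem_left _ _ (affineSubst_mem_pow _ hd)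
  · intro i
    have h1 : translate a (ω i) = pullback 0 A⁻¹ ω' i := by
      rw [hω', pullback_pullback_inv a hA ω]
    have : 2 * translate a (ω i) - pderiv i (affineSubst 0 A⁻¹ F₀) =
        ∑ j, C (A⁻¹ j i) * affineSubst 0 A⁻¹ (2 * ω' j - pderiv j F₀) := by
      rw [h1, pullback_apply, pderiv_affineSubst]
      simp only [Fin.sum_univ_two, map_sub, map_mul, map_ofNat]
      ring
    rw [this]
    exact Ideal.sum_mem _ fun j _ => Ideal.mul_mem_left _ _ (affineSubst_mem_pow _ (hθ j))

theorem dWedge_pow (F : Poly2) (ω : Form) (n : ℕ) :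
    dWedge (F ^ (n + 1)) ω = (n + 1 : Poly2) * F ^ n * dWedge F ω := by
  simp only [dWedge, Derivation.leibniz_pow, smul_eq_mul, nsmul_eq_mul, Nat.add_sub_cancel]
  push_cast
  ring

/-- Telescoping: powers of `F` and of its quadratic part agree in their lowest possible degree. -/
theorem pow_sub_pow_mem {F H : Poly2} (hH : H ∈ idealOfVars (Fin 2) ℂ ^ 2)
    (hFH : F - H ∈ idealOfVars (Fin 2) ℂ ^ 3) (n : ℕ) :
    F ^ n - H ^ n ∈ idealOfVars (Fin 2) ℂ ^ (2 * n + 1) ∧ F ^ n ∈ idealOfVars (Fin 2) ℂ ^ (2 * n) := by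
  have hF : F ∈ idealOfVars (Fin 2) ℂ ^ 2 := by
    have := Ideal.add_mem _ (Ideal.pow_le_pow_right (show 2 ≤ 3 by norm_num) hFH) hH
    rwa [sub_add_cancel] at this
  have hFn : ∀ n, F ^ n ∈ idealOfVars (Fin 2) ℂ ^ (2 * n) := fun n => by
    rw [pow_mul]; exact Ideal.pow_mem_pow hF n
  refine ⟨?_, hFn n⟩
  induction n with
  | zero => simp
  | succ n ih =>
    have e : F ^ (n + 1) - H ^ (n + 1) = F ^ n * (F - H) + (F ^ n - H ^ n) * H := by ring
    rw [e]
    refine Ideal.add_mem _ ?_ ?_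
    · rw [show 2 * (n + 1) + 1 = 2 * n + 3 by ring, pow_add]
      exact Ideal.mul_mem_mul (hFn n) hFH
    · rw [show 2 * (n + 1) + 1 = (2 * n + 1) + 2 by ring, pow_add]
      exact Ideal.mul_mem_mul ih hH

/-- The diagonal coefficients of a first integral can be normalized to zero. -/
theorem exists_normalized_firstIntegral {ω : Form} {N : ℕ} {F H : Poly2}
    (hH : H ∈ idealOfVars (Fin 2) ℂ ^ 2) (hFH : F - H ∈ idealOfVars (Fin 2) ℂ ^ 3)
    (hd : dWedge F ω ∈ idealOfVars (Fin 2) ℂ ^ N) (K : ℕ)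
    (hg : ∀ k, 2 ≤ k → k ≤ K → coeff (expo k k) (H ^ k) ≠ 0) :
    ∃ F', F' - H ∈ idealOfVars (Fin 2) ℂ ^ 3 ∧ dWedge F' ω ∈ idealOfVars (Fin 2) ℂ ^ N ∧
      ∀ k, 2 ≤ k → k ≤ K → coeff (expo k k) F' = 0 := by
  induction K with
  | zero => exact ⟨F, hFH, hd, fun k h1 h2 => by omega⟩
  | succ K ih =>
    obtain ⟨G, hG1, hG2, hG3⟩ := ih fun k h1 h2 => hg k h1 (by omega)
    by_cases hK : K = 0
    · exact ⟨G, hG1, hG2, fun k h1 h2 => by omega⟩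
    obtain ⟨hp1, hp2⟩ := pow_sub_pow_mem hH hG1 (K + 1)
    set c := coeff (expo (K + 1) (K + 1)) (H ^ (K + 1)) with hc
    have hc0 : c ≠ 0 := hg (K + 1) (by omega) le_rfl
    have hGc : coeff (expo (K + 1) (K + 1)) (G ^ (K + 1)) = c := by
      have := coeff_expo_of_mem (i := K + 1) (j := K + 1) hp1 (by omega)
      rwa [coeff_sub, sub_eq_zero] at this
    set t := coeff (expo (K + 1) (K + 1)) G / c with ht
    -- A power of a first integral is a first integral to the same order, and it starts in degree
    -- `2K + 2`, so the diagonal coefficients already cleared are not disturbed.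
    refine ⟨G - C t * G ^ (K + 1), ?_, ?_, ?_⟩
    · rw [sub_right_comm]
      exact Ideal.sub_mem _ hG1 (Ideal.mul_mem_left _ _
        (Ideal.pow_le_pow_right (by omega) hp2))
    · have : dWedge (G - C t * G ^ (K + 1)) ω =
          dWedge G ω - C t * dWedge (G ^ (K + 1)) ω := by
        simp only [dWedge, map_sub, Derivation.leibniz (pderiv _) (C t), pderiv_C,
          smul_eq_mul]
        ring
      rw [this, dWedge_pow]
      exact Ideal.sub_mem _ hG2 (Ideal.mul_mem_left _ _ (Ideal.mul_mem_left _ _ hG2))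
    · intro k h1 h2
      rw [coeff_sub, coeff_C_mul]
      rcases Nat.lt_or_ge k (K + 1) with hk | hk
      · rw [hG3 k h1 (by omega), coeff_expo_of_mem hp2 (by omega), mul_zero, sub_zero]
      · obtain rfl : k = K + 1 := by omega
        rw [hGc, ht, div_mul_cancel₀ _ hc0, sub_self]

end FirstIntegral

/-! ### Polynomial conditions satisfied by centers. -/

section FocalPolynomials

variable {T : Type*} [CommRing T]

/-- The quadratic part of a first integral of a form with coefficients `w`. -/
def focalQuadric (w : Fin 2 → ℕ → ℕ → T) : MvPolynomial (Fin 2) T :=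
  C (w 0 1 0) * X 0 ^ 2 + C (w 0 0 1 + w 1 1 0) * (X 0 * X 1) + C (w 1 0 1) * X 1 ^ 2

/-- The coefficients whose nonvanishing allows to normalize the diagonal of a first integral. -/
def focalNormalizer (w : Fin 2 → ℕ → ℕ → T) : T :=
  ∏ k ∈ Finset.Icc 2 10, coeff (expo k k) (focalQuadric w ^ k)

theorem map_focalNormalizer {S : Type*} [CommRing S] (f : T →+* S) (w : Fin 2 → ℕ → ℕ → T) :
    f (focalNormalizer w) = focalNormalizer fun i a b => f (w i a b) := by
  simp only [focalNormalizer, map_prod, ← coeff_map, map_pow, focalQuadric, map_add, map_mul, map_C,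
    map_X]

/-- Conditions on the coefficients `w` of a form which hold if it has a center at the origin, up
to the nonvanishing of the normalizer. -/
def focalCondition (w : Fin 2 → ℕ → ℕ → T) : Fin 3 ⊕ Fin 9 → T
  | Sum.inl 0 => w 0 0 0
  | Sum.inl 1 => w 1 0 0
  | Sum.inl 2 => w 1 1 0 - w 0 0 1
  | Sum.inr k => (focalMatrix w (k + 2)).det

theorem map_focalCondition {S : Type*} [CommRing S] (f : T →+* S) (w : Fin 2 → ℕ → ℕ → T)
    (r : Fin 3 ⊕ Fin 9) : f (focalCondition w r) = focalCondition (fun i a b => f (w i a b)) r := by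
  rcases r with r | k
  · fin_cases r <;> simp [focalCondition]
  · simp only [focalCondition, RingHom.map_det, RingHom.mapMatrix_apply, map_focalMatrix]

/-- A center has a first integral to high order; with its diagonal normalized it solves the
off-diagonal equations and the diagonal one, so the augmented determinants vanish. -/
theorem focalCondition_eq_zero {p : CoeffIdx ⊕ Fin 2 → ℂ} (hp : p ∈ centers)
    (hg : focalNormalizer (translateCoeff p) ≠ 0) (r : Fin 3 ⊕ Fin 9) :
    focalCondition (translateCoeff p) r = 0 := by
  -- The last diagonal equation, at `(10, 10)`, has degree 20, so vanishing below degree 21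
  -- suffices.
  obtain ⟨F, hF2, hFd, hFq⟩ := HasCenterAt.exists_firstIntegral hp 21 (by norm_num)
  set w := translateCoeff p with hw
  set ω : Form := fun i => translate (fun k => p (Sum.inr k))
    (cubicForm (fun k => p (Sum.inl k)) i) with hω
  have hwω : ∀ i a b, w i a b = coeff (expo a b) (ω i) := fun i a b => translateCoeff_eq p i a b
  have hω3 : ∀ i, (ω i).totalDegree ≤ 3 := fun i =>
    (totalDegree_translate_le _ _).trans (totalDegree_cubicForm_le _ _)
  have hlin : ∀ i a b, a + b < 2 → 2 * w i a b = coeff (expo a b) (pderiv i F) := by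
    intro i a b hab
    have := coeff_expo_of_mem (hFq i) hab
    rw [coeff_sub, show (2 : Poly2) = C 2 from rfl, coeff_C_mul, sub_eq_zero] at this
    rw [hwω]; exact this
  have hFlow : ∀ i j, i + j < 2 → coeff (expo i j) F = 0 := fun i j h => coeff_expo_of_mem hF2 h
  have h000 : w 0 0 0 = 0 := by
    have := hlin 0 0 0 (by norm_num)
    rw [coeff_pderiv_expo_zero, hFlow 1 0 (by norm_num)] at this
    simpa using this
  have h100 : w 1 0 0 = 0 := by
    have := hlin 1 0 0 (by norm_num)
    rw [coeff_pderiv_expo_one, hFlow 0 1 (by norm_num)] at this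
    simpa using this
  have hF20 : coeff (expo 2 0) F = w 0 1 0 := by
    have := hlin 0 1 0 (by norm_num)
    rw [coeff_pderiv_expo_zero] at this
    push_cast at this
    linear_combination - this / 2
  have hF11 : coeff (expo 1 1) F = 2 * w 0 0 1 := by
    have := hlin 0 0 1 (by norm_num)
    rw [coeff_pderiv_expo_zero] at this
    push_cast at this
    linear_combination - this
  have hF11' : coeff (expo 1 1) F = 2 * w 1 1 0 := by
    have := hlin 1 1 0 (by norm_num)
    rw [coeff_pderiv_expo_one] at this
    push_cast at this
    linear_combination - this
  have hF02 : coeff (expo 0 2) F = w 1 0 1 := by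
    have := hlin 1 0 1 (by norm_num)
    rw [coeff_pderiv_expo_one] at this
    push_cast at this
    linear_combination - this / 2
  have hmon : ∀ a b, (X 0 ^ a * X 1 ^ b : Poly2) = monomial (expo a b) 1 := by
    intro a b
    rw [X_pow_eq_monomial, X_pow_eq_monomial, monomial_mul, expo, one_mul]
  have hQ : focalQuadric w = monomial (expo 2 0) (w 0 1 0) +
      monomial (expo 1 1) (w 0 0 1 + w 1 1 0) + monomial (expo 0 2) (w 1 0 1) := by
    have e1 := hmon 2 0
    have e2 := hmon 1 1
    have e3 := hmon 0 2
    rw [pow_zero, mul_one] at e1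
    rw [pow_one, pow_one] at e2
    rw [pow_zero, one_mul] at e3
    rw [focalQuadric, e1, e2, e3, C_mul_monomial, C_mul_monomial, C_mul_monomial, mul_one, mul_one,
      mul_one]
  have hQ2 : focalQuadric w ∈ idealOfVars (Fin 2) ℂ ^ 2 := by
    rw [mem_pow_idealOfVars_iff']
    intro m hm
    have hne : ∀ a b, a + b = 2 → expo a b ≠ m := by
      rintro a b hab rfl
      rw [degree_expo] at hm
      omega
    rw [hQ, coeff_add, coeff_add, coeff_monomial, coeff_monomial, coeff_monomial,
      if_neg (hne _ _ rfl), if_neg (hne _ _ rfl), if_neg (hne _ _ rfl), add_zero, add_zero]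
  have hFQ : F - focalQuadric w ∈ idealOfVars (Fin 2) ℂ ^ 3 := by
    rw [mem_pow_idealOfVars_iff']
    intro m hm
    rw [← expo_apply m] at hm ⊢
    rw [degree_expo] at hm
    simp only [coeff_sub, hQ, coeff_add, coeff_monomial, expo_inj]
    have : m 0 + m 1 < 2 ∨ (m 0 = 2 ∧ m 1 = 0) ∨ (m 0 = 1 ∧ m 1 = 1) ∨ (m 0 = 0 ∧ m 1 = 2) := by
      omega
    rcases this with h | ⟨h1, h2⟩ | ⟨h1, h2⟩ | ⟨h1, h2⟩
    · rw [hFlow _ _ h, if_neg (by omega), if_neg (by omega), if_neg (by omega)]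
      ring
    · rw [h1, h2, hF20]; simp
    · rw [h1, h2, hF11]; simp
      linear_combination (hF11' - hF11) / 2
    · rw [h1, h2, hF02]; simp
  have hg' : ∀ k, 2 ≤ k → k ≤ 10 → coeff (expo k k) (focalQuadric w ^ k) ≠ 0 := fun k h1 h2 =>
    Finset.prod_ne_zero_iff.mp hg k (Finset.mem_Icc.mpr ⟨h1, h2⟩)
  obtain ⟨G, hG1, hG2, hG3⟩ := exists_normalized_firstIntegral hQ2 hFQ hFd 10 hg'
  have hG : ∀ i j, i + j < 3 → coeff (expo i j) G = coeff (expo i j) (focalQuadric w) := by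
    intro i j hij
    have := coeff_expo_of_mem hG1 hij
    rwa [coeff_sub, sub_eq_zero] at this
  have hwedge : ∀ i j, i + j ≤ 20 → wedgeCoeff w (fun i j => coeff (expo i j) G) i j = 0 := by
    intro i j hij
    have h1 := coeff_dWedge (F := G) hω3 (fun i => by
      rw [← hwω]; fin_cases i; exacts [h000, h100]) i j
    rw [coeff_expo_of_mem hG2 (by omega)] at h1
    rw [h1]
    congr 1
    funext i a b
    exact hwω i a b
  rcases r with r | k
  · fin_cases r
    · exact h000
    · exact h100
    · change w 1 1 0 - w 0 0 1 = 0
      linear_combination (hF11 - hF11') / 2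
  · rw [focalCondition, det_focalMatrix (x := fun i j => coeff (expo i j) G), hwedge, mul_zero]
    · omega
    · intro i a b hab
      rw [hwω]
      refine coeff_eq_zero_of_totalDegree_lt ?_
      have := degree_expo a b
      rw [Finsupp.degree_apply] at this
      rw [this]
      exact lt_of_le_of_lt (hω3 i) hab
    all_goals first
      | (rw [hG _ _ (by norm_num), hQ]; simp [coeff_monomial, expo_inj])
      | skip
    · exact hG3
    · intro i j _ hij _
      exact hwedge i j hij
    · omega
    · omega

end FocalPolynomials

end

end CuspidalCenter

namespace CuspidalCenter

noncomputable section

/-! ### Certified data modulo `23` at one pair of a form and a center. -/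

section BasePoint

/-- The coefficients of a form of the family with a center at the origin. -/
def baseCoeff : Fin 2 → ℕ → ℕ → ℤ
  | 0, 0, 1 => -24
  | 0, 1, 1 => 4
  | 0, 2, 1 => 2
  | 0, 0, 3 => -2
  | 1, 1, 0 => -24
  | 1, 2, 0 => -16
  | 1, 0, 2 => 12
  | 1, 3, 0 => -2
  | 1, 1, 2 => 2
  | _, _, _ => 0

/-- A form of the family together with its center, the origin. -/
def basePoint : CoeffIdx ⊕ Fin 2 → ℤ
  | Sum.inl c => baseCoeff c.1 c.2.1.1 c.2.1.2
  | Sum.inr _ => 0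

/-- Coordinates in which the focal conditions are independent at the base point. -/
def focalDirection : Fin 3 ⊕ Fin 9 → CoeffIdx :=
  Sum.elim ![(0, ⟨(0, 0), by decide⟩), (1, ⟨(0, 0), by decide⟩), (1, ⟨(1, 0), by decide⟩)]
    ![(0, ⟨(0, 2), by decide⟩), (0, ⟨(1, 1), by decide⟩), (0, ⟨(2, 0), by decide⟩),
      (1, ⟨(0, 2), by decide⟩), (0, ⟨(0, 3), by decide⟩), (0, ⟨(1, 2), by decide⟩),
      (0, ⟨(2, 1), by decide⟩), (0, ⟨(3, 0), by decide⟩), (1, ⟨(0, 3), by decide⟩)]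

/-- The digits of a number in base `23`, arranged by degree. -/
def digit (N i j : ℕ) : ℤ := ((N / 23 ^ ((i + j) * (i + j + 1) / 2 + i) % 23 : ℕ) : ℤ)

/-- A first integral of the base point modulo `23`. -/
def baseIntegral : ℕ :=
  11648462111912947682354001014027793916953221365470984371920224854771595765288685509693337981846857307002477005316340118692734651995575936453500082725248726969825574124520377692737191240418681567742451846881541520236750723097152442040326298047556686524499115476099563600025329153483287522147809606786437905394707253

/-- The derivatives of the first integral in nine directions. -/
def integralDerivative : Fin 9 → ℕ := ![
  537251652328273046976412727677701378356165688836770742313876077575441310305891361298025856873313521980558598196495185362324649693623153993396885210359121226122530609085900538672815657484600166001646010254279027588748770474224576411084721678745567912092148521007311071255097059300312452241557267663608764607860049,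
  13024875676504346892984191403054030080805667977461405992150962081952487081920054036301033770342930026776190414528577743836104560029589884921534673902771706412199315435592307224723608616414974032313869854790532963750048137938995162114262253510068966196582915758328659664842551459351911566995216670396922621512749355,
  205284238409942938791423282976160593843599371378743422513609807992582925942009348763780954480801000050357011620500395033589144834704110326127240394931609535623669454877202327399134738012299510484076446098921450767509975852173653135639126694410060377647752165902751360848659368669827249399796088820606092516349030631,
  19437493710119547201715571280149775697403414621105081620890437263132551319241373393842086472702865638742695618384884438504747861635049149269213223700961983855839886937255461416341885040329606255945692065638588443526831445927784686674774167421898651569478010753966131005327266973242877055663760755392376747773853,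
  28528359069306187117949697386066737270632797221008915878435036100376090036923154522251289826698327471127285327578597317937684791460713953513705143284229227138056564329936102650784984019585146682313768291773872004963378472522690278579708412689846578694102260018418639797572020563571060885121018915598878463725866,
  417560850275259970834349856036071774321003314232290972192015005696972922571030634612304345868347351459305307741145640275128488270115692736404896113134818186978996807153700574589160959191435095400913625878943439518528510976135737844290468133635295589369274459698649876182665824408382628197006642226963048098133194,
  5497934240818957156430764451511071358739494951949743670638288752715719548620562553534007380711123879801333679878298970661854430432455555502563192481110348898369678425352791334170431214164733141540776877189321675598827606240570817027396151669546701345203726602236701463031372723373496210678454892751062666887667792,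
  205284125814468400902303842467113191542766417794261369446932773420240495363019133022701027376201495552846274807321091004031513013823333604277343156920084978708290477223459934872328874666430491293776436049243380268457040713751564083251586637019589506876147324825942345454478792580927509012964005949824899192602350024,
  734002262278612283291724636080700546171764791789036145088999205946195897308284871038563734176612850595815313181177555575175032958377436579485732473855143223184438761329940353864322632405731113354735886187243343080423890716643222569479024178348219611733808396812344806572019903017275944919521478208653346806448]

/-- The inverse of the matrix of the derivatives of the focal values. -/
def focalInverse : ℕ :=
  138901476279424113454955392018763311816466498799089813144842273158970275566620913069984516232961431770492337801

/-- One term of `wedgeCoeff`. -/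
def wedgeTerm (w : Fin 2 → ℕ → ℕ → ℤ) (x : ℕ → ℕ → ℤ) (i j a b : ℕ) : ℤ :=
  bif Nat.ble a i && Nat.ble b j then
    x (i - a + 1) (j - b) * ((i - a + 1 : ℕ) : ℤ) * w 1 a b -
      x (i - a) (j - b + 1) * ((j - b + 1 : ℕ) : ℤ) * w 0 a b else 0

/-- `wedgeCoeff` over the integers with only the nine possible terms of degree one to three,
unrolled for evaluation by the kernel. -/
def wedgeInt (w : Fin 2 → ℕ → ℕ → ℤ) (x : ℕ → ℕ → ℤ) (i j : ℕ) : ℤ :=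
  wedgeTerm w x i j 0 1 + wedgeTerm w x i j 1 0 + wedgeTerm w x i j 0 2 + wedgeTerm w x i j 1 1 +
  wedgeTerm w x i j 2 0 + wedgeTerm w x i j 0 3 + wedgeTerm w x i j 1 2 + wedgeTerm w x i j 2 1 +
  wedgeTerm w x i j 3 0

/-- The coefficients of the form in the direction of one of the nine coordinates. -/
def directionCoeff (r : Fin 9) (i : Fin 2) (a b : ℕ) : ℤ :=
  match focalDirection (Sum.inr r) with
  | (i', m) => bif i.val == i'.val && (a == m.1.1.val && b == m.1.2.val) then 1 else 0

/-- By the product rule, the derivative of `dF ∧ ω` in a coordinate direction is `dF' ∧ ω + dF ∧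
ω'`. On the diagonal it is the obstruction to deforming the first integral. -/
def derivativeWedge (r : Fin 9) (i j : ℕ) : ℤ :=
  wedgeInt baseCoeff (digit (integralDerivative r)) i j +
    wedgeInt (directionCoeff r) (digit baseIntegral) i j

def pairsUpTo (N : ℕ) : List (ℕ × ℕ) :=
  (List.range (N + 1)).flatMap fun d => (List.range (d + 1)).map fun i => (i, d - i)

def checkBase : Bool := (pairsUpTo 20).all fun p =>
  bif Nat.ble (p.1 + p.2) 2 then true else wedgeInt baseCoeff (digit baseIntegral) p.1 p.2 % 23 == 0

def checkDerivative (r : Fin 9) : Bool := (pairsUpTo 20).all fun p =>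
  bif Nat.ble (p.1 + p.2) 2 || p.1 == p.2 then true else derivativeWedge r p.1 p.2 % 23 == 0

/-- The quadratic part of the base integral is `-48xy`, and `-48` is `21` modulo `23`. The
deformations leave the linear part of the form alone, so they have no quadratic part, and all
further diagonal coefficients are normalized to zero. -/
def checkLow : Bool := (pairsUpTo 20).all fun p =>
  bif Nat.ble (p.1 + p.2) 2 || p.1 == p.2 then
    (digit baseIntegral p.1 p.2 == bif p.1 == 1 && p.2 == 1 then 21 else 0) &&
    (List.finRange 9).all fun r => digit (integralDerivative r) p.1 p.2 == 0
  else true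

/-- The obstructions in the nine directions form an invertible matrix; its inverse is supplied as
digits and only the product is verified. -/
def checkInverse : Bool := (List.finRange 9).all fun k => (List.finRange 9).all fun l =>
  ((List.finRange 9).map fun j => derivativeWedge j (k.val + 2) (k.val + 2) *
    ((focalInverse / 23 ^ (9 * j.val + l.val) % 23 : ℕ) : ℤ)).sum % 23 ==
      bif k.val == l.val then 1 else 0

theorem checkBase_eq : checkBase = true := by decide +kernel

theorem checkDerivative_eq : ∀ r, checkDerivative r = true := by decide +kernel

theorem checkLow_eq : checkLow = true := by decide +kernel

theorem checkInverse_eq : checkInverse = true := by decide +kernel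

end BasePoint

end

end CuspidalCenter

namespace CuspidalCenter

noncomputable section

/-! ### Derivatives by evaluation over dual numbers. -/

section DualNumbers

/-- Evaluation over the dual numbers computes a partial derivative. -/
theorem snd_eval₂_dualNumber {σ K : Type*} [CommRing K] [DecidableEq σ] (p : σ → ℤ) (e : σ)
    (f : MvPolynomial σ ℤ) :
    eval₂Hom (Int.castRingHom (TrivSqZeroExt K K)) (fun c => TrivSqZeroExt.inl ((p c : ℤ) : K) +
      TrivSqZeroExt.inr (if c = e then 1 else 0)) f = TrivSqZeroExt.inl ((eval p f : ℤ) : K) +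
      TrivSqZeroExt.inr ((eval p (pderiv e f) : ℤ) : K) := by
  induction f using MvPolynomial.induction_on with
  | C a => ext <;> simp
  | add f g hf hg =>
    rw [map_add, hf, hg]
    ext <;> simp
  | mul_X f c hf =>
    rw [map_mul, hf, eval₂Hom_X']
    ext
    · split_ifs <;> simp
    · rcases eq_or_ne c e with rfl | hc
      · simp [pderiv_X, Derivation.leibniz]
        ring
      · simp [pderiv_X, Derivation.leibniz, hc]
        ring

/-- Bilinearity in the form and the integral becomes the product rule when both carry infinitesimal
parts. -/
theorem wedgeCoeff_dual {K : Type*} [CommRing K] (w v : Fin 2 → ℕ → ℕ → K) (x y : ℕ → ℕ → K)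
    (i j : ℕ) : wedgeCoeff (fun i a b => (TrivSqZeroExt.inl (w i a b) + TrivSqZeroExt.inr (v i a b) :
        TrivSqZeroExt K K)) (fun i j => TrivSqZeroExt.inl (x i j) + TrivSqZeroExt.inr (y i j)) i j =
      TrivSqZeroExt.inl (wedgeCoeff w x i j) +
        TrivSqZeroExt.inr (wedgeCoeff w y i j + wedgeCoeff v x i j) := by
  have hs : ∀ {ι : Type} (s : Finset ι) (f : ι → TrivSqZeroExt K K),
      (∑ i ∈ s, f i).snd = ∑ i ∈ s, (f i).snd := fun s f =>
    map_sum (TrivSqZeroExt.sndHom K K) f s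
  have hf : ∀ {ι : Type} (s : Finset ι) (f : ι → TrivSqZeroExt K K),
      (∑ i ∈ s, f i).fst = ∑ i ∈ s, (f i).fst := fun s f =>
    map_sum (TrivSqZeroExt.fstHom K K K) f s
  ext
  · simp only [wedgeCoeff, hf, TrivSqZeroExt.fst_add, TrivSqZeroExt.fst_inl, TrivSqZeroExt.fst_inr,
      add_zero]
    refine Finset.sum_congr rfl fun a _ => Finset.sum_congr rfl fun b _ => ?_
    split_ifs <;> simp
  · simp only [wedgeCoeff, hs, TrivSqZeroExt.snd_add, TrivSqZeroExt.snd_inl, TrivSqZeroExt.snd_inr,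
      zero_add, ← Finset.sum_add_distrib]
    refine Finset.sum_congr rfl fun a _ => Finset.sum_congr rfl fun b _ => ?_
    split_ifs
    · simp
      ring
    · simp

end DualNumbers

/-! ### Independence of the twelve conditions at the base point. -/

section BasePointJacobian

theorem wedgeCoeff_eq_wedgeInt {w : Fin 2 → ℕ → ℕ → ℤ} (hw : ∀ i a b, a + b > 3 → w i a b = 0)
    (x : ℕ → ℕ → ℤ) (i j : ℕ) : wedgeCoeff w x i j = wedgeInt w x i j := by
  have ht : ∀ a b, a + b ≠ 0 → (if a + b ≠ 0 ∧ a ≤ i ∧ b ≤ j then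
      x (i - a + 1) (j - b) * ((i - a + 1 : ℕ) : ℤ) * w 1 a b -
      x (i - a) (j - b + 1) * ((j - b + 1 : ℕ) : ℤ) * w 0 a b else 0) = wedgeTerm w x i j a b := by
    intro a b hab
    by_cases h : a ≤ i ∧ b ≤ j
    · rw [if_pos ⟨hab, h⟩, wedgeTerm, Nat.ble_eq_true_of_le h.1, Nat.ble_eq_true_of_le h.2]
      rfl
    · rw [if_neg (by tauto), wedgeTerm]
      have : (Nat.ble a i && Nat.ble b j) = false := by
        rw [Bool.eq_false_iff]
        intro h'
        rw [Bool.and_eq_true, Nat.ble_eq, Nat.ble_eq] at h'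
        exact h h'
      rw [this]
      rfl
  have hz : ∀ a b, a + b > 3 → wedgeTerm w x i j a b = 0 := by
    intro a b hab
    rw [wedgeTerm, hw 0 a b hab, hw 1 a b hab]
    simp
  simp only [wedgeCoeff, Finset.sum_range_succ, Finset.sum_range_zero]
  rw [if_neg (by simp)]
  simp only [ht _ _ (show (0 + 1 ≠ 0) by decide), ht _ _ (show (0 + 2 ≠ 0) by decide),
    ht _ _ (show (0 + 3 ≠ 0) by decide), ht _ _ (show (1 + 0 ≠ 0) by decide),
    ht _ _ (show (1 + 1 ≠ 0) by decide), ht _ _ (show (1 + 2 ≠ 0) by decide),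
    ht _ _ (show (1 + 3 ≠ 0) by decide), ht _ _ (show (2 + 0 ≠ 0) by decide),
    ht _ _ (show (2 + 1 ≠ 0) by decide), ht _ _ (show (2 + 2 ≠ 0) by decide),
    ht _ _ (show (2 + 3 ≠ 0) by decide), ht _ _ (show (3 + 0 ≠ 0) by decide),
    ht _ _ (show (3 + 1 ≠ 0) by decide), ht _ _ (show (3 + 2 ≠ 0) by decide),
    ht _ _ (show (3 + 3 ≠ 0) by decide)]
  rw [hz 1 3 (by norm_num), hz 2 2 (by norm_num), hz 2 3 (by norm_num), hz 3 1 (by norm_num),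
    hz 3 2 (by norm_num), hz 3 3 (by norm_num), wedgeInt]
  ring

theorem baseCoeff_of_gt (i : Fin 2) (a b : ℕ) (h : a + b > 3) : baseCoeff i a b = 0 := by
  unfold baseCoeff
  split <;> first | rfl | (simp at h)

theorem directionCoeff_eq (r : Fin 9) (i : Fin 2) (a b : ℕ) : directionCoeff r i a b =
    if h : a + b ≤ 3 then if (i, ⟨(⟨a, by omega⟩, ⟨b, by omega⟩), h⟩) = focalDirection (Sum.inr r)
      then 1 else 0 else 0 := by
  rw [directionCoeff]
  obtain ⟨i', m, hm⟩ := focalDirection (Sum.inr r)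
  by_cases h : i.val = i'.val ∧ a = m.1.val ∧ b = m.2.val
  · obtain ⟨h1, rfl, rfl⟩ := h
    obtain rfl := Fin.ext h1
    rw [dif_pos hm, if_pos rfl]
    simp
  · have h' : (i.val == i'.val && (a == m.1.val && b == m.2.val)) = false := by
      rw [Bool.eq_false_iff]
      simpa using h
    simp only [h']
    split_ifs with h1 h2
    · exfalso
      apply h
      simp only [Prod.mk.injEq, Subtype.mk.injEq] at h2
      obtain ⟨rfl, rfl⟩ := h2
      exact ⟨rfl, rfl, rfl⟩
    · rfl
    · rfl

theorem directionCoeff_of_gt (r : Fin 9) (i : Fin 2) (a b : ℕ) (h : a + b > 3) :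
    directionCoeff r i a b = 0 := by
  rw [directionCoeff_eq, dif_neg (by omega)]

theorem mem_pairsUpTo {N i j : ℕ} (h : i + j ≤ N) : (i, j) ∈ pairsUpTo N := by
  rw [pairsUpTo, List.mem_flatMap]
  exact ⟨i + j, List.mem_range.mpr (by omega), List.mem_map.mpr
    ⟨i, List.mem_range.mpr (by omega), by simp⟩⟩

instance fact_prime_twentyThree : Fact (Nat.Prime 23) := ⟨by norm_num⟩

theorem cast_eq_zero_of_emod {n : ℤ} (h : n % 23 = 0) : ((n : ℤ) : ZMod 23) = 0 :=
  (ZMod.intCast_zmod_eq_zero_iff_dvd n 23).mpr (Int.dvd_of_emod_eq_zero h)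

theorem wedgeCoeff_cast (w : Fin 2 → ℕ → ℕ → ℤ) (x : ℕ → ℕ → ℤ) (i j : ℕ) :
    wedgeCoeff (fun i a b => ((w i a b : ℤ) : ZMod 23)) (fun i j => ((x i j : ℤ) : ZMod 23)) i j =
      ((wedgeCoeff w x i j : ℤ) : ZMod 23) :=
  (map_wedgeCoeff (Int.castRingHom (ZMod 23)) w x i j).symm

theorem wedgeCoeff_base {i j : ℕ} (h : 3 ≤ i + j) (h' : i + j ≤ 20) :
    wedgeCoeff (fun i a b => ((baseCoeff i a b : ℤ) : ZMod 23))
      (fun i j => ((digit baseIntegral i j : ℤ) : ZMod 23)) i j = 0 := by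
  rw [wedgeCoeff_cast, wedgeCoeff_eq_wedgeInt baseCoeff_of_gt]
  have := List.all_eq_true.mp checkBase_eq _ (mem_pairsUpTo h')
  have hb : Nat.ble (i + j) 2 = false := by
    rw [Bool.eq_false_iff]; intro h2; rw [Nat.ble_eq] at h2; omega
  simp only [hb, cond_false, beq_iff_eq] at this
  exact cast_eq_zero_of_emod this

theorem derivativeWedge_cast (r : Fin 9) (i j : ℕ) :
    wedgeCoeff (fun i a b => ((baseCoeff i a b : ℤ) : ZMod 23))
      (fun i j => ((digit (integralDerivative r) i j : ℤ) : ZMod 23)) i j +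
    wedgeCoeff (fun i a b => ((directionCoeff r i a b : ℤ) : ZMod 23))
      (fun i j => ((digit baseIntegral i j : ℤ) : ZMod 23)) i j =
      ((derivativeWedge r i j : ℤ) : ZMod 23) := by
  rw [wedgeCoeff_cast, wedgeCoeff_cast, wedgeCoeff_eq_wedgeInt baseCoeff_of_gt,
    wedgeCoeff_eq_wedgeInt (directionCoeff_of_gt r), derivativeWedge, Int.cast_add]

theorem derivativeWedge_eq_zero (r : Fin 9) {i j : ℕ} (h : 3 ≤ i + j) (h' : i + j ≤ 20)
    (hij : i ≠ j) : ((derivativeWedge r i j : ℤ) : ZMod 23) = 0 := by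
  have := List.all_eq_true.mp (checkDerivative_eq r) _ (mem_pairsUpTo h')
  have hb : (Nat.ble (i + j) 2 || i == j) = false := by
    rw [Bool.eq_false_iff]; intro h2
    rw [Bool.or_eq_true, Nat.ble_eq, beq_iff_eq] at h2; omega
  simp only [hb, cond_false, beq_iff_eq] at this
  exact cast_eq_zero_of_emod this

theorem digit_low {i j : ℕ} (h' : i + j ≤ 20) (h : i + j ≤ 2 ∨ i = j) :
    digit baseIntegral i j = (if i = 1 ∧ j = 1 then 21 else 0) ∧
      ∀ r, digit (integralDerivative r) i j = 0 := by
  have := List.all_eq_true.mp checkLow_eq _ (mem_pairsUpTo h')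
  have hb : (Nat.ble (i + j) 2 || i == j) = true := by
    rw [Bool.or_eq_true, Nat.ble_eq, beq_iff_eq]; exact h
  simp only [hb, cond_true, Bool.and_eq_true, beq_iff_eq, List.all_eq_true] at this
  refine ⟨?_, fun r => this.2 r (List.mem_finRange r)⟩
  rw [this.1]
  by_cases hc : i = 1 ∧ j = 1
  · obtain ⟨rfl, rfl⟩ := hc; rfl
  · have : (i == 1 && j == 1) = false := by
      rw [Bool.eq_false_iff]; simpa using hc
    rw [this, if_neg hc]; rfl

/-- The leading block of the focal matrix is invertible at the base point. -/
theorem det_toBlocks_base_ne_zero (k : ℕ) :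
    (focalMatrix (fun i a b => ((baseCoeff i a b : ℤ) : ZMod 23)) k).toBlocks₁₁.det ≠ 0 := by
  intro h0
  obtain ⟨v, hv, hMv⟩ := Matrix.exists_mulVec_eq_zero_iff.mpr h0
  apply hv
  set w : Fin 2 → ℕ → ℕ → ZMod 23 := fun i a b => ((baseCoeff i a b : ℤ) : ZMod 23) with hw
  set x : ℕ → ℕ → ZMod 23 := fun i j => ∑ c : FocalIdx, focalColumn w (Sum.inl c) i j * v c with hx
  have hxv : ∀ c : FocalIdx, x c.1.1 c.1.2 = v c := by
    intro c
    simp only [hx]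
    rw [Finset.sum_eq_single c]
    · rw [focalColumn_inl, if_pos ⟨rfl, rfl⟩, one_mul]
    · intro d _ hd
      rw [focalColumn_inl, if_neg, zero_mul]
      rintro ⟨h1, h2⟩
      exact hd (Subtype.ext (Prod.ext (Fin.ext h1.symm) (Fin.ext h2.symm)))
    · simp
  have hx0 : ∀ i j : ℕ, (¬ ∃ c : FocalIdx, i = c.1.1 ∧ j = c.1.2) → x i j = 0 := by
    intro i j h
    refine Finset.sum_eq_zero fun c _ => ?_
    rw [focalColumn_inl, if_neg (fun h' => h ⟨c, h'⟩), zero_mul]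
  have heq : ∀ c : FocalIdx, wedgeCoeff w x c.1.1 c.1.2 = 0 := by
    intro c
    have := congrFun hMv c
    simp only [Matrix.mulVec, dotProduct, Matrix.toBlocks₁₁, focalMatrix, Matrix.of_apply, focalRow,
      Pi.zero_apply] at this
    rwa [wedgeCoeff_sum] at this
  -- The block is triangular with respect to degree: quadratic and cubic terms of the form only
  -- bring in coefficients of lower degree. The linear part `-24 (y dx + x dy)` multiplies the
  -- coefficient at `(i, j)` by `24 (j - i)`.
  have main : ∀ d, ∀ i j, i + j = d → x i j = 0 := by
    intro d
    induction d using Nat.strong_induction_on with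
    | _ d ih =>
      intro i j hij
      by_cases hc : ∃ c : FocalIdx, i = c.1.1 ∧ j = c.1.2
      · obtain ⟨c, rfl, rfl⟩ := hc
        have h := heq c
        obtain ⟨⟨i, j⟩, h1, h2, h3⟩ := c
        simp only at hij h ⊢
        have hne : (i : ℕ) ≠ j := fun h => h3 (Fin.ext h)
        generalize (i : ℕ) = i at *
        generalize (j : ℕ) = j at *
        have hterm : ∀ a b, 2 ≤ a + b → x (i - a + 1) (j - b) = 0 ∨ ¬ (a ≤ i ∧ b ≤ j) := by
          intro a b hab
          by_cases h : a ≤ i ∧ b ≤ j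
          · left; exact ih (i - a + 1 + (j - b)) (by omega) _ _ rfl
          · right; exact h
        have hterm' : ∀ a b, 2 ≤ a + b → x (i - a) (j - b + 1) = 0 ∨ ¬ (a ≤ i ∧ b ≤ j) := by
          intro a b hab
          by_cases h : a ≤ i ∧ b ≤ j
          · left; exact ih (i - a + (j - b + 1)) (by omega) _ _ rfl
          · right; exact h
        have hz : ∀ a b, 2 ≤ a + b → (if a + b ≠ 0 ∧ a ≤ i ∧ b ≤ j then
            x (i - a + 1) (j - b) * ((i - a + 1 : ℕ) : ZMod 23) * w 1 a b -
            x (i - a) (j - b + 1) * ((j - b + 1 : ℕ) : ZMod 23) * w 0 a b else 0) = 0 := by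
          intro a b hab
          split_ifs with hc
          · rw [(hterm a b hab).resolve_right (not_not.mpr hc.2),
              (hterm' a b hab).resolve_right (not_not.mpr hc.2)]
            ring
          · rfl
        simp only [wedgeCoeff, Finset.sum_range_succ, Finset.sum_range_zero] at h
        rw [if_neg (by simp)] at h
        rw [hz 0 2 (by norm_num), hz 0 3 (by norm_num), hz 1 1 (by norm_num), hz 1 2 (by norm_num),
          hz 1 3 (by norm_num), hz 2 0 (by norm_num), hz 2 1 (by norm_num), hz 2 2 (by norm_num),
          hz 2 3 (by norm_num), hz 3 0 (by norm_num), hz 3 1 (by norm_num), hz 3 2 (by norm_num),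
          hz 3 3 (by norm_num)] at h
        have hw001 : w 0 0 1 = -24 := by simp [hw, baseCoeff]
        have hw101 : w 1 0 1 = 0 := by simp [hw, baseCoeff]
        have hw010 : w 0 1 0 = 0 := by simp [hw, baseCoeff]
        have hw110 : w 1 1 0 = -24 := by simp [hw, baseCoeff]
        rw [hw001, hw101, hw010, hw110] at h
        have e1 : (if 0 + 1 ≠ 0 ∧ 0 ≤ i ∧ 1 ≤ j then
            x (i - 0 + 1) (j - 1) * ((i - 0 + 1 : ℕ) : ZMod 23) * 0 -
            x (i - 0) (j - 1 + 1) * ((j - 1 + 1 : ℕ) : ZMod 23) * (-24) else 0) =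
            24 * (j : ZMod 23) * x i j := by
          rcases Nat.eq_zero_or_pos j with rfl | hj
          · simp
          · rw [if_pos ⟨by norm_num, by omega, hj⟩, Nat.sub_add_cancel hj, Nat.sub_zero]
            ring
        have e2 : (if 1 + 0 ≠ 0 ∧ 1 ≤ i ∧ 0 ≤ j then
            x (i - 1 + 1) (j - 0) * ((i - 1 + 1 : ℕ) : ZMod 23) * (-24) -
            x (i - 1) (j - 0 + 1) * ((j - 0 + 1 : ℕ) : ZMod 23) * 0 else 0) =
            -24 * (i : ZMod 23) * x i j := by
          rcases Nat.eq_zero_or_pos i with rfl | hi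
          · simp
          · rw [if_pos ⟨by norm_num, hi, by omega⟩, Nat.sub_add_cancel hi, Nat.sub_zero]
            ring
        rw [e1, e2] at h
        -- The diagonal entries become `j - i`, nonzero modulo `23` because `i ≠ j` and `i + j ≤
        -- 20`.
        have h24 : (24 : ZMod 23) = 1 := by decide
        rw [h24] at h
        have hfin : ((j : ℤ) - (i : ℤ) : ZMod 23) * x i j = 0 := by
          push_cast
          linear_combination h
        rcases mul_eq_zero.mp hfin with h4 | h4
        · exfalso
          have h5 : (((j : ℤ) - (i : ℤ) : ℤ) : ZMod 23) = 0 := by rw [← h4]; push_cast; ring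
          rw [ZMod.intCast_zmod_eq_zero_iff_dvd] at h5
          omega
        · exact h4
      · exact hx0 i j hc
  funext c
  rw [← hxv c]
  exact main _ _ _ rfl

/-- The focal condition polynomials. -/
def focalEquation (r : Fin 3 ⊕ Fin 9) : MvPolynomial (CoeffIdx ⊕ Fin 2) ℤ :=
  focalCondition (translateCoeff X) r

/-- Evaluation at the base point with the coordinate `e` moved by an infinitesimal; the
infinitesimal part of the value is the derivative with respect to `e`. -/
def dualEval (e : CoeffIdx ⊕ Fin 2) :
    MvPolynomial (CoeffIdx ⊕ Fin 2) ℤ →+* TrivSqZeroExt (ZMod 23) (ZMod 23) :=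
  eval₂Hom (Int.castRingHom _) fun c => TrivSqZeroExt.inl ((basePoint c : ℤ) : ZMod 23) +
      TrivSqZeroExt.inr (if c = e then 1 else 0)

theorem dualEval_focalEquation (e : CoeffIdx) (r : Fin 3 ⊕ Fin 9) :
    dualEval (Sum.inl e) (focalEquation r) = focalCondition (fun i a b =>
      TrivSqZeroExt.inl ((baseCoeff i a b : ℤ) : ZMod 23) + TrivSqZeroExt.inr
        (if h : a + b ≤ 3 then if (i, ⟨(⟨a, by omega⟩, ⟨b, by omega⟩), h⟩) = e then 1 else 0
          else 0)) r := by
  rw [focalEquation, map_focalCondition]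
  congr 1
  funext i a b
  rw [map_translateCoeff, translateCoeff_of_zero]
  · split_ifs with h h'
    · rw [dualEval, eval₂Hom_X', if_pos (by rw [h'])]
      rfl
    · rw [dualEval, eval₂Hom_X', if_neg (by simpa using h')]
      rfl
    · rw [baseCoeff_of_gt i a b (by omega)]
      simp
  · intro k
    rw [dualEval, eval₂Hom_X', if_neg (by simp)]
    simp [basePoint]

/-- The derivatives of the focal conditions at the base point, modulo `23`. -/
def focalJacobian : Matrix (Fin 3 ⊕ Fin 9) (Fin 3 ⊕ Fin 9) (ZMod 23) :=
  Matrix.of fun r s => (dualEval (Sum.inl (focalDirection s)) (focalEquation r)).snd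

/-- The base integral together with its deformation solves the off-diagonal equations over the dual
numbers. `det_focalMatrix` then gives the block determinant times a purely infinitesimal residual,
so only the constant part of the block determinant survives. -/
theorem focalJacobian_inr_inr (k r : Fin 9) : focalJacobian (Sum.inr k) (Sum.inr r) =
    (focalMatrix (fun i a b => ((baseCoeff i a b : ℤ) : ZMod 23)) (k + 2)).toBlocks₁₁.det *
      ((derivativeWedge r (k + 2) (k + 2) : ℤ) : ZMod 23) := by
  set w : Fin 2 → ℕ → ℕ → TrivSqZeroExt (ZMod 23) (ZMod 23) := fun i a b =>
    TrivSqZeroExt.inl ((baseCoeff i a b : ℤ) : ZMod 23) +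
      TrivSqZeroExt.inr ((directionCoeff r i a b : ℤ) : ZMod 23) with hw
  set x : ℕ → ℕ → TrivSqZeroExt (ZMod 23) (ZMod 23) := fun i j =>
    TrivSqZeroExt.inl ((digit baseIntegral i j : ℤ) : ZMod 23) +
      TrivSqZeroExt.inr ((digit (integralDerivative r) i j : ℤ) : ZMod 23) with hx
  have h1 : dualEval (Sum.inl (focalDirection (Sum.inr r))) (focalEquation (Sum.inr k)) =
      focalCondition w (Sum.inr k) := by
    rw [dualEval_focalEquation]
    congr 1
    funext i a b
    simp only [hw, directionCoeff_eq]
    split_ifs <;> simp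
  have hwedge : ∀ i j, 3 ≤ i + j → i + j ≤ 20 → wedgeCoeff w x i j =
      TrivSqZeroExt.inr ((derivativeWedge r i j : ℤ) : ZMod 23) := by
    intro i j h3 h20
    rw [wedgeCoeff_dual, wedgeCoeff_base h3 h20, derivativeWedge_cast]
    simp
  have hdir : ∀ i a b, a + b ≤ 1 → directionCoeff r i a b = 0 := by
    have : ∀ r : Fin 9, ∀ i : Fin 2, ∀ a < 2, ∀ b < 2, a + b ≤ 1 → directionCoeff r i a b = 0 := by
      decide
    intro i a b hab
    exact this r i a (by omega) b (by omega) hab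
  have hlow : ∀ i j, i + j ≤ 20 → (i + j ≤ 2 ∨ i = j) → ¬ (i = 1 ∧ j = 1) → x i j = 0 := by
    intro i j h h' h11
    obtain ⟨e1, e2⟩ := digit_low h h'
    simp only [hx]
    rw [e1, e2, if_neg h11]
    simp
  have h2 : focalCondition w (Sum.inr k) = (focalMatrix w (k + 2)).toBlocks₁₁.det *
      TrivSqZeroExt.inr ((derivativeWedge r (k + 2) (k + 2) : ℤ) : ZMod 23) := by
    rw [focalCondition, det_focalMatrix (x := x), hwedge]
    · omega
    · omega
    · intro i a b hab
      simp only [hw]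
      rw [baseCoeff_of_gt i a b hab, directionCoeff_of_gt r i a b hab]
      simp
    · exact hlow 1 0 (by norm_num) (by norm_num) (by norm_num)
    · exact hlow 0 1 (by norm_num) (by norm_num) (by norm_num)
    · rw [hlow 2 0 (by norm_num) (by norm_num) (by norm_num)]
      simp only [hw]
      rw [hdir 0 1 0 (by norm_num)]
      simp [baseCoeff]
    · obtain ⟨e1, e2⟩ := digit_low (i := 1) (j := 1) (by norm_num) (by norm_num)
      simp only [hx, hw]
      rw [e1, e2, hdir 0 0 1 (by norm_num), hdir 1 1 0 (by norm_num), if_pos ⟨rfl, rfl⟩]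
      simp only [baseCoeff, Int.cast_zero, TrivSqZeroExt.inr_zero, add_zero]
      rw [← TrivSqZeroExt.inl_add]
      congr 1
    · rw [hlow 0 2 (by norm_num) (by norm_num) (by norm_num)]
      simp only [hw]
      rw [hdir 1 0 1 (by norm_num)]
      simp [baseCoeff]
    · intro k h1 h2
      exact hlow k k (by omega) (by omega) (by omega)
    · intro i j h3 h20 hij
      rw [hwedge i j h3 h20, derivativeWedge_eq_zero r h3 h20 hij, TrivSqZeroExt.inr_zero]
    · omega
    · omega
  rw [focalJacobian, Matrix.of_apply, h1, h2, TrivSqZeroExt.snd_mul]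
  simp only [TrivSqZeroExt.snd_inr, TrivSqZeroExt.fst_inr, MulOpposite.op_zero, zero_smul, add_zero,
    smul_eq_mul]
  refine congrArg (· * ((derivativeWedge r (k + 2) (k + 2) : ℤ) : ZMod 23)) ?_
  have hf : ∀ z, (TrivSqZeroExt.fstHom (ZMod 23) (ZMod 23) (ZMod 23)).toRingHom z = z.fst :=
    fun _ => rfl
  rw [← hf, RingHom.map_det]
  refine congrArg Matrix.det ?_
  have h4 := map_focalMatrix (TrivSqZeroExt.fstHom (ZMod 23) (ZMod 23) (ZMod 23)).toRingHom w (k + 2)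
  ext c d
  have h5 := congrFun (congrFun h4 (Sum.inl c)) (Sum.inl d)
  rw [Matrix.map_apply] at h5
  rw [RingHom.mapMatrix_apply, Matrix.map_apply, Matrix.toBlocks₁₁, Matrix.of_apply, h5,
    Matrix.toBlocks₁₁, Matrix.of_apply]
  have h6 : (fun i a b => (TrivSqZeroExt.fstHom (ZMod 23) (ZMod 23) (ZMod 23)).toRingHom (w i a b)) =
      fun i a b => ((baseCoeff i a b : ℤ) : ZMod 23) := by
    funext i a b
    simp [hw]
  rw [h6]

/-- The first three conditions are linear in the first three chosen coordinates and do not involve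
the other nine at a center lying at the origin. -/
theorem focalJacobian_inl (r : Fin 3) (s : Fin 3 ⊕ Fin 9) : focalJacobian (Sum.inl r) s =
    if s = Sum.inl r then 1 else 0 := by
  rw [focalJacobian, Matrix.of_apply, dualEval_focalEquation]
  fin_cases r <;> fin_cases s <;>
  simp [focalCondition, focalDirection]

/-- The Jacobian is block lower triangular: an identity block, then the certified invertible matrix
with rows scaled by nonzero block determinants. -/
theorem det_focalJacobian_ne_zero : focalJacobian.det ≠ 0 := by
  set O : Matrix (Fin 9) (Fin 9) (ZMod 23) := Matrix.of fun k r =>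
    ((derivativeWedge r (k + 2) (k + 2) : ℤ) : ZMod 23) with hO
  set O' : Matrix (Fin 9) (Fin 9) (ZMod 23) := Matrix.of fun j l =>
    ((focalInverse / 23 ^ (9 * j.val + l.val) % 23 : ℕ) : ZMod 23) with hO'
  have hOO' : O * O' = 1 := by
    ext k l
    have h1 := checkInverse_eq
    rw [checkInverse, List.all_eq_true] at h1
    have h2 := h1 k (List.mem_finRange k)
    rw [List.all_eq_true] at h2
    have h3 := h2 l (List.mem_finRange l)
    rw [beq_iff_eq] at h3
    have h4 := congrArg (Int.cast : ℤ → ZMod 23) h3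
    rw [show ∀ n : ℤ, ((n % 23 : ℤ) : ZMod 23) = n from fun n => ZMod.intCast_mod n 23] at h4
    rw [Matrix.mul_apply, Matrix.one_apply]
    rw [← List.ofFn_eq_map, List.sum_ofFn] at h4
    simp only [Int.cast_sum, Int.cast_mul, Int.cast_natCast] at h4
    simp only [hO, hO', Matrix.of_apply]
    rw [h4]
    by_cases hkl : k = l
    · simp [hkl]
    · rw [if_neg hkl]
      have : (k.val == l.val) = false := by
        rw [Bool.eq_false_iff]; simpa [Fin.ext_iff] using hkl
      rw [this]; rfl
  have hdO : O.det ≠ 0 := by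
    intro h
    have := congrArg Matrix.det hOO'
    rw [Matrix.det_mul, h, zero_mul, Matrix.det_one] at this
    exact zero_ne_one this
  have hJ : focalJacobian = Matrix.fromBlocks 1 0 focalJacobian.toBlocks₂₁
      (Matrix.diagonal (fun k : Fin 9 => (focalMatrix (fun i a b =>
        ((baseCoeff i a b : ℤ) : ZMod 23)) (k + 2)).toBlocks₁₁.det) * O) := by
    have h11 : focalJacobian.toBlocks₁₁ = 1 := by
      ext r s
      rw [Matrix.toBlocks₁₁, Matrix.of_apply, focalJacobian_inl, Matrix.one_apply]
      simp [eq_comm]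
    have h12 : focalJacobian.toBlocks₁₂ = 0 := by
      ext r s
      rw [Matrix.toBlocks₁₂, Matrix.of_apply, focalJacobian_inl]
      simp
    have h22 : focalJacobian.toBlocks₂₂ = Matrix.diagonal (fun k : Fin 9 => (focalMatrix
        (fun i a b => ((baseCoeff i a b : ℤ) : ZMod 23)) (k + 2)).toBlocks₁₁.det) * O := by
      ext k r
      rw [Matrix.toBlocks₂₂, Matrix.of_apply, focalJacobian_inr_inr, Matrix.diagonal_mul]
      rfl
    rw [← h22, ← h11, ← h12, Matrix.fromBlocks_toBlocks]
  rw [hJ, Matrix.det_fromBlocks_zero₁₂, Matrix.det_one, one_mul, Matrix.det_mul,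
    Matrix.det_diagonal]
  exact mul_ne_zero (Finset.prod_ne_zero_iff.mpr fun k _ => det_toBlocks_base_ne_zero _) hdO

/-- The quadratic part here is `-48xy`, whose `k`-th power has diagonal coefficient `(-48) ^ k`. -/
theorem focalNormalizer_base_ne_zero :
    focalNormalizer (translateCoeff fun c => ((basePoint c : ℤ) : ℂ)) ≠ 0 := by
  have hw : translateCoeff (fun c => ((basePoint c : ℤ) : ℂ)) =
      fun i a b => ((baseCoeff i a b : ℤ) : ℂ) := by
    funext i a b
    rw [translateCoeff_of_zero (fun k => by simp [basePoint])]
    split_ifs with h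
    · rfl
    · rw [baseCoeff_of_gt i a b (by omega), Int.cast_zero]
  rw [hw, focalNormalizer, Finset.prod_ne_zero_iff]
  intro k _
  have : focalQuadric (fun i a b => ((baseCoeff i a b : ℤ) : ℂ)) = C (-48) * (X 0 * X 1) := by
    rw [focalQuadric]
    simp only [baseCoeff]
    norm_num
  rw [this, mul_pow, mul_pow, ← C_pow, coeff_C_mul, X_pow_eq_monomial, X_pow_eq_monomial,
    monomial_mul, coeff_monomial, ← expo, if_pos rfl, mul_one, mul_one]
  exact pow_ne_zero _ (by norm_num)

end BasePointJacobian

end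

end CuspidalCenter

namespace CuspidalCenter

noncomputable section

/-! ### The upper bound for components through the base point. -/

section CenterEquations

theorem eval_map_focal (p : CoeffIdx ⊕ Fin 2 → ℂ) (r : Fin 3 ⊕ Fin 9) :
    eval p (map (Int.castRingHom ℂ) (focalEquation r)) = focalCondition (translateCoeff p) r := by
  change ((eval p).comp (map (Int.castRingHom ℂ))) (focalCondition (translateCoeff X) r) = _
  rw [map_focalCondition]
  congr 1
  funext i a b
  rw [map_translateCoeff]
  congr 1
  funext k
  simp

theorem eval_map_normalizer (p : CoeffIdx ⊕ Fin 2 → ℂ) :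
    eval p (map (Int.castRingHom ℂ) (focalNormalizer (translateCoeff X))) =
      focalNormalizer (translateCoeff p) := by
  change ((eval p).comp (map (Int.castRingHom ℂ))) (focalNormalizer (translateCoeff X)) = _
  rw [map_focalNormalizer]
  congr 1
  funext i a b
  rw [map_translateCoeff]
  congr 1
  funext k
  simp

theorem eval_intCast_map {σ : Type*} (p : σ → ℤ) (f : MvPolynomial σ ℤ) :
    eval (fun c => ((p c : ℤ) : ℂ)) (map (Int.castRingHom ℂ) f) = ((eval p f : ℤ) : ℂ) := by
  induction f using MvPolynomial.induction_on with
  | C a => simp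
  | add f g hf hg => simp [hf, hg]
  | mul_X f c hf => simp [hf]

/-- A prime ideal of dimension ten through the base point which contains all relations between the
coordinates of forms with a center is minimal among these. -/
theorem eq_of_vanishingIdeal_centers_le {P Q : Ideal (MvPolynomial (CoeffIdx ⊕ Fin 2) ℂ)}
    [P.IsPrime] [Q.IsPrime] (hJ : vanishingIdeal ℂ centers ≤ P) (hPQ : P ≤ Q)
    (h0 : ∀ f ∈ Q, eval (fun c => ((basePoint c : ℤ) : ℂ)) f = 0)
    (hQ : ringKrullDim (MvPolynomial (CoeffIdx ⊕ Fin 2) ℂ ⧸ Q) = (10 : ℕ)) : P = Q := by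
  set p₀ : CoeffIdx ⊕ Fin 2 → ℂ := fun c => ((basePoint c : ℤ) : ℂ) with hp₀
  have hN : map (Int.castRingHom ℂ) (focalNormalizer (translateCoeff X)) ∉ P := by
    intro h
    have := h0 _ (hPQ h)
    rw [eval_map_normalizer] at this
    exact focalNormalizer_base_ne_zero this
  refine eq_of_jacobian hPQ (fun r => Sum.inl (focalDirection r)) ?_
    (fun r => map (Int.castRingHom ℂ) (focalEquation r)) ?_ ?_ ?_
  · refine Sum.inl_injective.comp ?_
    decide
  · intro r
    -- The conditions hold at centers only where the normalizer is nonzero. Its product with each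
    -- condition vanishes at all centers, and primality removes the normalizer, which does not
    -- vanish at the base point.
    refine (Ideal.IsPrime.mem_or_mem ‹P.IsPrime› (hJ ?_ :
      map (Int.castRingHom ℂ) (focalNormalizer (translateCoeff X)) * _ ∈ P)).resolve_left hN
    rw [mem_vanishingIdeal_iff]
    intro p hp
    rw [aeval_eq_eval, map_mul, eval_map_normalizer, eval_map_focal]
    by_cases hg : focalNormalizer (translateCoeff p) = 0
    · rw [hg, zero_mul]
    · rw [focalCondition_eq_zero hp hg, mul_zero]
  -- The minor has integral coefficients, so it can be tested at the base point modulo `23`.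
  · intro h
    have h1 := h0 _ (hPQ h)
    have h2 : (Matrix.of fun i j => pderiv (Sum.inl (focalDirection j))
        (map (Int.castRingHom ℂ) (focalEquation i))) = (map (Int.castRingHom ℂ)).mapMatrix
        (Matrix.of fun i j => pderiv (Sum.inl (focalDirection j)) (focalEquation i)) := by
      ext i j : 2
      rw [Matrix.of_apply, RingHom.mapMatrix_apply, Matrix.map_apply, Matrix.of_apply, pderiv_map]
    rw [h2, ← RingHom.map_det, eval_intCast_map, Int.cast_eq_zero] at h1
    apply det_focalJacobian_ne_zero
    have h3 := congrArg (Int.cast : ℤ → ZMod 23) h1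
    rw [Int.cast_zero] at h3
    rw [← h3]
    change _ = ((Int.castRingHom (ZMod 23)).comp (eval basePoint)) _
    rw [RingHom.map_det]
    congr 1
    ext i j
    rw [focalJacobian, Matrix.of_apply, dualEval, snd_eval₂_dualNumber, RingHom.mapMatrix_apply,
      Matrix.map_apply, Matrix.of_apply]
    simp
  -- Twenty coefficients and two coordinates of the center, minus twelve conditions, leave ten.
  · rw [hQ]
    congr 1

end CenterEquations

end

end CuspidalCenter

namespace CuspidalCenter

noncomputable section

/-! ### Binary forms and restriction to lines. -/

section Homogeneous

theorem homogeneousComponent_mul_of_totalDegree_le {σ R : Type*} [CommSemiring R]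
    {a b : MvPolynomial σ R} {m n : ℕ} (ha : a.totalDegree ≤ m) (hb : b.totalDegree ≤ n) :
    homogeneousComponent (m + n) (a * b) = homogeneousComponent m a * homogeneousComponent n b := by
  classical
  have hz : ∀ {f : MvPolynomial σ R} {k : ℕ} (d : σ →₀ ℕ), f.totalDegree ≤ k → k < d.degree →
      coeff d f = 0 := by
    intro f k d hf hd
    refine coeff_eq_zero_of_totalDegree_lt (lt_of_le_of_lt hf ?_)
    rwa [Finsupp.degree_apply] at hd
  ext d
  rw [coeff_homogeneousComponent, coeff_mul, coeff_mul]
  by_cases hd : d.degree = m + n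
  · rw [if_pos hd]
    refine Finset.sum_congr rfl fun p hp => ?_
    have hp' := congrArg Finsupp.degree (Finset.HasAntidiagonal.mem_antidiagonal.mp hp)
    rw [map_add] at hp'
    rw [coeff_homogeneousComponent, coeff_homogeneousComponent]
    rcases lt_trichotomy p.1.degree m with h | h | h
    · rw [hz p.2 hb (by omega), mul_zero, if_neg (by omega), zero_mul]
    · rw [if_pos h, if_pos (by omega)]
    · rw [hz p.1 ha h, zero_mul, if_neg (by omega), zero_mul]
  · rw [if_neg hd, Finset.sum_eq_zero]
    intro p hp
    have hp' := congrArg Finsupp.degree (Finset.HasAntidiagonal.mem_antidiagonal.mp hp)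
    rw [map_add] at hp'
    rw [coeff_homogeneousComponent, coeff_homogeneousComponent]
    by_cases h : p.1.degree = m
    · rw [if_neg (show ¬ p.2.degree = n by omega), mul_zero]
    · rw [if_neg h, zero_mul]

theorem homogeneousComponent_pderiv (n : ℕ) (i : Fin 2) (f : Poly2) :
    homogeneousComponent n (pderiv i f) = pderiv i (homogeneousComponent (n + 1) f) := by
  ext m
  have h1 := MvPowerSeries.coeff_pderiv (R := ℂ) (i := i) (f : MvPowerSeries (Fin 2) ℂ) m
  have h2 := MvPowerSeries.coeff_pderiv (R := ℂ) (i := i)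
    ((homogeneousComponent (n + 1) f : Poly2) : MvPowerSeries (Fin 2) ℂ) m
  rw [MvPowerSeries.pderiv_coe, MvPolynomial.coeff_coe, MvPolynomial.coeff_coe] at h1 h2
  rw [coeff_homogeneousComponent, h1, h2, coeff_homogeneousComponent, map_add,
    Finsupp.degree_single]
  by_cases h : m.degree = n
  · rw [if_pos h, if_pos (by omega)]
  · rw [if_neg h, if_neg (by omega), zero_mul]

theorem totalDegree_pderiv_le {f : Poly2} {n : ℕ} (hf : f.totalDegree ≤ n + 1) (i : Fin 2) :
    (pderiv i f).totalDegree ≤ n := by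
  refine Finset.sup_le fun m hm => ?_
  by_contra hlt
  rw [mem_support_iff] at hm
  apply hm
  have h1 := MvPowerSeries.coeff_pderiv (R := ℂ) (i := i) (f : MvPowerSeries (Fin 2) ℂ) m
  rw [MvPowerSeries.pderiv_coe, MvPolynomial.coeff_coe, MvPolynomial.coeff_coe] at h1
  rw [h1, coeff_eq_zero_of_totalDegree_lt, zero_mul]
  have : (m + Finsupp.single i 1).degree = m.degree + 1 := by rw [map_add, Finsupp.degree_single]
  simp only [Finsupp.degree_apply] at this
  have h2 : ¬ ∑ i ∈ m.support, m i ≤ n := hlt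
  omega

theorem eval_smul_of_isHomogeneous {f : Poly2} {n : ℕ} (hf : f.IsHomogeneous n) (c : ℂ)
    (v : Fin 2 → ℂ) : eval (c • v) f = c ^ n * eval v f := by
  rw [eval_eq', eval_eq', Finset.mul_sum]
  refine Finset.sum_congr rfl fun d hd => ?_
  have hdeg : d.degree = n := by
    have := hf (mem_support_iff.mp hd)
    rwa [Finsupp.degree_eq_weight_one]
  rw [← hdeg, Finsupp.degree_eq_sum]
  simp only [Pi.smul_apply, smul_eq_mul, mul_pow, Finset.prod_mul_distrib,
    Finset.prod_pow_eq_pow_sum]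
  ring

theorem euler_two {f : Poly2} {n : ℕ} (hf : f.IsHomogeneous n) :
    X 0 * pderiv 0 f + X 1 * pderiv 1 f = (n : Poly2) * f := by
  have := hf.sum_X_mul_pderiv
  rwa [Fin.sum_univ_two, nsmul_eq_mul] at this

/-- The restriction of a polynomial to the line through `a` with direction `e`. -/
def restrict (a e : Fin 2 → ℂ) (f : Poly2) : Polynomial ℂ :=
  aeval (fun i => Polynomial.C (a i) + Polynomial.C (e i) * Polynomial.X) f

theorem eval_restrict (a e : Fin 2 → ℂ) (f : Poly2) (t : ℂ) :
    (restrict a e f).eval t = eval (a + t • e) f := by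
  induction f using MvPolynomial.induction_on with
  | C c => simp [restrict]
  | add f g hf hg => simp_all [restrict]
  | mul_X f i hf =>
    simp only [restrict, map_mul, aeval_X, Polynomial.eval_mul, eval_X] at hf ⊢
    rw [hf]
    simp only [Polynomial.eval_add, Polynomial.eval_mul, Polynomial.eval_C, Polynomial.eval_X,
      Pi.add_apply, Pi.smul_apply, smul_eq_mul]
    ring

theorem derivative_restrict (a e : Fin 2 → ℂ) (f : Poly2) :
    (restrict a e f).derivative = Polynomial.C (e 0) * restrict a e (pderiv 0 f) +
      Polynomial.C (e 1) * restrict a e (pderiv 1 f) := by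
  induction f using MvPolynomial.induction_on with
  | C c => simp [restrict]
  | add f g hf hg =>
    simp only [restrict, map_add] at hf hg ⊢
    rw [hf, hg]
    ring
  | mul_X f i hf =>
    simp only [restrict, map_mul, aeval_X, Derivation.leibniz, smul_eq_mul, map_add,
      Polynomial.derivative_mul, pderiv_X] at hf ⊢
    rw [hf]
    fin_cases i <;> simp <;> ring

theorem natDegree_restrict_le {f : Poly2} {n : ℕ} (hf : f.totalDegree ≤ n) (a e : Fin 2 → ℂ) :
    (restrict a e f).natDegree ≤ n := by
  have := aeval_natDegree_le f hf (fun i => Polynomial.C (a i) + Polynomial.C (e i) * Polynomial.X)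
    (n := 1) (fun i => by compute_degree)
  rwa [mul_one] at this

theorem eq_div_mul_add_div_mul {a b d v w e : ℂ} (ha : a ≠ 0) (hd : d ≠ 0)
    (h : a * w + b * e = d * v) : v = a / d * (w + b / a * e) := by
  field_simp
  linear_combination - h

/-- The rays through an affine line missing the origin cover every direction except that of the
line; by homogeneity `f` vanishes on all of them. -/
theorem eq_zero_of_restrict_eq_zero {f : Poly2} {n : ℕ} (hf : f.IsHomogeneous n)
    {w e : Fin 2 → ℂ} (hd : e 0 * w 1 - e 1 * w 0 ≠ 0) (h : restrict w e f = 0) : f = 0 := by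
  have hl : (C (e 0) * X 1 - C (e 1) * X 0 : Poly2) ≠ 0 := by
    intro h0
    have := congrArg (eval w) h0
    simp only [map_sub, map_mul, eval_C, eval_X, map_zero] at this
    exact hd this
  have : f * (C (e 0) * X 1 - C (e 1) * X 0 : Poly2) = 0 := by
    refine MvPolynomial.funext fun v => ?_
    simp only [map_mul, map_sub, eval_C, eval_X, map_zero]
    by_cases hv : e 0 * v 1 - e 1 * v 0 = 0
    · rw [hv, mul_zero]
    · have hv' : v = ((e 0 * v 1 - e 1 * v 0) / (e 0 * w 1 - e 1 * w 0)) •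
          (w + ((v 0 * w 1 - v 1 * w 0) / (e 0 * v 1 - e 1 * v 0)) • e) := by
        funext i
        refine eq_div_mul_add_div_mul hv hd ?_
        fin_cases i <;> simp <;> ring
      rw [hv', eval_smul_of_isHomogeneous hf, ← eval_restrict, h]
      simp
  exact (mul_eq_zero.mp this).resolve_right hl

/-- A polynomial with as many distinct roots as its degree has only simple ones. -/
theorem roots_of_card_eq_natDegree {φ : Polynomial ℂ} (hφ : φ ≠ 0) {T : Finset ℂ}
    (hT : ∀ t ∈ T, φ.eval t = 0) (hc : φ.natDegree ≤ T.card) {t : ℂ} (ht : φ.eval t = 0) :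
    φ.derivative.eval t ≠ 0 := by
  intro hd
  have h1 : T ⊆ φ.roots.toFinset := fun s hs => by
    rw [Multiset.mem_toFinset, Polynomial.mem_roots hφ]
    exact hT s hs
  have h2 : φ.roots.Nodup := by
    rw [← Multiset.toFinset_card_eq_card_iff_nodup]
    refine le_antisymm (Multiset.toFinset_card_le _) ?_
    exact (φ.card_roots').trans (hc.trans (Finset.card_le_card h1))
  have h3 := (Polynomial.one_lt_rootMultiplicity_iff_isRoot hφ).mpr ⟨ht, hd⟩
  rw [← Polynomial.count_roots] at h3
  have := Multiset.nodup_iff_count_le_one.mp h2 t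
  omega

/-- A binary form of degree less than five vanishes if it vanishes at the simple zeros of a quintic
form with five distinct zeros. -/
theorem eq_zero_of_zeros_of_quintic {f h : Poly2} {n : ℕ} (hf : f.IsHomogeneous 5) (hf0 : f ≠ 0)
    (hcard : {p : Projectivization ℂ (Fin 2 → ℂ) | eval p.rep f = 0}.ncard = 5)
    (hh : h.IsHomogeneous n) (hn : n < 5)
    (hz : ∀ v, eval v f = 0 → (eval v (pderiv 0 f) ≠ 0 ∨ eval v (pderiv 1 f) ≠ 0) →
      eval v h = 0) : h = 0 := by
  -- With `e` not a zero of the quintic, all five zeros lie in the affine chart `w + t e`, where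
  -- they become distinct roots of a polynomial of degree at most five.
  obtain ⟨e, he⟩ : ∃ e, eval e f ≠ 0 := by
    by_contra! hc
    exact hf0 (MvPolynomial.funext fun v => by rw [hc v, map_zero])
  obtain ⟨w, hw⟩ : ∃ w : Fin 2 → ℂ, e 0 * w 1 - e 1 * w 0 ≠ 0 := by
    by_contra! hc
    have h0 : e = 0 := by
      funext i
      fin_cases i
      · simpa using hc ![0, 1]
      · simpa using hc ![1, 0]
    rw [h0, ← zero_smul ℂ (0 : Fin 2 → ℂ), eval_smul_of_isHomogeneous hf] at he
    simp at he
  set S := {p : Projectivization ℂ (Fin 2 → ℂ) | eval p.rep f = 0} with hS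
  set φ := restrict w e f with hφ
  have hφ0 : φ ≠ 0 := fun h0 => hf0 (eq_zero_of_restrict_eq_zero hf hw h0)
  set β : (Fin 2 → ℂ) → ℂ := fun v => (e 0 * v 1 - e 1 * v 0) / (e 0 * w 1 - e 1 * w 0) with hβ
  set τ : (Fin 2 → ℂ) → ℂ := fun v => (v 0 * w 1 - v 1 * w 0) / (e 0 * v 1 - e 1 * v 0) with hτ
  have hβS : ∀ p ∈ S, e 0 * p.rep 1 - e 1 * p.rep 0 ≠ 0 := by
    intro p hp h0
    have hpe : p.rep = ((p.rep 0 * w 1 - p.rep 1 * w 0) / (e 0 * w 1 - e 1 * w 0)) • e := by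
      funext i
      rw [Pi.smul_apply, smul_eq_mul, div_mul_eq_mul_div, eq_div_iff hw]
      fin_cases i <;> simp
      · linear_combination w 0 * h0
      · linear_combination w 1 * h0
    have hp' : eval p.rep f = 0 := hp
    rw [hpe, eval_smul_of_isHomogeneous hf] at hp'
    rcases mul_eq_zero.mp hp' with h1 | h1
    · rw [pow_eq_zero_iff (by norm_num)] at h1
      rw [h1, zero_smul] at hpe
      exact p.rep_nonzero hpe
    · exact he h1
  have hdec : ∀ p ∈ S, p.rep = β p.rep • (w + τ p.rep • e) := by
    intro p hp
    have := hβS p hp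
    funext i
    refine eq_div_mul_add_div_mul this hw ?_
    fin_cases i <;> simp <;> ring
  have hβ0 : ∀ p ∈ S, β p.rep ≠ 0 := fun p hp => div_ne_zero (hβS p hp) hw
  have hroot : ∀ p ∈ S, φ.eval (τ p.rep) = 0 := by
    intro p hp
    have hp' : eval p.rep f = 0 := hp
    rw [hdec p hp, eval_smul_of_isHomogeneous hf] at hp'
    rw [hφ, eval_restrict]
    exact (mul_eq_zero.mp hp').resolve_left (pow_ne_zero _ (hβ0 p hp))
  have hinj : Set.InjOn (fun p : Projectivization ℂ (Fin 2 → ℂ) => τ p.rep) S := by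
    intro p hp p' hp' heq
    simp only at heq
    rw [← p.mk_rep, ← p'.mk_rep, Projectivization.mk_eq_mk_iff']
    refine ⟨β p.rep / β p'.rep, ?_⟩
    have h1 := hβ0 p' hp'
    have e1 := hdec p' hp'
    have e2 := hdec p hp
    rw [heq] at e2
    generalize β p'.rep = b' at *
    rw [e1, smul_smul, div_mul_cancel₀ _ h1]
    exact e2.symm
  have hfin : S.Finite := Set.finite_of_ncard_pos (by rw [hcard]; norm_num)
  set T := hfin.toFinset.image (fun p => τ p.rep) with hT
  have hTc : T.card = 5 := by
    rw [hT, Finset.card_image_of_injOn (by simpa using hinj), ← Set.ncard_eq_toFinset_card S hfin,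
      hcard]
  have hTr : ∀ t ∈ T, φ.eval t = 0 := by
    intro t ht
    obtain ⟨p, hp, rfl⟩ := Finset.mem_image.mp ht
    exact hroot p (by simpa using hp)
  have hdeg : φ.natDegree ≤ T.card := by
    rw [hTc]
    exact natDegree_restrict_le hf.totalDegree_le w e
  have hψ : restrict w e h = 0 := by
    refine Polynomial.eq_zero_of_natDegree_lt_card_of_eval_eq_zero' _ T (fun t ht => ?_) ?_
    · rw [eval_restrict]
      have h0 := hTr t ht
      have h1 := roots_of_card_eq_natDegree hφ0 hTr hdeg h0
      rw [hφ, eval_restrict] at h0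
      rw [hφ, derivative_restrict, Polynomial.eval_add, Polynomial.eval_mul, Polynomial.eval_mul,
        eval_restrict, eval_restrict] at h1
      refine hz _ h0 ?_
      by_contra! hc
      rw [hc.1, hc.2] at h1
      simp at h1
    · rw [hTc]
      exact lt_of_le_of_lt (natDegree_restrict_le hh.totalDegree_le w e) hn
  exact eq_zero_of_restrict_eq_zero hh hw hψ

end Homogeneous

/-! ### Affine-linear polynomials and divisibility. -/

section Lines

theorem exists_lin_eq {l : Poly2} (hl : l.totalDegree ≤ 1) : ∃ u : Fin 3 → ℂ, l = lin u := by
  refine ⟨![coeff (expo 0 0) l, coeff (expo 1 0) l, coeff (expo 0 1) l], ?_⟩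
  have h := eq_sum_range_monomial hl
  simp only [Finset.sum_range_succ, Finset.sum_range_zero, zero_add] at h
  have h11 : coeff (expo 1 1) l = 0 := by
    refine coeff_eq_zero_of_totalDegree_lt ?_
    have := degree_expo 1 1
    rw [Finsupp.degree_apply] at this
    omega
  have h00 : expo 0 0 = 0 := by simp [expo]
  have h10 : expo 1 0 = Finsupp.single 0 1 := by simp [expo]
  have h01 : expo 0 1 = Finsupp.single 1 1 := by simp [expo]
  rw [h11, map_zero, add_zero] at h
  conv_lhs => rw [h]
  simp only [lin, Matrix.cons_val_zero, Matrix.cons_val_one, Matrix.cons_val]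
  rw [h00, h10, h01, ← C_mul_X_eq_monomial, ← C_mul_X_eq_monomial]
  change C _ + _ + _ = _
  ring

/-- Solving `l = 0` for the coordinate `j` gives a substitution that is the identity modulo `l` and
sends `f` to a polynomial with only zero values. -/
theorem mem_span_of_eq_on_line {l f : Poly2} {c : ℂ} (i j : Fin 2) (hij : i ≠ j)
    (hc : c ≠ 0) {p : Poly2} (hp : ∀ v w : Fin 2 → ℂ, v i = w i → eval v p = eval w p)
    (hl : l = p + C c * X j) (h : ∀ v, eval v l = 0 → eval v f = 0) : l ∣ f := by
  set g : Fin 2 → Poly2 := fun k => if k = j then - C c⁻¹ * p else X k with hg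
  have h1 : Ideal.Quotient.mk (Ideal.span {l}) f = Ideal.Quotient.mk (Ideal.span {l}) (aeval g f) := by
    have : Ideal.Quotient.mkₐ ℂ (Ideal.span {l}) =
        (Ideal.Quotient.mkₐ ℂ (Ideal.span {l})).comp (aeval g) := by
      ext k
      rw [AlgHom.comp_apply, aeval_X]
      simp only [hg]
      split_ifs with hk
      · subst hk
        rw [Ideal.Quotient.mkₐ_eq_mk, Ideal.Quotient.eq, Ideal.mem_span_singleton]
        refine ⟨C c⁻¹, ?_⟩
        have : (C c⁻¹ * C c : Poly2) = 1 := by rw [← C_mul, inv_mul_cancel₀ hc, C_1]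
        rw [hl]
        linear_combination - X k * this
      · rfl
    exact DFunLike.congr_fun this f
  have h2 : aeval g f = 0 := by
    refine MvPolynomial.funext fun v => ?_
    rw [eval_aeval, map_zero]
    apply h
    have hgi : ∀ k, k ≠ j → eval v (g k) = v k := fun k hk => by simp [hg, hk]
    have hgj : eval v (g j) = - c⁻¹ * eval v p := by simp [hg]
    rw [hl, map_add, map_mul, eval_C, eval_X, hgj, hp _ v (hgi i hij)]
    field_simp
    ring
  rw [h2, map_zero, Ideal.Quotient.eq_zero_iff_dvd] at h1
  exact h1

/-- A linear polynomial divides every polynomial that vanishes on its line. -/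
theorem lin_dvd {u : Fin 3 → ℂ} (hu : u 1 ≠ 0 ∨ u 2 ≠ 0) {f : Poly2}
    (h : ∀ v, eval v (lin u) = 0 → eval v f = 0) : lin u ∣ f := by
  rcases hu with hu | hu
  · refine mem_span_of_eq_on_line 1 0 (by decide) hu (p := C (u 0) + C (u 2) * X 1) ?_ ?_ h
    · intro v w hvw; simp [hvw]
    · rw [lin]; ring
  · refine mem_span_of_eq_on_line 0 1 (by decide) hu (p := C (u 0) + C (u 1) * X 0) ?_ ?_ h
    · intro v w hvw; simp [hvw]
    · rw [lin]

theorem totalDegree_lin_le (u : Fin 3 → ℂ) : (lin u).totalDegree ≤ 1 := by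
  rw [lin]
  refine (totalDegree_add _ _).trans (max_le ((totalDegree_add _ _).trans (max_le ?_ ?_)) ?_)
  · simp
  · exact (totalDegree_mul _ _).trans (by simp)
  · exact (totalDegree_mul _ _).trans (by simp)

theorem totalDegree_lin {u : Fin 3 → ℂ} (hu : u 1 ≠ 0 ∨ u 2 ≠ 0) : (lin u).totalDegree = 1 := by
  refine le_antisymm (totalDegree_lin_le u) ?_
  · by_contra hlt
    have h0 : (lin u).totalDegree = 0 := by omega
    rw [totalDegree_eq_zero_iff_eq_C] at h0
    have h1 := pderiv_lin u 0
    have h2 := pderiv_lin u 1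
    rw [h0, pderiv_C] at h1 h2
    have h1' := congrArg (eval 0) h1
    have h2' := congrArg (eval 0) h2
    simp only [map_zero, eval_C] at h1' h2'
    rcases hu with hu | hu
    · exact hu h1'.symm
    · exact hu h2'.symm

end Lines

end

end CuspidalCenter

namespace CuspidalCenter

noncomputable section

/-! ### Cusps through partial derivatives. -/

section Cusps

theorem homogeneousComponent_eq_sum (n : ℕ) (f : Poly2) : homogeneousComponent n f =
    ∑ i ∈ Finset.range (n + 1), monomial (expo i (n - i)) (coeff (expo i (n - i)) f) := by
  ext m
  rw [← expo_apply m, coeff_homogeneousComponent, degree_expo, coeff_sum]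
  simp only [coeff_monomial, expo_inj]
  split_ifs with h
  · rw [Finset.sum_eq_single (m 0)]
    · rw [if_pos (by omega), show n - m 0 = m 1 by omega]
    · intro i _ hi
      rw [if_neg (by omega)]
    · intro hi
      exact absurd (Finset.mem_range.mpr (by omega)) hi
  · rw [Finset.sum_eq_zero]
    intro i hi
    rw [Finset.mem_range] at hi
    rw [if_neg (by omega)]

theorem pderiv_comm (f : Poly2) : pderiv 1 (pderiv 0 f) = pderiv 0 (pderiv 1 f) := by
  ext m
  rw [← expo_apply m]
  simp only [coeff_pderiv_expo_zero, coeff_pderiv_expo_one]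
  ring

theorem eval_eq_coeff_translate (a : Fin 2 → ℂ) (f : Poly2) :
    eval a f = coeff (expo 0 0) (translate a f) := by
  rw [show expo 0 0 = 0 by simp [expo], ← constantCoeff_eq, ← eval_zero, translate, eval_aeval]
  congr 2
  funext k
  simp

theorem monomial_expo (i j : ℕ) (c : ℂ) :
    monomial (expo i j) c = (C c * (X 0 ^ i * X 1 ^ j) : Poly2) := by
  rw [X_pow_eq_monomial, X_pow_eq_monomial, monomial_mul, C_mul_monomial, expo, mul_one, mul_one]

/-- Ordinary cusps in terms of partial derivatives. -/
theorem isCusp_iff (f : Poly2) (a : Fin 2 → ℂ) : IsCusp f a ↔ eval a f = 0 ∧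
    eval a (pderiv 0 f) = 0 ∧ eval a (pderiv 1 f) = 0 ∧ ∃ u v : ℂ, (u ≠ 0 ∨ v ≠ 0) ∧
      eval a (pderiv 0 (pderiv 0 f)) = 2 * u ^ 2 ∧ eval a (pderiv 0 (pderiv 1 f)) = 2 * u * v ∧
      eval a (pderiv 1 (pderiv 1 f)) = 2 * v ^ 2 ∧
      -v ^ 3 * eval a (pderiv 0 (pderiv 0 (pderiv 0 f))) +
        3 * v ^ 2 * u * eval a (pderiv 0 (pderiv 0 (pderiv 1 f))) -
        3 * v * u ^ 2 * eval a (pderiv 0 (pderiv 1 (pderiv 1 f))) +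
        u ^ 3 * eval a (pderiv 1 (pderiv 1 (pderiv 1 f))) ≠ 0 := by
  simp only [eval_eq_coeff_translate, ← pderiv_translate, coeff_pderiv_expo_zero,
    coeff_pderiv_expo_one]
  rw [IsCusp]
  generalize translate a f = g
  have h0 : homogeneousComponent 0 g = 0 ↔ coeff (expo 0 0) g = 0 := by
    rw [homogeneousComponent_eq_sum]
    simp
  have hne : expo 0 1 ≠ expo 1 0 := by rw [Ne, expo_inj]; simp
  have h1 : homogeneousComponent 1 g = 0 ↔
      coeff (expo 1 0) g = 0 ∧ coeff (expo 0 1) g = 0 := by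
    rw [homogeneousComponent_eq_sum]
    simp only [Finset.sum_range_succ, Finset.sum_range_zero]
    constructor
    · intro h
      have e1 := congrArg (coeff (expo 1 0)) h
      have e2 := congrArg (coeff (expo 0 1)) h
      simp [coeff_monomial, expo_inj] at e1 e2
      exact ⟨e1, e2⟩
    · rintro ⟨e1, e2⟩
      simp [e1, e2]
  have h2 : ∀ u v : ℂ, homogeneousComponent 2 g = (C u * X 0 + C v * X 1) ^ 2 ↔
      coeff (expo 2 0) g = u ^ 2 ∧ coeff (expo 1 1) g = 2 * u * v ∧
        coeff (expo 0 2) g = v ^ 2 := by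
    intro u v
    have e : (C u * X 0 + C v * X 1 : Poly2) ^ 2 = monomial (expo 2 0) (u ^ 2) +
        monomial (expo 1 1) (2 * u * v) + monomial (expo 0 2) (v ^ 2) := by
      rw [monomial_expo, monomial_expo, monomial_expo]
      simp only [map_mul, map_pow, map_ofNat]
      ring
    rw [homogeneousComponent_eq_sum, e]
    simp only [Finset.sum_range_succ, Finset.sum_range_zero]
    constructor
    · intro h
      have e0 := congrArg (coeff (expo 2 0)) h
      have e1 := congrArg (coeff (expo 1 1)) h
      have e2 := congrArg (coeff (expo 0 2)) h
      simp [coeff_monomial, expo_inj] at e0 e1 e2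
      exact ⟨e0, e1, e2⟩
    · rintro ⟨e0, e1, e2⟩
      norm_num
      rw [e0, e1, e2]
      ring
  have h3 : ∀ u v : ℂ, eval ![-v, u] (homogeneousComponent 3 g) =
      -v ^ 3 * coeff (expo 3 0) g + v ^ 2 * u * coeff (expo 2 1) g -
        v * u ^ 2 * coeff (expo 1 2) g + u ^ 3 * coeff (expo 0 3) g := by
    intro u v
    rw [homogeneousComponent_eq_sum]
    simp only [Finset.sum_range_succ, Finset.sum_range_zero, monomial_expo]
    simp
    ring
  simp only [h0, h1, h2, h3, Nat.cast_one, zero_add, mul_one,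
    Nat.reduceAdd]
  constructor
  · rintro ⟨e1, ⟨e2, e3⟩, u, v, huv, ⟨e4, e5, e6⟩, e7⟩
    refine ⟨e1, e2, e3, u, v, huv, by rw [e4]; ring, e5, by rw [e6]; ring, fun h => e7 ?_⟩
    linear_combination h / 6
  · rintro ⟨e1, e2, e3, u, v, huv, e4, e5, e6, e7⟩
    refine ⟨e1, ⟨e2, e3⟩, u, v, huv, ⟨by linear_combination e4 / 2, e5,
      by linear_combination e6 / 2⟩, fun h => e7 ?_⟩
    linear_combination 6 * h

/-- A double point with a degenerate quadratic part. -/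
def IsDegenerateDouble (f : Poly2) (a : Fin 2 → ℂ) : Prop :=
  eval a f = 0 ∧ eval a (pderiv 0 f) = 0 ∧ eval a (pderiv 1 f) = 0 ∧
    eval a (pderiv 0 (pderiv 0 f)) * eval a (pderiv 1 (pderiv 1 f)) =
      eval a (pderiv 0 (pderiv 1 f)) ^ 2

theorem IsCusp.isDegenerateDouble {f : Poly2} {a : Fin 2 → ℂ} (h : IsCusp f a) :
    IsDegenerateDouble f a := by
  obtain ⟨h0, h1, h2, u, v, -, h3, h4, h5, -⟩ := (isCusp_iff f a).mp h
  refine ⟨h0, h1, h2, ?_⟩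
  rw [h3, h4, h5]
  ring

/-- The Hessian determinant is multiplied by the squared determinant of the affine map; the
first-order conditions are invariant by the chain rule. -/
theorem IsDegenerateDouble.affineSubst {f : Poly2} {a r : Fin 2 → ℂ}
    {A : Matrix (Fin 2) (Fin 2) ℂ} (h : IsDegenerateDouble f (r + A.mulVec a)) :
    IsDegenerateDouble (affineSubst r A f) a := by
  obtain ⟨h0, h1, h2, h3⟩ := h
  have hC : ∀ c i, pderiv i (C c : Poly2) = 0 := fun c i => pderiv_C
  simp only [IsDegenerateDouble, pderiv_affineSubst, Fin.sum_univ_two, map_add, Derivation.leibniz,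
    smul_eq_mul, map_mul, eval_affineSubst, hC, mul_zero, zero_add, eval_C,
    pderiv_comm]
  refine ⟨h0, by rw [h1, h2]; ring, by rw [h1, h2]; ring, ?_⟩
  linear_combination (A 0 0 * A 1 1 - A 0 1 * A 1 0) ^ 2 * h3

end Cusps

end

end CuspidalCenter

namespace CuspidalCenter

noncomputable section

/-! ### A quartic with three degenerate double points at the standard triangle. -/

section NormalFormExistence

theorem exists_quartic_coeffs {f : Poly2} (hf : f.totalDegree ≤ 4) : ∃ c : ℕ → ℕ → ℂ, f =
    C (c 0 0) + C (c 1 0) * X 0 + C (c 0 1) * X 1 + C (c 2 0) * X 0 ^ 2 + C (c 1 1) * (X 0 * X 1)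
    + C (c 0 2) * X 1 ^ 2 + C (c 3 0) * X 0 ^ 3 + C (c 2 1) * (X 0 ^ 2 * X 1)
    + C (c 1 2) * (X 0 * X 1 ^ 2) + C (c 0 3) * X 1 ^ 3 + C (c 4 0) * X 0 ^ 4
    + C (c 3 1) * (X 0 ^ 3 * X 1) + C (c 2 2) * (X 0 ^ 2 * X 1 ^ 2) + C (c 1 3) * (X 0 * X 1 ^ 3)
    + C (c 0 4) * X 1 ^ 4 := by
  refine ⟨fun i j => coeff (expo i j) f, ?_⟩
  have h := eq_sum_range_monomial hf
  have hz : ∀ i j, 4 < i + j → coeff (expo i j) f = 0 := by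
    intro i j hij
    refine coeff_eq_zero_of_totalDegree_lt (lt_of_le_of_lt hf ?_)
    have := degree_expo i j
    rw [Finsupp.degree_apply] at this
    rwa [this]
  simp only [Finset.sum_range_succ, Finset.sum_range_zero] at h
  rw [hz 1 4 (by norm_num), hz 2 3 (by norm_num), hz 2 4 (by norm_num), hz 3 2 (by norm_num),
    hz 3 3 (by norm_num), hz 3 4 (by norm_num), hz 4 1 (by norm_num), hz 4 2 (by norm_num),
    hz 4 3 (by norm_num), hz 4 4 (by norm_num)] at h
  simp only [monomial_expo, map_zero] at h
  conv_lhs => rw [h]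
  ring

/-- With `z = 1 - x - y`, double points at the three vertices make the quartic a conic in `yz, zx,
xy`. Each degenerate tangent cone says that the conic is tangent to a side of the triangle, i.e.
that a binary discriminant vanishes. -/
theorem exists_conic_form {f : Poly2} (hf : f.totalDegree ≤ 4) (h0 : IsDegenerateDouble f ![0, 0])
    (h1 : IsDegenerateDouble f ![1, 0]) (h2 : IsDegenerateDouble f ![0, 1]) :
    ∃ α β γ δ ε φ : ℂ, f = C α * (X 0 ^ 2 * X 1 ^ 2) + C β * (X 1 ^ 2 * (1 - X 0 - X 1) ^ 2)
      + C γ * ((1 - X 0 - X 1) ^ 2 * X 0 ^ 2)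
      + X 0 * X 1 * (1 - X 0 - X 1) * (C δ * X 0 + C ε * X 1 + C φ * (1 - X 0 - X 1)) ∧
      φ ^ 2 = 4 * β * γ ∧ δ ^ 2 = 4 * α * γ ∧ ε ^ 2 = 4 * α * β := by
  obtain ⟨c, rfl⟩ := exists_quartic_coeffs hf
  have hn : ∀ (i : Fin 2) (n : ℕ) [n.AtLeastTwo], pderiv i (OfNat.ofNat n : Poly2) = 0 :=
    fun i n _ => Derivation.map_natCast _ n
  simp only [IsDegenerateDouble, map_add, Derivation.leibniz, Derivation.leibniz_pow, smul_eq_mul,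
    pderiv_C, pderiv_X, map_mul, map_pow, eval_C, eval_X, nsmul_eq_mul, map_natCast] at h0 h1 h2
  simp [hn] at h0 h1 h2
  obtain ⟨a1, a2, a3, a4⟩ := h0
  obtain ⟨b1, b2, b3, b4⟩ := h1
  obtain ⟨d1, d2, d3, d4⟩ := h2
  set γ := c 2 0
  set β := c 0 2
  set φ := c 1 1
  have e30 : c 3 0 = -2 * γ := by linear_combination 4 * b1 - b2 - 4 * a1 - 3 * a2
  have e40 : c 4 0 = γ := by linear_combination b2 - 3 * b1 + 3 * a1 + 2 * a2
  have e03 : c 0 3 = -2 * β := by linear_combination 4 * d1 - d3 - 4 * a1 - 3 * a3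
  have e04 : c 0 4 = β := by linear_combination d3 - 3 * d1 + 3 * a1 + 2 * a3
  have e31 : c 3 1 = - φ - c 2 1 := by linear_combination b3 - a3
  have e13 : c 1 3 = - φ - c 1 2 := by linear_combination d2 - a2
  refine ⟨c 2 2 - β - γ + (c 2 1 + 2 * γ + 2 * φ) + (c 1 2 + 2 * β + 2 * φ) - 2 * φ, β, γ,
    c 2 1 + 2 * γ + 2 * φ, c 1 2 + 2 * β + 2 * φ, φ, ?_, ?_, ?_, ?_⟩
  · rw [a1, a2, a3, e30, e40, e03, e04, e31, e13]
    simp only [map_add, map_sub, map_mul, map_neg, map_ofNat, map_zero]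
    ring
  · linear_combination -a4
  · rw [e30, e40, e31] at b4
    linear_combination -b4
  · rw [e03, e04, e13] at d4
    linear_combination -d4

theorem not_irreducible_of_sq_mul {f p g : Poly2} (hp : ¬ IsUnit p) (h : f = p ^ 2 * g) :
    ¬ Irreducible f := by
  intro hf
  have e : f = p * (p * g) := by rw [h]; ring
  rcases hf.isUnit_or_isUnit e with h1 | h1
  · exact hp h1
  · exact hp (isUnit_of_mul_isUnit_left h1)

theorem not_isUnit_of_eval_eq_zero {p : Poly2} (v : Fin 2 → ℂ) (h : eval v p = 0) : ¬ IsUnit p := by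
  intro hp
  have := hp.map (eval v)
  rw [h] at this
  exact not_isUnit_zero this

theorem exists_sq_eq (c : ℂ) : ∃ d : ℂ, d ^ 2 = c :=
  IsAlgClosed.exists_pow_nat_eq c (by norm_num)

/-- The tangency conditions fix the mixed coefficients up to signs. A vanishing pure coefficient
would split off the square of a side, and one of the two essentially different sign choices gives a
square; irreducibility leaves the normal form. -/
theorem exists_quart_form {f : Poly2} (hf : f.totalDegree ≤ 4) (hirr : Irreducible f)
    (h0 : IsDegenerateDouble f ![0, 0]) (h1 : IsDegenerateDouble f ![1, 0])
    (h2 : IsDegenerateDouble f ![0, 1]) : ∃ p q r : ℂ, p ≠ 0 ∧ q ≠ 0 ∧ r ≠ 0 ∧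
      f = quart (C p * X 0) (C q * X 1) (C r * (1 - X 0 - X 1)) := by
  obtain ⟨α, β, γ, δ, ε, φ, hfe, hφ, hδ, hε⟩ := exists_conic_form hf h0 h1 h2
  have hX0 : ¬ IsUnit (X 0 : Poly2) := not_isUnit_of_eval_eq_zero 0 (by simp)
  have hX1 : ¬ IsUnit (X 1 : Poly2) := not_isUnit_of_eval_eq_zero 0 (by simp)
  have hZ : ¬ IsUnit (1 - X 0 - X 1 : Poly2) := not_isUnit_of_eval_eq_zero ![1, 0] (by simp)
  have hγ : γ ≠ 0 := by
    rintro rfl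
    have e1 : φ = 0 := by simpa using hφ
    have e2 : δ = 0 := by simpa using hδ
    refine not_irreducible_of_sq_mul hX1 (g := C α * X 0 ^ 2 + C β * (1 - X 0 - X 1) ^ 2 +
      C ε * (X 0 * (1 - X 0 - X 1))) ?_ hirr
    rw [hfe, e1, e2, C_0]
    ring
  have hβ : β ≠ 0 := by
    rintro rfl
    have e1 : φ = 0 := by simpa using hφ
    have e2 : ε = 0 := by simpa using hε
    refine not_irreducible_of_sq_mul hX0 (g := C α * X 1 ^ 2 + C γ * (1 - X 0 - X 1) ^ 2 +
      C δ * (X 1 * (1 - X 0 - X 1))) ?_ hirr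
    rw [hfe, e1, e2, C_0]
    ring
  have hα : α ≠ 0 := by
    rintro rfl
    have e1 : δ = 0 := by simpa using hδ
    have e2 : ε = 0 := by simpa using hε
    refine not_irreducible_of_sq_mul hZ (g := C β * X 1 ^ 2 + C γ * X 0 ^ 2 +
      C φ * (X 0 * X 1)) ?_ hirr
    rw [hfe, e1, e2, C_0]
    ring
  obtain ⟨r, rfl⟩ := exists_sq_eq γ
  have hr : r ≠ 0 := fun h => hγ (by rw [h]; ring)
  obtain ⟨s, rfl⟩ : ∃ s, φ = -2 * r * s := ⟨-φ / (2 * r), by field_simp⟩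
  obtain ⟨p, rfl⟩ : ∃ p, δ = -2 * r * p := ⟨-δ / (2 * r), by field_simp⟩
  have hr2 : (4 * r ^ 2) ≠ 0 := mul_ne_zero (by norm_num) hγ
  obtain rfl : β = s ^ 2 := mul_left_cancel₀ hr2 (by linear_combination - hφ)
  obtain rfl : α = p ^ 2 := mul_left_cancel₀ hr2 (by linear_combination - hδ)
  have hs : s ≠ 0 := fun h => hβ (by rw [h]; ring)
  have hp : p ≠ 0 := fun h => hα (by rw [h]; ring)
  have hε' : (ε - 2 * p * s) * (ε + 2 * p * s) = 0 := by linear_combination hε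
  rcases mul_eq_zero.mp hε' with h | h
  -- This sign makes the conic a double line, so the quartic would be a square.
  · exfalso
    obtain rfl : ε = 2 * p * s := by linear_combination h
    have e : f = (C p * (X 0 * X 1) + C s * (X 1 * (1 - X 0 - X 1)) -
        C r * (X 0 * (1 - X 0 - X 1))) ^ 2 * 1 := by
      rw [hfe]
      simp only [map_mul, map_pow, map_neg, map_ofNat]
      ring
    refine not_irreducible_of_sq_mul (not_isUnit_of_eval_eq_zero 0 ?_) e hirr
    simp
  · obtain rfl : ε = -2 * p * s := by linear_combination h
    -- The scale factors `t`, `p / t`, `r / t` must have pairwise products `p`, `r` and `s`; the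
    -- last requires `t ^ 2 = p r / s`.
    obtain ⟨t, ht⟩ := exists_sq_eq (p * r / s)
    have ht0 : t ≠ 0 := by
      rintro rfl
      have : p * r / s ≠ 0 := div_ne_zero (mul_ne_zero hp hr) hs
      rw [← ht] at this
      simp at this
    have ht' : t ^ 2 * s = p * r := by rw [ht]; field_simp
    refine ⟨t, p / t, r / t, ht0, div_ne_zero hp ht0, div_ne_zero hr ht0, ?_⟩
    have e1 : (C t * C (p / t) : Poly2) = C p := by rw [← C_mul]; congr 1; field_simp
    have e2 : (C t * C (r / t) : Poly2) = C r := by rw [← C_mul]; congr 1; field_simp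
    have e3 : (C (p / t) * C (r / t) : Poly2) = C s := by
      rw [← C_mul]; congr 1; field_simp; linear_combination - ht'
    rw [hfe]
    simp only [map_mul, map_pow, map_neg, map_ofNat, quart]
    rw [← e1, ← e2, ← e3]
    ring

theorem affineSubst_affineSubst (a b : Fin 2 → ℂ) (A B : Matrix (Fin 2) (Fin 2) ℂ) (f : Poly2) :
    affineSubst b B (affineSubst a A f) = affineSubst (a + A.mulVec b) (A * B) f := by
  refine MvPolynomial.funext fun v => ?_
  rw [eval_affineSubst, eval_affineSubst, eval_affineSubst, Matrix.mulVec_add, ← Matrix.mulVec_mulVec,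
    add_assoc]

theorem affineSubst_zero_one (f : Poly2) : affineSubst 0 1 f = f := by
  refine MvPolynomial.funext fun v => ?_
  rw [eval_affineSubst, Matrix.one_mulVec, zero_add]

theorem affineSubst_inv_left (a : Fin 2 → ℂ) {A : Matrix (Fin 2) (Fin 2) ℂ} (hA : A.det ≠ 0)
    (f : Poly2) : affineSubst (-A⁻¹.mulVec a) A⁻¹ (affineSubst a A f) = f := by
  have h : A * A⁻¹ = 1 := Matrix.mul_nonsing_inv _ (isUnit_iff_ne_zero.mpr hA)
  rw [affineSubst_affineSubst, Matrix.mulVec_neg, Matrix.mulVec_mulVec, h, Matrix.one_mulVec,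
    add_neg_cancel, affineSubst_zero_one]

theorem affineSubst_inv_right (a : Fin 2 → ℂ) {A : Matrix (Fin 2) (Fin 2) ℂ} (hA : A.det ≠ 0)
    (f : Poly2) : affineSubst a A (affineSubst (-A⁻¹.mulVec a) A⁻¹ f) = f := by
  have h : A⁻¹ * A = 1 := Matrix.nonsing_inv_mul _ (isUnit_iff_ne_zero.mpr hA)
  rw [affineSubst_affineSubst, h, neg_add_cancel, affineSubst_zero_one]

/-- An affine change of coordinates as an automorphism of the polynomial ring. -/
def affineEquiv (a : Fin 2 → ℂ) {A : Matrix (Fin 2) (Fin 2) ℂ} (hA : A.det ≠ 0) :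
    Poly2 ≃ₐ[ℂ] Poly2 :=
  AlgEquiv.ofAlgHom (affineSubst a A) (affineSubst (-A⁻¹.mulVec a) A⁻¹)
    (AlgHom.ext fun f => affineSubst_inv_right a hA f)
    (AlgHom.ext fun f => affineSubst_inv_left a hA f)

theorem irreducible_affineSubst (a : Fin 2 → ℂ) {A : Matrix (Fin 2) (Fin 2) ℂ} (hA : A.det ≠ 0)
    {f : Poly2} (hf : Irreducible f) : Irreducible (affineSubst a A f) :=
  (MulEquiv.irreducible_iff (affineEquiv a hA)).mpr hf

theorem totalDegree_aeval_le {f : Poly2} {g : Fin 2 → Poly2} (hg : ∀ k, (g k).totalDegree ≤ 1) :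
    (aeval g f).totalDegree ≤ f.totalDegree := by
  rw [aeval_def, eval₂_eq']
  refine (totalDegree_finsetSum _ _).trans (Finset.sup_le fun m hm => ?_)
  refine (totalDegree_mul _ _).trans ?_
  rw [MvPolynomial.algebraMap_eq, totalDegree_C, zero_add]
  refine (totalDegree_finsetProd _ _).trans ?_
  refine le_trans (Finset.sum_le_sum fun k _ => (totalDegree_pow _ _).trans
    (Nat.mul_le_mul_left (m k) (hg k))) ?_
  have := le_totalDegree hm
  rw [Finsupp.sum_fintype _ _ (fun _ => rfl)] at this
  simpa using this

theorem affineSubst_X (a : Fin 2 → ℂ) (A : Matrix (Fin 2) (Fin 2) ℂ) (k : Fin 2) :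
    affineSubst a A (X k) = lin ![a k, A k 0, A k 1] := by
  simp [affineSubst, lin, Fin.sum_univ_two, add_assoc]

theorem totalDegree_affineSubst_le (a : Fin 2 → ℂ) (A : Matrix (Fin 2) (Fin 2) ℂ) (f : Poly2) :
    (affineSubst a A f).totalDegree ≤ f.totalDegree := by
  refine totalDegree_aeval_le fun k => ?_
  have h := affineSubst_X a A k
  rw [affineSubst, aeval_X] at h
  rw [h]
  exact totalDegree_lin_le _

theorem not_lin_dvd {q : Poly2} (hq : Irreducible q) (hd : q.totalDegree = 4) {u : Fin 3 → ℂ}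
    (hu : u 1 ≠ 0 ∨ u 2 ≠ 0) : ¬ lin u ∣ q := by
  rintro ⟨g, hg⟩
  have hq0 : q ≠ 0 := hq.ne_zero
  have hl0 : lin u ≠ 0 := by rintro h; rw [h, zero_mul] at hg; exact hq0 hg
  have hg0 : g ≠ 0 := by rintro h; rw [h, mul_zero] at hg; exact hq0 hg
  have hunit : ∀ p : Poly2, IsUnit p → p.totalDegree = 0 := by
    intro p hp
    obtain ⟨p', hp'⟩ := hp.exists_right_inv
    have h0 : p ≠ 0 := left_ne_zero_of_mul_eq_one hp'
    have h0' : p' ≠ 0 := right_ne_zero_of_mul_eq_one hp'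
    have := totalDegree_mul_of_isDomain h0 h0'
    rw [hp', totalDegree_one] at this
    omega
  have hdeg := totalDegree_mul_of_isDomain hl0 hg0
  rw [← hg, hd, totalDegree_lin hu] at hdeg
  rcases hq.isUnit_or_isUnit hg with h | h
  · have := hunit _ h
    rw [totalDegree_lin hu] at this
    omega
  · have := hunit _ h
    omega

theorem eq_zero_of_double_roots {φ : Polynomial ℂ} {d : ℕ} (hφ : φ.natDegree ≤ d) {T : Finset ℂ}
    (hT : d < 2 * T.card) (h : ∀ t ∈ T, φ.eval t = 0 ∧ φ.derivative.eval t = 0) : φ = 0 := by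
  by_contra h0
  have h1 : 2 • T.val ≤ φ.roots := by
    rw [Multiset.le_iff_count]
    intro t
    rw [Multiset.count_nsmul]
    by_cases ht : t ∈ T
    · have h3 := (Polynomial.one_lt_rootMultiplicity_iff_isRoot h0).mpr (h t ht)
      rw [Polynomial.count_roots]
      have : Multiset.count t T.val ≤ 1 := Multiset.nodup_iff_count_le_one.mp T.nodup t
      omega
    · rw [Multiset.count_eq_zero_of_notMem (by simpa using ht)]
      omega
  have h2 := Multiset.card_le_card h1
  rw [Multiset.card_nsmul, Finset.card_val] at h2
  have := φ.card_roots'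
  omega

theorem exists_on_line {r d v : Fin 2 → ℂ} (hd : d ≠ 0)
    (h : d 0 * (v 1 - r 1) = d 1 * (v 0 - r 0)) : ∃ τ : ℂ, v = r + τ • d := by
  by_cases h0 : d 0 = 0
  · have h1 : d 1 ≠ 0 := by
      intro h1
      apply hd
      funext i
      fin_cases i
      · exact h0
      · exact h1
    refine ⟨(v 1 - r 1) / d 1, ?_⟩
    funext i
    rw [h0, zero_mul] at h
    have h2 : v 0 - r 0 = 0 := (mul_eq_zero.mp h.symm).resolve_left h1
    fin_cases i
    · simp [h0]; linear_combination h2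
    · simp; field_simp; ring
  · refine ⟨(v 0 - r 0) / d 0, ?_⟩
    funext i
    fin_cases i
    · simp; field_simp; ring
    · simp; field_simp; linear_combination h

/-- The restriction to a line through three double points would have six roots with multiplicity, so
the line would be a component of the irreducible quartic. -/
theorem cusps_not_collinear {q : Poly2} (hq : Irreducible q) (hd : q.totalDegree = 4)
    {r s t : Fin 2 → ℂ} (hrs : r ≠ s) (hst : s ≠ t) (hrt : r ≠ t) (hr : IsDegenerateDouble q r)
    (hs : IsDegenerateDouble q s) (ht : IsDegenerateDouble q t) :
    (s 0 - r 0) * (t 1 - r 1) - (t 0 - r 0) * (s 1 - r 1) ≠ 0 := by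
  intro hcol
  set d : Fin 2 → ℂ := s - r with hdd
  have hd0 : d ≠ 0 := sub_ne_zero.mpr hrs.symm
  obtain ⟨τ, hτ⟩ := exists_on_line (r := r) (v := t) hd0 (by
    simp only [hdd, Pi.sub_apply]; linear_combination hcol)
  have hτ0 : τ ≠ 0 := by rintro rfl; apply hrt; rw [hτ]; simp
  have hτ1 : τ ≠ 1 := by rintro rfl; apply hst; rw [hτ, hdd]; simp
  have hφ : restrict r d q = 0 := by
    refine eq_zero_of_double_roots (natDegree_restrict_le hd.le r d) (T := {0, 1, τ}) ?_ ?_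
    · rw [Finset.card_insert_of_notMem, Finset.card_insert_of_notMem, Finset.card_singleton]
      · norm_num
      · simpa using hτ1.symm
      · simpa using hτ0.symm
    · have key : ∀ σ : ℂ, IsDegenerateDouble q (r + σ • d) →
          (restrict r d q).eval σ = 0 ∧ (restrict r d q).derivative.eval σ = 0 := by
        rintro σ ⟨e0, e1, e2, -⟩
        rw [eval_restrict, derivative_restrict]
        refine ⟨e0, ?_⟩
        simp only [Polynomial.eval_add, Polynomial.eval_mul, eval_restrict, e1, e2, mul_zero,
          add_zero]
      intro σ hσ
      simp only [Finset.mem_insert, Finset.mem_singleton] at hσ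
      rcases hσ with rfl | rfl | rfl
      · exact key 0 (by simpa using hr)
      · refine key 1 ?_
        rw [one_smul, hdd, add_sub_cancel]; exact hs
      · exact key σ (by rw [← hτ]; exact ht)
  have hu : (![d 1 * r 0 - d 0 * r 1, -d 1, d 0] : Fin 3 → ℂ) 1 ≠ 0 ∨
      (![d 1 * r 0 - d 0 * r 1, -d 1, d 0] : Fin 3 → ℂ) 2 ≠ 0 := by
    by_contra! hc
    apply hd0
    funext i
    fin_cases i
    · simpa using hc.2
    · simpa using hc.1
  refine not_lin_dvd hq hd hu (lin_dvd hu fun v hv => ?_)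
  rw [eval_lin] at hv
  obtain ⟨σ, rfl⟩ := exists_on_line (r := r) (v := v) hd0 (by simp at hv; linear_combination hv)
  rw [← eval_restrict, hφ, Polynomial.eval_zero]

end NormalFormExistence

end

end CuspidalCenter

namespace CuspidalCenter

noncomputable section

/-! ### Frames of configurations and the rational parametrization. -/

section Frames

theorem affineSubst_C (a : Fin 2 → ℂ) (A : Matrix (Fin 2) (Fin 2) ℂ) (c : ℂ) :
    affineSubst a A (C c) = C c :=
  algHom_C _ c

theorem C_mul_lin (c : ℂ) (u : Fin 3 → ℂ) : C c * lin u = lin (c • u) := by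
  simp only [lin, Pi.smul_apply, smul_eq_mul, map_mul]
  ring

/-- A three-cuspidal quartic is in normal form with respect to three affine-linear polynomials. -/
theorem exists_frameQuartic_eq {q : Poly2} (hq : Irreducible q) (hd : q.totalDegree = 4)
    {r s t : Fin 2 → ℂ} (hrs : r ≠ s) (hst : s ≠ t) (hrt : r ≠ t) (hr : IsDegenerateDouble q r)
    (hs : IsDegenerateDouble q s) (ht : IsDegenerateDouble q t) :
    ∃ U : Matrix (Fin 3) (Fin 3) ℂ, U.det ≠ 0 ∧ q = frameQuartic U := by
  set A : Matrix (Fin 2) (Fin 2) ℂ := !![s 0 - r 0, t 0 - r 0; s 1 - r 1, t 1 - r 1] with hAdef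
  have hA : A.det ≠ 0 := by
    rw [hAdef, Matrix.det_fin_two_of]
    exact cusps_not_collinear hq hd hrs hst hrt hr hs ht
  have h0 : IsDegenerateDouble (affineSubst r A q) ![0, 0] := by
    apply IsDegenerateDouble.affineSubst
    convert hr using 1
    funext i; fin_cases i <;> simp
  have h1 : IsDegenerateDouble (affineSubst r A q) ![1, 0] := by
    apply IsDegenerateDouble.affineSubst
    convert hs using 1
    funext i; fin_cases i <;> simp [hAdef]
  have h2 : IsDegenerateDouble (affineSubst r A q) ![0, 1] := by
    apply IsDegenerateDouble.affineSubst
    convert ht using 1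
    funext i; fin_cases i <;> simp [hAdef]
  obtain ⟨α, β, γ, hα, hβ, hγ, hf⟩ := exists_quart_form
    ((totalDegree_affineSubst_le r A q).trans hd.le) (irreducible_affineSubst r hA hq) h0 h1 h2
  have hB : A⁻¹.det ≠ 0 := by
    rw [Matrix.det_nonsing_inv]
    simpa using hA
  have hfq := affineSubst_inv_left r hA q
  rw [hf] at hfq
  generalize A⁻¹ = B at hB hfq
  generalize -B.mulVec r = b at hfq
  refine ⟨Matrix.of ![α • ![b 0, B 0 0, B 0 1], β • ![b 1, B 1 0, B 1 1],
    γ • ![1 - b 0 - b 1, - B 0 0 - B 1 0, - B 0 1 - B 1 1]], ?_, ?_⟩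
  · have : (Matrix.of ![α • ![b 0, B 0 0, B 0 1], β • ![b 1, B 1 0, B 1 1],
      γ • ![1 - b 0 - b 1, - B 0 0 - B 1 0, - B 0 1 - B 1 1]]).det = α * β * γ * B.det := by
      rw [Matrix.det_fin_three, Matrix.det_fin_two]
      simp
      ring
    rw [this]
    exact mul_ne_zero (mul_ne_zero (mul_ne_zero hα hβ) hγ) hB
  · have e : ∀ x y z : Poly2, affineSubst b B (quart x y z) =
        quart (affineSubst b B x) (affineSubst b B y) (affineSubst b B z) := by
      intro x y z
      simp only [quart, map_add, map_sub, map_mul, map_pow, map_ofNat]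
    rw [← hfq, e, frameQuartic]
    simp only [map_mul, map_sub, map_one, affineSubst_C, affineSubst_X]
    congr 1
    · exact C_mul_lin _ _
    · exact C_mul_lin _ _
    · refine Eq.trans ?_ (C_mul_lin _ _)
      congr 1
      simp [lin]
      ring

/-- The partial derivatives of the normal form of the quartic. -/
def quartGrad {R : Type*} [CommRing R] (x y z : R) : R :=
  2 * x * y ^ 2 + 2 * x * z ^ 2 - 4 * x * y * z - 2 * y * z * (y + z)

theorem eval_pderiv_frameQuartic (U : Matrix (Fin 3) (Fin 3) ℂ) (a : Fin 2 → ℂ) (i : Fin 2) :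
    eval a (pderiv i (frameQuartic U)) =
      quartGrad (eval a (lin (U 0))) (eval a (lin (U 1))) (eval a (lin (U 2))) * U 0 i.succ
      + quartGrad (eval a (lin (U 1))) (eval a (lin (U 2))) (eval a (lin (U 0))) * U 1 i.succ
      + quartGrad (eval a (lin (U 2))) (eval a (lin (U 0))) (eval a (lin (U 1))) * U 2 i.succ := by
  simp only [frameQuartic, pderiv_quart, pderiv_lin, map_add, map_sub, map_mul, map_pow,
    map_ofNat, eval_C, quartGrad]
  ring

theorem eval_frameQuartic (U : Matrix (Fin 3) (Fin 3) ℂ) (a : Fin 2 → ℂ) :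
    eval a (frameQuartic U) =
      quart (eval a (lin (U 0))) (eval a (lin (U 1))) (eval a (lin (U 2))) := by
  simp only [frameQuartic, quart, map_add, map_sub, map_mul, map_pow, map_ofNat]

/-- The rational parametrization of the quartic. -/
theorem exists_quart_param {x y z : ℂ} (hx : x ≠ 0) (hy : y ≠ 0) (hz : z ≠ 0)
    (h : quart x y z = 0) : ∃ m n : ℂ, m ≠ 0 ∧ n ≠ 0 ∧ m + n ≠ 0 ∧
      x = 1 / m ^ 2 ∧ y = 1 / n ^ 2 ∧ z = 1 / (m + n) ^ 2 := by
  obtain ⟨m, hm⟩ := exists_sq_eq (1 / x)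
  obtain ⟨n', hn'⟩ := exists_sq_eq (1 / y)
  have hm0 : m ≠ 0 := by
    rintro rfl
    have : 1 / x ≠ 0 := one_div_ne_zero hx
    rw [← hm] at this; simp at this
  have hn0 : n' ≠ 0 := by
    rintro rfl
    have : 1 / y ≠ 0 := one_div_ne_zero hy
    rw [← hn'] at this; simp at this
  -- In the inverse coordinates the quartic becomes the inscribed conic. It splits into these
  -- factors once square roots of two coordinates are chosen, and the sign of `n'` selects the
  -- factor.
  have key : (1 / z - (m + n') ^ 2) * (1 / z - (m + -n') ^ 2) = 0 := by
    have : (1 / z - (m + n') ^ 2) * (1 / z - (m + -n') ^ 2) =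
        (1 / z - m ^ 2 - n' ^ 2) ^ 2 - 4 * m ^ 2 * n' ^ 2 := by ring
    rw [this, hm, hn']
    field_simp
    rw [quart] at h
    linear_combination h
  obtain ⟨n, hn, hnz, hk⟩ : ∃ n, n ^ 2 = 1 / y ∧ n ≠ 0 ∧ 1 / z = (m + n) ^ 2 := by
    rcases mul_eq_zero.mp key with h1 | h1
    · exact ⟨n', hn', hn0, by linear_combination h1⟩
    · exact ⟨-n', by rw [← hn']; ring, neg_ne_zero.mpr hn0, by linear_combination h1⟩
  have hmn : m + n ≠ 0 := by
    intro h1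
    have : 1 / z ≠ 0 := one_div_ne_zero hz
    rw [hk, h1] at this; simp at this
  exact ⟨m, n, hm0, hnz, hmn, by rw [hm]; simp, by rw [hn]; simp, by rw [← hk]; simp⟩

/-- At `(1/m² : 1/n² : 1/k²)` with `m + n + k = 0` the gradient of the quartic is proportional to
`(m³, n³, k³)`. -/
theorem exists_tangent_param {x y z : ℂ} (hx : x ≠ 0) (hy : y ≠ 0) (hz : z ≠ 0)
    (h : quart x y z = 0) : ∃ m n k c : ℂ, c ≠ 0 ∧ m ≠ 0 ∧ n ≠ 0 ∧ k ≠ 0 ∧ m + n + k = 0 ∧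
      quartGrad x y z = c * m ^ 3 ∧ quartGrad y z x = c * n ^ 3 ∧
      quartGrad z x y = c * k ^ 3 := by
  obtain ⟨m, n, hm0, hnz, hmn, rfl, rfl, rfl⟩ := exists_quart_param hx hy hz h
  refine ⟨m, n, -(m + n), 4 / (m * n * (m + n)) ^ 3, ?_, hm0, hnz, neg_ne_zero.mpr hmn, by ring,
    ?_, ?_, ?_⟩
  · exact div_ne_zero (by norm_num) (pow_ne_zero _ (mul_ne_zero (mul_ne_zero hm0 hnz) hmn))
  all_goals
    rw [quartGrad]
    field_simp
    ring

/-- A configuration in normal form. -/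
theorem IsConfig.exists_frame {q l : Poly2} {r s t b : Fin 2 → ℂ} (h : IsConfig q l r s t b) :
    ∃ (U : Matrix (Fin 3) (Fin 3) ℂ) (m n k : ℂ), U.det ≠ 0 ∧ m + n + k = 0 ∧ m ≠ 0 ∧ n ≠ 0 ∧
      k ≠ 0 ∧ q = frameQuartic U ∧ l = frameLine U m n k := by
  obtain ⟨U, hU, rfl⟩ := exists_frameQuartic_eq h.irreducible h.degree_q h.r_ne_s h.s_ne_t h.r_ne_t
    h.cusp_r.isDegenerateDouble h.cusp_s.isDegenerateDouble h.cusp_t.isDegenerateDouble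
  obtain ⟨w, rfl⟩ := exists_lin_eq h.degree_l.le
  obtain ⟨hqb, hlb, hsm, htan⟩ := h.tangent
  have e0 := eval_pderiv_frameQuartic U b 0
  have e1 := eval_pderiv_frameQuartic U b 1
  rw [eval_frameQuartic] at hqb
  simp only [pderiv_lin, eval_C, Fin.succ_zero_eq_one, Fin.succ_one_eq_two] at htan e0 e1
  generalize hg0 : eval b (pderiv 0 (frameQuartic U)) = g0 at *
  generalize hg1 : eval b (pderiv 1 (frameQuartic U)) = g1 at *
  have hw : ∃ κ, w 1 = κ * g0 ∧ w 2 = κ * g1 := by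
    rcases hsm with hs | hs
    · exact ⟨w 1 / g0, by field_simp, by field_simp; linear_combination htan⟩
    · exact ⟨w 2 / g1, by field_simp; linear_combination -htan, by field_simp⟩
  obtain ⟨κ, hκ1, hκ2⟩ := hw
  have hκ : κ ≠ 0 := by
    rintro rfl
    have := h.degree_l
    rw [lin, hκ1, hκ2] at this
    simp at this
  rw [eval_lin] at hlb
  have hxyz : eval b (lin (U 0)) ≠ 0 ∧ eval b (lin (U 1)) ≠ 0 ∧ eval b (lin (U 2)) ≠ 0 := by
    generalize eval b (lin (U 0)) = x at *
    generalize eval b (lin (U 1)) = y at *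
    generalize eval b (lin (U 2)) = z at *
    have hne : ¬ (quartGrad x y z = 0 ∧ quartGrad y z x = 0 ∧ quartGrad z x y = 0) := by
      rintro ⟨h1, h2, h3⟩
      rw [h1, h2, h3] at e0 e1
      rcases hsm with hs | hs
      · exact hs (by linear_combination e0)
      · exact hs (by linear_combination e1)
    refine ⟨?_, ?_, ?_⟩ <;> rintro rfl <;> apply hne
    · have : y * z = 0 := by simpa [quart] using hqb
      rcases mul_eq_zero.mp this with rfl | rfl <;> simp [quartGrad]
    · have : z * x = 0 := by simpa [quart] using hqb
      rcases mul_eq_zero.mp this with rfl | rfl <;> simp [quartGrad]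
    · have : x * y = 0 := by simpa [quart] using hqb
      rcases mul_eq_zero.mp this with rfl | rfl <;> simp [quartGrad]
  obtain ⟨m, n, k, c, hc, hm, hn, hk, hmnk, f1, f2, f3⟩ :=
    exists_tangent_param hxyz.1 hxyz.2.1 hxyz.2.2 hqb
  rw [f1, f2, f3] at e0 e1
  -- The coefficients of the line are cubes of the parameters, so a cube root absorbs the
  -- proportionality factor.
  obtain ⟨ρ, hρ⟩ := IsAlgClosed.exists_pow_nat_eq (κ * c) (n := 3) (by norm_num)
  have hρ0 : ρ ≠ 0 := by
    rintro rfl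
    apply mul_ne_zero hκ hc
    rw [← hρ]; simp
  refine ⟨U, ρ * m, ρ * n, ρ * k, hU, by linear_combination ρ * hmnk, mul_ne_zero hρ0 hm,
    mul_ne_zero hρ0 hn, mul_ne_zero hρ0 hk, rfl, ?_⟩
  have i1 : w 1 = ρ ^ 3 * (m ^ 3 * U 0 1 + n ^ 3 * U 1 1 + k ^ 3 * U 2 1) := by
    rw [hκ1, e0, hρ]; ring
  have i2 : w 2 = ρ ^ 3 * (m ^ 3 * U 0 2 + n ^ 3 * U 1 2 + k ^ 3 * U 2 2) := by
    rw [hκ2, e1, hρ]; ring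
  -- Euler's relation: a point of the quartic lies on the line defined by the gradient there. This
  -- fixes the constant term, which the tangency condition leaves open.
  have hE : eval b (lin (U 0)) * m ^ 3 + eval b (lin (U 1)) * n ^ 3 + eval b (lin (U 2)) * k ^ 3 =
      0 := by
    apply mul_left_cancel₀ hc
    have : eval b (lin (U 0)) * quartGrad (eval b (lin (U 0))) (eval b (lin (U 1)))
          (eval b (lin (U 2))) +
        eval b (lin (U 1)) * quartGrad (eval b (lin (U 1))) (eval b (lin (U 2)))
          (eval b (lin (U 0))) +
        eval b (lin (U 2)) * quartGrad (eval b (lin (U 2))) (eval b (lin (U 0)))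
          (eval b (lin (U 1))) = 4 * quart (eval b (lin (U 0))) (eval b (lin (U 1)))
          (eval b (lin (U 2))) := by
      simp only [quartGrad, quart]; ring
    rw [f1, f2, f3, hqb] at this
    linear_combination this
  simp only [eval_lin] at hE
  have i0 : w 0 = ρ ^ 3 * (m ^ 3 * U 0 0 + n ^ 3 * U 1 0 + k ^ 3 * U 2 0) := by
    rw [i1, i2] at hlb
    linear_combination hlb - ρ ^ 3 * hE
  rw [lin, i0, i1, i2, frameLine]
  simp only [lin, map_add, map_mul, map_pow]
  ring

end Frames

end

end CuspidalCenter

namespace CuspidalCenter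

noncomputable section

/-! ### Leading parts of the form and of the cofactors. -/

section Infinity

theorem totalDegree_le_of_homogeneousComponent_eq_zero {f : Poly2} {n : ℕ}
    (hf : f.totalDegree ≤ n + 1) (h : homogeneousComponent (n + 1) f = 0) : f.totalDegree ≤ n := by
  refine Finset.sup_le fun m hm => ?_
  have h1 : m.degree ≤ n + 1 := (le_totalDegree hm).trans hf
  have h2 : m.degree ≠ n + 1 := by
    intro he
    have := congrArg (coeff m) h
    rw [coeff_homogeneousComponent, if_pos he, coeff_zero] at this
    exact mem_support_iff.mp hm this
  have : m.degree ≤ n := by omega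
  exact this

theorem homogeneousComponent_totalDegree_ne_zero {f : Poly2} {n : ℕ}
    (hf : f.totalDegree = n + 1) : homogeneousComponent (n + 1) f ≠ 0 := by
  intro h
  have := totalDegree_le_of_homogeneousComponent_eq_zero hf.le h
  omega

theorem totalDegree_dWedge_le {f : Poly2} {ω : Form} {n d : ℕ} (hf : f.totalDegree ≤ n + 1)
    (hω : ∀ i, (ω i).totalDegree ≤ d) : (dWedge f ω).totalDegree ≤ n + d := by
  refine (totalDegree_sub _ _).trans (max_le ?_ ?_)
  · exact (totalDegree_mul _ _).trans (add_le_add (totalDegree_pderiv_le hf 0) (hω 1))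
  · exact (totalDegree_mul _ _).trans (add_le_add (totalDegree_pderiv_le hf 1) (hω 0))

theorem homogeneousComponent_dWedge {f : Poly2} {ω : Form} {n d : ℕ} (hf : f.totalDegree ≤ n + 1)
    (hω : ∀ i, (ω i).totalDegree ≤ d) : homogeneousComponent (n + d) (dWedge f ω) =
      pderiv 0 (homogeneousComponent (n + 1) f) * homogeneousComponent d (ω 1)
      - pderiv 1 (homogeneousComponent (n + 1) f) * homogeneousComponent d (ω 0) := by
  rw [dWedge, map_sub,
    homogeneousComponent_mul_of_totalDegree_le (totalDegree_pderiv_le hf 0) (hω 1),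
    homogeneousComponent_mul_of_totalDegree_le (totalDegree_pderiv_le hf 1) (hω 0),
    homogeneousComponent_pderiv, homogeneousComponent_pderiv]

theorem IsCofactor.totalDegree_le {f K : Poly2} {ω : Form} {n d : ℕ} (h : IsCofactor ω f K)
    (hf : f.totalDegree = n + 1) (hω : ∀ i, (ω i).totalDegree ≤ d + 1) : K.totalDegree ≤ d := by
  by_cases hK : K = 0
  · simp [hK]
  · have hf0 : f ≠ 0 := by
      rintro rfl
      simp at hf
    have h1 := totalDegree_mul_of_isDomain hf0 hK
    have h2 := totalDegree_dWedge_le hf.le hω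
    rw [h, h1] at h2
    omega

theorem IsCofactor.eq_zero_of_totalDegree {f K : Poly2} {ω : Form} {n : ℕ} (h : IsCofactor ω f K)
    (hf : f.totalDegree = n + 1) (hω : ∀ i, (ω i).totalDegree ≤ 0) : K = 0 := by
  by_contra hK
  have hf0 : f ≠ 0 := by
    rintro rfl
    simp at hf
  have h1 := totalDegree_mul_of_isDomain hf0 hK
  have h2 := totalDegree_dWedge_le hf.le hω
  rw [h, h1] at h2
  omega

theorem IsCofactor.mul {ω : Form} {f g K M : Poly2} (hf : IsCofactor ω f K)
    (hg : IsCofactor ω g M) : IsCofactor ω (f * g) (K + M) := by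
  simp only [IsCofactor, dWedge, Derivation.leibniz, smul_eq_mul] at *
  linear_combination g * hf + f * hg

/-- A quartic and a line with five distinct points at infinity. -/
structure HasFivePoints (q l : Poly2) : Prop where
  degree_q : q.totalDegree = 4
  degree_l : l.totalDegree = 1
  infinity : (pointsAtInfinity (q * l)).ncard = 5

theorem IsConfig.hasFivePoints {q l : Poly2} {r s t b : Fin 2 → ℂ} (h : IsConfig q l r s t b) :
    HasFivePoints q l :=
  ⟨h.degree_q, h.degree_l, h.infinity⟩

variable {q l : Poly2} {ω : Form} {Kl Kq : Poly2}

/-- Each point at infinity of the curves is a singular point of the foliation's tangency locus with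
the line at infinity, which forces the line at infinity to be invariant. -/
theorem HasFivePoints.radial_eq_zero (h : HasFivePoints q l) {d : ℕ} (hd : d ≤ 3)
    (hω : ∀ i, (ω i).totalDegree ≤ d) (hl : IsCofactor ω l Kl) (hq : IsCofactor ω q Kq) :
    X 0 * homogeneousComponent d (ω 0) + X 1 * homogeneousComponent d (ω 1) = 0 := by
  have hq0 : q ≠ 0 := by
    intro h0; have := h.degree_q; rw [h0] at this; simp at this
  have hl0 : l ≠ 0 := by
    intro h0; have := h.degree_l; rw [h0] at this; simp at this
  have hdeg : (q * l).totalDegree = 4 + 1 := by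
    rw [totalDegree_mul_of_isDomain hq0 hl0, h.degree_q, h.degree_l]
  have hinf := h.infinity
  rw [pointsAtInfinity, hdeg] at hinf
  have hhom : ∀ i, (homogeneousComponent d (ω i)).IsHomogeneous d := fun i =>
    homogeneousComponent_isHomogeneous _ _
  refine eq_zero_of_zeros_of_quintic (n := d + 1)
    (homogeneousComponent_isHomogeneous (4 + 1) (q * l))
    (homogeneousComponent_totalDegree_ne_zero hdeg) hinf ?_ (by omega) ?_
  · rw [add_comm d 1]
    exact ((isHomogeneous_X ℂ 0).mul (hhom 0)).add ((isHomogeneous_X ℂ 1).mul (hhom 1))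
  · intro v hv hne
    have hcof := hq.mul hl
    have htop := homogeneousComponent_dWedge hdeg.le hω
    have hE := congrArg (eval v) (euler_two (homogeneousComponent_isHomogeneous (4 + 1) (q * l)))
    have hz : eval v (homogeneousComponent (4 + d) (dWedge (q * l) ω)) = 0 := by
      rw [hcof]
      cases d with
      -- For a constant form the cofactor would have negative degree, so it is zero.
      | zero =>
        rw [hcof.eq_zero_of_totalDegree hdeg hω]
        simp
      | succ e =>
        rw [show 4 + (e + 1) = 4 + 1 + e by ring, homogeneousComponent_mul_of_totalDegree_le hdeg.le
          (hcof.totalDegree_le hdeg hω), map_mul, hv, zero_mul]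
    rw [htop] at hz
    simp only [map_mul, map_add, map_sub, eval_X, map_natCast, hv, mul_zero] at hz hE ⊢
    -- At a zero `v` of the quintic, Euler's relation makes the gradient orthogonal to `v`, and the
    -- leading part of `dF ∧ ω = F K` makes the leading part of `ω` parallel to the gradient. A
    -- nonzero gradient component can be cancelled.
    rcases hne with hne | hne
    · refine (mul_eq_zero.mp ?_).resolve_left hne
      linear_combination eval v (homogeneousComponent d (ω 0)) * hE + v 1 * hz
    · refine (mul_eq_zero.mp ?_).resolve_left hne
      linear_combination eval v (homogeneousComponent d (ω 1)) * hE - v 0 * hz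

/-- The leading parts of the form, of the cofactors and of the exterior derivative. -/
theorem HasFivePoints.exists_top (h : HasFivePoints q l) {e : ℕ} (he : e ≤ 2)
    (hω : ∀ i, (ω i).totalDegree ≤ e + 1) (hl : IsCofactor ω l Kl) (hq : IsCofactor ω q Kq) :
    ∃ g : Poly2, homogeneousComponent (e + 1) (ω 0) = - (X 1 * g) ∧
      homogeneousComponent (e + 1) (ω 1) = X 0 * g ∧ homogeneousComponent e Kl = g ∧
      homogeneousComponent e Kq = 4 * g ∧
      homogeneousComponent e (dForm ω) = ((e + 2 : ℕ) : Poly2) * g := by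
  have hr := h.radial_eq_zero (by omega) hω hl hq
  have hl1 : l.totalDegree = 0 + 1 := h.degree_l
  have hq1 : q.totalDegree = 3 + 1 := h.degree_q
  have tl := homogeneousComponent_dWedge hl1.le hω
  rw [hl, show 0 + (e + 1) = 0 + 1 + e by ring, homogeneousComponent_mul_of_totalDegree_le hl1.le
    (hl.totalDegree_le hl1 hω)] at tl
  have tq := homogeneousComponent_dWedge hq1.le hω
  rw [hq, show 3 + (e + 1) = 3 + 1 + e by ring, homogeneousComponent_mul_of_totalDegree_le hq1.le
    (hq.totalDegree_le hq1 hω)] at tq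
  have nl := homogeneousComponent_totalDegree_ne_zero hl1
  have nq := homogeneousComponent_totalDegree_ne_zero hq1
  have el := euler_two (homogeneousComponent_isHomogeneous (0 + 1) l)
  have eq := euler_two (homogeneousComponent_isHomogeneous (3 + 1) q)
  have eg := euler_two (homogeneousComponent_isHomogeneous e Kl)
  have hd : homogeneousComponent e (dForm ω) = pderiv 0 (homogeneousComponent (e + 1) (ω 1)) -
      pderiv 1 (homogeneousComponent (e + 1) (ω 0)) := by
    rw [dForm, map_sub, homogeneousComponent_pderiv, homogeneousComponent_pderiv]
  push_cast at el eq eg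
  have h1 : homogeneousComponent (e + 1) (ω 1) = X 0 * homogeneousComponent e Kl := by
    apply mul_left_cancel₀ nl
    linear_combination -X 0 * tl - homogeneousComponent (e + 1) (ω 1) * el +
      pderiv 1 (homogeneousComponent (0 + 1) l) * hr
  have h0 : homogeneousComponent (e + 1) (ω 0) = -(X 1 * homogeneousComponent e Kl) := by
    apply mul_left_cancel₀ nl
    linear_combination X 1 * tl - homogeneousComponent (e + 1) (ω 0) * el +
      pderiv 0 (homogeneousComponent (0 + 1) l) * hr
  refine ⟨homogeneousComponent e Kl, h0, h1, rfl, ?_, ?_⟩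
  · apply mul_left_cancel₀ nq
    rw [h0, h1] at tq
    linear_combination tq + homogeneousComponent e Kl * eq
  · rw [hd, h0, h1]
    simp only [map_neg, Derivation.leibniz, smul_eq_mul, pderiv_X_self]
    push_cast
    linear_combination eg

/-- A form whose leading part is determined by the relation between the cofactors. -/
theorem HasFivePoints.eq_zero_of_relation (h : HasFivePoints q l)
    (hω : ∀ i, (ω i).totalDegree ≤ 2) (hl : IsCofactor ω l Kl) (hq : IsCofactor ω q Kq)
    (hS : 4 * Kl + 5 * Kq - 6 * dForm ω = 0) : ω = 0 := by
  have step : ∀ e : ℕ, e ≤ 1 → (∀ i, (ω i).totalDegree ≤ e + 1) →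
      ∀ i, (ω i).totalDegree ≤ e := by
    intro e he hωe
    obtain ⟨g, g0, g1, gl, gq, gd⟩ := h.exists_top (by omega) hωe hl hq
    have hS' := congrArg (homogeneousComponent e) hS
    have hc : ∀ (n : ℕ) (f : Poly2), homogeneousComponent e ((n : Poly2) * f) =
        (n : Poly2) * homogeneousComponent e f := by
      intro n f
      rw [← map_natCast (C : ℂ →+* Poly2) n, homogeneousComponent_C_mul]
    have hc4 := hc 4 Kl
    have hc5 := hc 5 Kq
    have hc6 := hc 6 (dForm ω)
    push_cast at hc4 hc5 hc6
    rw [map_sub, map_add, hc4, hc5, hc6, gl, gq, gd, map_zero] at hS'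
    -- The leading parts give `(4 + 5 · 4 - 6 (e + 2)) g = 0`; the factor vanishes for `e = 2` only.
    have hg : g = 0 := by
      have e1 : C (24 - 6 * ((e + 2 : ℕ) : ℂ)) * g = 0 := by
        simp only [map_sub, map_mul, map_natCast, map_ofNat]
        linear_combination hS'
      rcases mul_eq_zero.mp e1 with e2 | e2
      · rw [C_eq_zero] at e2
        interval_cases e <;> norm_num at e2
      · exact e2
    intro i
    refine totalDegree_le_of_homogeneousComponent_eq_zero (hωe i) ?_
    fin_cases i
    · simp [g0, hg]
    · simp [g1, hg]
  have hω0 := step 0 (by omega) (step 1 le_rfl hω)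
  have hr := h.radial_eq_zero (by omega) hω0 hl hq
  have hC : ∀ i, ω i = C (coeff 0 (ω i)) := fun i =>
    totalDegree_eq_zero_iff_eq_C.mp (Nat.le_zero.mp (hω0 i))
  rw [homogeneousComponent_zero, homogeneousComponent_zero] at hr
  funext i
  rw [hC i, Pi.zero_apply, C_eq_zero]
  fin_cases i
  · simpa using congrArg (eval ![1, 0]) hr
  · simpa using congrArg (eval ![0, 1]) hr

end Infinity

end

end CuspidalCenter

namespace CuspidalCenter

noncomputable section

/-! ### Local analysis of `dF ∧ ω = F K`. -/

section LocalCofactors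

variable {ω : Form} {f K : Poly2} {a : Fin 2 → ℂ}

theorem IsCofactor.eval (h : IsCofactor ω f K) (a : Fin 2 → ℂ) :
    eval a (pderiv 0 f) * eval a (ω 1) - eval a (pderiv 1 f) * eval a (ω 0) =
      eval a f * eval a K := by
  simpa [IsCofactor, dWedge] using congrArg (MvPolynomial.eval a) h

theorem IsCofactor.eval_pderiv (h : IsCofactor ω f K) (a : Fin 2 → ℂ) (j : Fin 2) :
    MvPolynomial.eval a (pderiv j (pderiv 0 f)) * MvPolynomial.eval a (ω 1)
      + MvPolynomial.eval a (pderiv 0 f) * MvPolynomial.eval a (pderiv j (ω 1))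
      - MvPolynomial.eval a (pderiv j (pderiv 1 f)) * MvPolynomial.eval a (ω 0)
      - MvPolynomial.eval a (pderiv 1 f) * MvPolynomial.eval a (pderiv j (ω 0)) =
      MvPolynomial.eval a (pderiv j f) * MvPolynomial.eval a K
      + MvPolynomial.eval a f * MvPolynomial.eval a (pderiv j K) := by
  have := congrArg (fun g => MvPolynomial.eval a (pderiv j g)) h
  simp only [dWedge, map_sub, map_add, map_mul, Derivation.leibniz, smul_eq_mul] at this
  linear_combination this

theorem IsCofactor.eval_pderiv_pderiv (h : IsCofactor ω f K) (a : Fin 2 → ℂ) (i j : Fin 2) :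
    MvPolynomial.eval a (pderiv i (pderiv j (pderiv 0 f))) * MvPolynomial.eval a (ω 1)
      + MvPolynomial.eval a (pderiv j (pderiv 0 f)) * MvPolynomial.eval a (pderiv i (ω 1))
      + MvPolynomial.eval a (pderiv i (pderiv 0 f)) * MvPolynomial.eval a (pderiv j (ω 1))
      + MvPolynomial.eval a (pderiv 0 f) * MvPolynomial.eval a (pderiv i (pderiv j (ω 1)))
      - MvPolynomial.eval a (pderiv i (pderiv j (pderiv 1 f))) * MvPolynomial.eval a (ω 0)
      - MvPolynomial.eval a (pderiv j (pderiv 1 f)) * MvPolynomial.eval a (pderiv i (ω 0))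
      - MvPolynomial.eval a (pderiv i (pderiv 1 f)) * MvPolynomial.eval a (pderiv j (ω 0))
      - MvPolynomial.eval a (pderiv 1 f) * MvPolynomial.eval a (pderiv i (pderiv j (ω 0))) =
      MvPolynomial.eval a (pderiv i (pderiv j f)) * MvPolynomial.eval a K
      + MvPolynomial.eval a (pderiv j f) * MvPolynomial.eval a (pderiv i K)
      + MvPolynomial.eval a (pderiv i f) * MvPolynomial.eval a (pderiv j K)
      + MvPolynomial.eval a f * MvPolynomial.eval a (pderiv i (pderiv j K)) := by
  have := congrArg (fun g => MvPolynomial.eval a (pderiv i (pderiv j g))) h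
  simp only [dWedge, map_sub, map_add, map_mul, Derivation.leibniz, smul_eq_mul] at this
  linear_combination this

/-- Third derivatives at a point where the form vanishes and the curve is singular. -/
theorem IsCofactor.eval_pderiv₃ (h : IsCofactor ω f K) (a : Fin 2 → ℂ)
    (hω : ∀ i, MvPolynomial.eval a (ω i) = 0) (hf : MvPolynomial.eval a f = 0)
    (hfi : ∀ i, MvPolynomial.eval a (pderiv i f) = 0) (i j k : Fin 2) :
    MvPolynomial.eval a (pderiv i (pderiv j (pderiv 0 f)))
        * MvPolynomial.eval a (pderiv k (ω 1))
      + MvPolynomial.eval a (pderiv i (pderiv k (pderiv 0 f)))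
        * MvPolynomial.eval a (pderiv j (ω 1))
      + MvPolynomial.eval a (pderiv j (pderiv k (pderiv 0 f)))
        * MvPolynomial.eval a (pderiv i (ω 1))
      + MvPolynomial.eval a (pderiv i (pderiv 0 f))
        * MvPolynomial.eval a (pderiv j (pderiv k (ω 1)))
      + MvPolynomial.eval a (pderiv j (pderiv 0 f))
        * MvPolynomial.eval a (pderiv i (pderiv k (ω 1)))
      + MvPolynomial.eval a (pderiv k (pderiv 0 f))
        * MvPolynomial.eval a (pderiv i (pderiv j (ω 1)))
      - MvPolynomial.eval a (pderiv i (pderiv j (pderiv 1 f)))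
        * MvPolynomial.eval a (pderiv k (ω 0))
      - MvPolynomial.eval a (pderiv i (pderiv k (pderiv 1 f)))
        * MvPolynomial.eval a (pderiv j (ω 0))
      - MvPolynomial.eval a (pderiv j (pderiv k (pderiv 1 f)))
        * MvPolynomial.eval a (pderiv i (ω 0))
      - MvPolynomial.eval a (pderiv i (pderiv 1 f))
        * MvPolynomial.eval a (pderiv j (pderiv k (ω 0)))
      - MvPolynomial.eval a (pderiv j (pderiv 1 f))
        * MvPolynomial.eval a (pderiv i (pderiv k (ω 0)))
      - MvPolynomial.eval a (pderiv k (pderiv 1 f))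
        * MvPolynomial.eval a (pderiv i (pderiv j (ω 0))) =
      MvPolynomial.eval a (pderiv i (pderiv j (pderiv k f))) * MvPolynomial.eval a K
      + MvPolynomial.eval a (pderiv i (pderiv j f)) * MvPolynomial.eval a (pderiv k K)
      + MvPolynomial.eval a (pderiv i (pderiv k f)) * MvPolynomial.eval a (pderiv j K)
      + MvPolynomial.eval a (pderiv j (pderiv k f)) * MvPolynomial.eval a (pderiv i K) := by
  have := congrArg (fun g => MvPolynomial.eval a (pderiv i (pderiv j (pderiv k g)))) h
  simp only [dWedge, map_sub, map_add, map_mul, Derivation.leibniz, smul_eq_mul, hω, hf, hfi,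
    mul_zero, zero_mul, add_zero, zero_add] at this
  linear_combination this

theorem eval_dForm (ω : Form) (a : Fin 2 → ℂ) : MvPolynomial.eval a (dForm ω) =
    MvPolynomial.eval a (pderiv 0 (ω 1)) - MvPolynomial.eval a (pderiv 1 (ω 0)) := by
  rw [dForm, map_sub]

/-- At an ordinary cusp of an integral curve the form vanishes, and the exterior derivative is a
fixed multiple of the cofactor. -/
theorem IsCusp.eval_form (hc : IsCusp f a) (h : IsCofactor ω f K) :
    (∀ i, MvPolynomial.eval a (ω i) = 0) ∧
      6 * MvPolynomial.eval a (dForm ω) = 5 * MvPolynomial.eval a K := by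
  obtain ⟨hf, hf0, hf1, u, v, huv, h00, h01, h11, hT⟩ := (isCusp_iff f a).mp hc
  have c1 := pderiv_comm f
  have c3 := pderiv_comm (pderiv 1 f)
  have a0 := h.eval_pderiv a 0
  have a1 := h.eval_pderiv a 1
  have b00 := h.eval_pderiv_pderiv a 0 0
  have b01 := h.eval_pderiv_pderiv a 0 1
  have b11 := h.eval_pderiv_pderiv a 1 1
  simp only [c1, c3, hf, hf0, hf1, h00, h01, h11, zero_mul, add_zero, sub_zero] at a0 a1 b00 b01 b11
  -- First derivatives at the cusp: the value of `ω` is proportional to the covector `(u, v)`.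
  have hs : u * MvPolynomial.eval a (ω 1) = v * MvPolynomial.eval a (ω 0) := by
    rcases huv with hu | hv
    · apply mul_left_cancel₀ (mul_ne_zero two_ne_zero hu)
      linear_combination a0
    · apply mul_left_cancel₀ (mul_ne_zero two_ne_zero hv)
      linear_combination a1
  set T := -v ^ 3 * MvPolynomial.eval a (pderiv 0 (pderiv 0 (pderiv 0 f))) +
    3 * v ^ 2 * u * MvPolynomial.eval a (pderiv 0 (pderiv 0 (pderiv 1 f))) -
    3 * v * u ^ 2 * MvPolynomial.eval a (pderiv 0 (pderiv 1 (pderiv 1 f))) +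
    u ^ 3 * MvPolynomial.eval a (pderiv 1 (pderiv 1 (pderiv 1 f))) with hTdef
  obtain ⟨c, hc0, hc1⟩ : ∃ c, MvPolynomial.eval a (ω 0) = c * u ∧
      MvPolynomial.eval a (ω 1) = c * v := by
    rcases huv with hu | hv
    · exact ⟨MvPolynomial.eval a (ω 0) / u, by field_simp, by field_simp; linear_combination hs⟩
    · exact ⟨MvPolynomial.eval a (ω 1) / v, by field_simp; linear_combination -hs, by field_simp⟩
  -- Second derivatives contracted twice with the tangent vector `(-v, u)`: the quadratic part drops
  -- out, and what remains is `c` times the nonzero cubic value `T`.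
  have hcz : c = 0 := by
    have : c * T = 0 := by
      rw [hc0, hc1] at b00 b01 b11
      rw [hTdef]
      linear_combination -v ^ 2 * b00 + 2 * u * v * b01 - u ^ 2 * b11
    exact (mul_eq_zero.mp this).resolve_right hT
  rw [hcz, zero_mul] at hc0 hc1
  have hω : ∀ i, MvPolynomial.eval a (ω i) = 0 := by
    intro i
    fin_cases i
    · exact hc0
    · exact hc1
  refine ⟨hω, ?_⟩
  have hfi : ∀ i, MvPolynomial.eval a (pderiv i f) = 0 := by
    intro i
    fin_cases i
    · exact hf0
    · exact hf1
  have d000 := h.eval_pderiv₃ a hω hf hfi 0 0 0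
  have d001 := h.eval_pderiv₃ a hω hf hfi 0 0 1
  have d011 := h.eval_pderiv₃ a hω hf hfi 0 1 1
  have d111 := h.eval_pderiv₃ a hω hf hfi 1 1 1
  simp only [c1, c3, h00, h01, h11] at d000 d001 d011 d111
  rw [hc0, hc1] at b00 b01 b11
  rw [eval_dForm]
  generalize MvPolynomial.eval a (pderiv 0 (ω 0)) = P0 at *
  generalize MvPolynomial.eval a (pderiv 1 (ω 0)) = P1 at *
  generalize MvPolynomial.eval a (pderiv 0 (ω 1)) = Q0 at *
  generalize MvPolynomial.eval a (pderiv 1 (ω 1)) = Q1 at *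
  generalize MvPolynomial.eval a K = κ at *
  have hs0 : 2 * (u * Q0 - v * P0) = u * κ := by
    by_cases hu : u = 0
    · have hv := huv.resolve_left (not_not.mpr hu)
      subst hu
      apply mul_left_cancel₀ hv
      linear_combination b01
    · apply mul_left_cancel₀ (mul_ne_zero two_ne_zero hu)
      linear_combination b00
  have hs1 : 2 * (u * Q1 - v * P1) = v * κ := by
    by_cases hv : v = 0
    · have hu := huv.resolve_right (not_not.mpr hv)
      subst hv
      apply mul_left_cancel₀ hu
      linear_combination b01
    · apply mul_left_cancel₀ (mul_ne_zero two_ne_zero hv)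
      linear_combination b11
  have hse : u * (-v * Q0 + u * Q1) = v * (-v * P0 + u * P1) := by
    linear_combination (-v * hs0 + u * hs1) / 2
  obtain ⟨c', hp, hq⟩ : ∃ c', -v * P0 + u * P1 = c' * u ∧ -v * Q0 + u * Q1 = c' * v := by
    rcases huv with hu | hv
    · exact ⟨(-v * P0 + u * P1) / u, by field_simp, by field_simp; linear_combination hse⟩
    · exact ⟨(-v * Q0 + u * Q1) / v, by field_simp; linear_combination -hse, by field_simp⟩
  -- Third derivatives contracted three times with the tangent vector; dividing by `T` compares the
  -- cofactor with the derivative of `ω` along the tangent.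
  have hc3 : κ = -3 * c' := by
    apply mul_left_cancel₀ hT
    rw [hTdef]
    have hcomb := congrArg₂ (· + ·) (congrArg₂ (· + ·) (congrArg (-v ^ 3 * ·) d000)
      (congrArg (3 * v ^ 2 * u * ·) d001)) (congrArg₂ (· + ·) (congrArg (-3 * v * u ^ 2 * ·) d011)
      (congrArg (u ^ 3 * ·) d111))
    generalize MvPolynomial.eval a (pderiv 0 (pderiv 0 (pderiv 0 f))) = t0 at *
    generalize MvPolynomial.eval a (pderiv 0 (pderiv 0 (pderiv 1 f))) = t1 at *
    generalize MvPolynomial.eval a (pderiv 0 (pderiv 1 (pderiv 1 f))) = t2 at *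
    generalize MvPolynomial.eval a (pderiv 1 (pderiv 1 (pderiv 1 f))) = t3 at *
    linear_combination -hcomb + 3 * (v ^ 2 * t0 - 2 * u * v * t1 + u ^ 2 * t2) * hq
      - 3 * (v ^ 2 * t1 - 2 * u * v * t2 + u ^ 2 * t3) * hp
  rcases huv with hu | hv
  · apply mul_left_cancel₀ hu
    linear_combination 3 * hs0 - 6 * hp - 2 * u * hc3
  · apply mul_left_cancel₀ hv
    linear_combination 3 * hs1 - 6 * hq - 2 * v * hc3

/-- The derivative vanishes at a root to one order less than `φ`; if `φ` divides `ψ φ'`, the missing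
order must come from `ψ`. -/
theorem polynomial_eval_eq_zero_of_mul_derivative {φ ψ χ : Polynomial ℂ} (hφ : φ ≠ 0) {t : ℂ}
    (ht : φ.eval t = 0) (h : ψ * φ.derivative = φ * χ) : ψ.eval t = 0 := by
  have hd : φ.derivative ≠ 0 := by
    intro h0
    obtain ⟨c, rfl⟩ := Polynomial.natDegree_eq_zero.mp
      (Polynomial.derivative_eq_zero.mp h0)
    rw [Polynomial.eval_C] at ht
    exact hφ (by rw [ht, Polynomial.C_0])
  by_contra hne
  have hm := Polynomial.derivative_rootMultiplicity_of_root (p := φ) (t := t) ht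
  have hpos : 0 < φ.rootMultiplicity t := (Polynomial.rootMultiplicity_pos hφ).mpr ht
  have h1 : (Polynomial.X - Polynomial.C t) ^ φ.rootMultiplicity t ∣ ψ * φ.derivative := by
    rw [h]
    exact (Polynomial.pow_rootMultiplicity_dvd φ t).mul_right χ
  have hcop : IsCoprime ((Polynomial.X - Polynomial.C t) ^ φ.rootMultiplicity t) ψ := by
    apply IsCoprime.pow_left
    rw [(Polynomial.irreducible_X_sub_C t).coprime_iff_not_dvd, Polynomial.dvd_iff_isRoot]
    exact hne
  have h2 := (Polynomial.le_rootMultiplicity_iff hd).mpr (hcop.dvd_of_dvd_mul_left h1)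
  omega

/-- The form vanishes at the intersection points of an integral line and another integral curve. -/
theorem eval_eq_zero_of_mem_line {u : Fin 3 → ℂ} (hu : u 1 ≠ 0 ∨ u 2 ≠ 0) {L : Poly2}
    (hl : IsCofactor ω (lin u) L) (h : IsCofactor ω f K) (hdvd : ¬ lin u ∣ f)
    (ha : MvPolynomial.eval a (lin u) = 0) (haf : MvPolynomial.eval a f = 0) :
    ∀ i, MvPolynomial.eval a (ω i) = 0 := by
  set e : Fin 2 → ℂ := ![-u 2, u 1] with he
  have hline : ∀ t : ℂ, MvPolynomial.eval (a + t • e) (lin u) = 0 := by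
    intro t
    rw [eval_lin] at ha ⊢
    simp [he]
    linear_combination ha
  have hφ : restrict a e f ≠ 0 := by
    intro h0
    refine hdvd (lin_dvd hu fun v hv => ?_)
    have hd0 : e ≠ 0 := by
      intro h0
      have e0 := congrFun h0 0
      have e1 := congrFun h0 1
      simp [he] at e0 e1
      rcases hu with hu | hu
      · exact hu e1
      · exact hu e0
    obtain ⟨τ, rfl⟩ := exists_on_line (r := a) (v := v) hd0 (by
      rw [eval_lin] at ha hv
      simp [he]
      linear_combination ha - hv)
    rw [← eval_restrict, h0, Polynomial.eval_zero]
  have hdwl : Polynomial.C (u 1) * restrict a e (ω 1) = Polynomial.C (u 2) * restrict a e (ω 0) := by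
    refine Polynomial.funext fun t => ?_
    have := hl.eval (a + t • e)
    rw [hline, pderiv_lin, pderiv_lin, eval_C, eval_C, zero_mul, Fin.succ_zero_eq_one,
      Fin.succ_one_eq_two] at this
    simp only [Polynomial.eval_mul, Polynomial.eval_C, eval_restrict]
    linear_combination this
  have hdwf : restrict a e (pderiv 0 f) * restrict a e (ω 1) -
      restrict a e (pderiv 1 f) * restrict a e (ω 0) = restrict a e f * restrict a e K := by
    refine Polynomial.funext fun t => ?_
    simp only [Polynomial.eval_mul, Polynomial.eval_sub, eval_restrict]
    exact h.eval _
  have hder := derivative_restrict a e f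
  simp only [he, Matrix.cons_val_zero, Matrix.cons_val_one, Polynomial.C_neg] at hder
  rw [← he] at hder
  have hf0 : (restrict a e f).eval 0 = 0 := by rw [eval_restrict, zero_smul, add_zero, haf]
  -- On the line, `dL ∧ ω = 0` makes `ω` a multiple of `dL`, so `dF ∧ ω = F K` turns into an
  -- equation between a component of `ω` times the derivative of `F` and a multiple of `F`.
  have k0 := polynomial_eval_eq_zero_of_mul_derivative (ψ := restrict a e (ω 0))
    (χ := - Polynomial.C (u 1) * restrict a e K) hφ hf0 (by
      rw [hder]
      linear_combination -Polynomial.C (u 1) * hdwf + restrict a e (pderiv 0 f) * hdwl)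
  have k1 := polynomial_eval_eq_zero_of_mul_derivative (ψ := restrict a e (ω 1))
    (χ := - Polynomial.C (u 2) * restrict a e K) hφ hf0 (by
      rw [hder]
      linear_combination -Polynomial.C (u 2) * hdwf + restrict a e (pderiv 1 f) * hdwl)
  rw [eval_restrict, zero_smul, add_zero] at k0 k1
  intro i
  fin_cases i
  · exact k0
  · exact k1

end LocalCofactors

end

end CuspidalCenter

namespace CuspidalCenter

noncomputable section

/-! ### The global relation for every configuration. -/

section CofactorRelation

variable {U : Matrix (Fin 3) (Fin 3) ℂ} {m n k : ℂ} {a : Fin 2 → ℂ}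

theorem quartGrad_eq_zero {x y z : ℂ} (h1 : quartGrad x y z = 0) (h2 : quartGrad y z x = 0)
    (h3 : quartGrad z x y = 0) : (x = 0 ∧ y = 0) ∨ (y = 0 ∧ z = 0) ∨ (z = 0 ∧ x = 0) := by
  simp only [quartGrad] at h1 h2 h3
  by_cases hx : x = 0
  · subst hx
    have : y * z = 0 := by
      have e : (y * z) ^ 2 = 0 := by linear_combination y / 2 * h2
      exact pow_eq_zero_iff two_ne_zero |>.mp e
    rcases mul_eq_zero.mp this with h | h
    · exact Or.inl ⟨rfl, h⟩
    · exact Or.inr (Or.inr ⟨h, rfl⟩)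
  by_cases hy : y = 0
  · subst hy
    have : z * x = 0 := by
      have e : (z * x) ^ 2 = 0 := by linear_combination z / 2 * h3
      exact pow_eq_zero_iff two_ne_zero |>.mp e
    rcases mul_eq_zero.mp this with h | h
    · exact Or.inr (Or.inl ⟨rfl, h⟩)
    · exact absurd h hx
  by_cases hz : z = 0
  · subst hz
    have : x * y = 0 := by
      have e : (x * y) ^ 2 = 0 := by linear_combination x / 2 * h1
      exact pow_eq_zero_iff two_ne_zero |>.mp e
    exact absurd this (mul_ne_zero hx hy)
  exfalso
  -- The combination `x ∂x - y ∂y` of the partial derivatives splits off `x - y`. With the cyclic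
  -- analogues and nonzero coordinates, every choice of factors leads to a contradiction.
  have k1 : (x - y) * (z * (x + y) - x * y) = 0 := by
    apply mul_left_cancel₀ (mul_ne_zero two_ne_zero hz)
    linear_combination x * h1 - y * h2
  have k2 : (y - z) * (x * (y + z) - y * z) = 0 := by
    apply mul_left_cancel₀ (mul_ne_zero two_ne_zero hx)
    linear_combination y * h2 - z * h3
  have k3 : (z - x) * (y * (z + x) - z * x) = 0 := by
    apply mul_left_cancel₀ (mul_ne_zero two_ne_zero hy)
    linear_combination z * h3 - x * h1
  have hx2 := mul_ne_zero hx hx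
  have two : ∀ {p r : ℂ}, p ≠ 0 → r ≠ 0 → (2 : ℂ) * p * r = 0 → False := fun hp hr h =>
    mul_ne_zero (mul_ne_zero two_ne_zero hp) hr h
  rcases mul_eq_zero.mp k1 with e1 | e1 <;> rcases mul_eq_zero.mp k2 with e2 | e2 <;>
    rcases mul_eq_zero.mp k3 with e3 | e3
  · obtain rfl : x = y := by linear_combination e1
    obtain rfl : x = z := by linear_combination e2
    exact two hx hx2 (by linear_combination -h1 / 2)
  · obtain rfl : x = y := by linear_combination e1
    obtain rfl : x = z := by linear_combination e2
    exact two hx hx2 (by linear_combination -h1 / 2)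
  · obtain rfl : x = y := by linear_combination e1
    exact hx2 (by linear_combination e2)
  · obtain rfl : x = y := by linear_combination e1
    exact hx2 (by linear_combination e2)
  · obtain rfl : y = z := by linear_combination e2
    exact mul_ne_zero hy hy (by linear_combination e1)
  · obtain rfl : y = z := by linear_combination e2
    exact mul_ne_zero hy hy (by linear_combination e1)
  · obtain rfl : z = x := by linear_combination e3
    exact hx2 (by linear_combination e1)
  · exact two hx hz (by linear_combination e1 + e2)

theorem frame_vector_ne_zero (hU : U.det ≠ 0) (a : Fin 2 → ℂ) :
    ¬ (eval a (lin (U 0)) = 0 ∧ eval a (lin (U 1)) = 0 ∧ eval a (lin (U 2)) = 0) := by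
  rintro ⟨h0, h1, h2⟩
  have hz : (![1, a 0, a 1] : Fin 3 → ℂ) = 0 := by
    refine Matrix.eq_zero_of_mulVec_eq_zero hU ?_
    rw [eval_lin] at h0 h1 h2
    funext j
    fin_cases j <;> simp [Matrix.mulVec, dotProduct, Fin.sum_univ_three]
    · linear_combination h0
    · linear_combination h1
    · linear_combination h2
  simpa using congrFun hz 0

/-- The singular points of the quartic are the vertices of the triangle of coordinate lines. -/
theorem frameQuartic_singular (hU : U.det ≠ 0) (h : eval a (frameQuartic U) = 0)
    (h' : ∀ i, eval a (pderiv i (frameQuartic U)) = 0) :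
    (eval a (lin (U 0)) = 0 ∧ eval a (lin (U 1)) = 0) ∨
    (eval a (lin (U 1)) = 0 ∧ eval a (lin (U 2)) = 0) ∨
    (eval a (lin (U 2)) = 0 ∧ eval a (lin (U 0)) = 0) := by
  have e0 := h' 0
  have e1 := h' 1
  rw [eval_pderiv_frameQuartic] at e0 e1
  rw [eval_frameQuartic] at h
  have hE : eval a (lin (U 0)) * quartGrad (eval a (lin (U 0))) (eval a (lin (U 1)))
          (eval a (lin (U 2))) +
        eval a (lin (U 1)) * quartGrad (eval a (lin (U 1))) (eval a (lin (U 2)))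
          (eval a (lin (U 0))) +
        eval a (lin (U 2)) * quartGrad (eval a (lin (U 2))) (eval a (lin (U 0)))
          (eval a (lin (U 1))) = 0 := by
    refine Eq.trans ?_ ((congrArg (4 * ·) h).trans (mul_zero 4))
    simp only [quartGrad, quart]; ring
  set v : Fin 3 → ℂ :=
    ![quartGrad (eval a (lin (U 0))) (eval a (lin (U 1))) (eval a (lin (U 2))),
      quartGrad (eval a (lin (U 1))) (eval a (lin (U 2))) (eval a (lin (U 0))),
      quartGrad (eval a (lin (U 2))) (eval a (lin (U 0))) (eval a (lin (U 1)))] with hv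
  have hz : v = 0 := by
    refine Matrix.eq_zero_of_vecMul_eq_zero hU ?_
    rw [Fin.succ_zero_eq_one] at e0
    rw [Fin.succ_one_eq_two] at e1
    have l0 := eval_lin (U 0) a
    have l1 := eval_lin (U 1) a
    have l2 := eval_lin (U 2) a
    generalize eval a (lin (U 0)) = x at *
    generalize eval a (lin (U 1)) = y at *
    generalize eval a (lin (U 2)) = z at *
    generalize quartGrad x y z = g0 at *
    generalize quartGrad y z x = g1 at *
    generalize quartGrad z x y = g2 at *
    funext j
    fin_cases j <;> simp [Matrix.vecMul, dotProduct, Fin.sum_univ_three, hv]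
    · linear_combination hE - a 0 * e0 - a 1 * e1 - g0 * l0 - g1 * l1 - g2 * l2
    · linear_combination e0
    · linear_combination e1
  exact quartGrad_eq_zero (congrFun hz 0) (congrFun hz 1) (congrFun hz 2)

theorem eval_frameLine : eval a (frameLine U m n k) = m ^ 3 * eval a (lin (U 0))
    + n ^ 3 * eval a (lin (U 1)) + k ^ 3 * eval a (lin (U 2)) := by
  simp [frameLine]

/-- At a vertex of the triangle only one coordinate survives, and the line has there a nonzero cube
times it. -/
theorem eval_frameLine_ne_zero (hU : U.det ≠ 0) (hm : m ≠ 0) (hn : n ≠ 0) (hk : k ≠ 0)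
    (h : eval a (frameQuartic U) = 0) (h' : ∀ i, eval a (pderiv i (frameQuartic U)) = 0) :
    eval a (frameLine U m n k) ≠ 0 := by
  have hv := frame_vector_ne_zero hU a
  rw [eval_frameLine]
  rcases frameQuartic_singular hU h h' with ⟨e1, e2⟩ | ⟨e1, e2⟩ | ⟨e1, e2⟩ <;>
    simp only [e1, e2, mul_zero, zero_add, add_zero] <;>
    exact mul_ne_zero (pow_ne_zero _ ‹_›) (fun e3 => hv ⟨by assumption, by assumption, by assumption⟩)

theorem IsCusp.eval_eq_zero {f : Poly2} (h : IsCusp f a) : eval a f = 0 :=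
  ((isCusp_iff f a).mp h).1

theorem IsCusp.eval_pderiv_eq_zero {f : Poly2} (h : IsCusp f a) (i : Fin 2) :
    eval a (pderiv i f) = 0 := by
  obtain ⟨-, h0, h1, -⟩ := (isCusp_iff f a).mp h
  fin_cases i
  · exact h0
  · exact h1

theorem lin_eq_zero_of_eval {w : Fin 3 → ℂ} {r s t : Fin 2 → ℂ}
    (h : (s 0 - r 0) * (t 1 - r 1) - (t 0 - r 0) * (s 1 - r 1) ≠ 0)
    (hr : eval r (lin w) = 0) (hs : eval s (lin w) = 0) (ht : eval t (lin w) = 0) : lin w = 0 := by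
  rw [eval_lin] at hr hs ht
  have h1 : w 1 = 0 := by
    refine (mul_eq_zero.mp ?_).resolve_right h
    linear_combination (t 1 - r 1) * (hs - hr) - (s 1 - r 1) * (ht - hr)
  have h2 : w 2 = 0 := by
    refine (mul_eq_zero.mp ?_).resolve_right h
    linear_combination (s 0 - r 0) * (ht - hr) - (t 0 - r 0) * (hs - hr)
  have h0 : w 0 = 0 := by
    rw [h1, h2] at hr
    linear_combination hr
  simp [lin, h0, h1, h2]

theorem totalDegree_dForm_le {ω : Form} {d : ℕ} (hω : ∀ i, (ω i).totalDegree ≤ d + 1) :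
    (dForm ω).totalDegree ≤ d :=
  (totalDegree_sub _ _).trans
    (max_le (totalDegree_pderiv_le (hω 1) 0) (totalDegree_pderiv_le (hω 0) 1))

theorem ne_zero_of_totalDegree_lin {u : Fin 3 → ℂ} (h : (lin u).totalDegree = 1) :
    u 1 ≠ 0 ∨ u 2 ≠ 0 := by
  by_contra! hc
  rw [lin, hc.1, hc.2] at h
  simp at h

variable {q l : Poly2} {r s t b : Fin 2 → ℂ} {ω : Form} {Kl Kq : Poly2}

theorem IsConfig.eval_line_ne_zero (h : IsConfig q l r s t b) (ha : IsCusp q a) :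
    eval a l ≠ 0 := by
  obtain ⟨U, m, n, k, hU, hs, hm, hn, hk, rfl, rfl⟩ := h.exists_frame
  exact eval_frameLine_ne_zero hU hm hn hk ha.eval_eq_zero ha.eval_pderiv_eq_zero

/-- The form vanishes at the cusp and the line does not, so the cofactor of the line is zero there.
-/
theorem IsConfig.hasEta_of_isCusp (h : IsConfig q l r s t b) (hl : IsCofactor ω l Kl)
    (hq : IsCofactor ω q Kq) (ha : IsCusp q a) : HasEta Kl Kq (dForm ω) a 0 6 5 := by
  obtain ⟨h0, h1⟩ := ha.eval_form hq
  have h2 := hl.eval a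
  rw [h0, h0, mul_zero, mul_zero, sub_zero] at h2
  refine ⟨eval a Kq / 6, ?_, by ring, by linear_combination h1 / 6⟩
  rw [mul_zero]
  exact (mul_eq_zero.mp h2.symm).resolve_left (h.eval_line_ne_zero ha)

theorem IsConfig.eval_form_eq_zero (h : IsConfig q l r s t b) (hl : IsCofactor ω l Kl)
    (hq : IsCofactor ω q Kq) (hal : eval a l = 0) (haq : eval a q = 0) (i : Fin 2) :
    eval a (ω i) = 0 := by
  obtain ⟨u, rfl⟩ := exists_lin_eq h.degree_l.le
  have hu := ne_zero_of_totalDegree_lin h.degree_l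
  exact eval_eq_zero_of_mem_line hu hl hq (not_lin_dvd h.irreducible h.degree_q hu) hal haq i

/-- The relation between the cofactors and the exterior derivative. -/
theorem IsConfig.cofactor_relation (h : IsConfig q l r s t b)
    (hω : ∀ i, (ω i).totalDegree ≤ 3) (hl : IsCofactor ω l Kl) (hq : IsCofactor ω q Kq) :
    4 * Kl + 5 * Kq - 6 * dForm ω = 0 := by
  obtain ⟨g, -, -, gl, gq, gd⟩ := h.hasFivePoints.exists_top le_rfl hω hl hq
  have hl1 : l.totalDegree = 0 + 1 := h.degree_l
  have hq1 : q.totalDegree = 3 + 1 := h.degree_q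
  have dl := hl.totalDegree_le (d := 2) hl1 hω
  have dq := hq.totalDegree_le (d := 2) hq1 hω
  have dd := totalDegree_dForm_le (d := 2) hω
  have hrw : 4 * Kl + 5 * Kq - 6 * dForm ω = C 4 * Kl + C 5 * Kq - C 6 * dForm ω := rfl
  have hdeg : (4 * Kl + 5 * Kq - 6 * dForm ω).totalDegree ≤ 1 + 1 := by
    rw [hrw]
    refine (totalDegree_sub _ _).trans (max_le ((totalDegree_add _ _).trans (max_le ?_ ?_)) ?_) <;>
      refine (totalDegree_mul _ _).trans ?_ <;> rw [totalDegree_C, zero_add] <;> assumption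
  -- The leading parts contribute `4 · 1 + 5 · 4 - 6 · 4 = 0`.
  have htop : homogeneousComponent (1 + 1) (4 * Kl + 5 * Kq - 6 * dForm ω) = 0 := by
    rw [hrw, map_sub, map_add, homogeneousComponent_C_mul, homogeneousComponent_C_mul,
      homogeneousComponent_C_mul, gl, gq, gd]
    simp only [map_ofNat]
    push_cast
    ring
  obtain ⟨w, hw⟩ := exists_lin_eq (totalDegree_le_of_homogeneousComponent_eq_zero hdeg htop)
  -- At the cusps the ratio `(0 : 6 : 5)` gives `4 · 0 + 5 · 6 - 6 · 5 = 0`.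
  have key : ∀ a, IsCusp q a → eval a (lin w) = 0 := by
    intro a ha
    obtain ⟨c, c1, c2, c3⟩ := h.hasEta_of_isCusp hl hq ha
    rw [← hw]
    simp only [map_sub, map_add, map_mul, map_ofNat, c1, c2, c3]
    ring
  rw [hw]
  exact lin_eq_zero_of_eval (cusps_not_collinear h.irreducible h.degree_q h.r_ne_s h.s_ne_t
    h.r_ne_t h.cusp_r.isDegenerateDouble h.cusp_s.isDegenerateDouble h.cusp_t.isDegenerateDouble)
    (key r h.cusp_r) (key s h.cusp_s) (key t h.cusp_t)

/-- At a zero of the form on a smooth curve, the cofactor is determined by the direction of the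
gradient and the linear part of the form. Tangent curves have parallel gradients, hence equal
cofactors, and the relation gives `dω`. -/
theorem IsConfig.hasEta_tangent (h : IsConfig q l r s t b)
    (hω : ∀ i, (ω i).totalDegree ≤ 3) (hl : IsCofactor ω l Kl) (hq : IsCofactor ω q Kq) :
    HasEta Kl Kq (dForm ω) b 2 2 3 := by
  have hS := congrArg (eval b) (h.cofactor_relation hω hl hq)
  obtain ⟨hbq, hbl, hsm, htan⟩ := h.tangent
  have h0 := h.eval_form_eq_zero hl hq hbl hbq
  obtain ⟨u, rfl⟩ := exists_lin_eq h.degree_l.le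
  have hu := ne_zero_of_totalDegree_lin h.degree_l
  have l0 := hl.eval_pderiv b 0
  have l1 := hl.eval_pderiv b 1
  have q0 := hq.eval_pderiv b 0
  have q1 := hq.eval_pderiv b 1
  simp only [h0, hbq, hbl, pderiv_lin, eval_C, mul_zero, zero_mul, add_zero, sub_zero, zero_add,
    Fin.succ_zero_eq_one, Fin.succ_one_eq_two] at l0 l1 q0 q1 htan
  simp only [map_sub, map_add, map_mul, map_ofNat, map_zero] at hS
  have hK : eval b Kl = eval b Kq := by
    rcases hsm with hs | hs <;> rcases hu with hu | hu
    · apply mul_left_cancel₀ (mul_ne_zero hs hu)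
      linear_combination - eval b (pderiv 0 q) * l0 + u 1 * q0 - eval b (pderiv 0 (ω 0)) * htan
    · apply mul_left_cancel₀ (mul_ne_zero hs hu)
      linear_combination - eval b (pderiv 0 q) * l1 + u 1 * q1
        - (eval b (pderiv 1 (ω 0)) + eval b Kq) * htan
    · apply mul_left_cancel₀ (mul_ne_zero hs hu)
      linear_combination - eval b (pderiv 1 q) * l0 + u 2 * q0
        - (eval b (pderiv 0 (ω 1)) - eval b Kq) * htan
    · apply mul_left_cancel₀ (mul_ne_zero hs hu)
      linear_combination - eval b (pderiv 1 q) * l1 + u 2 * q1 - eval b (pderiv 1 (ω 1)) * htan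
  refine ⟨eval b Kl / 2, by ring, by rw [← hK]; ring, ?_⟩
  linear_combination -hS / 6 - 5 / 6 * hK

/-- The local and global relations between the cofactors for every configuration. -/
theorem IsConfig.main (h : IsConfig q l r s t b) (hω : ∀ i, (ω i).totalDegree ≤ 3)
    (hl : IsCofactor ω l Kl) (hq : IsCofactor ω q Kq) :
    (∀ a ∈ ({r, s, t, b} : Set (Fin 2 → ℂ)), ∀ i, eval a (ω i) = 0) ∧
      (∀ a ∈ ({r, s, t} : Set (Fin 2 → ℂ)), HasEta Kl Kq (dForm ω) a 0 6 5) ∧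
      HasEta Kl Kq (dForm ω) b 2 2 3 ∧
      HasEtaAtInfinity 2 Kl Kq (dForm ω) 1 4 4 ∧
      4 * Kl + 5 * Kq - 6 * dForm ω = 0 ∧
      HasDarbouxFactor ω l q := by
  refine ⟨?_, ?_, h.hasEta_tangent hω hl hq, ?_, h.cofactor_relation hω hl hq,
    hasDarbouxFactor_of_relation hl hq (h.cofactor_relation hω hl hq)⟩
  · rintro a (rfl | rfl | rfl | rfl)
    · exact (h.cusp_r.eval_form hq).1
    · exact (h.cusp_s.eval_form hq).1
    · exact (h.cusp_t.eval_form hq).1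
    · exact h.eval_form_eq_zero hl hq h.tangent.2.1 h.tangent.1
  · rintro a (rfl | rfl | rfl)
    · exact h.hasEta_of_isCusp hl hq h.cusp_r
    · exact h.hasEta_of_isCusp hl hq h.cusp_s
    · exact h.hasEta_of_isCusp hl hq h.cusp_t
  · obtain ⟨g, -, -, gl, gq, gd⟩ := h.hasFivePoints.exists_top le_rfl hω hl hq
    intro p _
    refine ⟨eval p g, ?_, ?_, ?_⟩
    · rw [gl, mul_one]
    · rw [gq, map_mul, map_ofNat]; ring
    · rw [gd]; push_cast; simp only [map_mul, map_ofNat]; ring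

end CofactorRelation

end

end CuspidalCenter

namespace CuspidalCenter

noncomputable section

/-! ### Coprimality and transversal intersection points. -/

section Uniqueness

theorem totalDegree_eq_zero_of_isUnit {p : Poly2} (hp : IsUnit p) : p.totalDegree = 0 :=
  (isUnit_iff_totalDegree_of_isReduced.mp hp).2

theorem totalDegree_pos_of_irreducible {p : Poly2} (hp : Irreducible p) : 0 < p.totalDegree := by
  by_contra h0
  have h1 := totalDegree_eq_zero_iff_eq_C.mp (Nat.le_zero.mp (not_lt.mp h0))
  apply hp.not_isUnit
  rw [h1]
  refine IsUnit.map _ (isUnit_iff_ne_zero.mpr fun h2 => hp.ne_zero ?_)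
  rw [h1, h2, C_0]

theorem irreducible_of_totalDegree_one {l : Poly2} (h : l.totalDegree = 1) : Irreducible l := by
  refine irreducible_of_totalDegree_eq_one h fun x hx => isUnit_iff_ne_zero.mpr ?_
  rintro rfl
  have : l = 0 := by
    ext m
    simpa using hx m
  rw [this] at h
  simp at h

theorem exists_not_dvd_pderiv {f : Poly2} {n : ℕ} (hf : f.totalDegree = n + 1) :
    ∃ i, ¬ f ∣ pderiv i f := by
  by_contra! hall
  have hz : ∀ i, pderiv i f = 0 := by
    intro i
    by_contra h0
    have h1 := totalDegree_le_of_dvd_of_isDomain (hall i) h0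
    have h2 := totalDegree_pderiv_le hf.le i
    omega
  have hE := euler_two (homogeneousComponent_isHomogeneous (n + 1) f)
  rw [← homogeneousComponent_pderiv, ← homogeneousComponent_pderiv, hz, hz, map_zero, mul_zero,
    mul_zero, add_zero] at hE
  rcases mul_eq_zero.mp hE.symm with h | h
  · exact Nat.cast_ne_zero.mpr (Nat.succ_ne_zero n) h
  · exact homogeneousComponent_totalDegree_ne_zero hf h

/-- Along an integral curve both forms are proportional to its differential, so their wedge vanishes
there; irreducibility converts this into divisibility, using a partial derivative not divisible by
`f`. -/
theorem IsCofactor.dvd_wedge {f K L : Poly2} {ω η : Form} {n : ℕ} (hf : Irreducible f)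
    (hd : f.totalDegree = n + 1) (h : IsCofactor ω f K) (h' : IsCofactor η f L) :
    f ∣ ω 0 * η 1 - ω 1 * η 0 := by
  obtain ⟨i, hi⟩ := exists_not_dvd_pderiv hd
  simp only [IsCofactor, dWedge] at h h'
  have key : f ∣ pderiv i f * (ω 0 * η 1 - ω 1 * η 0) := by
    fin_cases i
    · exact ⟨ω 0 * L - η 0 * K, by simp only [Fin.zero_eta]; linear_combination ω 0 * h' - η 0 * h⟩
    · exact ⟨ω 1 * L - η 1 * K, by simp only [Fin.mk_one]; linear_combination ω 1 * h' - η 1 * h⟩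
  exact (hf.prime.dvd_or_dvd key).resolve_left hi

variable {q l : Poly2} {r s t b : Fin 2 → ℂ} {ω η : Form} {Kl Kq Ml Mq : Poly2}

theorem dWedge_mul_form {ω : Form} {h : Poly2} {η : Form} (he : ∀ i, ω i = h * η i) (f : Poly2) :
    dWedge f ω = h * dWedge f η := by
  simp only [dWedge, he]
  ring

theorem dForm_mul_form {ω : Form} {h : Poly2} {η : Form} (he : ∀ i, ω i = h * η i) :
    dForm ω = h * dForm η + dWedge h η := by
  simp only [dForm, dWedge, he, Derivation.leibniz, smul_eq_mul]
  ring

/-- The components of a nonzero form of degree three have no common factor. -/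
theorem IsConfig.isRelPrime (hc : IsConfig q l r s t b) (hω : ∀ i, (ω i).totalDegree ≤ 3)
    (hl : IsCofactor ω l Kl) (hq : IsCofactor ω q Kq) (h0 : ω ≠ 0) :
    IsRelPrime (ω 0) (ω 1) := by
  refine WfDvdMonoid.isRelPrime_of_no_irreducible_factors ?_ fun h hirr hd0 hd1 => ?_
  · rintro ⟨e0, e1⟩
    apply h0
    funext i
    fin_cases i
    · exact e0
    · exact e1
  have hdvd : ∀ i, ∃ g, ω i = h * g := by
    intro i
    fin_cases i
    · exact hd0
    · exact hd1
  choose η hη using hdvd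
  have hne : ∃ i, ω i ≠ 0 := by
    by_contra! hall
    exact h0 (funext hall)
  have hpos := totalDegree_pos_of_irreducible hirr
  have hh0 := hirr.ne_zero
  have hηd : ∀ i, (η i).totalDegree ≤ 2 := by
    intro i
    by_cases hi : η i = 0
    · simp [hi]
    · have := totalDegree_mul_of_isDomain hh0 hi
      rw [← hη] at this
      have := hω i
      omega
  have hhd : h.totalDegree ≤ 3 := by
    obtain ⟨i, hi⟩ := hne
    exact (totalDegree_le_of_dvd_of_isDomain ⟨η i, hη i⟩ hi).trans (hω i)
  have hq' : ∃ Kq', Kq = h * Kq' := by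
    have : h ∣ q * Kq := by
      rw [← hq, dWedge_mul_form hη]
      exact dvd_mul_right _ _
    refine (hirr.prime.dvd_or_dvd this).resolve_left fun hhq => ?_
    have h1 := (hirr.dvd_irreducible_iff_associated hc.irreducible).mp hhq
    have h2 := totalDegree_le_of_dvd_of_isDomain h1.symm.dvd hh0
    have := hc.degree_q
    omega
  obtain ⟨Kq', rfl⟩ := hq'
  have hq2 : IsCofactor η q Kq' := by
    apply mul_left_cancel₀ hh0
    rw [← dWedge_mul_form hη, hq]
    ring
  have hl' : ∃ Kl', IsCofactor η l Kl' := by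
    have hdvd : h ∣ l * Kl := by
      rw [← hl, dWedge_mul_form hη]
      exact dvd_mul_right _ _
    rcases hirr.prime.dvd_or_dvd hdvd with h1 | h1
    -- Here the common factor is the line itself. Then `Kl = dh ∧ η`, and the relation becomes `2 dh
    -- ∧ η = h (6 dη - 5 Kq')` up to sign conventions for moving terms, so the line is again an
    -- integral curve of `η`.
    · obtain ⟨u, hu⟩ := (hirr.dvd_irreducible_iff_associated
        (irreducible_of_totalDegree_one hc.degree_l)).mp h1
      have hrel := hc.cofactor_relation hω hl hq
      rw [dForm_mul_form hη] at hrel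
      have hu0 : (u : Poly2).totalDegree = 0 := totalDegree_eq_zero_of_isUnit u.isUnit
      obtain ⟨c, hcu⟩ : ∃ c, (u : Poly2) = C c := ⟨_, totalDegree_eq_zero_iff_eq_C.mp hu0⟩
      have hwl : dWedge l η = C c * dWedge h η := by
        rw [← hu, hcu]
        simp only [dWedge, Derivation.leibniz, pderiv_C, smul_eq_mul, mul_zero, zero_add]
        ring
      have hKl : Kl = dWedge h η := by
        have hlne : l ≠ 0 := (irreducible_of_totalDegree_one hc.degree_l).ne_zero
        apply mul_left_cancel₀ hlne
        rw [← hl, dWedge_mul_form hη, hwl, ← hu, hcu]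
        ring
      rw [hKl] at hrel
      refine ⟨C (1 / 2) * (5 * Kq' - 6 * dForm η), ?_⟩
      rw [IsCofactor, hwl, ← hu, hcu]
      have h2 : (C (1 / 2) : Poly2) * 2 = 1 := by
        rw [show (2 : Poly2) = C 2 from rfl, ← C_mul]
        norm_num
      linear_combination -C c * C (1 / 2) * hrel - C c * dWedge h η * h2
    · obtain ⟨Kl', rfl⟩ := h1
      refine ⟨Kl', ?_⟩
      apply mul_left_cancel₀ hh0
      rw [← dWedge_mul_form hη, hl]
      ring
  obtain ⟨Kl', hl2⟩ := hl'
  -- After division the degree is at most two, where the leading part cannot satisfy the relation.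
  have hz := hc.hasFivePoints.eq_zero_of_relation hηd hl2 hq2
    (hc.cofactor_relation (fun i => (hηd i).trans (by norm_num)) hl2 hq2)
  apply h0
  funext i
  rw [hη, hz]
  simp

/-- An integral curve `q l = 0` splits into the integral curves `q = 0` and `l = 0`. -/
theorem IsConfig.isAlgIntegralCurve_of_mul (hc : IsConfig q l r s t b)
    (h : IsAlgIntegralCurve ω (q * l)) : IsAlgIntegralCurve ω q ∧ IsAlgIntegralCurve ω l := by
  obtain ⟨K, hK⟩ := h
  have hlirr := irreducible_of_totalDegree_one hc.degree_l
  have hexp : dWedge (q * l) ω = q * dWedge l ω + l * dWedge q ω := by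
    simp only [dWedge, Derivation.leibniz, smul_eq_mul]
    ring
  rw [IsCofactor, hexp] at hK
  constructor
  · have h1 : q ∣ l * dWedge q ω := ⟨l * K - dWedge l ω, by linear_combination hK⟩
    obtain ⟨M, hM⟩ := (hc.irreducible.prime.dvd_or_dvd h1).resolve_left fun h2 => by
      have := totalDegree_le_of_dvd_of_isDomain h2 hlirr.ne_zero
      rw [hc.degree_q, hc.degree_l] at this
      omega
    exact ⟨M, hM⟩
  · have h1 : l ∣ q * dWedge l ω := ⟨q * K - dWedge q ω, by linear_combination hK⟩
    obtain ⟨M, hM⟩ := (hlirr.prime.dvd_or_dvd h1).resolve_left fun h2 => by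
      obtain ⟨u, rfl⟩ := exists_lin_eq hc.degree_l.le
      exact not_lin_dvd hc.irreducible hc.degree_q (ne_zero_of_totalDegree_lin hc.degree_l) h2
    exact ⟨M, hM⟩

/-- A line meeting the quartic in three points meets it transversally in one of them. -/
theorem IsGenericConfig.exists_node (hc : IsGenericConfig q l r s t b) :
    ∃ p, eval p q = 0 ∧ eval p l = 0 ∧ eval p (pderiv 0 q) * eval p (pderiv 1 l) -
      eval p (pderiv 1 q) * eval p (pderiv 0 l) ≠ 0 := by
  obtain ⟨u, rfl⟩ := exists_lin_eq hc.degree_l.le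
  have hu := ne_zero_of_totalDegree_lin hc.degree_l
  by_contra! hall
  set e : Fin 2 → ℂ := ![-u 2, u 1] with he
  have he0 : e ≠ 0 := by
    intro h0
    have e0 := congrFun h0 0
    have e1 := congrFun h0 1
    simp [he] at e0 e1
    rcases hu with hu | hu
    · exact hu e1
    · exact hu e0
  have hb := hc.tangent.2.1
  have hpar : ∀ p, eval p (lin u) = 0 → ∃ τ : ℂ, p = b + τ • e := by
    intro p hp
    refine exists_on_line he0 ?_
    rw [eval_lin] at hb hp
    simp [he]
    linear_combination hb - hp
  set S := {p : Fin 2 → ℂ | eval p q = 0 ∧ eval p (lin u) = 0} with hS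
  have hinj : Function.Injective fun τ : ℂ => b + τ • e := by
    intro τ τ' h
    have h1 : τ • e = τ' • e := add_left_cancel h
    exact smul_left_injective ℂ he0 h1
  set T := (fun τ : ℂ => b + τ • e) ⁻¹' S with hT
  have hTcard : T.ncard = 3 := by
    rw [hT, Set.ncard_preimage_of_injective_subset_range hinj]
    · exact hc.meets
    · rintro p ⟨-, hp⟩
      obtain ⟨τ, rfl⟩ := hpar p hp
      exact ⟨τ, rfl⟩
  have hTfin : T.Finite := Set.finite_of_ncard_ne_zero (by rw [hTcard]; norm_num)
  -- If all three intersections were tangential, a polynomial of degree at most four would have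
  -- three double roots.
  have hφ : restrict b e q = 0 := by
    refine eq_zero_of_double_roots (natDegree_restrict_le hc.degree_q.le b e)
      (T := hTfin.toFinset) (by rw [← Set.ncard_eq_toFinset_card T hTfin, hTcard]; norm_num) ?_
    intro τ hτ
    rw [Set.Finite.mem_toFinset] at hτ
    obtain ⟨h1, h2⟩ := hτ
    have h3 := hall _ h1 h2
    rw [pderiv_lin, pderiv_lin, eval_C, eval_C, Fin.succ_zero_eq_one, Fin.succ_one_eq_two] at h3
    rw [eval_restrict, derivative_restrict]
    refine ⟨h1, ?_⟩
    simp only [Polynomial.eval_add, Polynomial.eval_mul, Polynomial.eval_C, eval_restrict, he,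
      Matrix.cons_val_zero, Matrix.cons_val_one]
    rw [← he]
    linear_combination -h3
  refine not_lin_dvd hc.irreducible hc.degree_q hu (lin_dvd hu fun v hv => ?_)
  obtain ⟨τ, rfl⟩ := hpar v hv
  rw [← eval_restrict, hφ, Polynomial.eval_zero]

end Uniqueness

end

end CuspidalCenter

namespace CuspidalCenter

noncomputable section

/-! ### Uniqueness of the form for a generic configuration. -/

section UniquenessOfForm

variable {q l : Poly2} {r s t b : Fin 2 → ℂ} {ω η : Form} {Kl Kq Ml Mq : Poly2}

/-- The linear part of the form at a node of the two curves, in terms of one cofactor. -/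
theorem IsConfig.eval_pderiv_node (hc : IsConfig q l r s t b) (hω : ∀ i, (ω i).totalDegree ≤ 3)
    (hl : IsCofactor ω l Kl) (hq : IsCofactor ω q Kq) {p : Fin 2 → ℂ} (hpq : eval p q = 0)
    (hpl : eval p l = 0) {Δ : ℂ} (hΔ : Δ = eval p (pderiv 0 q) * eval p (pderiv 1 l) -
      eval p (pderiv 1 q) * eval p (pderiv 0 l)) (hΔ0 : Δ ≠ 0) (i j : Fin 2) :
    Δ * eval p (pderiv j (ω i)) = - eval p Kl * (2 * eval p (pderiv i l) * eval p (pderiv j q)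
      + eval p (pderiv i q) * eval p (pderiv j l)) := by
  have h0 := hc.eval_form_eq_zero hl hq hpl hpq
  have lj := fun j => hl.eval_pderiv p j
  have qj := fun j => hq.eval_pderiv p j
  simp only [h0, hpq, hpl, mul_zero, zero_mul, add_zero, sub_zero, zero_add] at lj qj
  have hP : ∀ j, Δ * eval p (pderiv j (ω 0)) =
      eval p (pderiv 0 l) * eval p (pderiv j q) * eval p Kq
      - eval p (pderiv 0 q) * eval p (pderiv j l) * eval p Kl := by
    intro j
    rw [hΔ]
    linear_combination eval p (pderiv 0 l) * qj j - eval p (pderiv 0 q) * lj j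
  have hQ : ∀ j, Δ * eval p (pderiv j (ω 1)) =
      eval p (pderiv 1 l) * eval p (pderiv j q) * eval p Kq
      - eval p (pderiv 1 q) * eval p (pderiv j l) * eval p Kl := by
    intro j
    rw [hΔ]
    linear_combination eval p (pderiv 1 l) * qj j - eval p (pderiv 1 q) * lj j
  have hS := congrArg (eval p) (hc.cofactor_relation hω hl hq)
  simp only [map_sub, map_add, map_mul, map_ofNat, map_zero, eval_dForm] at hS
  -- At a node `dω = Kl + Kq`; inserted into the relation this leaves `2 Kl + Kq = 0`.
  have hK : eval p Kq = -2 * eval p Kl := by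
    apply mul_left_cancel₀ hΔ0
    linear_combination -Δ * hS - 6 * hQ 0 + 6 * hP 1 +
      6 * (eval p Kq + eval p Kl) * hΔ
  fin_cases i
  · have := hP j
    rw [hK] at this
    simp only [Fin.zero_eta]
    linear_combination this
  · have := hQ j
    rw [hK] at this
    simp only [Fin.mk_one]
    linear_combination this

/-- Any two forms with the two integral curves are proportional over the rational functions. -/
theorem IsGenericConfig.wedge_eq_zero (hc : IsGenericConfig q l r s t b)
    (hω : ∀ i, (ω i).totalDegree ≤ 3) (hl : IsCofactor ω l Kl) (hq : IsCofactor ω q Kq)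
    (hη : ∀ i, (η i).totalDegree ≤ 3) (hl' : IsCofactor η l Ml) (hq' : IsCofactor η q Mq) :
    ω 0 * η 1 - ω 1 * η 0 = 0 := by
  have hlirr := irreducible_of_totalDegree_one hc.degree_l
  have hl1 : l.totalDegree = 0 + 1 := hc.degree_l
  have hq1 : q.totalDegree = 3 + 1 := hc.degree_q
  obtain ⟨W', hW'⟩ := IsCofactor.dvd_wedge hc.irreducible hq1 hq hq'
  have h1 := IsCofactor.dvd_wedge hlirr hl1 hl hl'
  rw [hW'] at h1
  obtain ⟨κ, rfl⟩ := (hlirr.prime.dvd_or_dvd h1).resolve_left fun h2 => by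
    obtain ⟨u, rfl⟩ := exists_lin_eq hc.degree_l.le
    exact not_lin_dvd hc.irreducible hc.degree_q (ne_zero_of_totalDegree_lin hc.degree_l) h2
  by_contra hne
  rw [hW'] at hne
  have hκ0 : κ ≠ 0 := by
    rintro rfl
    simp at hne
  obtain ⟨g, g0, g1, -⟩ := hc.hasFivePoints.exists_top le_rfl hω hl hq
  obtain ⟨f, f0, f1, -⟩ := hc.hasFivePoints.exists_top le_rfl hη hl' hq'
  -- Both leading parts are multiples of `x dy - y dx`, so the part of degree six cancels. As `q l`
  -- has degree five, the remaining factor is constant.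
  have hdeg : (ω 0 * η 1 - ω 1 * η 0).totalDegree ≤ 5 := by
    refine totalDegree_le_of_homogeneousComponent_eq_zero ?_ ?_
    · refine (totalDegree_sub _ _).trans (max_le ?_ ?_)
      · have := hω 0
        have := hη 1
        exact (totalDegree_mul _ _).trans (by omega)
      · have := hω 1
        have := hη 0
        exact (totalDegree_mul _ _).trans (by omega)
    · rw [show 5 + 1 = 3 + 3 by rfl, map_sub,
        homogeneousComponent_mul_of_totalDegree_le (hω 0) (hη 1),
        homogeneousComponent_mul_of_totalDegree_le (hω 1) (hη 0)]
      rw [show (2 + 1 : ℕ) = 3 by rfl] at g0 g1 f0 f1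
      rw [g0, g1, f0, f1]
      ring
  rw [hW', totalDegree_mul_of_isDomain hc.irreducible.ne_zero (mul_ne_zero hlirr.ne_zero hκ0),
    totalDegree_mul_of_isDomain hlirr.ne_zero hκ0, hc.degree_q, hc.degree_l] at hdeg
  obtain ⟨c, rfl⟩ : ∃ c, κ = C c :=
    ⟨_, totalDegree_eq_zero_iff_eq_C.mp (by omega)⟩
  obtain ⟨p, hpq, hpl, hΔ0⟩ := hc.exists_node
  generalize hΔ : eval p (pderiv 0 q) * eval p (pderiv 1 l) -
      eval p (pderiv 1 q) * eval p (pderiv 0 l) = Δ at hΔ0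
  have d1 := hc.eval_pderiv_node hω hl hq hpq hpl hΔ.symm hΔ0
  have d2 := hc.eval_pderiv_node hη hl' hq' hpq hpl hΔ.symm hΔ0
  have z1 := hc.eval_form_eq_zero hl hq hpl hpq
  have z2 := hc.eval_form_eq_zero hl' hq' hpl hpq
  -- The linear parts of the two forms at the node are proportional, so the second derivatives of
  -- their wedge vanish, while those of `c q l` are the stated products.
  have second : ∀ i j, c * (eval p (pderiv i q) * eval p (pderiv j l) +
      eval p (pderiv j q) * eval p (pderiv i l)) = 0 := by
    intro i j
    have := congrArg (fun g => eval p (pderiv i (pderiv j g))) hW'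
    simp only [map_sub, map_add, map_mul, Derivation.leibniz, smul_eq_mul, z1, z2, hpq, hpl,
      pderiv_C, eval_C, mul_zero, zero_mul, add_zero, zero_add] at this
    apply mul_left_cancel₀ (mul_ne_zero hΔ0 hΔ0)
    have e1 := d1 0 i
    have e2 := d1 0 j
    have e3 := d1 1 i
    have e4 := d1 1 j
    have f1 := d2 0 i
    have f2 := d2 0 j
    have f3 := d2 1 i
    have f4 := d2 1 j
    have key : ∀ x y x' y' X Y X' Y' : ℂ, Δ * x = X → Δ * y = Y → Δ * x' = X' → Δ * y' = Y' →
        Δ * Δ * (x * y' + y * x') = X * Y' + Y * X' := by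
      rintro x y x' y' X Y X' Y' rfl rfl rfl rfl
      ring
    have k1 := key _ _ _ _ _ _ _ _ e1 e2 f3 f4
    have k2 := key _ _ _ _ _ _ _ _ e3 e4 f1 f2
    linear_combination -Δ * Δ * this + k1 - k2
  have s00 := second 0 0
  have s01 := second 0 1
  have s11 := second 1 1
  have hc0 : c ≠ 0 := fun h => hκ0 (by rw [h, C_0])
  have : (c * Δ) ^ 2 = 0 := by
    rw [← hΔ]
    linear_combination c * (eval p (pderiv 0 q) * eval p (pderiv 1 l) +
      eval p (pderiv 1 q) * eval p (pderiv 0 l)) * s01 -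
      c * eval p (pderiv 1 q) * eval p (pderiv 1 l) * 2 * s00
  exact mul_ne_zero hc0 hΔ0 (pow_eq_zero_iff two_ne_zero |>.mp this)

/-- With zero wedge and coprime components of `η`, the form `ω` is a polynomial multiple of `η`. The
component `η 0` has degree exactly three, so the multiplier is constant. -/
theorem IsGenericConfig.exists_smul_eq (hc : IsGenericConfig q l r s t b)
    (hω : ∀ i, (ω i).totalDegree ≤ 3) (hl : IsCofactor ω l Kl) (hq : IsCofactor ω q Kq)
    (hη : ∀ i, (η i).totalDegree ≤ 3) (hl' : IsCofactor η l Ml) (hq' : IsCofactor η q Mq)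
    (h0 : η ≠ 0) : ∃ c : ℂ, ∀ i, ω i = C c * η i := by
  have hW := hc.wedge_eq_zero hω hl hq hη hl' hq'
  have hrel := hc.toIsConfig.isRelPrime hη hl' hq' h0
  obtain ⟨g, g0, g1, -⟩ := hc.hasFivePoints.exists_top le_rfl hη hl' hq'
  have hg : g ≠ 0 := by
    rintro rfl
    apply h0
    refine hc.hasFivePoints.eq_zero_of_relation (fun i => ?_) hl' hq'
      (hc.toIsConfig.cofactor_relation hη hl' hq')
    refine totalDegree_le_of_homogeneousComponent_eq_zero (hη i) ?_
    fin_cases i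
    · simpa using g0
    · simpa using g1
  have hX : ∀ i, (X i : Poly2) ≠ 0 := fun i => X_ne_zero i
  have hη0 : homogeneousComponent 3 (η 0) ≠ 0 := by
    rw [g0]
    exact neg_ne_zero.mpr (mul_ne_zero (hX 1) hg)
  have hη00 : η 0 ≠ 0 := by
    intro h
    rw [h, map_zero] at hη0
    exact hη0 rfl
  have hdeg : (η 0).totalDegree = 3 := by
    refine le_antisymm (hη 0) ?_
    by_contra hlt
    exact hη0 (homogeneousComponent_eq_zero _ _ (not_le.mp hlt))
  obtain ⟨f, hf⟩ : η 0 ∣ ω 0 := by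
    refine hrel.dvd_of_dvd_mul_left (z := ω 0) ⟨ω 1, ?_⟩
    linear_combination hW
  have hf1 : ω 1 = η 1 * f := by
    apply mul_left_cancel₀ hη00
    linear_combination -hW + η 1 * hf
  have hfd : f.totalDegree = 0 := by
    by_cases h : f = 0
    · simp [h]
    · have := totalDegree_mul_of_isDomain hη00 h
      rw [← hf, hdeg] at this
      have := hω 0
      omega
  refine ⟨coeff 0 f, fun i => ?_⟩
  rw [← totalDegree_eq_zero_iff_eq_C.mp hfd]
  fin_cases i
  · simp only [Fin.zero_eta]; rw [hf, mul_comm]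
  · simp only [Fin.mk_one]; rw [hf1, mul_comm]

theorem cubicForm_injective : Function.Injective cubicForm := by
  intro c d h
  funext ⟨i, m⟩
  have hcoeff : ∀ c : CoeffIdx → ℂ, coeff (expo m.1.1 m.1.2) (cubicForm c i) = c (i, m) := by
    intro c
    simp only [cubicForm, coeff_sum, ← monomial_expo, coeff_monomial, expo_inj]
    rw [Finset.sum_eq_single m]
    · simp
    · intro m' _ hm
      rw [if_neg]
      rintro ⟨h1, h2⟩
      exact hm (Subtype.ext (Prod.ext (Fin.ext h1) (Fin.ext h2)))
    · intro hm
      exact absurd (Finset.mem_univ _) hm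
  rw [← hcoeff c, ← hcoeff d, h]

/-- The space of forms is spanned by any of its nonzero elements. -/
theorem IsGenericConfig.cubicFormsWith_eq_span (hc : IsGenericConfig q l r s t b)
    {c : CoeffIdx → ℂ} (hc0 : c ≠ 0) (hq : IsAlgIntegralCurve (cubicForm c) q)
    (hl : IsAlgIntegralCurve (cubicForm c) l) : cubicFormsWith (q * l) = Submodule.span ℂ {c} := by
  obtain ⟨Kq, hq⟩ := hq
  obtain ⟨Kl, hl⟩ := hl
  have hne : cubicForm c ≠ 0 := by
    intro h
    apply hc0
    apply cubicForm_injective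
    rw [h]
    funext i
    simp [cubicForm]
  ext d
  rw [Submodule.mem_span_singleton]
  constructor
  · intro hd
    obtain ⟨⟨Mq, hMq⟩, ⟨Ml, hMl⟩⟩ := hc.toIsConfig.isAlgIntegralCurve_of_mul hd
    obtain ⟨a, ha⟩ := hc.exists_smul_eq (totalDegree_cubicForm_le d) hMl hMq
      (totalDegree_cubicForm_le c) hl hq hne
    refine ⟨a, cubicForm_injective ?_⟩
    funext i
    rw [cubicForm_smul, ha]
  · rintro ⟨a, rfl⟩
    exact (cubicFormsWith (q * l)).smul_mem a ⟨_, hq.mul hl⟩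

end UniquenessOfForm

end

end CuspidalCenter

namespace CuspidalCenter

noncomputable section

/-! ### Coefficients of the form of a frame over arbitrary rings. -/

section FrameCoefficients

variable {R : Type*} [CommRing R]

/-- The coefficients of a product of three affine-linear polynomials. -/
def linProd (u v w : Fin 3 → R) : Matrix (Fin 4) (Fin 4) R :=
  !![u 0 * v 0 * w 0, u 2 * v 0 * w 0 + u 0 * v 2 * w 0 + u 0 * v 0 * w 2,
      u 2 * v 2 * w 0 + u 2 * v 0 * w 2 + u 0 * v 2 * w 2, u 2 * v 2 * w 2;
    u 1 * v 0 * w 0 + u 0 * v 1 * w 0 + u 0 * v 0 * w 1,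
      u 1 * v 2 * w 0 + u 1 * v 0 * w 2 + u 2 * v 1 * w 0 + u 0 * v 1 * w 2 + u 2 * v 0 * w 1
        + u 0 * v 2 * w 1,
      u 1 * v 2 * w 2 + u 2 * v 1 * w 2 + u 2 * v 2 * w 1, 0;
    u 1 * v 1 * w 0 + u 1 * v 0 * w 1 + u 0 * v 1 * w 1,
      u 1 * v 1 * w 2 + u 1 * v 2 * w 1 + u 2 * v 1 * w 1, 0, 0;
    u 1 * v 1 * w 1, 0, 0, 0]

/-- The coefficients of `netCoeff` at three affine-linear polynomials. -/
def netTable (m n k : R) (u v w : Fin 3 → R) : Matrix (Fin 4) (Fin 4) R := fun i j =>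
  m * k * linProd u w w i j + m * (n - k) * linProd u v w i j - m * n * linProd u v v i j
    + k * (2 * k - m) * linProd v w w i j - n * (2 * n - m) * linProd v v w i j

/-- The coefficients of the form of a frame. -/
def frameCoeff (U : Matrix (Fin 3) (Fin 3) R) (m n k : R) : CoeffIdx → R := fun c =>
  netTable m n k (U 0) (U 1) (U 2) c.2.1.1 c.2.1.2 * U 0 c.1.succ
    + netTable n k m (U 1) (U 2) (U 0) c.2.1.1 c.2.1.2 * U 1 c.1.succ
    + netTable k m n (U 2) (U 0) (U 1) c.2.1.1 c.2.1.2 * U 2 c.1.succ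

theorem map_linProd {S : Type*} [CommRing S] (f : R →+* S) (u v w : Fin 3 → R) (i j : Fin 4) :
    f (linProd u v w i j) = linProd (f ∘ u) (f ∘ v) (f ∘ w) i j := by
  fin_cases i <;> fin_cases j <;> simp [linProd]

theorem map_frameCoeff {S : Type*} [CommRing S] (f : R →+* S) (U : Matrix (Fin 3) (Fin 3) R)
    (m n k : R) (c : CoeffIdx) :
    f (frameCoeff U m n k c) = frameCoeff (U.map f) (f m) (f n) (f k) c := by
  simp only [frameCoeff, netTable, map_add, map_sub, map_mul, map_linProd, map_ofNat]
  rfl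

theorem frameCoeff_smul_matrix (a : R) (U : Matrix (Fin 3) (Fin 3) R) (m n k : R) :
    frameCoeff (a • U) m n k = a ^ 4 • frameCoeff U m n k := by
  have h : ∀ (u v w : Fin 3 → R) (i j : Fin 4), linProd (a • u) (a • v) (a • w) i j =
      a ^ 3 * linProd u v w i j := by
    intro u v w i j
    fin_cases i <;> fin_cases j <;> simp [linProd] <;> ring
  have hrow : ∀ i, (a • U) i = a • U i := fun i => rfl
  funext c
  simp only [frameCoeff, netTable, hrow, h, Pi.smul_apply, smul_eq_mul]
  ring

theorem frameCoeff_smul_param (a : R) (U : Matrix (Fin 3) (Fin 3) R) (m n k : R) :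
    frameCoeff U (a * m) (a * n) (a * k) = a ^ 2 • frameCoeff U m n k := by
  funext c
  simp only [frameCoeff, netTable, Pi.smul_apply, smul_eq_mul]
  ring

/-- The polynomial with a given table of coefficients. -/
def tablePoly (M : Matrix (Fin 4) (Fin 4) ℂ) : Poly2 :=
  ∑ m : {m : Fin 4 × Fin 4 // (m.1 : ℕ) + (m.2 : ℕ) ≤ 3},
    C (M m.1.1 m.1.2) * (X 0 ^ (m.1.1 : ℕ) * X 1 ^ (m.1.2 : ℕ))

theorem tablePoly_linProd (u v w : Fin 3 → ℂ) : tablePoly (linProd u v w) =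
    lin u * lin v * lin w := by
  have h : ∑ m ∈ Finset.univ.filter (fun m : Fin 4 × Fin 4 => (m.1 : ℕ) + (m.2 : ℕ) ≤ 3),
      (C (linProd u v w m.1 m.2) * (X 0 ^ (m.1 : ℕ) * X 1 ^ (m.2 : ℕ)) : Poly2) =
      ∑ m : {m : Fin 4 × Fin 4 // (m.1 : ℕ) + (m.2 : ℕ) ≤ 3},
        C (linProd u v w m.1.1 m.1.2) * (X 0 ^ (m.1.1 : ℕ) * X 1 ^ (m.1.2 : ℕ)) :=
    Finset.sum_subtype _ (by simp) _
  rw [tablePoly, ← h, Finset.sum_filter, Fintype.sum_prod_type]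
  simp only [Fin.sum_univ_four]
  simp [linProd, lin]
  ring

theorem tablePoly_add (M N : Matrix (Fin 4) (Fin 4) ℂ) :
    tablePoly (M + N) = tablePoly M + tablePoly N := by
  simp [tablePoly, add_mul, Finset.sum_add_distrib]

theorem tablePoly_smul (a : ℂ) (M : Matrix (Fin 4) (Fin 4) ℂ) :
    tablePoly (a • M) = C a * tablePoly M := by
  simp [tablePoly, Finset.mul_sum, mul_assoc]

theorem tablePoly_netTable (m n k : ℂ) (u v w : Fin 3 → ℂ) : tablePoly (netTable m n k u v w) =
    netCoeff (C m) (C n) (C k) (lin u) (lin v) (lin w) := by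
  have h : netTable m n k u v w = (m * k) • linProd u w w + (m * (n - k)) • linProd u v w
      + (-(m * n)) • linProd u v v + (k * (2 * k - m)) • linProd v w w
      + (-(n * (2 * n - m))) • linProd v v w := by
    funext i j
    simp only [netTable, Matrix.add_apply, Matrix.smul_apply, smul_eq_mul]
    ring
  rw [h]
  simp only [tablePoly_add, tablePoly_smul, tablePoly_linProd, netCoeff, map_mul, map_sub, map_neg,
    map_ofNat]
  ring

theorem cubicForm_frameCoeff (U : Matrix (Fin 3) (Fin 3) ℂ) (m n k : ℂ) :
    cubicForm (frameCoeff U m n k) = frameForm U m n k := by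
  funext i
  have h : cubicForm (frameCoeff U m n k) i = tablePoly (
      U 0 i.succ • netTable m n k (U 0) (U 1) (U 2) + U 1 i.succ •
      netTable n k m (U 1) (U 2) (U 0) + U 2 i.succ • netTable k m n (U 2) (U 0) (U 1)) := by
    simp only [cubicForm, tablePoly, frameCoeff, Matrix.add_apply, Matrix.smul_apply, smul_eq_mul]
    refine Finset.sum_congr rfl fun _ _ => ?_
    congr 2
    ring
  rw [h]
  simp only [tablePoly_add, tablePoly_smul, tablePoly_netTable, frameForm, frameA, frameB, frameC]
  ring

end FrameCoefficients

/-! ### Members of the family in terms of frames. -/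

section FamilyMembers

variable {q l : Poly2} {r s t b : Fin 2 → ℂ}

theorem frameCoeff_ne_zero {U : Matrix (Fin 3) (Fin 3) ℂ} {m n k : ℂ} (hU : U.det ≠ 0)
    (h : m + n + k = 0) (hm : m ≠ 0) (hn : n ≠ 0) : frameCoeff U m n k ≠ 0 := by
  intro h0
  apply frameForm_ne_zero hU h hm hn
  rw [← cubicForm_frameCoeff, h0]
  funext i
  simp [cubicForm]

/-- The forms of degree at most three with a generic configuration as integral curve form a line. -/
theorem IsGenericConfig.finrank_cubicFormsWith (hc : IsGenericConfig q l r s t b) :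
    Module.finrank ℂ (cubicFormsWith (q * l)) = 1 := by
  obtain ⟨U, m, n, k, hU, hs, hm, hn, hk, rfl, rfl⟩ := hc.toIsConfig.exists_frame
  have hne := frameCoeff_ne_zero hU hs hm hn
  rw [hc.cubicFormsWith_eq_span hne, finrank_span_singleton hne]
  · rw [cubicForm_frameCoeff]
    exact ⟨_, isCofactor_frameQuartic hs⟩
  · rw [cubicForm_frameCoeff]
    exact ⟨_, isCofactor_frameLine hs⟩

/-- The members of the family are the forms of frames, with a normalized parameter. -/
theorem exists_frameCoeff_of_mem_family {c : CoeffIdx → ℂ} (h : c ∈ family) :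
    ∃ (U : Matrix (Fin 3) (Fin 3) ℂ) (m : ℂ), U.det ≠ 0 ∧ m ≠ 0 ∧ -(1 + m) ≠ 0 ∧
      c = frameCoeff U m 1 (-(1 + m)) := by
  obtain ⟨hc0, q, l, r, s, t, b, hc, hq, hl⟩ := h
  obtain ⟨U, m, n, k, hU, hs, hm, hn, hk, rfl, rfl⟩ := hc.toIsConfig.exists_frame
  have hne := frameCoeff_ne_zero hU hs hm hn
  have hspan := hc.cubicFormsWith_eq_span hne
    (by rw [cubicForm_frameCoeff]; exact ⟨_, isCofactor_frameQuartic hs⟩)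
    (by rw [cubicForm_frameCoeff]; exact ⟨_, isCofactor_frameLine hs⟩)
  have hmem : c ∈ cubicFormsWith (frameQuartic U * frameLine U m n k) := by
    obtain ⟨Kq, hq⟩ := hq
    obtain ⟨Kl, hl⟩ := hl
    exact ⟨_, hq.mul hl⟩
  rw [hspan, Submodule.mem_span_singleton] at hmem
  obtain ⟨a, rfl⟩ := hmem
  have ha : a ≠ 0 := by
    rintro rfl
    simp at hc0
  -- Scaling the frame by `ρ` multiplies the form by `ρ ^ 4`, and normalizing `n = 1` divides it by
  -- `n ^ 2`; a fourth root balances both with the scalar `a`.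
  obtain ⟨ρ, hρ⟩ := IsAlgClosed.exists_pow_nat_eq (a * n ^ 2) (n := 4) (by norm_num)
  have hρ0 : ρ ≠ 0 := by
    rintro rfl
    apply mul_ne_zero ha (pow_ne_zero 2 hn)
    rw [← hρ]
    simp
  have hk' : -(1 + m / n) = k / n := by
    field_simp
    linear_combination -hs
  refine ⟨ρ • U, m / n, ?_, div_ne_zero hm hn, ?_, ?_⟩
  · rw [Matrix.det_smul]
    exact mul_ne_zero (pow_ne_zero _ hρ0) hU
  · rw [hk']
    exact div_ne_zero hk hn
  · rw [frameCoeff_smul_matrix, hρ, hk', mul_smul, ← frameCoeff_smul_param]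
    congr 2
    · field_simp
    · ring
    · field_simp

end FamilyMembers

/-! ### Location of the centers of the form of a frame. -/

section Centers

/-- The linear part of a form at a center. -/
theorem HasCenterAt.linear_part {ω : Form} {a : Fin 2 → ℂ} (h : HasCenterAt ω a) :
    (∀ i, eval a (ω i) = 0) ∧ eval a (dForm ω) = 0 ∧
      eval a (pderiv 0 (ω 0)) * eval a (pderiv 1 (ω 1)) -
        eval a (pderiv 1 (ω 0)) * eval a (pderiv 0 (ω 1)) ≠ 0 := by
  obtain ⟨A, hA, hlow, -⟩ := h
  have hz : ∀ f : Poly2, homogeneousComponent 0 f = C (eval 0 f) := by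
    intro f
    rw [homogeneousComponent_zero, eval_zero, constantCoeff_eq]
  have h0 : ∀ j, eval 0 (pullback a A ω j) = 0 := by
    intro j
    have := (hlow j).1
    rwa [hz, C_eq_zero] at this
  have h1 : ∀ j k, eval 0 (pderiv k (pullback a A ω j)) = if j = k then 1 else 0 := by
    intro j k
    have := homogeneousComponent_pderiv 0 k (pullback a A ω j)
    rw [hz, (hlow j).2, pderiv_X] at this
    have h2 := congrArg (eval 0) this
    rw [eval_C] at h2
    rw [h2]
    by_cases hjk : j = k
    · subst hjk; simp
    · simp [hjk]
  simp only [pullback_apply, Derivation.leibniz, smul_eq_mul, pderiv_C, mul_zero,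
    add_zero, pderiv_affineSubst, map_mul, eval_C, eval_affineSubst, Matrix.mulVec_zero,
    Fin.sum_univ_two, map_add] at h0 h1
  rw [Matrix.det_fin_two] at hA
  have e0 := h0 0
  have e1 := h0 1
  have f00 := h1 0 0
  have f01 := h1 0 1
  have f10 := h1 1 0
  have f11 := h1 1 1
  simp at f00 f01 f10 f11
  rw [eval_dForm]
  refine ⟨?_, ?_, ?_⟩
  · intro i
    apply mul_left_cancel₀ hA
    fin_cases i
    · simp only [Fin.zero_eta]; linear_combination A 1 1 * e0 - A 1 0 * e1
    · simp only [Fin.mk_one]; linear_combination A 0 0 * e1 - A 0 1 * e0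
  · apply mul_left_cancel₀ hA
    linear_combination f10 - f01
  · intro hdet
    have g1 := congrArg₂ (· * ·) f00 f11
    have g2 := congrArg₂ (· * ·) f01 f10
    have : (1 : ℂ) = 0 := by
      linear_combination (A 0 0 * A 1 1 - A 0 1 * A 1 0) ^ 2 * hdet - g1 + g2
    exact one_ne_zero this

/-- The cofactor of a curve at a zero of the form where the curve is smooth. -/
theorem cofactor_sq_of_smooth {g₀ g₁ p₀ p₁ s₀ s₁ K : ℂ} (hg : g₀ ≠ 0 ∨ g₁ ≠ 0)
    (hd : s₀ - p₁ = 0) (h0 : g₀ * s₀ - g₁ * p₀ = g₀ * K) (h1 : g₀ * s₁ - g₁ * p₁ = g₁ * K) :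
    K ^ 2 = -(p₀ * s₁ - p₁ * s₀) := by
  obtain rfl : s₀ = p₁ := by linear_combination hd
  rcases hg with hg | hg
  · apply mul_left_cancel₀ hg
    linear_combination -(K + s₀) * h0 + p₀ * h1
  · apply mul_left_cancel₀ hg
    linear_combination -s₁ * h0 - (K - s₀) * h1

variable {U : Matrix (Fin 3) (Fin 3) ℂ} {m n k : ℂ} {a : Fin 2 → ℂ}

theorem minor_ne_zero_of_vertex (hU : U.det ≠ 0) (h0 : eval a (lin (U 0)) = 0)
    (h1 : eval a (lin (U 1)) = 0) :
    eval a (lin (U 2)) ≠ 0 ∧ U 0 1 * U 1 2 - U 0 2 * U 1 1 ≠ 0 := by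
  have hdet : U.det = eval a (lin (U 2)) * (U 0 1 * U 1 2 - U 0 2 * U 1 1) := by
    rw [eval_lin] at h0 h1 ⊢
    rw [Matrix.det_fin_three]
    linear_combination (U 1 1 * U 2 2 - U 1 2 * U 2 1) * h0
      + (U 2 1 * U 0 2 - U 2 2 * U 0 1) * h1
  rw [hdet] at hU
  exact ⟨left_ne_zero_of_mul hU, right_ne_zero_of_mul hU⟩

/-- The cyclic permutation of the coordinates. -/
theorem frame_rotate_det : (U.submatrix ![1, 2, 0] id).det = U.det := by
  rw [Matrix.det_fin_three, Matrix.det_fin_three]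
  simp
  ring

/-- At a vertex of the triangle a single minor and a single square term of the cofactor survive, and
neither vanishes. -/
theorem frameQuarticCofactor_ne_zero (hU : U.det ≠ 0) (hm : m ≠ 0) (hn : n ≠ 0) (hk : k ≠ 0)
    (h : eval a (frameQuartic U) = 0) (h' : ∀ i, eval a (pderiv i (frameQuartic U)) = 0) :
    eval a (frameQuarticCofactor U m n k) ≠ 0 := by
  have e : eval a (frameQuarticCofactor U m n k) =
      (U 1 1 * U 2 2 - U 1 2 * U 2 1) * quartCofactor m n (eval a (lin (U 0)))
        (eval a (lin (U 1))) (eval a (lin (U 2)))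
      + (U 2 1 * U 0 2 - U 2 2 * U 0 1) * quartCofactor n k (eval a (lin (U 1)))
        (eval a (lin (U 2))) (eval a (lin (U 0)))
      + (U 0 1 * U 1 2 - U 0 2 * U 1 1) * quartCofactor k m (eval a (lin (U 2)))
        (eval a (lin (U 0))) (eval a (lin (U 1))) := by
    simp only [frameQuarticCofactor, minorSum, quartCofactor, map_add, map_sub, map_mul, map_neg,
      map_pow, eval_C, map_ofNat]
  rw [e]
  rcases frameQuartic_singular hU h h' with ⟨e1, e2⟩ | ⟨e1, e2⟩ | ⟨e1, e2⟩
  · obtain ⟨h1, h2⟩ := minor_ne_zero_of_vertex hU e1 e2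
    have : 6 * (U 0 1 * U 1 2 - U 0 2 * U 1 1) * (eval a (lin (U 2)) * k) ^ 2 ≠ 0 :=
      mul_ne_zero (mul_ne_zero (by norm_num) h2) (pow_ne_zero _ (mul_ne_zero h1 hk))
    intro h0
    apply this
    rw [e1, e2] at h0
    simp only [quartCofactor] at h0
    linear_combination -h0
  · obtain ⟨h1, h2⟩ := minor_ne_zero_of_vertex (U := U.submatrix ![1, 2, 0] id)
      (by rwa [frame_rotate_det]) (a := a) e1 e2
    change eval a (lin (U 0)) ≠ 0 at h1
    change U 1 1 * U 2 2 - U 1 2 * U 2 1 ≠ 0 at h2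
    have : 6 * (U 1 1 * U 2 2 - U 1 2 * U 2 1) * (eval a (lin (U 0)) * m) ^ 2 ≠ 0 :=
      mul_ne_zero (mul_ne_zero (by norm_num) h2) (pow_ne_zero _ (mul_ne_zero h1 hm))
    intro h0
    apply this
    rw [e1, e2] at h0
    simp only [quartCofactor] at h0
    linear_combination -h0
  · obtain ⟨h1, h2⟩ := minor_ne_zero_of_vertex
      (U := (U.submatrix ![1, 2, 0] id).submatrix ![1, 2, 0] id)
      (by rwa [frame_rotate_det, frame_rotate_det]) (a := a) e1 e2
    change eval a (lin (U 1)) ≠ 0 at h1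
    change U 2 1 * U 0 2 - U 2 2 * U 0 1 ≠ 0 at h2
    have : 6 * (U 2 1 * U 0 2 - U 2 2 * U 0 1) * (eval a (lin (U 1)) * n) ^ 2 ≠ 0 :=
      mul_ne_zero (mul_ne_zero (by norm_num) h2) (pow_ne_zero _ (mul_ne_zero h1 hn))
    intro h0
    apply this
    rw [e1, e2] at h0
    simp only [quartCofactor] at h0
    linear_combination -h0

/-- A center of the form of a frame lies off the two curves. -/
theorem HasCenterAt.frame_eval_ne_zero (hU : U.det ≠ 0) (h : m + n + k = 0) (hm : m ≠ 0)
    (hn : n ≠ 0) (hk : k ≠ 0) (hc : HasCenterAt (frameForm U m n k) a) :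
    eval a (frameLine U m n k) ≠ 0 ∧ eval a (frameQuartic U) ≠ 0 := by
  obtain ⟨h0, hd, hdet⟩ := hc.linear_part
  have hq := isCofactor_frameQuartic (U := U) h
  have hl := isCofactor_frameLine (U := U) h
  have hS := congrArg (eval a) (frame_relation (U := U) h)
  simp only [map_sub, map_add, map_mul, map_ofNat, map_zero, hd, mul_zero, sub_zero] at hS
  rw [eval_dForm] at hd
  have l0 := hl.eval_pderiv a 0
  have l1 := hl.eval_pderiv a 1
  have q0 := hq.eval_pderiv a 0
  have q1 := hq.eval_pderiv a 1
  have le := hl.eval a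
  have qe := hq.eval a
  simp only [h0, mul_zero, zero_add, sub_zero] at l0 l1 q0 q1 le qe
  -- A cusp is excluded as a center: there neither the cofactor of the quartic nor the line
  -- vanishes.
  have hsing : eval a (frameQuartic U) = 0 → eval a (frameQuarticCofactor U m n k) = 0 ∨
      eval a (frameLine U m n k) = 0 →
      eval a (pderiv 0 (frameQuartic U)) ≠ 0 ∨ eval a (pderiv 1 (frameQuartic U)) ≠ 0 := by
    intro hq0 hor
    by_contra! hall
    have hall' : ∀ i, eval a (pderiv i (frameQuartic U)) = 0 := by
      intro i
      fin_cases i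
      · exact hall.1
      · exact hall.2
    rcases hor with h1 | h1
    · exact frameQuarticCofactor_ne_zero hU hm hn hk hq0 hall' h1
    · exact eval_frameLine_ne_zero hU hm hn hk hq0 hall' h1
  have hKq : eval a (frameQuartic U) = 0 → eval a (frameQuarticCofactor U m n k) = 0 ∨
      eval a (frameLine U m n k) = 0 → eval a (frameQuarticCofactor U m n k) ^ 2 =
      -(eval a (pderiv 0 (frameForm U m n k 0)) * eval a (pderiv 1 (frameForm U m n k 1)) -
        eval a (pderiv 1 (frameForm U m n k 0)) * eval a (pderiv 0 (frameForm U m n k 1))) := by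
    intro hq0 hor
    rw [hq0, zero_mul, add_zero] at q0 q1
    exact cofactor_sq_of_smooth (hsing hq0 hor) hd q0 q1
  have hl0 : eval a (frameLine U m n k) ≠ 0 := by
    intro hl0
    have hgl : eval a (pderiv 0 (frameLine U m n k)) ≠ 0 ∨
        eval a (pderiv 1 (frameLine U m n k)) ≠ 0 := by
      by_contra! hall
      have e : ∀ i, eval a (pderiv i (frameLine U m n k)) =
          m ^ 3 * U 0 i.succ + n ^ 3 * U 1 i.succ + k ^ 3 * U 2 i.succ := by
        intro i
        simp [frameLine, pderiv_lin, Derivation.leibniz]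
      rw [e, e, Fin.succ_zero_eq_one, Fin.succ_one_eq_two] at hall
      rw [eval_frameLine] at hl0
      simp only [eval_lin] at hl0
      have hz : (![m ^ 3, n ^ 3, k ^ 3] : Fin 3 → ℂ) = 0 := by
        refine Matrix.eq_zero_of_vecMul_eq_zero hU ?_
        funext j
        fin_cases j <;> simp [Matrix.vecMul, dotProduct, Fin.sum_univ_three]
        · linear_combination hl0 - a 0 * hall.1 - a 1 * hall.2
        · linear_combination hall.1
        · linear_combination hall.2
      exact pow_ne_zero 3 hm (congrFun hz 0)
    rw [hl0, zero_mul, add_zero] at l0 l1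
    have hKl := cofactor_sq_of_smooth hgl hd l0 l1
    by_cases hq0 : eval a (frameQuartic U) = 0
    -- On both curves each cofactor has square minus the determinant of the linear part. But `4 Kl +
    -- 5 Kq = 0` also gives `16 Kl² = 25 Kq²`, so the determinant vanishes.
    · have hKq' := hKq hq0 (Or.inr hl0)
      apply hdet
      linear_combination (4 * eval a (frameLineCofactor U m n k) - 5 *
        eval a (frameQuarticCofactor U m n k)) / 9 * hS - 16 / 9 * hKl + 25 / 9 * hKq'
    -- On the line alone `Kq = 0`, so the relation makes `Kl` zero too and again the determinant
    -- vanishes.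
    · have hK0 : eval a (frameQuarticCofactor U m n k) = 0 :=
        (mul_eq_zero.mp (by linear_combination -qe)).resolve_left hq0
      rw [hK0, mul_zero, add_zero] at hS
      have hL0 : eval a (frameLineCofactor U m n k) = 0 :=
        (mul_eq_zero.mp hS).resolve_left (by norm_num)
      rw [hL0] at hKl
      exact hdet (by linear_combination hKl)
  refine ⟨hl0, fun hq0 => ?_⟩
  have hL0 : eval a (frameLineCofactor U m n k) = 0 :=
    (mul_eq_zero.mp (by linear_combination -le)).resolve_left hl0
  rw [hL0, mul_zero, zero_add] at hS
  have hK0 := (mul_eq_zero.mp hS).resolve_left (by norm_num)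
  have hKq' := hKq hq0 (Or.inl hK0)
  rw [hK0] at hKq'
  exact hdet (by linear_combination hKq')

/-- The members of the family with a center, together with the center. -/
theorem exists_frameCoeff_of_mem_familyCenters {p : CoeffIdx ⊕ Fin 2 → ℂ}
    (h : p ∈ familyCenters) : ∃ (U : Matrix (Fin 3) (Fin 3) ℂ) (m c : ℂ),
      (fun i => p (Sum.inl i)) = frameCoeff U m 1 (-(1 + m)) ∧
      eval (fun k => p (Sum.inr k)) (lin (U 0)) = c * (1 * (-(1 + m))) ∧
      eval (fun k => p (Sum.inr k)) (lin (U 1)) = c * (m * (-(1 + m))) ∧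
      eval (fun k => p (Sum.inr k)) (lin (U 2)) = c * (m * 1) := by
  obtain ⟨hf, hcen⟩ := h
  obtain ⟨U, m, hU, hm, hk, hp⟩ := exists_frameCoeff_of_mem_family hf
  have hs : m + 1 + -(1 + m) = 0 := by ring
  simp only [centers, Set.mem_ofPred_eq, hp, cubicForm_frameCoeff] at hcen
  obtain ⟨hl, hq⟩ := hcen.frame_eval_ne_zero hU hs hm one_ne_zero hk
  obtain ⟨c, -, h0, h1, h2⟩ := center_of_eval_eq_zero hU hs one_ne_zero hk hcen.linear_part.1 hl hq
  exact ⟨U, m, c, hp, h0, h1, h2⟩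

end Centers

end

end CuspidalCenter

namespace CuspidalCenter

noncomputable section

/-! ### Counting the zeros of binary forms. -/

section ProjectiveZeros

theorem coeff_restrict_of_isHomogeneous {f : Poly2} {n : ℕ} (hf : f.IsHomogeneous n)
    (a e : Fin 2 → ℂ) : (restrict a e f).coeff n = eval e f := by
  rw [restrict, aeval_def, eval₂_eq', eval_eq', Polynomial.finsetSum_coeff]
  refine Finset.sum_congr rfl fun d hd => ?_
  have hdeg : d 0 + d 1 = n := by
    have h1 : d.degree = n := by
      have := hf (mem_support_iff.mp hd)
      rwa [Finsupp.degree_eq_weight_one]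
    rwa [Finsupp.degree_eq_sum, Fin.sum_univ_two] at h1
  have hlin : ∀ i, (Polynomial.C (a i) + Polynomial.C (e i) * Polynomial.X).natDegree ≤ 1 := by
    intro i
    compute_degree
  have hpow : ∀ i, ((Polynomial.C (a i) + Polynomial.C (e i) * Polynomial.X) ^ d i).coeff (d i) =
      e i ^ d i := by
    intro i
    have := Polynomial.coeff_pow_of_natDegree_le (m := d i) (hlin i)
    rw [mul_one] at this
    rw [this]
    simp
  have hpd : ∀ i, ((Polynomial.C (a i) + Polynomial.C (e i) * Polynomial.X) ^ d i).natDegree ≤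
      d i := by
    intro i
    refine Polynomial.natDegree_pow_le.trans ?_
    simpa using Nat.mul_le_mul_left (d i) (hlin i)
  rw [Fin.prod_univ_two, Fin.prod_univ_two, Polynomial.algebraMap_apply, Polynomial.coeff_C_mul,
    ← hdeg, Polynomial.coeff_mul_add_eq_of_natDegree_le (hpd 0) (hpd 1), hpow, hpow]
  rfl

/-- A binary form without multiple zeros has as many zeros as its degree. -/
theorem ncard_zeros_of_isHomogeneous {f : Poly2} {n : ℕ} (hf : f.IsHomogeneous n) (hf0 : f ≠ 0)
    (hs : ∀ v, v ≠ 0 → eval v f = 0 → eval v (pderiv 0 f) ≠ 0 ∨ eval v (pderiv 1 f) ≠ 0) :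
    {p : Projectivization ℂ (Fin 2 → ℂ) | eval p.rep f = 0}.ncard = n := by
  -- A direction that is not a zero makes the restriction to `w + t e` a polynomial of full degree
  -- whose roots parametrize all projective zeros.
  obtain ⟨e, he⟩ : ∃ e, e ≠ 0 ∧ eval e f ≠ 0 := by
    by_contra! hc
    refine hf0 (MvPolynomial.funext fun v => ?_)
    rw [map_zero]
    by_cases hv : v = 0
    · have h1 : restrict 0 (fun _ => 1) f = 0 := by
        refine Polynomial.eq_zero_of_infinite_isRoot _ ((Set.infinite_univ.sdiff
          (Set.finite_singleton (0 : ℂ))).mono fun t ht => ?_)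
        rw [Set.mem_ofPred_eq, Polynomial.IsRoot, eval_restrict, zero_add]
        refine hc _ fun h0 => ht.2 ?_
        simpa using congrFun h0 0
      have h2 := congrArg (Polynomial.eval 0) h1
      rw [eval_restrict] at h2
      rw [hv]
      simpa using h2
    · exact hc v hv
  obtain ⟨he0, he⟩ := he
  obtain ⟨w, hw⟩ : ∃ w : Fin 2 → ℂ, e 0 * w 1 - e 1 * w 0 ≠ 0 := by
    by_contra! hc
    apply he0
    funext i
    fin_cases i
    · simpa using hc ![0, 1]
    · simpa using hc ![1, 0]
  set φ := restrict w e f with hφ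
  have hlead : φ.coeff n ≠ 0 := by rwa [hφ, coeff_restrict_of_isHomogeneous hf]
  have hφ0 : φ ≠ 0 := by
    intro h
    rw [h] at hlead
    simp at hlead
  have hdeg : φ.natDegree = n :=
    le_antisymm (natDegree_restrict_le hf.totalDegree_le w e) (Polynomial.le_natDegree_of_ne_zero hlead)
  have hne : ∀ t : ℂ, w + t • e ≠ 0 := by
    intro t h
    apply hw
    have h0 := congrFun h 0
    have h1 := congrFun h 1
    simp only [Pi.add_apply, Pi.smul_apply, smul_eq_mul, Pi.zero_apply] at h0 h1
    linear_combination e 0 * h1 - e 1 * h0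
  have hsimple : ∀ t, φ.eval t = 0 → φ.derivative.eval t ≠ 0 := by
    intro t ht hd
    rw [hφ, eval_restrict] at ht
    rw [hφ, derivative_restrict, Polynomial.eval_add, Polynomial.eval_mul, Polynomial.eval_mul,
      Polynomial.eval_C, Polynomial.eval_C, eval_restrict, eval_restrict] at hd
    have hE := congrArg (eval (w + t • e)) (euler_two hf)
    simp only [map_add, map_mul, eval_X, ht, mul_zero, Pi.add_apply, Pi.smul_apply,
      smul_eq_mul] at hE
    rcases hs _ (hne t) ht with h | h
    · refine mul_ne_zero hw h ?_
      linear_combination -e 1 * hE + (w 1 + t * e 1) * hd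
    · refine mul_ne_zero hw h ?_
      linear_combination e 0 * hE - (w 0 + t * e 0) * hd
  have hnodup : φ.roots.Nodup := by
    rw [Multiset.nodup_iff_count_le_one]
    intro t
    by_contra hlt
    rw [Polynomial.count_roots, not_le] at hlt
    have := (Polynomial.one_lt_rootMultiplicity_iff_isRoot hφ0).mp hlt
    exact hsimple t this.1 this.2
  have hcard : φ.roots.toFinset.card = n := by
    rw [Multiset.toFinset_card_of_nodup hnodup, ← hdeg]
    exact Polynomial.splits_iff_card_roots.mp (IsAlgClosed.splits φ)
  have hS : {p : Projectivization ℂ (Fin 2 → ℂ) | eval p.rep f = 0} =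
      (fun t : ℂ => Projectivization.mk ℂ (w + t • e) (hne t)) '' (φ.roots.toFinset : Set ℂ) := by
    have hev : ∀ (v : Fin 2 → ℂ) (hv : v ≠ 0),
        eval (Projectivization.mk ℂ v hv).rep f = 0 ↔ eval v f = 0 := by
      intro v hv
      obtain ⟨a, ha⟩ := Projectivization.exists_smul_eq_mk_rep ℂ v hv
      rw [← ha, Units.smul_def, eval_smul_of_isHomogeneous hf]
      simp
    ext p
    rw [Set.mem_image]
    constructor
    · intro hp
      have hp' : eval p.rep f = 0 := hp
      have hp0 : e 0 * p.rep 1 - e 1 * p.rep 0 ≠ 0 := by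
        intro h0
        have hpe : p.rep = ((p.rep 0 * w 1 - p.rep 1 * w 0) / (e 0 * w 1 - e 1 * w 0)) • e := by
          funext i
          rw [Pi.smul_apply, smul_eq_mul, div_mul_eq_mul_div, eq_div_iff hw]
          fin_cases i <;> simp
          · linear_combination w 0 * h0
          · linear_combination w 1 * h0
        rw [hpe, eval_smul_of_isHomogeneous hf] at hp'
        rcases mul_eq_zero.mp hp' with h1 | h1
        · rw [eq_zero_of_pow_eq_zero h1, zero_smul] at hpe
          exact p.rep_nonzero hpe
        · exact he h1
      set τ := (p.rep 0 * w 1 - p.rep 1 * w 0) / (e 0 * p.rep 1 - e 1 * p.rep 0) with hτ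
      have hdec : p.rep = ((e 0 * p.rep 1 - e 1 * p.rep 0) / (e 0 * w 1 - e 1 * w 0)) •
          (w + τ • e) := by
        funext i
        refine eq_div_mul_add_div_mul hp0 hw ?_
        fin_cases i <;> simp <;> ring
      have hmk : Projectivization.mk ℂ (w + τ • e) (hne τ) = p := by
        conv_rhs => rw [← p.mk_rep]
        rw [Projectivization.mk_eq_mk_iff']
        refine ⟨(e 0 * w 1 - e 1 * w 0) / (e 0 * p.rep 1 - e 1 * p.rep 0), ?_⟩
        generalize e 0 * p.rep 1 - e 1 * p.rep 0 = B at *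
        rw [hdec, smul_smul, div_mul_div_comm, mul_comm (e 0 * w 1 - e 1 * w 0), div_self, one_smul]
        exact mul_ne_zero hp0 hw
      refine ⟨τ, ?_, hmk⟩
      rw [Finset.mem_coe, Multiset.mem_toFinset, Polynomial.mem_roots hφ0, Polynomial.IsRoot, hφ,
        eval_restrict, ← hev _ (hne τ), hmk]
      exact hp'
    · rintro ⟨t, ht, rfl⟩
      rw [Finset.mem_coe, Multiset.mem_toFinset, Polynomial.mem_roots hφ0, Polynomial.IsRoot, hφ,
        eval_restrict] at ht
      exact (hev _ (hne t)).mpr ht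
  rw [hS, Set.ncard_image_of_injective, Set.ncard_coe_finset, hcard]
  intro t t' h
  obtain ⟨a, ha⟩ := (Projectivization.mk_eq_mk_iff' ℂ _ _ _ _).mp h
  have h0 := congrFun ha 0
  have h1 := congrFun ha 1
  simp only [Pi.add_apply, Pi.smul_apply, smul_eq_mul] at h0 h1
  have ha1 : a = 1 := by
    apply mul_left_cancel₀ hw
    linear_combination e 0 * h1 - e 1 * h0
  rw [ha1] at h0 h1
  apply mul_left_cancel₀ hw
  linear_combination w 0 * h1 - w 1 * h0

end ProjectiveZeros

/-! ### Degree bounds with prescribed leading parts. -/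

section Tops

/-- `f` has degree at most `n` with leading part `g`. -/
def HasTop (n : ℕ) (f g : Poly2) : Prop := f.totalDegree ≤ n ∧ homogeneousComponent n f = g

variable {f g f' g' : Poly2} {n n' : ℕ}

theorem HasTop.mul (h : HasTop n f g) (h' : HasTop n' f' g') : HasTop (n + n') (f * f') (g * g') :=
  ⟨(totalDegree_mul _ _).trans (add_le_add h.1 h'.1), by
    rw [homogeneousComponent_mul_of_totalDegree_le h.1 h'.1, h.2, h'.2]⟩

theorem HasTop.add (h : HasTop n f g) (h' : HasTop n f' g') : HasTop n (f + f') (g + g') :=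
  ⟨(totalDegree_add _ _).trans (max_le h.1 h'.1), by rw [map_add, h.2, h'.2]⟩

theorem HasTop.sub (h : HasTop n f g) (h' : HasTop n f' g') : HasTop n (f - f') (g - g') :=
  ⟨(totalDegree_sub _ _).trans (max_le h.1 h'.1), by rw [map_sub, h.2, h'.2]⟩

theorem hasTop_C (c : ℂ) : HasTop 0 (C c) (C c) :=
  ⟨(totalDegree_C c).le, by rw [homogeneousComponent_zero, coeff_zero_C]⟩

/-- The linear part of an affine-linear polynomial. -/
def linTop (u : Fin 3 → ℂ) : Poly2 := C (u 1) * X 0 + C (u 2) * X 1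

theorem hasTop_lin (u : Fin 3 → ℂ) : HasTop 1 (lin u) (linTop u) := by
  refine ⟨totalDegree_lin_le u, ?_⟩
  have hX : ∀ i : Fin 2, homogeneousComponent 1 (X i : Poly2) = X i := fun i =>
    (homogeneousComponent_of_mem (isHomogeneous_X ℂ i)).trans (if_pos rfl)
  rw [lin, map_add, map_add, homogeneousComponent_C_mul, homogeneousComponent_C_mul, hX, hX,
    homogeneousComponent_eq_zero 1 (C (u 0)) (by rw [totalDegree_C]; norm_num), zero_add, linTop]

theorem HasTop.totalDegree_eq (h : HasTop n f g) (hg : g ≠ 0) : f.totalDegree = n := by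
  refine le_antisymm h.1 ?_
  by_contra hlt
  apply hg
  rw [← h.2, homogeneousComponent_eq_zero _ _ (not_le.mp hlt)]

theorem hasTop_frameQuartic (U : Matrix (Fin 3) (Fin 3) ℂ) : HasTop 4 (frameQuartic U)
    (quart (linTop (U 0)) (linTop (U 1)) (linTop (U 2))) := by
  have h0 := hasTop_lin (U 0)
  have h1 := hasTop_lin (U 1)
  have h2 := hasTop_lin (U 2)
  have h := ((((h0.mul h0).mul (h1.mul h1)).add ((h1.mul h1).mul (h2.mul h2))).add
    ((h2.mul h2).mul (h0.mul h0))).sub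
    ((((hasTop_C 2).mul (h0.mul h1)).mul h2).mul ((h0.add h1).add h2))
  have e : ∀ x y z : Poly2, quart x y z = x * x * (y * y) + y * y * (z * z) + z * z * (x * x) -
      C 2 * (x * y) * z * (x + y + z) := by
    intro x y z
    rw [quart, map_ofNat]
    ring
  rw [frameQuartic, e, e]
  exact h

theorem hasTop_frameLine (U : Matrix (Fin 3) (Fin 3) ℂ) (m n k : ℂ) :
    HasTop 1 (frameLine U m n k) (C (m ^ 3) * linTop (U 0) + C (n ^ 3) * linTop (U 1) +
      C (k ^ 3) * linTop (U 2)) :=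
  (((hasTop_C (m ^ 3)).mul (hasTop_lin (U 0))).add ((hasTop_C (n ^ 3)).mul (hasTop_lin (U 1)))).add
    ((hasTop_C (k ^ 3)).mul (hasTop_lin (U 2)))

end Tops

end

end CuspidalCenter

namespace CuspidalCenter

noncomputable section

/-! ### The triangle of a frame and its cusps. -/

section FrameGeometry

/-- The vector of `2 × 2` minors of the linear parts of three affine-linear polynomials. -/
def minors {R : Type*} [CommRing R] (U : Matrix (Fin 3) (Fin 3) R) : Fin 3 → R :=
  ![U 1 1 * U 2 2 - U 1 2 * U 2 1, U 2 1 * U 0 2 - U 2 2 * U 0 1, U 0 1 * U 1 2 - U 0 2 * U 1 1]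

variable {U : Matrix (Fin 3) (Fin 3) ℂ} {m n k : ℂ}

theorem minors_dot (v : Fin 2 → ℂ) : minors U 0 * eval v (lin (U 0)) +
    minors U 1 * eval v (lin (U 1)) + minors U 2 * eval v (lin (U 2)) = U.det := by
  simp only [eval_lin, minors, Matrix.det_fin_three, Matrix.cons_val_zero, Matrix.cons_val_one,
    Matrix.cons_val]
  ring

theorem minors_dot_linTop (v : Fin 2 → ℂ) : minors U 0 * eval v (linTop (U 0)) +
    minors U 1 * eval v (linTop (U 1)) + minors U 2 * eval v (linTop (U 2)) = 0 := by
  simp only [linTop, minors, Matrix.cons_val_zero, Matrix.cons_val_one, Matrix.cons_val, map_add,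
    map_mul, eval_C, eval_X]
  ring

/-- A point with given ratios of the three affine-linear polynomials, off the line at infinity. -/
theorem exists_point (hU : U.det ≠ 0) (x : Fin 3 → ℂ)
    (hx : minors U 0 * x 0 + minors U 1 * x 1 + minors U 2 * x 2 ≠ 0) :
    ∃ (v : Fin 2 → ℂ) (c : ℂ), c ≠ 0 ∧ ∀ i, eval v (lin (U i)) = c * x i := by
  set w := U⁻¹.mulVec x with hw
  have hUw : U.mulVec w = x := by
    rw [hw, Matrix.mulVec_mulVec, Matrix.mul_nonsing_inv _ (isUnit_iff_ne_zero.mpr hU),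
      Matrix.one_mulVec]
  have hx' : ∀ i, U i 0 * w 0 + U i 1 * w 1 + U i 2 * w 2 = x i := by
    intro i
    rw [← hUw, Matrix.mulVec, dotProduct, Fin.sum_univ_three]
  have hw0 : w 0 ≠ 0 := by
    intro h0
    apply hx
    rw [← hx' 0, ← hx' 1, ← hx' 2, h0]
    simp only [minors, Matrix.cons_val_zero, Matrix.cons_val_one, Matrix.cons_val]
    ring
  refine ⟨![w 1 / w 0, w 2 / w 0], 1 / w 0, one_div_ne_zero hw0, fun i => ?_⟩
  rw [eval_lin, ← hx' i]
  simp
  field_simp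

/-- The combination of the three linear polynomials with the minors is the constant `U.det`, so the
proportionality factor is one. -/
theorem eq_of_proportional (hU : U.det ≠ 0) {v w : Fin 2 → ℂ} {c : ℂ}
    (h : ∀ i, eval v (lin (U i)) = c * eval w (lin (U i))) : v = w := by
  have hc : c = 1 := by
    have h1 := minors_dot (U := U) v
    rw [h, h, h] at h1
    have h2 := minors_dot (U := U) w
    apply mul_right_cancel₀ hU
    linear_combination h1 - c * h2
  have hz : (![0, v 0 - w 0, v 1 - w 1] : Fin 3 → ℂ) = 0 := by
    refine Matrix.eq_zero_of_mulVec_eq_zero hU ?_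
    funext j
    have := h j
    rw [hc, eval_lin, eval_lin] at this
    simp [Matrix.mulVec, dotProduct, Fin.sum_univ_three]
    linear_combination this
  funext i
  fin_cases i
  · exact sub_eq_zero.mp (congrFun hz 1)
  · exact sub_eq_zero.mp (congrFun hz 2)

theorem quart_rotate {R : Type*} [CommRing R] (x y z : R) : quart x y z = quart y z x := by
  simp only [quart]
  ring

theorem translate_lin (a : Fin 2 → ℂ) (u : Fin 3 → ℂ) :
    translate a (lin u) = C (eval a (lin u)) + linTop u := by
  rw [eval_lin]
  simp only [translate, lin, linTop, map_add, map_mul, aeval_C, aeval_X, algebraMap_eq]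
  ring

theorem isHomogeneous_linTop (u : Fin 3 → ℂ) : (linTop u).IsHomogeneous 1 := by
  rw [linTop]
  have h := fun (c : ℂ) (i : Fin 2) => (isHomogeneous_C (Fin 2) c).mul (isHomogeneous_X ℂ i)
  simp only [zero_add] at h
  exact (h _ _).add (h _ _)

/-- The vertices of the triangle are ordinary cusps. -/
theorem isCusp_quart {u v w : Fin 3 → ℂ} {a : Fin 2 → ℂ} (hu : eval a (lin u) = 0)
    (hv : eval a (lin v) = 0) (hw : eval a (lin w) ≠ 0) (huv : u 1 * v 2 - u 2 * v 1 ≠ 0) :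
    IsCusp (quart (lin u) (lin v) (lin w)) a := by
  set ζ := eval a (lin w) with hζ
  have hu1 := isHomogeneous_linTop u
  have hv1 := isHomogeneous_linTop v
  have hw1 := isHomogeneous_linTop w
  have hC := fun c : ℂ => isHomogeneous_C (Fin 2) c
  -- Taylor expansion at the vertex: the tangent cone is the double line `u = v`, on which the cubic
  -- part is a nonzero multiple of a cube.
  have ht : translate a (quart (lin u) (lin v) (lin w)) =
      C (ζ ^ 2) * ((linTop u - linTop v) * (linTop u - linTop v))
      + C (2 * ζ) * (linTop w * ((linTop u - linTop v) * (linTop u - linTop v))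
        - (linTop u * linTop v) * (linTop u + linTop v))
      + quart (linTop u) (linTop v) (linTop w) := by
    have e : translate a (quart (lin u) (lin v) (lin w)) =
        quart (translate a (lin u)) (translate a (lin v)) (translate a (lin w)) := by
      simp only [translate, quart, map_add, map_sub, map_mul, map_pow, map_ofNat]
    rw [e, translate_lin, translate_lin, translate_lin, hu, hv, ← hζ, C_0, zero_add, zero_add]
    simp only [quart, map_mul, map_pow, map_ofNat]
    ring
  have h2 : (C (ζ ^ 2) * ((linTop u - linTop v) * (linTop u - linTop v))).IsHomogeneous 2 := by
    have h := (hC (ζ ^ 2)).mul ((hu1.sub hv1).mul (hu1.sub hv1))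
    rwa [zero_add] at h
  have h3 : (C (2 * ζ) * (linTop w * ((linTop u - linTop v) * (linTop u - linTop v))
        - (linTop u * linTop v) * (linTop u + linTop v))).IsHomogeneous 3 := by
    have h := (hC (2 * ζ)).mul ((hw1.mul ((hu1.sub hv1).mul (hu1.sub hv1))).sub
      ((hu1.mul hv1).mul (hu1.add hv1)))
    rwa [zero_add] at h
  have h4 : (quart (linTop u) (linTop v) (linTop w)).IsHomogeneous 4 := by
    have e : quart (linTop u) (linTop v) (linTop w) = linTop u * linTop u * (linTop v * linTop v)
        + linTop v * linTop v * (linTop w * linTop w) + linTop w * linTop w * (linTop u * linTop u) -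
        C 2 * ((linTop u * linTop v) * (linTop w * (linTop u + linTop v + linTop w))) := by
      rw [quart, map_ofNat]
      ring
    rw [e]
    have h5 := (hC 2).mul ((hu1.mul hv1).mul (hw1.mul ((hu1.add hv1).add hw1)))
    rw [zero_add] at h5
    exact ((((hu1.mul hu1).mul (hv1.mul hv1)).add ((hv1.mul hv1).mul (hw1.mul hw1))).add
      ((hw1.mul hw1).mul (hu1.mul hu1))).sub h5
  have hc : ∀ j, homogeneousComponent j (translate a (quart (lin u) (lin v) (lin w))) =
      (if j = 2 then C (ζ ^ 2) * ((linTop u - linTop v) * (linTop u - linTop v)) else 0)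
      + (if j = 3 then C (2 * ζ) * (linTop w * ((linTop u - linTop v) * (linTop u - linTop v))
        - (linTop u * linTop v) * (linTop u + linTop v)) else 0)
      + (if j = 4 then quart (linTop u) (linTop v) (linTop w) else 0) := by
    intro j
    rw [ht, map_add, map_add, homogeneousComponent_of_mem h2, homogeneousComponent_of_mem h3,
      homogeneousComponent_of_mem h4]
  refine ⟨by simp [hc], by simp [hc], ζ * (u 1 - v 1), ζ * (u 2 - v 2), ?_, ?_, ?_⟩
  · by_contra! h0
    have e1 := (mul_eq_zero.mp h0.1).resolve_left hw
    have e2 := (mul_eq_zero.mp h0.2).resolve_left hw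
    apply huv
    linear_combination u 2 * e1 - u 1 * e2
  · simp only [hc, linTop]
    norm_num
    ring
  · have e : eval ![-(ζ * (u 2 - v 2)), ζ * (u 1 - v 1)] (homogeneousComponent 3
        (translate a (quart (lin u) (lin v) (lin w)))) =
        -4 * ζ ^ 4 * (u 1 * v 2 - u 2 * v 1) ^ 3 := by
      simp only [hc, linTop]
      norm_num
      ring
    rw [e]
    exact mul_ne_zero (mul_ne_zero (by norm_num) (pow_ne_zero _ hw)) (pow_ne_zero _ huv)

/-- At a cusp of a product exactly one of the factors vanishes, to order at least two. -/
theorem IsCusp.of_mul {f g : Poly2} {a : Fin 2 → ℂ} (h : IsCusp (f * g) a) :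
    (eval a f = 0 ∧ ∀ i, eval a (pderiv i f) = 0) ∨
      (eval a g = 0 ∧ ∀ i, eval a (pderiv i g) = 0) := by
  obtain ⟨h0, h1, h2, u, v, huv, h00, h01, h11, hT⟩ := (isCusp_iff _ a).mp h
  simp only [map_add, map_mul, Derivation.leibniz, smul_eq_mul] at h0 h1 h2 h00 h01 h11 hT
  by_cases hf : eval a f = 0 <;> by_cases hg : eval a g = 0
  · exfalso
    simp only [hf, hg, zero_mul, zero_add] at h00 h01 h11 hT
    generalize eval a (pderiv 0 f) = f0 at *
    generalize eval a (pderiv 1 f) = f1 at *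
    generalize eval a (pderiv 0 g) = g0 at *
    generalize eval a (pderiv 1 g) = g1 at *
    have k00 : f0 * g0 = u ^ 2 := by linear_combination h00 / 2
    have k01 : f0 * g1 + f1 * g0 = 2 * u * v := by linear_combination h01
    have k11 : f1 * g1 = v ^ 2 := by linear_combination h11 / 2
    have kd : f0 * g1 - f1 * g0 = 0 := by
      refine pow_eq_zero_iff two_ne_zero |>.mp ?_
      linear_combination (f0 * g1 + f1 * g0 + 2 * u * v) * k01 - 4 * f1 * g1 * k00
        - 4 * u ^ 2 * k11
    -- If both factors vanish, the product of their linear parts is a square, so both gradients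
    -- annihilate the tangent vector; this kills the cubic term on the tangent, which a cusp
    -- forbids.
    have hfe : -v * f0 + u * f1 = 0 := by
      by_contra hne
      have e0 : g0 = 0 := by
        refine (mul_eq_zero.mp ?_).resolve_left hne
        linear_combination -v * k00 + u / 2 * (k01 - kd)
      have e1 : g1 = 0 := by
        refine (mul_eq_zero.mp ?_).resolve_left hne
        linear_combination u * k11 - v / 2 * (k01 + kd)
      rw [e0, mul_zero] at k00
      rw [e1, mul_zero] at k11
      rcases huv with hu | hv
      · exact pow_ne_zero 2 hu k00.symm
      · exact pow_ne_zero 2 hv k11.symm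
    have hge : -v * g0 + u * g1 = 0 := by
      by_contra hne
      have e0 : f0 = 0 := by
        refine (mul_eq_zero.mp ?_).resolve_left hne
        linear_combination -v * k00 + u / 2 * (k01 + kd)
      have e1 : f1 = 0 := by
        refine (mul_eq_zero.mp ?_).resolve_left hne
        linear_combination u * k11 - v / 2 * (k01 - kd)
      rw [e0, zero_mul] at k00
      rw [e1, zero_mul] at k11
      rcases huv with hu | hv
      · exact pow_ne_zero 2 hu k00.symm
      · exact pow_ne_zero 2 hv k11.symm
    apply hT
    linear_combination 3 * (v ^ 2 * eval a (pderiv 0 (pderiv 0 f))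
      - 2 * u * v * eval a (pderiv 0 (pderiv 1 f)) + u ^ 2 * eval a (pderiv 1 (pderiv 1 f))) * hge
      + 3 * (v ^ 2 * eval a (pderiv 0 (pderiv 0 g))
      - 2 * u * v * eval a (pderiv 0 (pderiv 1 g)) + u ^ 2 * eval a (pderiv 1 (pderiv 1 g))) * hfe
  · refine Or.inl ⟨hf, fun i => ?_⟩
    fin_cases i
    · refine (mul_eq_zero.mp ?_).resolve_left hg
      simp only [Fin.zero_eta]
      linear_combination h1 - eval a (pderiv 0 g) * hf
    · refine (mul_eq_zero.mp ?_).resolve_left hg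
      simp only [Fin.mk_one]
      linear_combination h2 - eval a (pderiv 1 g) * hf
  · refine Or.inr ⟨hg, fun i => ?_⟩
    fin_cases i
    · refine (mul_eq_zero.mp ?_).resolve_left hf
      simp only [Fin.zero_eta]
      linear_combination h1 - eval a (pderiv 0 f) * hg
    · refine (mul_eq_zero.mp ?_).resolve_left hf
      simp only [Fin.mk_one]
      linear_combination h2 - eval a (pderiv 1 f) * hg
  · exact absurd h0 (mul_ne_zero hf hg)

end FrameGeometry

end

end CuspidalCenter

namespace CuspidalCenter

noncomputable section

/-! ### Genericity conditions and the five points at infinity. -/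

section GenericFrames

/-- The vector product of the minors with the coefficients of the tangent line. -/
def lineAtInfinity {R : Type*} [CommRing R] (U : Matrix (Fin 3) (Fin 3) R) (m n k : R) :
    Fin 3 → R :=
  ![minors U 1 * k ^ 3 - minors U 2 * n ^ 3, minors U 2 * m ^ 3 - minors U 0 * k ^ 3,
    minors U 0 * n ^ 3 - minors U 1 * m ^ 3]

/-- The conditions under which the curves of a frame form a generic configuration. -/
structure IsGenericFrame (U : Matrix (Fin 3) (Fin 3) ℂ) (m n k : ℂ) : Prop where
  det : U.det ≠ 0
  sum : m + n + k = 0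
  m_ne : m ≠ 0
  n_ne : n ≠ 0
  k_ne : k ≠ 0
  -- Excludes the bitangent `x + y + z = 0` and keeps the center nondegenerate.
  disc : m ^ 2 + m * n + n ^ 2 ≠ 0
  -- The line at infinity has the minors as coefficients; it must avoid the vertices, so that the
  -- cusps are affine.
  minors_ne : ∀ i, minors U i ≠ 0
  -- The line at infinity is not on the dual curve `(a + b + c)³ = 27abc`, so it is not tangent to
  -- the quartic.
  dual : (minors U 0 + minors U 1 + minors U 2) ^ 3 - 27 * (minors U 0 * minors U 1 * minors U 2) ≠ 0
  -- The point where the tangent line meets the line at infinity is not on the quartic.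
  infinity : quart (lineAtInfinity U m n k 0) (lineAtInfinity U m n k 1)
    (lineAtInfinity U m n k 2) ≠ 0

variable {U : Matrix (Fin 3) (Fin 3) ℂ} {m n k : ℂ}

theorem eq_zero_of_quart_eq_zero {x N : Fin 3 → ℂ} (h : ∀ i j, x i * N j = x j * N i)
    (hx : quart (x 0) (x 1) (x 2) = 0) (hN : quart (N 0) (N 1) (N 2) ≠ 0) (i : Fin 3) : x i = 0 := by
  have e : ∀ c y z w : ℂ, quart (c * y) (c * z) (c * w) = c ^ 4 * quart y z w := by
    intro c y z w
    simp only [quart]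
    ring
  have h1 := e (x i) (N 0) (N 1) (N 2)
  rw [h i 0, h i 1, h i 2, mul_comm (x 0), mul_comm (x 1), mul_comm (x 2), e, hx, mul_zero] at h1
  exact eq_zero_of_pow_eq_zero ((mul_eq_zero.mp h1.symm).resolve_right hN)

/-- A vector on both lines is proportional to their vector product, and homogeneity carries the
nonvanishing of the quartic there over to any nonzero multiple. -/
theorem IsGenericFrame.eq_zero (h : IsGenericFrame U m n k) {x : Fin 3 → ℂ}
    (hM : minors U 0 * x 0 + minors U 1 * x 1 + minors U 2 * x 2 = 0)
    (hl : m ^ 3 * x 0 + n ^ 3 * x 1 + k ^ 3 * x 2 = 0) (hx : quart (x 0) (x 1) (x 2) = 0)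
    (i : Fin 3) : x i = 0 := by
  refine eq_zero_of_quart_eq_zero (N := lineAtInfinity U m n k) (fun i j => ?_) hx h.infinity i
  fin_cases i <;> fin_cases j <;>
    simp only [lineAtInfinity, Fin.zero_eta, Fin.mk_one, Fin.reduceFinMk, Matrix.cons_val_zero,
      Matrix.cons_val_one, Matrix.cons_val]
  · linear_combination minors U 2 * hl - k ^ 3 * hM
  · linear_combination n ^ 3 * hM - minors U 1 * hl
  · linear_combination k ^ 3 * hM - minors U 2 * hl
  · linear_combination minors U 0 * hl - m ^ 3 * hM
  · linear_combination minors U 1 * hl - n ^ 3 * hM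
  · linear_combination m ^ 3 * hM - minors U 0 * hl

theorem eq_zero_of_linTop_eq_zero (hU : minors U 2 ≠ 0) {v : Fin 2 → ℂ}
    (hv : ∀ i, eval v (linTop (U i)) = 0) : v = 0 := by
  have h0 := hv 0
  have h1 := hv 1
  simp only [linTop, map_add, map_mul, eval_C, eval_X] at h0 h1
  have hm : minors U 2 = U 0 1 * U 1 2 - U 0 2 * U 1 1 := rfl
  funext i
  apply mul_left_cancel₀ hU
  fin_cases i
  · simp only [Fin.zero_eta, Pi.zero_apply, hm]
    linear_combination U 1 2 * h0 - U 0 2 * h1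
  · simp only [Fin.mk_one, Pi.zero_apply, hm]
    linear_combination U 0 1 * h1 - U 1 1 * h0

/-- A covector vanishing on the line at infinity is proportional to the minors. -/
theorem proportional_minors {g : Fin 3 → ℂ}
    (h : ∀ i : Fin 2, g 0 * U 0 i.succ + g 1 * U 1 i.succ + g 2 * U 2 i.succ = 0) :
    g 0 * minors U 1 = g 1 * minors U 0 ∧ g 0 * minors U 2 = g 2 * minors U 0 := by
  have e1 := h 0
  have e2 := h 1
  simp only [Fin.succ_zero_eq_one, Fin.succ_one_eq_two] at e1 e2
  simp only [minors, Matrix.cons_val_zero, Matrix.cons_val_one, Matrix.cons_val]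
  constructor
  · linear_combination U 2 1 * e2 - U 2 2 * e1
  · linear_combination U 1 2 * e1 - U 1 1 * e2

/-- The equation of the dual curve: tangents have coefficients proportional to `m³, n³, k³`, and `m
+ n + k = 0` gives `m³ + n³ + k³ = 3mnk`. -/
theorem cube_sum_quartGrad {x y z : ℂ} (hx : x ≠ 0) (hy : y ≠ 0) (hz : z ≠ 0)
    (h : quart x y z = 0) : quartGrad x y z ≠ 0 ∧
    (quartGrad x y z + quartGrad y z x + quartGrad z x y) ^ 3 =
      27 * (quartGrad x y z * quartGrad y z x * quartGrad z x y) := by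
  obtain ⟨m, n, k, c, hc, hm, -, -, hs, h1, h2, h3⟩ := exists_tangent_param hx hy hz h
  rw [h1, h2, h3]
  refine ⟨mul_ne_zero hc (pow_ne_zero 3 hm), ?_⟩
  obtain rfl : k = -(m + n) := by linear_combination hs
  ring

/-- The quartic of a generic frame has no singular point on the line at infinity. -/
theorem IsGenericFrame.eq_zero_of_singular (h : IsGenericFrame U m n k) {x : Fin 3 → ℂ}
    (hM : minors U 0 * x 0 + minors U 1 * x 1 + minors U 2 * x 2 = 0)
    (hx : quart (x 0) (x 1) (x 2) = 0)
    (hg : ∀ i : Fin 2, quartGrad (x 0) (x 1) (x 2) * U 0 i.succ +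
      quartGrad (x 1) (x 2) (x 0) * U 1 i.succ + quartGrad (x 2) (x 0) (x 1) * U 2 i.succ = 0)
    (i : Fin 3) : x i = 0 := by
  obtain ⟨p1, p2⟩ := proportional_minors
    (g := ![quartGrad (x 0) (x 1) (x 2), quartGrad (x 1) (x 2) (x 0), quartGrad (x 2) (x 0) (x 1)]) hg
  simp only [Matrix.cons_val_zero, Matrix.cons_val_one, Matrix.cons_val] at p1 p2
  have m0 := h.minors_ne 0
  have m1 := h.minors_ne 1
  have m2 := h.minors_ne 2
  have hq := hx
  simp only [quart] at hq
  have key : x 0 = 0 ∨ x 1 = 0 ∨ x 2 = 0 := by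
    by_contra! hne
    obtain ⟨hg0, hcube⟩ := cube_sum_quartGrad hne.1 hne.2.1 hne.2.2 hx
    set g0 := quartGrad (x 0) (x 1) (x 2)
    set g1 := quartGrad (x 1) (x 2) (x 0)
    set g2 := quartGrad (x 2) (x 0) (x 1)
    refine mul_ne_zero (pow_ne_zero 3 hg0) h.dual ?_
    have e : g0 * (minors U 0 + minors U 1 + minors U 2) = minors U 0 * (g0 + g1 + g2) := by
      linear_combination p1 + p2
    have e3 : (g0 * (minors U 0 + minors U 1 + minors U 2)) ^ 3 =
        (minors U 0 * (g0 + g1 + g2)) ^ 3 := by rw [e]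
    linear_combination e3 + minors U 0 ^ 3 * hcube
      - 27 * g0 * minors U 0 * (g0 * minors U 2 * p1 + g1 * minors U 0 * p2)
  have two : (x 0 = 0 ∧ x 1 = 0) ∨ (x 1 = 0 ∧ x 2 = 0) ∨ (x 2 = 0 ∧ x 0 = 0) := by
    rcases key with h0 | h0 | h0 <;> rw [h0] at hq
    · rcases mul_eq_zero.mp (show x 1 * x 2 = 0 from by
        apply pow_eq_zero_iff two_ne_zero |>.mp; linear_combination hq) with h1 | h1 <;> tauto
    · rcases mul_eq_zero.mp (show x 2 * x 0 = 0 from by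
        apply pow_eq_zero_iff two_ne_zero |>.mp; linear_combination hq) with h1 | h1 <;> tauto
    · rcases mul_eq_zero.mp (show x 0 * x 1 = 0 from by
        apply pow_eq_zero_iff two_ne_zero |>.mp; linear_combination hq) with h1 | h1 <;> tauto
  have all : x 0 = 0 ∧ x 1 = 0 ∧ x 2 = 0 := by
    rcases two with ⟨h0, h1⟩ | ⟨h0, h1⟩ | ⟨h0, h1⟩ <;> rw [h0, h1] at hM <;> simp_all
  fin_cases i
  exacts [all.1, all.2.1, all.2.2]

theorem eval_pderiv_quart_linTop (v : Fin 2 → ℂ) (i : Fin 2) :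
    eval v (pderiv i (quart (linTop (U 0)) (linTop (U 1)) (linTop (U 2)))) =
      quartGrad (eval v (linTop (U 0))) (eval v (linTop (U 1))) (eval v (linTop (U 2))) * U 0 i.succ
      + quartGrad (eval v (linTop (U 1))) (eval v (linTop (U 2))) (eval v (linTop (U 0))) * U 1 i.succ
      + quartGrad (eval v (linTop (U 2))) (eval v (linTop (U 0))) (eval v (linTop (U 1)))
        * U 2 i.succ := by
  have hp : ∀ j, pderiv i (linTop (U j)) = C (U j i.succ) := by
    intro j
    fin_cases i <;> simp [linTop, pderiv_X]
  simp only [pderiv_quart, hp, map_add, map_sub, map_mul, map_pow, map_ofNat, eval_C, quartGrad]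
  ring

theorem eval_quart (v : Fin 2 → ℂ) (x y z : Poly2) :
    eval v (quart x y z) = quart (eval v x) (eval v y) (eval v z) := by
  simp only [quart, map_add, map_sub, map_mul, map_pow, map_ofNat]

theorem IsGenericFrame.infinity_ne_zero (h : IsGenericFrame U m n k) :
    ¬ ∀ i : Fin 2, m ^ 3 * U 0 i.succ + n ^ 3 * U 1 i.succ + k ^ 3 * U 2 i.succ = 0 := by
  intro h0
  obtain ⟨p1, p2⟩ := proportional_minors (g := ![m ^ 3, n ^ 3, k ^ 3]) h0
  simp only [Matrix.cons_val_zero, Matrix.cons_val_one, Matrix.cons_val] at p1 p2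
  have hm := pow_ne_zero 3 h.m_ne
  have p3 : n ^ 3 * minors U 2 = k ^ 3 * minors U 1 := by
    apply mul_left_cancel₀ hm
    linear_combination n ^ 3 * p2 - k ^ 3 * p1
  apply h.infinity
  simp only [lineAtInfinity, Matrix.cons_val_zero, Matrix.cons_val_one, Matrix.cons_val]
  rw [show minors U 1 * k ^ 3 - minors U 2 * n ^ 3 = 0 by linear_combination -p3,
    show minors U 2 * m ^ 3 - minors U 0 * k ^ 3 = 0 by linear_combination p2]
  simp [quart]

/-- The quartic and the line of a generic frame have five points at infinity. -/
theorem IsGenericFrame.degrees (h : IsGenericFrame U m n k) :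
    (frameQuartic U).totalDegree = 4 ∧ (frameLine U m n k).totalDegree = 1 ∧
      (pointsAtInfinity (frameQuartic U * frameLine U m n k)).ncard = 5 := by
  have hQ := hasTop_frameQuartic U
  have hL := hasTop_frameLine U m n k
  have hQL := hQ.mul hL
  set Q := quart (linTop (U 0)) (linTop (U 1)) (linTop (U 2)) with hQdef
  set T := C (m ^ 3) * linTop (U 0) + C (n ^ 3) * linTop (U 1) + C (k ^ 3) * linTop (U 2) with hTdef
  have hpT : ∀ i v, eval v (pderiv i T) =
      m ^ 3 * U 0 i.succ + n ^ 3 * U 1 i.succ + k ^ 3 * U 2 i.succ := by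
    intro i v
    have hp : ∀ j, pderiv i (linTop (U j)) = C (U j i.succ) := by
      intro j
      fin_cases i <;> simp [linTop, pderiv_X]
    simp only [hTdef, map_add, pderiv_C_mul, hp, map_mul, eval_C]
  have hT0 : T ≠ 0 := by
    intro h0
    apply h.infinity_ne_zero
    intro i
    rw [← hpT i 0, h0, map_zero, map_zero]
  have hQ0 : Q ≠ 0 := by
    intro h0
    have hv := eq_zero_of_linTop_eq_zero (h.minors_ne 2) (v := ![1, 0])
      (h.eq_zero_of_singular (x := fun i => eval ![1, 0] (linTop (U i))) (minors_dot_linTop _)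
        (by rw [← eval_quart, ← hQdef, h0, map_zero])
        (fun i => by rw [← eval_pderiv_quart_linTop, ← hQdef, h0, map_zero, map_zero]))
    simpa using congrFun hv 0
  refine ⟨hQ.totalDegree_eq hQ0, hL.totalDegree_eq hT0, ?_⟩
  rw [pointsAtInfinity, hQL.totalDegree_eq (mul_ne_zero hQ0 hT0), hQL.2]
  have hhom : (Q * T).IsHomogeneous 5 := by
    rw [← hQL.2]
    exact homogeneousComponent_isHomogeneous 5 _
  refine ncard_zeros_of_isHomogeneous hhom (mul_ne_zero hQ0 hT0) fun v hv h0 => ?_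
  by_contra! hs
  have hs' : ∀ i, eval v Q * eval v (pderiv i T) + eval v T * eval v (pderiv i Q) = 0 := by
    intro i
    have hi : eval v (pderiv i (Q * T)) = 0 := by
      fin_cases i
      exacts [hs.1, hs.2]
    simpa only [Derivation.leibniz, smul_eq_mul, map_add, map_mul] using hi
  have hx0 : ∀ i, eval v (linTop (U i)) = 0 := by
    rw [map_mul] at h0
    by_cases hQv : eval v Q = 0 <;> by_cases hTv : eval v T = 0
    · refine h.eq_zero (x := fun i => eval v (linTop (U i))) (minors_dot_linTop v) ?_ ?_
      · simpa only [hTdef, map_add, map_mul, eval_C] using hTv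
      · rwa [← eval_quart]
    · refine h.eq_zero_of_singular (x := fun i => eval v (linTop (U i))) (minors_dot_linTop v) ?_ ?_
      · rwa [← eval_quart]
      · intro i
        rw [← eval_pderiv_quart_linTop, ← hQdef]
        have := hs' i
        rw [hQv, zero_mul, zero_add] at this
        exact (mul_eq_zero.mp this).resolve_left hTv
    · exfalso
      apply h.infinity_ne_zero
      intro i
      have := hs' i
      rw [hTv, zero_mul, add_zero, hpT] at this
      exact (mul_eq_zero.mp this).resolve_left hQv
    · exact absurd h0 (mul_ne_zero hQv hTv)
  exact hv (eq_zero_of_linTop_eq_zero (h.minors_ne 2) hx0)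

end GenericFrames

end

end CuspidalCenter

namespace CuspidalCenter

noncomputable section

/-! ### Generic frames give generic configurations. -/

section GenericFrames

variable {U : Matrix (Fin 3) (Fin 3) ℂ} {m n k : ℂ}

/-- Two double points give four roots with multiplicity on the line joining them, too many for
degree three, so the polynomial vanishes on this line. -/
theorem eval_segment_eq_zero {f : Poly2} (hf : f.totalDegree ≤ 3) {p q : Fin 2 → ℂ}
    (hp : eval p f = 0 ∧ ∀ i, eval p (pderiv i f) = 0)
    (hq : eval q f = 0 ∧ ∀ i, eval q (pderiv i f) = 0) (t : ℂ) :
    eval (p + t • (q - p)) f = 0 := by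
  have h0 : restrict p (q - p) f = 0 := by
    refine eq_zero_of_double_roots (natDegree_restrict_le hf _ _) (T := {0, 1}) (by simp) ?_
    have e0 : p + (0 : ℂ) • (q - p) = p := by simp
    have e1 : p + (1 : ℂ) • (q - p) = q := by simp
    intro σ hσ
    rw [eval_restrict, derivative_restrict]
    simp only [Polynomial.eval_add, Polynomial.eval_mul, eval_restrict]
    rcases Finset.mem_insert.mp hσ with rfl | hσ
    · rw [e0, hp.1, hp.2, hp.2]
      simp
    · rw [Finset.mem_singleton.mp hσ, e1, hq.1, hq.2, hq.2]
      simp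
  rw [← eval_restrict, h0, Polynomial.eval_zero]

theorem eval_midpoint_lin (p q : Fin 2 → ℂ) (u : Fin 3 → ℂ) :
    eval (p + (1 / 2 : ℂ) • (q - p)) (lin u) = (eval p (lin u) + eval q (lin u)) / 2 := by
  simp only [eval_lin, Pi.add_apply, Pi.smul_apply, Pi.sub_apply, smul_eq_mul]
  ring

theorem totalDegree_pos_of_not_isUnit {f : Poly2} (h0 : f ≠ 0) (hf : ¬ IsUnit f) :
    0 < f.totalDegree := by
  by_contra hn
  have h1 := totalDegree_eq_zero_iff_eq_C.mp (Nat.le_zero.mp (not_lt.mp hn))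
  apply hf
  rw [h1]
  refine (isUnit_iff_ne_zero.mpr fun hc => h0 ?_).map C
  rw [h1, hc, map_zero]

/-- The vertices of the triangle of a frame. -/
structure IsVertices (U : Matrix (Fin 3) (Fin 3) ℂ) (r s t : Fin 2 → ℂ) : Prop where
  r0 : eval r (lin (U 0)) = 0
  r1 : eval r (lin (U 1)) = 0
  s2 : eval s (lin (U 2)) = 0
  s0 : eval s (lin (U 0)) = 0
  t1 : eval t (lin (U 1)) = 0
  t2 : eval t (lin (U 2)) = 0
  r2 : eval r (lin (U 2)) ≠ 0
  s1 : eval s (lin (U 1)) ≠ 0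
  t0 : eval t (lin (U 0)) ≠ 0

variable {r s t b : Fin 2 → ℂ}

theorem IsVertices.isCusp (hv : IsVertices U r s t) (hM : ∀ i, minors U i ≠ 0) :
    IsCusp (frameQuartic U) r ∧ IsCusp (frameQuartic U) s ∧ IsCusp (frameQuartic U) t := by
  refine ⟨isCusp_quart hv.r0 hv.r1 hv.r2 (hM 2), ?_, ?_⟩
  · rw [frameQuartic, quart_rotate, quart_rotate]
    exact isCusp_quart hv.s2 hv.s0 hv.s1 (hM 1)
  · rw [frameQuartic, quart_rotate]
    exact isCusp_quart hv.t1 hv.t2 hv.t0 (hM 0)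

/-- In a factorization each cusp is a singular point of one of the two factors, so one factor has
two of the cusps. Its degree is at most three, hence it contains the line joining them, but the
quartic does not vanish at their midpoint. -/
theorem IsVertices.irreducible (hv : IsVertices U r s t) (hM : ∀ i, minors U i ≠ 0)
    (hd : (frameQuartic U).totalDegree = 4) : Irreducible (frameQuartic U) := by
  obtain ⟨cr, cs, ct⟩ := hv.isCusp hM
  have h2 : (2 : ℂ) ≠ 0 := two_ne_zero
  have hrs : eval (r + (1 / 2 : ℂ) • (s - r)) (frameQuartic U) ≠ 0 := by
    simp only [eval_frameQuartic, eval_midpoint_lin, hv.r0, hv.r1, hv.s0, hv.s2, quart]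
    simpa using ⟨hv.s1, hv.r2⟩
  have hst : eval (s + (1 / 2 : ℂ) • (t - s)) (frameQuartic U) ≠ 0 := by
    simp only [eval_frameQuartic, eval_midpoint_lin, hv.t1, hv.t2, hv.s0, hv.s2, quart]
    simpa using ⟨hv.t0, hv.s1⟩
  have hrt : eval (r + (1 / 2 : ℂ) • (t - r)) (frameQuartic U) ≠ 0 := by
    simp only [eval_frameQuartic, eval_midpoint_lin, hv.t1, hv.t2, hv.r0, hv.r1, quart]
    simpa using ⟨hv.r2, hv.t0⟩
  have h0 : frameQuartic U ≠ 0 := by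
    intro h
    rw [h, totalDegree_zero] at hd
    omega
  refine ⟨fun hu => ?_, fun f g hfg => ?_⟩
  · rw [totalDegree_eq_zero_of_isUnit hu] at hd
    omega
  by_contra! hn
  have hf0 : f ≠ 0 := by
    rintro rfl
    exact h0 (by rw [hfg, zero_mul])
  have hg0 : g ≠ 0 := by
    rintro rfl
    exact h0 (by rw [hfg, mul_zero])
  have hfd := totalDegree_pos_of_not_isUnit hf0 hn.1
  have hgd := totalDegree_pos_of_not_isUnit hg0 hn.2
  have hsum : f.totalDegree + g.totalDegree = 4 := by
    rw [← totalDegree_mul_of_isDomain hf0 hg0, ← hfg, hd]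
  have nf : ∀ {p q : Fin 2 → ℂ}, eval (p + (1 / 2 : ℂ) • (q - p)) (frameQuartic U) ≠ 0 →
      (eval p f = 0 ∧ ∀ i, eval p (pderiv i f) = 0) →
      ¬ (eval q f = 0 ∧ ∀ i, eval q (pderiv i f) = 0) := by
    intro p q hpq hp hq
    apply hpq
    rw [hfg, map_mul, eval_segment_eq_zero (by omega) hp hq, zero_mul]
  have ng : ∀ {p q : Fin 2 → ℂ}, eval (p + (1 / 2 : ℂ) • (q - p)) (frameQuartic U) ≠ 0 →
      (eval p g = 0 ∧ ∀ i, eval p (pderiv i g) = 0) →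
      ¬ (eval q g = 0 ∧ ∀ i, eval q (pderiv i g) = 0) := by
    intro p q hpq hp hq
    apply hpq
    rw [hfg, map_mul, eval_segment_eq_zero (f := g) (by omega) hp hq, mul_zero]
  rw [hfg] at cr cs ct
  rcases cr.of_mul with hr | hr <;> rcases cs.of_mul with hs | hs <;>
    rcases ct.of_mul with ht | ht
  exacts [nf hrs hr hs, nf hrs hr hs, nf hrt hr ht, ng hst hs ht, nf hst hs ht, ng hrt hr ht,
    ng hrs hr hs, ng hrs hr hs]

theorem eval_pderiv_frameLine (p : Fin 2 → ℂ) (i : Fin 2) : eval p (pderiv i (frameLine U m n k)) =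
    m ^ 3 * U 0 i.succ + n ^ 3 * U 1 i.succ + k ^ 3 * U 2 i.succ := by
  simp only [frameLine, map_add, pderiv_C_mul, pderiv_lin, map_mul, eval_C]

theorem quart_param (σ c : ℂ) :
    quart (c * (σ + 1) ^ 2) (c * (σ ^ 2 * (σ + 1) ^ 2)) (c * σ ^ 2) = 0 := by
  simp only [quart]
  ring

/-- The point has coordinates proportional to `(1/m² : 1/n² : 1/k²)`, and the gradient there is a
nonzero multiple of `(m³, n³, k³)`. It does not vanish on the affine plane because the line is not
the line at infinity. -/
theorem IsGenericFrame.isTangentAt (h : IsGenericFrame U m n k) {c : ℂ} (hc : c ≠ 0)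
    (h0 : eval b (lin (U 0)) = c * (n * k) ^ 2) (h1 : eval b (lin (U 1)) = c * (m * k) ^ 2)
    (h2 : eval b (lin (U 2)) = c * (m * n) ^ 2) :
    IsTangentAt (frameQuartic U) (frameLine U m n k) b := by
  have hk : k = -(m + n) := by linear_combination h.sum
  have hg : ∀ i, eval b (pderiv i (frameQuartic U)) = -4 * (c * (m * n * k)) ^ 3 *
      (m ^ 3 * U 0 i.succ + n ^ 3 * U 1 i.succ + k ^ 3 * U 2 i.succ) := by
    intro i
    rw [eval_pderiv_frameQuartic, h0, h1, h2, hk]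
    simp only [quartGrad]
    ring
  refine ⟨?_, ?_, ?_, ?_⟩
  · rw [eval_frameQuartic, h0, h1, h2, hk]
    simp only [quart]
    ring
  · rw [eval_frameLine, h0, h1, h2, hk]
    ring
  · have hne : -4 * (c * (m * n * k)) ^ 3 ≠ 0 :=
      mul_ne_zero (by norm_num) (pow_ne_zero 3 (mul_ne_zero hc (mul_ne_zero
        (mul_ne_zero h.m_ne h.n_ne) h.k_ne)))
    by_contra! h00
    apply h.infinity_ne_zero
    intro i
    have hi : eval b (pderiv i (frameQuartic U)) = 0 := by
      fin_cases i
      exacts [h00.1, h00.2]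
    rw [hg] at hi
    exact (mul_eq_zero.mp hi).resolve_left hne
  · rw [hg, hg, eval_pderiv_frameLine, eval_pderiv_frameLine]
    ring

/-- With the parameter `σ` on the quartic, the equation of the line becomes `(nσ - m)² (nσ² + 2(m +
n)σ + m) = 0`; the quadratic factor describes the residual intersection. The genericity condition at
infinity keeps these points affine. -/
theorem IsGenericFrame.exists_meeting_point (h : IsGenericFrame U m n k) {σ : ℂ} (hσ : σ ≠ 0)
    (hr : n * σ ^ 2 + 2 * (m + n) * σ + m = 0) :
    ∃ (v : Fin 2 → ℂ) (c : ℂ), c ≠ 0 ∧ eval v (lin (U 0)) = c * (σ + 1) ^ 2 ∧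
      eval v (lin (U 1)) = c * (σ ^ 2 * (σ + 1) ^ 2) ∧ eval v (lin (U 2)) = c * σ ^ 2 := by
  have hk : k = -(m + n) := by linear_combination h.sum
  obtain ⟨v, c, hc, hv⟩ := exists_point h.det ![(σ + 1) ^ 2, σ ^ 2 * (σ + 1) ^ 2, σ ^ 2] (by
    intro hM
    have := h.eq_zero hM (by
      simp only [Matrix.cons_val_zero, Matrix.cons_val_one, Matrix.cons_val, hk]
      linear_combination (n * σ - m) ^ 2 * hr) (by simpa using quart_param σ 1) 2
    simp only [Matrix.cons_val] at this
    exact hσ (eq_zero_of_pow_eq_zero this))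
  exact ⟨v, c, hc, hv 0, hv 1, hv 2⟩

theorem param_injective {c d σ τ : ℂ} (hd : d ≠ 0) (hτ : τ ≠ 0) (hτ1 : τ + 1 ≠ 0)
    (h0 : c * (σ + 1) ^ 2 = d * (τ + 1) ^ 2)
    (h1 : c * (σ ^ 2 * (σ + 1) ^ 2) = d * (τ ^ 2 * (τ + 1) ^ 2)) (h2 : c * σ ^ 2 = d * τ ^ 2) :
    σ = τ := by
  have e : σ ^ 2 = τ ^ 2 := by
    apply mul_right_cancel₀ (mul_ne_zero hd (pow_ne_zero 2 hτ1))
    linear_combination h1 - σ ^ 2 * h0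
  have ec : c = d := by
    apply mul_right_cancel₀ (pow_ne_zero 2 hτ)
    linear_combination h2 - c * e
  have e' : (σ + 1) ^ 2 = (τ + 1) ^ 2 := by
    apply mul_left_cancel₀ hd
    rw [← h0, ec]
  linear_combination (e' - e) / 2

theorem eq_of_param (hU : U.det ≠ 0) {p v : Fin 2 → ℂ} {c d σ : ℂ} (hc : c ≠ 0)
    (p0 : eval p (lin (U 0)) = d * (σ + 1) ^ 2)
    (p1 : eval p (lin (U 1)) = d * (σ ^ 2 * (σ + 1) ^ 2))
    (p2 : eval p (lin (U 2)) = d * σ ^ 2) (q0 : eval v (lin (U 0)) = c * (σ + 1) ^ 2)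
    (q1 : eval v (lin (U 1)) = c * (σ ^ 2 * (σ + 1) ^ 2))
    (q2 : eval v (lin (U 2)) = c * σ ^ 2) : p = v := by
  refine eq_of_proportional hU (c := d / c) fun i => ?_
  fin_cases i
  · simp only [Fin.zero_eta, p0, q0]
    field_simp
  · simp only [Fin.mk_one, p1, q1]
    field_simp
  · simp only [Fin.reduceFinMk, p2, q2]
    field_simp

theorem ne_zero_of_quart_eq_zero {x y z : ℂ} (hn : n ≠ 0) (hk : k ≠ 0)
    (hv : ¬ (x = 0 ∧ y = 0 ∧ z = 0)) (hq : quart x y z = 0)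
    (hl : m ^ 3 * x + n ^ 3 * y + k ^ 3 * z = 0) : x ≠ 0 := by
  rintro rfl
  have h0 : (y * z) ^ 2 = 0 := by
    simp only [quart] at hq
    linear_combination hq
  have hn3 := pow_ne_zero 3 hn
  have hk3 := pow_ne_zero 3 hk
  rcases mul_eq_zero.mp (eq_zero_of_pow_eq_zero h0) with rfl | rfl
  · exact hv ⟨rfl, rfl, (mul_eq_zero.mp (by linear_combination hl)).resolve_left hk3⟩
  · exact hv ⟨rfl, (mul_eq_zero.mp (by linear_combination hl)).resolve_left hn3, rfl⟩

theorem exists_param_of_meets {x y z : ℂ} (hm : m ≠ 0) (hn : n ≠ 0) (hk : k ≠ 0)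
    (hs : m + n + k = 0) (hv : ¬ (x = 0 ∧ y = 0 ∧ z = 0)) (hq : quart x y z = 0)
    (hl : m ^ 3 * x + n ^ 3 * y + k ^ 3 * z = 0) : ∃ d σ, x = d * (σ + 1) ^ 2 ∧
      y = d * (σ ^ 2 * (σ + 1) ^ 2) ∧ z = d * σ ^ 2 ∧
      (n * σ - m) ^ 2 * (n * σ ^ 2 + 2 * (m + n) * σ + m) = 0 := by
  have hx0 := ne_zero_of_quart_eq_zero hn hk hv hq hl
  have hy0 := ne_zero_of_quart_eq_zero (x := y) (y := z) (z := x) (m := n) (n := k) (k := m)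
    hk hm (by tauto) (by rwa [← quart_rotate]) (by linear_combination hl)
  have hz0 := ne_zero_of_quart_eq_zero (x := z) (y := x) (z := y) (m := k) (n := m) (k := n)
    hm hn (by tauto) (by rwa [quart_rotate]) (by linear_combination hl)
  obtain ⟨m', n', hm', hn', hmn', ex, ey, ez⟩ := exists_quart_param hx0 hy0 hz0 hq
  have p0 : x = n' ^ 2 / (m' ^ 2 * (m' + n') ^ 2) * (m' / n' + 1) ^ 2 := by
    rw [ex]
    field_simp
  have p1 : y = n' ^ 2 / (m' ^ 2 * (m' + n') ^ 2) * ((m' / n') ^ 2 * (m' / n' + 1) ^ 2) := by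
    rw [ey]
    field_simp
  have p2 : z = n' ^ 2 / (m' ^ 2 * (m' + n') ^ 2) * (m' / n') ^ 2 := by
    rw [ez]
    field_simp
  refine ⟨_, _, p0, p1, p2, ?_⟩
  have hd0 : n' ^ 2 / (m' ^ 2 * (m' + n') ^ 2) ≠ 0 := div_ne_zero (pow_ne_zero 2 hn')
    (mul_ne_zero (pow_ne_zero 2 hm') (pow_ne_zero 2 hmn'))
  apply mul_left_cancel₀ hd0
  obtain rfl : k = -(m + n) := by linear_combination hs
  rw [p0, p1, p2] at hl
  generalize n' ^ 2 / (m' ^ 2 * (m' + n') ^ 2) = d at hl ⊢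
  generalize m' / n' = σ at hl ⊢
  linear_combination hl

/-- The double root is the tangent point; the two roots of the residual quadratic are distinct and
differ from it. -/
theorem IsGenericFrame.meets (h : IsGenericFrame U m n k) {c : ℂ} (hc : c ≠ 0)
    (h0 : eval b (lin (U 0)) = c * (n * k) ^ 2) (h1 : eval b (lin (U 1)) = c * (m * k) ^ 2)
    (h2 : eval b (lin (U 2)) = c * (m * n) ^ 2) :
    {p : Fin 2 → ℂ | eval p (frameQuartic U) = 0 ∧ eval p (frameLine U m n k) = 0}.ncard = 3 := by
  have hk : k = -(m + n) := by linear_combination h.sum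
  have hm0 := h.m_ne
  have hn0 := h.n_ne
  have hk0 := h.k_ne
  have hmn : m + n ≠ 0 := fun h00 => hk0 (by rw [hk, h00, neg_zero])
  -- A quarter of the discriminant of the residual quadratic.
  obtain ⟨δ, hδ⟩ := exists_sq_eq (m ^ 2 + m * n + n ^ 2)
  have hδ0 : δ ≠ 0 := by
    rintro rfl
    exact h.disc (by linear_combination -hδ)
  set σ₀ := m / n with hσ₀
  set σ₁ := (-(m + n) + δ) / n with hσ₁
  set σ₂ := (-(m + n) - δ) / n with hσ₂
  have r1 : n * σ₁ ^ 2 + 2 * (m + n) * σ₁ + m = 0 := by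
    rw [hσ₁]
    field_simp
    linear_combination hδ
  have r2 : n * σ₂ ^ 2 + 2 * (m + n) * σ₂ + m = 0 := by
    rw [hσ₂]
    field_simp
    linear_combination hδ
  have hroots : ∀ σ, n * σ ^ 2 + 2 * (m + n) * σ + m = 0 → σ = σ₁ ∨ σ = σ₂ := by
    intro σ hσ
    have : (σ - σ₁) * (σ - σ₂) = 0 := by
      rw [hσ₁, hσ₂]
      field_simp
      linear_combination n * hσ - hδ
    rcases mul_eq_zero.mp this with e | e
    exacts [Or.inl (sub_eq_zero.mp e), Or.inr (sub_eq_zero.mp e)]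
  have hne : ∀ σ, n * σ ^ 2 + 2 * (m + n) * σ + m = 0 → σ ≠ 0 ∧ σ + 1 ≠ 0 ∧ σ ≠ σ₀ := by
    intro σ hσ
    refine ⟨?_, ?_, ?_⟩
    · rintro rfl
      exact hm0 (by linear_combination hσ)
    · intro e
      rw [show σ = -1 by linear_combination e] at hσ
      exact hmn (by linear_combination -hσ)
    · rintro rfl
      rw [hσ₀] at hσ
      field_simp at hσ
      exact mul_ne_zero (mul_ne_zero three_ne_zero hmn) hm0 (by linear_combination hσ)
  have h12 : σ₁ ≠ σ₂ := by
    intro e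
    rw [hσ₁, hσ₂, div_left_inj' hn0] at e
    exact hδ0 (by linear_combination e / 2)
  obtain ⟨v₁, c₁, hc₁, a0, a1, a2⟩ := h.exists_meeting_point (hne _ r1).1 r1
  obtain ⟨v₂, c₂, hc₂, b0, b1, b2⟩ := h.exists_meeting_point (hne _ r2).1 r2
  have h0' : eval b (lin (U 0)) = c * n ^ 4 * (σ₀ + 1) ^ 2 := by
    rw [h0, hσ₀, hk]
    field_simp
  have h1' : eval b (lin (U 1)) = c * n ^ 4 * (σ₀ ^ 2 * (σ₀ + 1) ^ 2) := by
    rw [h1, hσ₀, hk]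
    field_simp
  have h2' : eval b (lin (U 2)) = c * n ^ 4 * σ₀ ^ 2 := by
    rw [h2, hσ₀]
    field_simp
  have hcn : c * n ^ 4 ≠ 0 := mul_ne_zero hc (pow_ne_zero 4 hn0)
  rw [Set.ncard_eq_three]
  refine ⟨b, v₁, v₂, ?_, ?_, ?_, ?_⟩
  · rintro rfl
    exact (hne _ r1).2.2 (param_injective hc₁ (hne _ r1).1 (hne _ r1).2.1 (h0'.symm.trans a0)
      (h1'.symm.trans a1) (h2'.symm.trans a2)).symm
  · rintro rfl
    exact (hne _ r2).2.2 (param_injective hc₂ (hne _ r2).1 (hne _ r2).2.1 (h0'.symm.trans b0)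
      (h1'.symm.trans b1) (h2'.symm.trans b2)).symm
  · rintro rfl
    exact h12 (param_injective hc₂ (hne _ r2).1 (hne _ r2).2.1 (a0.symm.trans b0)
      (a1.symm.trans b1) (a2.symm.trans b2))
  have hmem : ∀ {p : Fin 2 → ℂ} {c σ : ℂ}, n * σ ^ 2 + 2 * (m + n) * σ + m = 0 →
      eval p (lin (U 0)) = c * (σ + 1) ^ 2 → eval p (lin (U 1)) = c * (σ ^ 2 * (σ + 1) ^ 2) →
      eval p (lin (U 2)) = c * σ ^ 2 →
      eval p (frameQuartic U) = 0 ∧ eval p (frameLine U m n k) = 0 := by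
    intro p c σ hσ e0 e1 e2
    rw [eval_frameQuartic, eval_frameLine, e0, e1, e2]
    refine ⟨quart_param σ c, ?_⟩
    rw [hk]
    linear_combination c * (n * σ - m) ^ 2 * hσ
  ext p
  simp only [Set.mem_ofPred_eq, Set.mem_insert_iff, Set.mem_singleton_iff]
  constructor
  · rintro ⟨hq, hl⟩
    rw [eval_frameQuartic] at hq
    rw [eval_frameLine] at hl
    obtain ⟨d, σ, p0, p1, p2, hfac⟩ := exists_param_of_meets hm0 hn0 hk0 h.sum
      (frame_vector_ne_zero h.det p) hq hl
    rcases mul_eq_zero.mp hfac with e | e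
    · left
      have hσ0 : σ = σ₀ := by
        rw [hσ₀, eq_div_iff hn0]
        linear_combination eq_zero_of_pow_eq_zero e
      rw [hσ0] at p0 p1 p2
      exact eq_of_param h.det hcn p0 p1 p2 h0' h1' h2'
    · right
      rcases hroots σ e with e' | e' <;> rw [e'] at p0 p1 p2
      · exact Or.inl (eq_of_param h.det hc₁ p0 p1 p2 a0 a1 a2)
      · exact Or.inr (eq_of_param h.det hc₂ p0 p1 p2 b0 b1 b2)
  · rintro (rfl | rfl | rfl)
    · have := h.isTangentAt hc h0 h1 h2
      exact ⟨this.1, this.2.1⟩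
    · exact hmem r1 a0 a1 a2
    · exact hmem r2 b0 b1 b2

/-- The curves of a generic frame form a generic configuration. -/
theorem IsGenericFrame.isGenericConfig (h : IsGenericFrame U m n k) (hv : IsVertices U r s t)
    {c : ℂ} (hc : c ≠ 0) (h0 : eval b (lin (U 0)) = c * (n * k) ^ 2)
    (h1 : eval b (lin (U 1)) = c * (m * k) ^ 2) (h2 : eval b (lin (U 2)) = c * (m * n) ^ 2) :
    IsGenericConfig (frameQuartic U) (frameLine U m n k) r s t b := by
  obtain ⟨hd4, hd1, h5⟩ := h.degrees
  obtain ⟨cr, cs, ct⟩ := hv.isCusp h.minors_ne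
  exact {
    irreducible := hv.irreducible h.minors_ne hd4
    degree_q := hd4
    degree_l := hd1
    r_ne_s := by
      rintro rfl
      exact hv.r2 hv.s2
    s_ne_t := by
      rintro rfl
      exact hv.s1 hv.t1
    r_ne_t := by
      rintro rfl
      exact hv.r2 hv.t2
    cusp_r := cr
    cusp_s := cs
    cusp_t := ct
    tangent := h.isTangentAt hc h0 h1 h2
    infinity := h5
    meets := h.meets hc h0 h1 h2 }

theorem IsGenericFrame.exists_config (h : IsGenericFrame U m n k) :
    ∃ r s t b, IsGenericConfig (frameQuartic U) (frameLine U m n k) r s t b := by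
  have hM := h.minors_ne
  obtain ⟨r, c₁, hc₁, hr⟩ := exists_point h.det ![0, 0, 1] (by simpa using hM 2)
  obtain ⟨s, c₂, hc₂, hs⟩ := exists_point h.det ![0, 1, 0] (by simpa using hM 1)
  obtain ⟨t, c₃, hc₃, ht⟩ := exists_point h.det ![1, 0, 0] (by simpa using hM 0)
  have hk : k = -(m + n) := by linear_combination h.sum
  obtain ⟨b, c, hc, hb⟩ := exists_point h.det ![(n * k) ^ 2, (m * k) ^ 2, (m * n) ^ 2] (by
    intro h0
    have := h.eq_zero h0 (by
      simp only [Matrix.cons_val_zero, Matrix.cons_val_one, Matrix.cons_val, hk]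
      ring) (by
      simp only [Matrix.cons_val_zero, Matrix.cons_val_one, Matrix.cons_val, hk, quart]
      ring) 0
    exact pow_ne_zero 2 (mul_ne_zero h.n_ne h.k_ne) this)
  refine ⟨r, s, t, b, h.isGenericConfig ⟨?_, ?_, ?_, ?_, ?_, ?_, ?_, ?_, ?_⟩ hc (hb 0) (hb 1) (hb 2)⟩
  all_goals simp [hr, hs, ht, hc₁, hc₂, hc₃]

/-- The form of a generic frame belongs to the family. -/
theorem IsGenericFrame.mem_family (h : IsGenericFrame U m n k) : frameCoeff U m n k ∈ family := by
  obtain ⟨r, s, t, b, hc⟩ := h.exists_config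
  refine ⟨frameCoeff_ne_zero h.det h.sum h.m_ne h.n_ne, _, _, r, s, t, b, hc, ?_, ?_⟩
  · rw [cubicForm_frameCoeff]
    exact ⟨_, isCofactor_frameQuartic h.sum⟩
  · rw [cubicForm_frameCoeff]
    exact ⟨_, isCofactor_frameLine h.sum⟩

end GenericFrames

end

end CuspidalCenter

namespace CuspidalCenter

noncomputable section

/-! ### Nonvanishing of Jacobians modulo `101`. -/

section IntegerJacobians

/-- A difference quotient of an integral polynomial is a derivative, up to multiples of the step. -/
theorem exists_eval_add_step {σ : Type*} [DecidableEq σ] (p : σ → ℤ) (e : σ) (d : ℤ)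
    (f : MvPolynomial σ ℤ) : ∃ r : ℤ, eval (fun c => p c + if c = e then d else 0) f =
      eval p f + d * (eval p (pderiv e f) + d * r) := by
  induction f using MvPolynomial.induction_on with
  | C a => exact ⟨0, by simp⟩
  | add f g hf hg =>
    obtain ⟨r, hr⟩ := hf
    obtain ⟨r', hr'⟩ := hg
    refine ⟨r + r', ?_⟩
    rw [map_add, hr, hr']
    simp only [map_add]
    ring
  | mul_X f c hf =>
    obtain ⟨r, hr⟩ := hf
    refine ⟨r * (p c + if c = e then d else 0) + eval p (pderiv e f) * if c = e then 1 else 0, ?_⟩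
    rw [map_mul, hr]
    simp only [eval_X, Derivation.leibniz, pderiv_X, smul_eq_mul, map_add, map_mul]
    by_cases hc : c = e
    · subst hc
      simp only [if_true, Pi.single_eq_same, map_one]
      ring
    · simp only [if_neg hc, Pi.single_eq_of_ne hc, map_zero]
      ring

/-- The integral matrix whose entries are the digits of a number in base `101`. -/
def digitMatrix (N : ℕ) (i j : Fin 10) : ℤ := ((N / 101 ^ (10 * i.val + j.val) % 101 : ℕ) : ℤ)

/-- Difference quotients for a step of length `101`. -/
def stepQuotient (F : (Fin 10 → ℤ) → Fin 10 → ℤ) (p : Fin 10 → ℤ) (i j : Fin 10) : ℤ :=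
  (F (fun c => p c + if c = j then 101 else 0) i - F p i) / 101

def checkQuotients (F : (Fin 10 → ℤ) → Fin 10 → ℤ) (p : Fin 10 → ℤ) (N : ℕ) : Bool :=
  (List.finRange 10).all fun i => (List.finRange 10).all fun j =>
    stepQuotient F p i j % 101 == digitMatrix N i j

def checkProduct (N N' : ℕ) : Bool :=
  (List.finRange 10).all fun i => (List.finRange 10).all fun j =>
    ((List.finRange 10).map fun l => digitMatrix N i l * digitMatrix N' l j).sum % 101 ==
      bif Nat.beq i j then 1 else 0

/-- Divided differences with step `101` of an integral polynomial are congruent to its derivatives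
modulo `101`, so evaluating at shifted points replaces symbolic differentiation. A supplied inverse
modulo `101` then certifies the determinant. -/
theorem det_jacobian_ne_zero (φ : Fin 10 → MvPolynomial (Fin 10) ℤ)
    (F : (Fin 10 → ℤ) → Fin 10 → ℤ) (hF : ∀ p i, eval p (φ i) = F p i) (p : Fin 10 → ℤ)
    {N N' : ℕ} (h : checkQuotients F p N = true) (h' : checkProduct N N' = true) :
    (Matrix.of fun i j => pderiv j (map (Int.castRingHom ℂ) (φ i))).det ≠ 0 := by
  intro h0
  set O : Matrix (Fin 10) (Fin 10) (ZMod 101) := Matrix.of fun i j => ((digitMatrix N i j : ℤ) : ZMod 101)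
    with hO
  set O' : Matrix (Fin 10) (Fin 10) (ZMod 101) := Matrix.of fun i j =>
    ((digitMatrix N' i j : ℤ) : ZMod 101) with hO'
  have hOO' : O * O' = 1 := by
    ext i j
    rw [checkProduct, List.all_eq_true] at h'
    have h2 := h' i (List.mem_finRange i)
    rw [List.all_eq_true] at h2
    have h3 := h2 j (List.mem_finRange j)
    rw [beq_iff_eq] at h3
    have h4 := congrArg (Int.cast : ℤ → ZMod 101) h3
    rw [show ∀ n : ℤ, ((n % 101 : ℤ) : ZMod 101) = n from fun n => ZMod.intCast_mod n 101,
      ← List.ofFn_eq_map, List.sum_ofFn] at h4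
    simp only [Int.cast_sum, Int.cast_mul] at h4
    rw [Matrix.mul_apply, Matrix.one_apply]
    simp only [hO, hO', Matrix.of_apply]
    rw [h4]
    by_cases hij : i = j
    · simp [hij]
    · rw [if_neg hij]
      have : Nat.beq i j = false := by
        rw [Bool.eq_false_iff]
        intro hb
        exact hij (Fin.ext (Nat.eq_of_beq_eq_true hb))
      rw [this]
      simp
  have hent : ∀ i j, ((eval p (pderiv j (φ i)) : ℤ) : ZMod 101) = O i j := by
    intro i j
    obtain ⟨r, hr⟩ := exists_eval_add_step p j 101 (φ i)
    rw [hF, hF] at hr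
    have hq : stepQuotient F p i j = eval p (pderiv j (φ i)) + 101 * r := by
      rw [stepQuotient, hr, add_sub_cancel_left, Int.mul_ediv_cancel_left _ (by norm_num)]
    rw [checkQuotients, List.all_eq_true] at h
    have h2 := h i (List.mem_finRange i)
    rw [List.all_eq_true] at h2
    have h3 := h2 j (List.mem_finRange j)
    rw [beq_iff_eq, hq] at h3
    have h4 := congrArg (Int.cast : ℤ → ZMod 101) h3
    rw [show ∀ n : ℤ, ((n % 101 : ℤ) : ZMod 101) = n from fun n => ZMod.intCast_mod n 101] at h4
    rw [hO, Matrix.of_apply, ← h4]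
    have h101 : ((101 : ℤ) : ZMod 101) = 0 := by decide
    rw [Int.cast_add, Int.cast_mul, h101, zero_mul, add_zero]
  have h1 : (Matrix.of fun i j => pderiv j (map (Int.castRingHom ℂ) (φ i))) =
      (map (Int.castRingHom ℂ)).mapMatrix (Matrix.of fun i j => pderiv j (φ i)) := by
    ext i j : 2
    rw [Matrix.of_apply, RingHom.mapMatrix_apply, Matrix.map_apply, Matrix.of_apply, pderiv_map]
  have h2 := congrArg (eval fun c => ((p c : ℤ) : ℂ)) h0
  rw [h1, ← RingHom.map_det, eval_intCast_map, map_zero, Int.cast_eq_zero] at h2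
  have h3 := congrArg (Int.castRingHom (ZMod 101)) h2
  rw [map_zero, RingHom.map_det, RingHom.map_det] at h3
  have hdet : O.det = 0 := by
    rw [← h3]
    congr 1
    ext i j
    exact (hent i j).symm
  have h4 := congrArg Matrix.det hOO'
  rw [Matrix.det_mul, hdet, zero_mul, Matrix.det_one] at h4
  exact absurd h4 (by decide)

end IntegerJacobians

/-! ### The two ten-parameter families. -/

section Parametrizations

variable {R : Type*} [CommRing R]

/-- The frame with given entries. -/
def frameMatrix (v : Fin 10 → R) : Matrix (Fin 3) (Fin 3) R :=
  !![v 0, v 1, v 2; v 3, v 4, v 5; v 6, v 7, v 8]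

/-- The parametrization of the family. -/
def familyParam (v : Fin 10 → R) : CoeffIdx → R := frameCoeff (frameMatrix v) (v 9) 1 (-(1 + v 9))

/-- The frame of a form with center `(v 0, v 1)`. -/
def centerMatrix (v : Fin 10 → R) : Matrix (Fin 3) (Fin 3) R :=
  -- The constant terms are solved from the requirement that at `(v 0, v 1)` the three linear
  -- polynomials equal `v 8` times `(nk, mk, mn)` with `m = v 9` and `n = 1`.
  !![v 8 * -(1 + v 9) - v 2 * v 0 - v 3 * v 1, v 2, v 3;
    v 8 * (v 9 * -(1 + v 9)) - v 4 * v 0 - v 5 * v 1, v 4, v 5;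
    v 8 * v 9 - v 6 * v 0 - v 7 * v 1, v 6, v 7]

/-- The parametrization of the members of the family together with a center. -/
def centerParam (v : Fin 10 → R) : CoeffIdx ⊕ Fin 2 → R :=
  Sum.elim (frameCoeff (centerMatrix v) (v 9) 1 (-(1 + v 9))) ![v 0, v 1]

theorem map_familyParam {S : Type*} [CommRing S] (f : R →+* S) (v : Fin 10 → R) (c : CoeffIdx) :
    f (familyParam v c) = familyParam (fun i => f (v i)) c := by
  rw [familyParam, map_frameCoeff, familyParam, map_neg, map_add, map_one]
  congr 1
  ext i j
  fin_cases i <;> fin_cases j <;> rfl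

theorem map_centerParam {S : Type*} [CommRing S] (f : R →+* S) (v : Fin 10 → R)
    (c : CoeffIdx ⊕ Fin 2) : f (centerParam v c) = centerParam (fun i => f (v i)) c := by
  rcases c with c | c
  · rw [centerParam, centerParam, Sum.elim_inl, Sum.elim_inl, map_frameCoeff, map_neg, map_add,
      map_one]
    congr 1
    ext i j
    fin_cases i <;> fin_cases j <;> simp [centerMatrix]
  · fin_cases c <;> rfl

/-- Ten coordinates in which the parametrizations are generically étale. -/
def paramDirection : Fin 10 → CoeffIdx :=
  ![(0, ⟨(0, 0), by decide⟩), (0, ⟨(0, 1), by decide⟩), (0, ⟨(0, 2), by decide⟩),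
    (0, ⟨(0, 3), by decide⟩), (0, ⟨(1, 0), by decide⟩), (0, ⟨(1, 1), by decide⟩),
    (0, ⟨(1, 2), by decide⟩), (0, ⟨(2, 0), by decide⟩), (0, ⟨(2, 1), by decide⟩),
    (1, ⟨(0, 0), by decide⟩)]

theorem checkQuotients_familyParam : checkQuotients (fun p i => familyParam p (paramDirection i))
    ![0, 1, 0, 0, 0, 1, 1, 1, 1, -2]
    252283114437742890500252459304637959725335375503008529356272796279599126499466920602039288239648086453952796664738691463527972043817986973046847055559685049877671288574583317925974720769464 = true := by
  decide +kernel

theorem checkProduct_familyParam : checkProduct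
    252283114437742890500252459304637959725335375503008529356272796279599126499466920602039288239648086453952796664738691463527972043817986973046847055559685049877671288574583317925974720769464
    175105422374646966544072451313966040276806129016296777634066455473674335502149766035851448711262890519016472725770886219912544540200817372270777424699324556511526366077776020623592245774225102140115066 = true := by
  decide +kernel

theorem checkQuotients_centerParam :
    checkQuotients (fun p i => centerParam p (Sum.inl (paramDirection i)))
    ![0, 0, 0, 0, -1, -1, -1, 1, 1, -2]
    61167333796645202617173417608659162003553157434202485669160310114159795521193935580314026511539203019877090463728674259092427199337682478134157313557064546685227899979722714491258729 = true := by
  decide +kernel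

theorem checkProduct_centerParam : checkProduct
    61167333796645202617173417608659162003553157434202485669160310114159795521193935580314026511539203019877090463728674259092427199337682478134157313557064546685227899979722714491258729
    26252675913382877166175869719022078111965731924473112876476664839090843147914176705993225388391949582733557271351018378168833822125528267884800334726528633732600399982222695650848543473614838729896 = true := by
  decide +kernel

theorem det_familyParam_ne_zero : (Matrix.of fun i j =>
    pderiv j (familyParam (X : Fin 10 → MvPolynomial (Fin 10) ℂ) (paramDirection i))).det ≠ 0 := by
  have h := det_jacobian_ne_zero (fun i => familyParam X (paramDirection i)) _
    (fun p i => (map_familyParam (eval p) X _).trans (by simp)) _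
    checkQuotients_familyParam checkProduct_familyParam
  simp only [map_familyParam, map_X] at h
  exact h

theorem det_centerParam_ne_zero : (Matrix.of fun i j => pderiv j
    (centerParam (X : Fin 10 → MvPolynomial (Fin 10) ℂ) (Sum.inl (paramDirection i)))).det ≠ 0 := by
  have h := det_jacobian_ne_zero (fun i => centerParam X (Sum.inl (paramDirection i))) _
    (fun p i => (map_centerParam (eval p) X _).trans (by simp)) _
    checkQuotients_centerParam checkProduct_centerParam
  simp only [map_centerParam, map_X] at h
  exact h

end Parametrizations

end

end CuspidalCenter

namespace CuspidalCenter

noncomputable section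

/-! ### Genericity as the nonvanishing of one polynomial. -/

section Genericity

variable {R : Type*} [CommRing R]

/-- The product of the genericity conditions for a frame. -/
def genericity (U : Matrix (Fin 3) (Fin 3) R) (m n k : R) : R :=
  U.det * (m * n * k) * (m ^ 2 + m * n + n ^ 2) * (minors U 0 * minors U 1 * minors U 2) *
    ((minors U 0 + minors U 1 + minors U 2) ^ 3 - 27 * (minors U 0 * minors U 1 * minors U 2)) *
    quart (lineAtInfinity U m n k 0) (lineAtInfinity U m n k 1) (lineAtInfinity U m n k 2) *
    -- This last factor keeps the candidate center off the line at infinity.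
    (minors U 0 * (n * k) + minors U 1 * (m * k) + minors U 2 * (m * n))

theorem map_genericity {S : Type*} [CommRing S] (f : R →+* S) (U : Matrix (Fin 3) (Fin 3) R)
    (m n k : R) : f (genericity U m n k) = genericity (U.map f) (f m) (f n) (f k) := by
  simp only [genericity, lineAtInfinity, minors, quart, Matrix.det_fin_three, Matrix.map_apply,
    Matrix.cons_val_zero, Matrix.cons_val_one, Matrix.cons_val, map_mul, map_add, map_sub, map_pow,
    map_ofNat]

variable {U : Matrix (Fin 3) (Fin 3) ℂ} {m n k : ℂ}

theorem isGenericFrame_of_genericity_ne_zero (hs : m + n + k = 0) (h : genericity U m n k ≠ 0) :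
    IsGenericFrame U m n k := by
  simp only [genericity, mul_ne_zero_iff] at h
  obtain ⟨⟨⟨⟨⟨⟨h1, ⟨h2, h3⟩, h4⟩, h5⟩, ⟨h6, h7⟩, h8⟩, h9⟩, h10⟩, -⟩ := h
  refine ⟨h1, hs, h2, h3, h4, h5, fun i => ?_, h9, h10⟩
  fin_cases i
  exacts [h6, h7, h8]

theorem exists_center_of_genericity_ne_zero (hs : m + n + k = 0) (h : genericity U m n k ≠ 0) :
    ∃ a, HasCenterAt (frameForm U m n k) a := by
  have hg := isGenericFrame_of_genericity_ne_zero hs h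
  obtain ⟨a, c, hc, ha⟩ := exists_point hg.det ![n * k, m * k, m * n] (by
    simp only [genericity, mul_ne_zero_iff] at h
    exact h.2)
  exact ⟨a, frameForm_hasCenterAt hg.det hs hg.m_ne hg.n_ne hg.k_ne hg.disc hc (ha 0) (ha 1) (ha 2)⟩

end Genericity

/-! ### Irreducibility, dimension and the component statement. -/

section VanishingIdeals

theorem eval_familyParam (t : Fin 10 → ℂ) (c : CoeffIdx) :
    eval t (familyParam X c) = familyParam t c :=
  (map_familyParam (eval t) X c).trans (by simp)

theorem eval_centerParam (t : Fin 10 → ℂ) (c : CoeffIdx ⊕ Fin 2) :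
    eval t (centerParam X c) = centerParam t c :=
  (map_centerParam (eval t) X c).trans (by simp)

/-- The genericity condition on the parameters of the family. -/
def familyGenericity : MvPolynomial (Fin 10) ℂ :=
  genericity (frameMatrix X) (X 9) 1 (-(1 + X 9))

theorem eval_familyGenericity (t : Fin 10 → ℂ) :
    eval t familyGenericity = genericity (frameMatrix t) (t 9) 1 (-(1 + t 9)) := by
  rw [familyGenericity, map_genericity]
  congr 1
  · ext i j
    fin_cases i <;> fin_cases j <;> simp [frameMatrix]
  all_goals simp

theorem familyGenericity_ne_zero : familyGenericity ≠ 0 := by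
  intro h
  -- The frame `x, y, x + y + 1` with `m = -2`, that of the explicit example.
  have := eval_familyGenericity ![0, 1, 0, 0, 0, 1, 1, 1, 1, -2]
  rw [h, map_zero] at this
  revert this
  simp [genericity, frameMatrix, lineAtInfinity, minors, quart, Matrix.det_fin_three]
  norm_num

/-- The genericity condition on the parameters of the family with centers. -/
def centerGenericity : MvPolynomial (Fin 10) ℂ :=
  genericity (centerMatrix X) (X 9) 1 (-(1 + X 9)) * X 8

theorem eval_centerGenericity (t : Fin 10 → ℂ) :
    eval t centerGenericity = genericity (centerMatrix t) (t 9) 1 (-(1 + t 9)) * t 8 := by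
  rw [centerGenericity, map_mul, map_genericity, eval_X]
  congr 2
  · ext i j
    fin_cases i <;> fin_cases j <;> simp [centerMatrix]
  all_goals simp

theorem centerGenericity_ne_zero : centerGenericity ≠ 0 := by
  intro h
  -- The explicit example again, now described by its center `(-1, 2)`.
  have := eval_centerGenericity ![-1, 2, 1, 0, 0, 1, 1, 1, -1, -2]
  rw [h, map_zero] at this
  revert this
  simp [genericity, centerMatrix, lineAtInfinity, minors, quart, Matrix.det_fin_three]
  norm_num

theorem exists_familyParam_of_mem {c : CoeffIdx → ℂ} (hc : c ∈ family) :
    ∃ t, c = fun i => eval t (familyParam X i) := by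
  obtain ⟨U, m, -, -, -, rfl⟩ := exists_frameCoeff_of_mem_family hc
  refine ⟨![U 0 0, U 0 1, U 0 2, U 1 0, U 1 1, U 1 2, U 2 0, U 2 1, U 2 2, m], ?_⟩
  funext i
  rw [eval_familyParam, familyParam]
  congr 1
  ext i j
  fin_cases i <;> fin_cases j <;> rfl

theorem vanishingIdeal_family : vanishingIdeal ℂ family =
    RingHom.ker (aeval (familyParam X) : MvPolynomial CoeffIdx ℂ →ₐ[ℂ] MvPolynomial (Fin 10) ℂ) := by
  refine vanishingIdeal_eq_ker_of_parametrization _ _ _ familyGenericity_ne_zero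
    (fun c hc => exists_familyParam_of_mem hc) fun t ht => ?_
  rw [eval_familyGenericity] at ht
  simp only [eval_familyParam]
  exact (isGenericFrame_of_genericity_ne_zero (by ring) ht).mem_family

/-- The members of the family with a center are dense. -/
theorem vanishingIdeal_family_with_center :
    vanishingIdeal ℂ {c | c ∈ family ∧ ∃ a, HasCenterAt (cubicForm c) a} =
      vanishingIdeal ℂ family := by
  rw [vanishingIdeal_family]
  refine vanishingIdeal_eq_ker_of_parametrization _ _ _ familyGenericity_ne_zero
    (fun c hc => exists_familyParam_of_mem hc.1) fun t ht => ?_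
  rw [eval_familyGenericity] at ht
  simp only [eval_familyParam]
  refine ⟨(isGenericFrame_of_genericity_ne_zero (by ring) ht).mem_family, ?_⟩
  have h := exists_center_of_genericity_ne_zero (by ring) ht
  rw [← cubicForm_frameCoeff] at h
  exact h

/-- A center can only be the point where the linear polynomials are proportional to `(nk : mk :
mn)`. Prescribing it determines the constant terms of the frame from the linear parts and the scale;
conversely, a generic frame with nonzero scale has a center there. -/
theorem vanishingIdeal_familyCenters : vanishingIdeal ℂ familyCenters = RingHom.ker
    (aeval (centerParam X) : MvPolynomial (CoeffIdx ⊕ Fin 2) ℂ →ₐ[ℂ] MvPolynomial (Fin 10) ℂ) := by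
  refine vanishingIdeal_eq_ker_of_parametrization _ _ _ centerGenericity_ne_zero
    (fun p hp => ?_) fun t ht => ?_
  · obtain ⟨U, m, c, hU, h0, h1, h2⟩ := exists_frameCoeff_of_mem_familyCenters hp
    refine ⟨![p (Sum.inr 0), p (Sum.inr 1), U 0 1, U 0 2, U 1 1, U 1 2, U 2 1, U 2 2, c, m], ?_⟩
    rw [eval_lin] at h0 h1 h2
    funext i
    rw [eval_centerParam]
    rcases i with i | i
    · rw [congrFun hU i, centerParam, Sum.elim_inl]
      congr 1
      ext i j
      fin_cases i <;> fin_cases j <;> try rfl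
      · simp only [centerMatrix, Matrix.of_apply, Matrix.cons_val_zero, Matrix.cons_val_one,
          Matrix.cons_val, Fin.zero_eta]
        linear_combination h0
      · simp only [centerMatrix, Matrix.of_apply, Matrix.cons_val_zero, Matrix.cons_val_one,
          Matrix.cons_val, Fin.zero_eta, Fin.mk_one]
        linear_combination h1
      · simp only [centerMatrix, Matrix.of_apply, Matrix.cons_val_zero, Matrix.cons_val_one,
          Matrix.cons_val, Fin.zero_eta, Fin.reduceFinMk]
        linear_combination h2
    · fin_cases i <;> rfl
  · rw [eval_centerGenericity] at ht
    simp only [eval_centerParam]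
    have hs : t 9 + 1 + -(1 + t 9) = 0 := by ring
    have hg := isGenericFrame_of_genericity_ne_zero hs (left_ne_zero_of_mul ht)
    refine ⟨hg.mem_family, ?_⟩
    change HasCenterAt (cubicForm (frameCoeff (centerMatrix t) (t 9) 1 (-(1 + t 9)))) ![t 0, t 1]
    rw [cubicForm_frameCoeff]
    refine frameForm_hasCenterAt hg.det hs hg.m_ne hg.n_ne hg.k_ne hg.disc
      (right_ne_zero_of_mul ht) ?_ ?_ ?_
    all_goals
      rw [eval_lin]
      simp only [centerMatrix, Matrix.of_apply, Matrix.cons_val_zero, Matrix.cons_val_one,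
          Matrix.cons_val]
      ring

theorem isZariskiIrreducible_family : IsZariskiIrreducible family := by
  rw [IsZariskiIrreducible, vanishingIdeal_family]
  exact RingHom.ker_isPrime _

theorem zariskiDim_family : zariskiDim family = 10 :=
  zariskiDim_of_vanishingIdeal_eq_ker _ _ vanishingIdeal_family paramDirection
    det_familyParam_ne_zero

theorem zariskiDim_familyCenters : zariskiDim familyCenters = 10 :=
  zariskiDim_of_vanishingIdeal_eq_ker _ _ vanishingIdeal_familyCenters
    (fun i => Sum.inl (paramDirection i)) det_centerParam_ne_zero

theorem centerParam_basePoint :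
    ∀ c, centerParam ![0, 0, 0, 0, -1, -1, -1, 1, 1, -2] c = basePoint c := by
  decide +kernel

/-- The base point is a value of the parametrization, which suffices. Its frame has a constant
linear polynomial and is not generic, so closure rather than membership is used. -/
theorem eval_basePoint_eq_zero {f : MvPolynomial (CoeffIdx ⊕ Fin 2) ℂ}
    (hf : f ∈ vanishingIdeal ℂ familyCenters) :
    eval (fun c => ((basePoint c : ℤ) : ℂ)) f = 0 := by
  rw [vanishingIdeal_familyCenters, RingHom.mem_ker] at hf
  have h := congrArg (aeval fun i : Fin 10 =>
    (((![0, 0, 0, 0, -1, -1, -1, 1, 1, -2] : Fin 10 → ℤ) i : ℤ) : ℂ)) hf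
  rw [map_zero, comp_aeval_apply, ← aeval_eq_eval] at *
  rw [← h]
  congr 2
  funext c
  rw [← centerParam_basePoint c, aeval_eq_eval]
  exact (map_centerParam (Int.castRingHom ℂ) _ c).trans (eval_centerParam _ c).symm

/-- The family is a component of the center variety. -/
theorem isZariskiComponent_familyCenters : IsZariskiComponent familyCenters centers := by
  have hprime : (vanishingIdeal ℂ familyCenters).IsPrime := by
    rw [vanishingIdeal_familyCenters]
    exact RingHom.ker_isPrime _
  refine ⟨⟨hprime, fun f hf => ?_⟩, fun P hP hPQ => ?_⟩
  · rw [mem_vanishingIdeal_iff] at hf ⊢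
    exact fun p hp => hf p hp.2
  · have := hP.1
    exact (eq_of_vanishingIdeal_centers_le hP.2 hPQ (fun f hf => eval_basePoint_eq_zero hf)
      zariskiDim_familyCenters).ge

end VanishingIdeals

end

end CuspidalCenter

namespace CuspidalCenter

noncomputable section

/-! ### The explicit example as a generic frame. -/

section Example

/-- The frame of the explicit example. -/
def exampleFrame : Matrix (Fin 3) (Fin 3) ℂ := !![0, 1, 0; 0, 0, 1; 1, 1, 1]

theorem lin_exampleFrame : lin (exampleFrame 0) = X 0 ∧ lin (exampleFrame 1) = X 1 ∧
    lin (exampleFrame 2) = exampleW := by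
  refine ⟨by simp [lin, exampleFrame], by simp [lin, exampleFrame], ?_⟩
  simp only [lin, exampleFrame, exampleW, Matrix.of_apply, Matrix.cons_val_zero, Matrix.cons_val_one,
    Matrix.cons_val, map_one]
  ring

theorem frameQuartic_exampleFrame : frameQuartic exampleFrame = exampleQuartic := by
  obtain ⟨h0, h1, h2⟩ := lin_exampleFrame
  rw [frameQuartic, h0, h1, h2, quart, exampleQuartic]
  ring

theorem frameLine_exampleFrame : frameLine exampleFrame (-2) 1 1 = exampleLine := by
  obtain ⟨h0, h1, h2⟩ := lin_exampleFrame
  rw [frameLine, h0, h1, h2, exampleLine, exampleW]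
  simp only [map_pow, map_neg, map_one, map_ofNat]
  ring

theorem frameForm_exampleFrame : frameForm exampleFrame (-2) 1 1 = exampleForm := by
  obtain ⟨h0, h1, h2⟩ := lin_exampleFrame
  funext i
  simp only [frameForm, frameA, frameB, frameC, h0, h1, h2, netCoeff, exampleW, exampleForm]
  fin_cases i
  · simp only [exampleFrame, Fin.zero_eta, Fin.succ_zero_eq_one, Matrix.of_apply,
      Matrix.cons_val_zero, Matrix.cons_val_one, Matrix.cons_val, map_neg, map_one, map_zero,
      map_ofNat]
    ring
  · simp only [exampleFrame, Fin.mk_one, Fin.succ_one_eq_two, Matrix.of_apply,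
      Matrix.cons_val_zero, Matrix.cons_val_one, Matrix.cons_val, map_neg, map_one, map_zero,
      map_ofNat]
    ring

theorem isGenericFrame_exampleFrame : IsGenericFrame exampleFrame (-2) 1 1 := by
  refine isGenericFrame_of_genericity_ne_zero (by norm_num) ?_
  simp [genericity, exampleFrame, lineAtInfinity, minors, quart, Matrix.det_fin_three]
  norm_num

theorem isGenericConfig_example :
    IsGenericConfig exampleQuartic exampleLine ![0, 0] ![0, -1] ![-1, 0] ![-1, -4] := by
  rw [← frameQuartic_exampleFrame, ← frameLine_exampleFrame]
  obtain ⟨h0, h1, h2⟩ := lin_exampleFrame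
  refine isGenericFrame_exampleFrame.isGenericConfig ⟨?_, ?_, ?_, ?_, ?_, ?_, ?_, ?_, ?_⟩
    (c := -1) (by norm_num) ?_ ?_ ?_
  all_goals norm_num [h0, h1, h2, exampleW]

theorem hasCenterAt_exampleForm : HasCenterAt exampleForm ![-1, 2] := by
  rw [← frameForm_exampleFrame]
  obtain ⟨h0, h1, h2⟩ := lin_exampleFrame
  have h := isGenericFrame_exampleFrame
  refine frameForm_hasCenterAt h.det h.sum h.m_ne h.n_ne h.k_ne h.disc (c := -1) (by norm_num)
    ?_ ?_ ?_
  all_goals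
    simp only [h0, h1, h2, exampleW, map_add, map_one, eval_X, Matrix.cons_val_zero,
      Matrix.cons_val_one]
    norm_num

theorem isAlgIntegralCurve_example : IsAlgIntegralCurve exampleForm exampleQuartic ∧
    IsAlgIntegralCurve exampleForm exampleLine := by
  have h := isGenericFrame_exampleFrame
  rw [← frameForm_exampleFrame, ← frameQuartic_exampleFrame, ← frameLine_exampleFrame]
  exact ⟨⟨_, isCofactor_frameQuartic h.sum⟩, ⟨_, isCofactor_frameLine h.sum⟩⟩

theorem exists_coefficients_exampleForm : ∃ c, cubicForm c = exampleForm ∧ c ∈ family ∧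
    cubicFormsWith (exampleQuartic * exampleLine) = Submodule.span ℂ {c} := by
  have h := isGenericFrame_exampleFrame
  have hc : cubicForm (frameCoeff exampleFrame (-2) 1 1) = exampleForm := by
    rw [cubicForm_frameCoeff, frameForm_exampleFrame]
  refine ⟨_, hc, h.mem_family, ?_⟩
  refine isGenericConfig_example.cubicFormsWith_eq_span
    (frameCoeff_ne_zero h.det h.sum h.m_ne h.n_ne) ?_ ?_
  · rw [hc]
    exact isAlgIntegralCurve_example.1
  · rw [hc]
    exact isAlgIntegralCurve_example.2

end Example

end

end CuspidalCenter

theorem mainTheorem2 :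
    -- the relation between the cofactors, for every configuration and every form of degree `≤ 3`
    (∀ (q l : Poly2) (r s t b : Fin 2 → ℂ), IsConfig q l r s t b →
      ∀ (ω : Form) (Kl Kq : Poly2), (∀ i, (ω i).totalDegree ≤ 3) →
        IsCofactor ω l Kl → IsCofactor ω q Kq →
        (∀ a ∈ ({r, s, t, b} : Set (Fin 2 → ℂ)), ∀ i, eval a (ω i) = 0) ∧
        (∀ a ∈ ({r, s, t} : Set (Fin 2 → ℂ)), HasEta Kl Kq (dForm ω) a 0 6 5) ∧
        HasEta Kl Kq (dForm ω) b 2 2 3 ∧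
        HasEtaAtInfinity 2 Kl Kq (dForm ω) 1 4 4 ∧
        4 * Kl + 5 * Kq - 6 * dForm ω = 0 ∧
        HasDarbouxFactor ω l q) ∧
    -- for a generic configuration the form is unique up to scaling
    (∀ (q l : Poly2) (r s t b : Fin 2 → ℂ), IsGenericConfig q l r s t b →
      Module.finrank ℂ (cubicFormsWith (q * l)) = 1) ∧
    -- the forms of the family (up to scaling) form an irreducible family of dimension `9`, and
    -- those with a center are dense in it
    IsZariskiIrreducible family ∧ zariskiDim family = 9 + 1 ∧
    vanishingIdeal ℂ {c | c ∈ family ∧ ∃ a, HasCenterAt (cubicForm c) a} =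
      vanishingIdeal ℂ family ∧
    -- the family is a component, of dimension `9` up to scaling, of the center variety
    IsZariskiComponent familyCenters centers ∧ zariskiDim familyCenters = 9 + 1 ∧
    -- the explicit example
    IsGenericConfig exampleQuartic exampleLine ![0, 0] ![0, -1] ![-1, 0] ![-1, -4] ∧
    IsAlgIntegralCurve exampleForm exampleQuartic ∧ IsAlgIntegralCurve exampleForm exampleLine ∧
    HasCenterAt exampleForm ![-1, 2] ∧
    ∃ c, cubicForm c = exampleForm ∧ c ∈ family ∧
      cubicFormsWith (exampleQuartic * exampleLine) = Submodule.span ℂ {c} := by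
  refine ⟨fun q l r s t b h ω Kl Kq hω hl hq => h.main hω hl hq,
    fun q l r s t b h => h.finrank_cubicFormsWith, isZariskiIrreducible_family, ?_,
    vanishingIdeal_family_with_center, isZariskiComponent_familyCenters, ?_,
    isGenericConfig_example, isAlgIntegralCurve_example.1, isAlgIntegralCurve_example.2,
    hasCenterAt_exampleForm, exists_coefficients_exampleForm⟩
  · rw [zariskiDim_family]
    norm_num
  · rw [zariskiDim_familyCenters]
    norm_num
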